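/- **Markings and tiles.** Digits $0,1,2,3$ are added by nim addition (bitwise, without carry); for a digit $d$ write $b=d+1$, $q=d+2$, $p=d+3$. An edge marking is a quadruple $(abcd)$ with $a\in\{+,-\}$ (outward/inward), $b\in\{0,+,-\}$ (unsided, or offset clockwise/counterclockwise seen from the tile) and digits $c,d$; $(\pm)$ abbreviates $(\pm000)$. Two markings fit together along an edge if their $a$ and $b$ entries are opposite and their $c$ and $d$ entries agree; reflecting a tile reverses the sign of every $b$. A tile is a unit square, cornered or uncornered, with four edge markings, and is considered up to congruence (rotations and reflections). In a tiling the tiles form a square lattice, markings fit along every edge, and every vertex of the lattice meets exactly one cornered tile. A set of tiles is *aperiodic* if it admits a tiling but no tiling invariant under a nonzero translation. * $\mathcal T_{+2}$: the 16 tiles, cornered or uncornered, with markings, in cyclic order, $(+)(+)({+}{+}1d)({+}{-}0d)$ (outer corner) or $(+)({+}{-}2d)(+)({+}{+}3d)$ (inner corner), $d=0,1,2,3$. * Crossing tiles $[h|v]$ are uncornered. The horizontal part $h$ gives the (west, east) markings: $-$ is $((-),(-))$; $0y$ is $(({-}{-}0y),({-}{+}0(y{+}2)))$; $1y$ is $(({-}{-}1y),({-}{+}2y))$;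 $3y$ is $(({-}{-}3y),({-}{+}3(y{+}1)))$; $-3y$ is $(({-}{+}3y),({-}{-}3(y{+}1)))$. The vertical part $v$ gives the (north, south) markings: $+$ is $((+),(-))$; $zw$ is $(({+}{+}zw),({-}{-}zw))$. Write $[[3y|v]]=\{[3y|v],[-3(y{+}2)|v]\}$. * $\mathcal K_2$: $[0d|30],[0d|32],[1d|00],[1d|02],[1d|11],[1d|13],[1d|21],[1d|23],[1d|31],[1d|33]$, $d=0,\dots,3$ (40 tiles). * $\mathcal U_2$: all $[\pm3y|zw]$, all $[-|zw]$, and $[h|+]$ for $h=-,00,01,10,11,12,13,30,-30,32,-32$ (155 tiles). $\mathcal T_2=\mathcal T_{+2}\cup\mathcal K_2\cup\mathcal U_2$ (211 tiles). * $\mathcal T_0$: $[-|+],[00|+],[01|+]$ and all $[-|zw]$ (19 tiles). **Codes and substitutions.** A code is a quadruple $\mathbf S=\mathbf s\mathbf t\mathbf u\mathbf v$ of nonempty subsets of $\{0,1,2,3\}$, deterministic if all four are singletons. An atomic symbol $\alpha\in\mathbf S$ is a choice of one of the four positions and of a digit in it, written $d\cdots$, $\cdot d\cdot\cdot$, $\cdot\cdot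 d\cdot$, $\cdots d$. A *frame* is an isometry placing the standard horizontal $2:1$ domino; the digits act on frames by the symmetries of the domino: $1$ is the left–right reflection, $2$ the top–bottom reflection, $3$ the half turn. The substitution $\sigma_{\mathbf S}$ doubles a framed domino and divides it into four framed children: in the left half (in the frame of the parent) the upper ($\mathbf s$) and lower ($\mathbf t$) horizontal dominoes, in the right half the inner ($\mathbf u$) and outer ($\mathbf v$) vertical dominoes. In orientation $0$ these are placed, respectively, by a translation, with a half turn, with a counterclockwise quarter turn, and with a clockwise quarter turn; the actual orientation of each child is any digit of the corresponding set, composed with orientation $0$. A level $0$ framed supertile is a framed domino; a level $n+1$ framed supertile is composed of four level $n$ framed supertiles placed in this way, all choices being independent, and is recorded together with the frames of all the supertiles in it. Forgetting all frames gives supertiles of (unmarked) dominoes. A domino tiling is *hierarchical* for $\sigma_{\mathbf S}$ if every domino lies in a nested sequence of supertiles of all levels contained in the tiling, and a *substitution tiling* if each of its finite subsets is contained in a supertile. **Enforcing.** Let dominoes have size $8\times4$. A level $n$ frame with centre $c$ and unit axis vectors $x,y$ is *marked* in a tiling by such tiles if, for each digit $d$, the corner $d$ of the frame ($0$ upper left,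 $1$ upper right, $2$ lower left, $3$ lower right) has an outer corner tile at $c\pm3\cdot2^nx\pm2^ny$ and an inner corner tile at $c\pm2^nx\pm2^ny$, both with digit $d$, cornered exactly when $n=0$, with their signed arms along the frame and offset to its interior (the outer tile has its $1$-arm along $\pm x$ and its $0$-arm along $\pm y$; the inner tile has its $2$-arm towards the outer tile), and each of these arms runs straight for $2^n$ steps. *Erasing* replaces each marked level $0$ frame by its unmarked domino. A set $\mathcal T$ of tiles *enforces* $\sigma_{\mathbf S}$ if (i) on the tilings by $\mathcal T$ erasing is a local map, given by finitely many finite patterns, whose values are hierarchical tilings for $\sigma_{\mathbf S}$; (ii) in each tiling by $\mathcal T$ every marked level $0$ frame lies in a nested sequence of framed supertiles of $\sigma_{\mathbf S}$ of all levels, all of whose frames are marked; (iii) every substitution tiling of $\sigma_{\mathbf S}$ is obtained by erasing, and for every framed supertile of $\sigma_{\mathbf S}$ there is a tiling by $\mathcal T$ in which all of its frames are marked. **Atomic sets.** $\mathcal T_{d\cdots}=\{[1q|00],[0b|30],[1d|+],[1b|+],[1p|+]\}$, $\mathcal T_{\cdot d\cdot\cdot}=\{[0d|32],[1p|02],[1d|+],[1b|+],[1q|+]\}$,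 $\mathcal T_{\cdot\cdot d\cdot}=\{[1d|33],[1b|31],[1q|23],[1p|21]\}$, $\mathcal T_{\cdots d}=\{[1q|11],[1p|13],[1d|+],[1b|+]\}$. The set $\mathcal T_{\beta\to\alpha}$ is the pair $[[3\,\ast]]$, where $\ast$ is the entry of the following table in the row of $\beta$ and in the column of the position of $\alpha$, and $d$ is the digit of $\alpha$: | $\beta$ | $d\cdots$ | $\cdot d\cdot\cdot$ | $\cdot\cdot d\cdot$ | $\cdots d$ | |---|---|---|---|---| | $0\cdots$ | $d\vert+$ | $b\vert00$ | $b\vert20$ | $d\vert30$ | | $1\cdots$ | $d\vert+$ | $d\vert+$ | $b\vert10$ | $d\vert+$ | | $2\cdots$ | $d\vert00$ | $d\vert+$ | $d\vert20$ | $b\vert30$ | | $3\cdots$ | $d\vert+$ | $d\vert+$ | $d\vert10$ | $d\vert+$ | | $\cdot0\cdot\cdot$ | $d\vert+$ | $d\vert+$ | $b\vert12$ | $d\vert+$ | | $\cdot1\cdot\cdot$ | $d\vert+$ | $b\vert02$ | $b\vert22$ | $d\vert32$ | | $\cdot2\cdot\cdot$ | $d\vert+$ | $d\vert+$ | $d\vert12$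 | $d\vert+$ | | $\cdot3\cdot\cdot$ | $d\vert02$ | $d\vert+$ | $d\vert22$ | $b\vert32$ | | $\cdot\cdot0\cdot$ | $d\vert33$ | $b\vert23$ | $d\vert+$ | $d\vert+$ | | $\cdot\cdot1\cdot$ | $d\vert31$ | $b\vert21$ | $d\vert+$ | $d\vert+$ | | $\cdot\cdot2\cdot$ | $d\vert23$ | $b\vert33$ | $d\vert+$ | $d\vert+$ | | $\cdot\cdot3\cdot$ | $d\vert21$ | $b\vert31$ | $d\vert+$ | $d\vert+$ | | $\cdots0$ | $d\vert+$ | $b\vert11$ | $b\vert03$ | $d\vert+$ | | $\cdots1$ | $d\vert+$ | $b\vert13$ | $b\vert01$ | $d\vert+$ | | $\cdots2$ | $d\vert11$ | $d\vert+$ | $d\vert03$ | $d\vert+$ | | $\cdots3$ | $d\vert13$ | $d\vert+$ | $d\vert01$ | $d\vert+$ | **Theorem 2.** For every code $\mathbf S$ (all four digits nonempty) let $$\mathcal T_{\mathbf S}=\mathcal T_{+2}\cup\mathcal T_0\cup\bigcup_{\alpha\in\mathbf S}\mathcal T_\alpha\cup\bigcup_{\alpha,\beta\in\mathbf S}\mathcal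 T_{\beta\to\alpha}\subseteq\mathcal T_2 .$$ Then $\mathcal T_{\mathbf S}$ is aperiodic and enforces $\sigma_{\mathbf S}$. Every subset of $\mathcal U_2\cup\mathcal T_{\mathbf S}$ that enforces $\sigma_{\mathbf S}$ contains $\mathcal T_{\mathbf S}$. If $\mathbf S$ is deterministic, no proper subset of $\mathcal T_{\mathbf S}$ admits a tiling. -/

import Mathlib

namespace DominoTiles

/-! ### Markings and tiles -/

/-- The digits `0, 1, 2, 3` of the `d`-channel, thought of as two-bit strings. -/
abbrev Digit := Fin 4

/-- Nim addition of digits: bitwise addition without carry. -/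
def nim (x y : Digit) : Digit := x ^^^ y

/-- The four directions, clockwise: `0` north, `1` east, `2` south, `3` west. -/
abbrev Dir := ZMod 4

/-- An edge marking `(abcd)`: `a` is the direction (`1` outward, `-1` inward), `b` the sidedness
(`1` clockwise, `-1` counterclockwise as seen from the tile, `0` unsided), `c` and `d` are two
digits. -/
@[ext]
structure Marking where
  a : ℤˣ
  b : SignType
  c : Digit
  d : Digit
deriving DecidableEq

/-- Two markings fit together along an edge. -/
def Marking.Matches (m m' : Marking) : Prop :=
  m'.a = -m.a ∧ m'.b = -m.b ∧ m'.c = m.c ∧ m'.d = m.d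

/-- The reflection of a marking reverses its sidedness. -/
def Marking.reflect (m : Marking) : Marking := { m with b := -m.b }

/-- The plain outward marking `(+) = (+000)`. -/
def plus : Marking := ⟨1, 0, 0, 0⟩

/-- The plain inward marking `(-) = (-000)`. -/
def minus : Marking := ⟨-1, 0, 0, 0⟩

/-- A marked square in a definite orientation: it is cornered or uncornered, and it has a marking
on each of its four edges. -/
@[ext]
structure Tile where
  cornered : Bool
  edge : Dir → Marking

/-! ### Isometries of the square lattice -/

/-- The unit vector in a direction. -/
def vec (j : Dir) : ℤ × ℤ :=
  (![((0 : ℤ), (1 : ℤ)), (1, 0), (0, -1), (-1, 0)] : Fin 4 → ℤ × ℤ) j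

/-- An isometry of the plane that preserves the square lattice: the origin goes to `c`, east goes
to the direction `east`, and `flip` tells whether the orientation of the plane is reversed. -/
@[ext]
structure Isom where
  c : ℤ × ℤ
  east : Dir
  flip : Bool
deriving DecidableEq

namespace Isom

/-- The action of an isometry on directions. -/
def dir (g : Isom) (j : Dir) : Dir := if g.flip then g.east + 1 - j else g.east - 1 + j

/-- The inverse of the action on directions. -/
def dirInv (g : Isom) (j : Dir) : Dir := if g.flip then g.east + 1 - j else j - g.east + 1

/-- The action of an isometry on points. -/
def point (g : Isom) (p : ℤ × ℤ) : ℤ × ℤ := g.c + p.1 • vec (g.dir 1) + p.2 • vec (g.dir 0)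

/-- The action of an isometry on markings. -/
def mark (g : Isom) (m : Marking) : Marking := if g.flip then m.reflect else m

/-- The action of an isometry on marked squares. -/
def tile (g : Isom) (t : Tile) : Tile := ⟨t.cornered, fun j => g.mark (t.edge (g.dirInv j))⟩

/-- Composition of isometries: `g.comp h` applies `h` first. -/
def comp (g h : Isom) : Isom := ⟨g.point h.c, g.dir h.east, xor g.flip h.flip⟩

end Isom

/-! ### Tiles up to congruence, and tilings -/

/-- Two marked squares are congruent when an isometry takes one to the other. -/
def Congruent (t t' : Tile) : Prop := ∃ g : Isom, t' = g.tile t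

theorem Congruent.refl (t : Tile) : Congruent t t :=
  ⟨⟨0, 1, false⟩, by ext j <;> simp [Isom.tile, Isom.mark, Isom.dirInv]⟩

theorem Congruent.symm {t t' : Tile} (h : Congruent t t') : Congruent t' t := by
  obtain ⟨⟨c, i, f⟩, rfl⟩ := h
  cases f
  · exact ⟨⟨0, 2 - i, false⟩, by
      ext j <;> simp only [Isom.tile, Isom.mark, Isom.dirInv] <;> simp <;> ring_nf⟩
  · exact ⟨⟨0, i, true⟩, by
      ext j <;> simp [Isom.tile, Isom.mark, Isom.dirInv, Marking.reflect]⟩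

theorem Congruent.trans {t t' t'' : Tile} (h : Congruent t t') (h' : Congruent t' t'') :
    Congruent t t'' := by
  obtain ⟨⟨c, i, f⟩, rfl⟩ := h
  obtain ⟨⟨c', i', f'⟩, rfl⟩ := h'
  refine ⟨Isom.comp ⟨c', i', f'⟩ ⟨c, i, f⟩, ?_⟩
  cases f <;> cases f' <;> ext j <;>
    simp [Isom.tile, Isom.mark, Isom.dirInv, Isom.comp, Isom.dir, Marking.reflect] <;> ring_nf

instance congruenceSetoid : Setoid Tile :=
  ⟨Congruent, Congruent.refl, Congruent.symm, Congruent.trans⟩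

/-- A tile up to congruence. A set of tiles is a `Set TileClass`. -/
def TileClass := Quotient congruenceSetoid

/-- The congruence class of a marked square. -/
def Tile.cls (t : Tile) : TileClass := Quotient.mk congruenceSetoid t

/-- A tiling of the plane by marked squares, `τ p` being the tile whose centre is `p`: markings
match along every edge, and every vertex of the lattice meets exactly one cornered tile. -/
structure IsTiling (τ : ℤ × ℤ → Tile) : Prop where
  fits : ∀ (p : ℤ × ℤ) (j : Dir), ((τ p).edge j).Matches ((τ (p + vec j)).edge (j + 2))
  corners : ∀ x y : ℤ, ∃! q : ℤ × ℤ,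
    (q.1 = x ∨ q.1 = x + 1) ∧ (q.2 = y ∨ q.2 = y + 1) ∧ (τ q).cornered = true

/-- The tilings admitted by a set of tiles. -/
def Tilings (T : Set TileClass) : Set (ℤ × ℤ → Tile) :=
  {τ | IsTiling τ ∧ ∀ p, (τ p).cls ∈ T}

/-- A set of tiles is aperiodic if it admits a tiling but no periodic one. -/
def Aperiodic (T : Set TileClass) : Prop :=
  (Tilings T).Nonempty ∧ ∀ τ ∈ Tilings T, ¬ ∃ v : ℤ × ℤ, v ≠ 0 ∧ ∀ p, τ (p + v) = τ p

/-! ### The tiles -/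

/-- Outward tile with markings `(+)(+)(++1d)(+-0d)`, cornered or not. -/
def outerCorner (k : Bool) (d : Digit) : Tile :=
  ⟨k, (![plus, ⟨1, 1, 1, d⟩, ⟨1, -1, 0, d⟩, plus] : Fin 4 → Marking)⟩

/-- Outward tile with markings `(+)(+-2d)(+)(++3d)`, cornered or not. -/
def innerCorner (k : Bool) (d : Digit) : Tile :=
  ⟨k, (![plus, ⟨1, 1, 3, d⟩, plus, ⟨1, -1, 2, d⟩] : Fin 4 → Marking)⟩

/-- Horizontal markings (west, east) of a crossing tile, denoted `[-|`. -/
def hPlain : Marking × Marking := (minus, minus)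

/-- Horizontal markings `[0y|`. -/
def h0 (y : Digit) : Marking × Marking := (⟨-1, -1, 0, y⟩, ⟨-1, 1, 0, nim y 2⟩)

/-- Horizontal markings `[1y|`. -/
def h1 (y : Digit) : Marking × Marking := (⟨-1, -1, 1, y⟩, ⟨-1, 1, 2, y⟩)

/-- Horizontal markings `[3y|`. -/
def h3 (y : Digit) : Marking × Marking := (⟨-1, -1, 3, y⟩, ⟨-1, 1, 3, nim y 1⟩)

/-- Horizontal markings `[-3y|`. -/
def hNeg3 (y : Digit) : Marking × Marking := (⟨-1, 1, 3, y⟩, ⟨-1, -1, 3, nim y 1⟩)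

/-- Vertical markings (north, south) of a crossing tile, denoted `|+]`. -/
def vPlain : Marking × Marking := (plus, minus)

/-- Vertical markings `|zw]`. -/
def v (z w : Digit) : Marking × Marking := (⟨1, 1, z, w⟩, ⟨-1, -1, z, w⟩)

/-- The crossing tile with given horizontal and vertical markings. -/
def cross (h v : Marking × Marking) : TileClass :=
  Tile.cls ⟨false, (![v.1, h.2, v.2, h.1] : Fin 4 → Marking)⟩

/-- The pair `⟦3y|v⟧ = {[3y|v], [-3(y+2)|v]}`. -/
def pair3 (y : Digit) (v : Marking × Marking) : Set TileClass :=
  {cross (h3 y) v, cross (hNeg3 (nim y 2)) v}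

/-- The sixteen outward tiles `T₊₂`. -/
def outwardTiles : Set TileClass :=
  {t | ∃ (k : Bool) (d : Digit), t = (outerCorner k d).cls ∨ t = (innerCorner k d).cls}

/-- The forty key tiles `K₂`. -/
def keyTiles : Set TileClass :=
  {t | ∃ d : Digit, t ∈ ({cross (h0 d) (v 3 0), cross (h0 d) (v 3 2),
    cross (h1 d) (v 0 0), cross (h1 d) (v 0 2), cross (h1 d) (v 1 1), cross (h1 d) (v 1 3),
    cross (h1 d) (v 2 1), cross (h1 d) (v 2 3), cross (h1 d) (v 3 1), cross (h1 d) (v 3 3)} :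
      Set TileClass)}

/-- The remaining 155 crossing tiles `U₂`. -/
def otherTiles : Set TileClass :=
  {t | ∃ y z w : Digit, t = cross (h3 y) (v z w) ∨ t = cross (hNeg3 y) (v z w)} ∪
  {t | ∃ z w : Digit, t = cross hPlain (v z w)} ∪
  {cross (h0 0) vPlain, cross (h0 1) vPlain,
    cross (h1 0) vPlain, cross (h1 1) vPlain, cross (h1 2) vPlain, cross (h1 3) vPlain,
    cross (h3 0) vPlain, cross (hNeg3 0) vPlain, cross (h3 2) vPlain, cross (hNeg3 2) vPlain,
    cross hPlain vPlain}

/-- The master set of tiles `T₂`. -/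
def masterTiles : Set TileClass := outwardTiles ∪ keyTiles ∪ otherTiles

/-- The nineteen tiles `T₀` common to all the sets of crossing tiles. -/
def commonTiles : Set TileClass :=
  {cross hPlain vPlain, cross (h0 0) vPlain, cross (h0 1) vPlain} ∪
  {t | ∃ z w : Digit, t = cross hPlain (v z w)}

/-! ### Codes, atomic symbols and atomic sets of tiles -/

/-- A symbol `stuv`: for each of the four children `s, t, u, v` (indexed by `0, 1, 2, 3`) the set
of its allowed orientations within the parent. -/
abbrev Code := Fin 4 → Finset Digit

/-- A symbol gives a well-defined substitution if no digit is empty. -/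
def Code.Full (S : Code) : Prop := ∀ i, (S i).Nonempty

/-- A full symbol is deterministic if all its digits are singletons. -/
def Code.Deterministic (S : Code) : Prop := ∀ i, (S i).card = 1

/-- An atomic symbol: the child `child` is placed in the orientation `digit`. -/
structure Atom where
  child : Fin 4
  digit : Digit

/-- The atomic symbol belongs to the code. -/
def Code.Has (S : Code) (α : Atom) : Prop := α.digit ∈ S α.child

/-- The atomic sets `T_α`. With `d` the digit of `α`, the digits `d+1, d+2, d+3` are written
`b, q, p`. -/
def atomTiles (α : Atom) : Set TileClass :=
  let d := α.digit
  let b := nim d 1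
  let q := nim d 2
  let p := nim d 3
  (![{cross (h1 q) (v 0 0), cross (h0 b) (v 3 0),
        cross (h1 d) vPlain, cross (h1 b) vPlain, cross (h1 p) vPlain},
      {cross (h0 d) (v 3 2), cross (h1 p) (v 0 2),
        cross (h1 d) vPlain, cross (h1 b) vPlain, cross (h1 q) vPlain},
      {cross (h1 d) (v 3 3), cross (h1 b) (v 3 1), cross (h1 q) (v 2 3), cross (h1 p) (v 2 1)},
      {cross (h1 q) (v 1 1), cross (h1 p) (v 1 3), cross (h1 d) vPlain, cross (h1 b) vPlain}] :
    Fin 4 → Set TileClass) α.child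

/-- The table of the sets `T_{β → α}`: the arguments are the child and the digit of `β` and the
child of `α`. An entry `(e, x)` stands for the pair `⟦3(d+e)|x⟧`, with `d` the digit of `α`. -/
def pairTable : Fin 4 → Digit → Fin 4 → Digit × (Marking × Marking) :=
  ![![![(0, vPlain), (1, v 0 0), (1, v 2 0), (0, v 3 0)],
      ![(0, vPlain), (0, vPlain), (1, v 1 0), (0, vPlain)],
      ![(0, v 0 0), (0, vPlain), (0, v 2 0), (1, v 3 0)],
      ![(0, vPlain), (0, vPlain), (0, v 1 0), (0, vPlain)]],
    ![![(0, vPlain), (0, vPlain), (1, v 1 2), (0, vPlain)],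
      ![(0, vPlain), (1, v 0 2), (1, v 2 2), (0, v 3 2)],
      ![(0, vPlain), (0, vPlain), (0, v 1 2), (0, vPlain)],
      ![(0, v 0 2), (0, vPlain), (0, v 2 2), (1, v 3 2)]],
    ![![(0, v 3 3), (1, v 2 3), (0, vPlain), (0, vPlain)],
      ![(0, v 3 1), (1, v 2 1), (0, vPlain), (0, vPlain)],
      ![(0, v 2 3), (1, v 3 3), (0, vPlain), (0, vPlain)],
      ![(0, v 2 1), (1, v 3 1), (0, vPlain), (0, vPlain)]],
    ![![(0, vPlain), (1, v 1 1), (1, v 0 3), (0, vPlain)],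
      ![(0, vPlain), (1, v 1 3), (1, v 0 1), (0, vPlain)],
      ![(0, v 1 1), (0, vPlain), (0, v 0 3), (0, vPlain)],
      ![(0, v 1 3), (0, vPlain), (0, v 0 1), (0, vPlain)]]]

/-- The atomic sets `T_{β → α}`. -/
def pairTiles (β α : Atom) : Set TileClass :=
  let x := pairTable β.child β.digit α.child
  pair3 (nim α.digit x.1) x.2

/-- The set of tiles `T_S` of the code `S`. -/
def tileSet (S : Code) : Set TileClass :=
  outwardTiles ∪ commonTiles ∪ {t | ∃ α, S.Has α ∧ t ∈ atomTiles α} ∪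
    {t | ∃ α β, S.Has α ∧ S.Has β ∧ t ∈ pairTiles β α}

/-! ### Dominoes and the substitution -/

/-- A domino in the plane, of size 8 by 4 (measured in sides of the marked squares), with centre at
a lattice point. -/
@[ext]
structure Domino where
  centre : ℤ × ℤ
  horizontal : Bool
deriving DecidableEq

/-- The closed rectangle covered by a domino. -/
def Domino.region (D : Domino) : Set (ℝ × ℝ) :=
  let x : ℝ := D.centre.1
  let y : ℝ := D.centre.2
  if D.horizontal then Set.Icc (x - 4, y - 2) (x + 4, y + 2)
  else Set.Icc (x - 2, y - 4) (x + 2, y + 4)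

/-- A tiling of the plane by dominoes. -/
def IsDominoTiling (X : Set Domino) : Prop :=
  (⋃ D ∈ X, D.region) = Set.univ ∧
    X.Pairwise fun D D' => Disjoint (interior D.region) (interior D'.region)

/-- The image of a domino under an isometry. -/
def Isom.moveDomino (g : Isom) (D : Domino) : Domino :=
  ⟨g.point D.centre, if g.east = 1 ∨ g.east = 3 then D.horizontal else !D.horizontal⟩

/-- The image under `g` of the standard domino, which is horizontal with its centre at the
origin. An isometry `g` is at the same time a framing of this domino: it tells which of its ends
is which. -/
def Isom.domino (g : Isom) : Domino := g.moveDomino ⟨0, true⟩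

/-- The four symmetries of the standard domino: `1` is the reflection in the vertical axis, `2` the
reflection in the horizontal axis, `3` the half turn. -/
def sym (d : Digit) : Isom :=
  (![⟨0, 1, false⟩, ⟨0, 3, true⟩, ⟨0, 1, true⟩, ⟨0, 3, false⟩] : Fin 4 → Isom) d

/-- The positions of the four children, in their orientation `0`, in the inflated standard domino
(16 by 8): in the left half two horizontal dominoes, the upper one (`0`) placed by a translation and
the lower one (`1`) rotated by a half turn; in the right half two vertical dominoes, the inner
one (`2`) rotated by a counterclockwise and the outer one (`3`) by a clockwise quarter turn. -/
def childBase (i : Fin 4) : Isom :=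
  (![⟨(-4, 2), 1, false⟩, ⟨(-4, -2), 3, false⟩, ⟨(2, 0), 0, false⟩, ⟨(6, 0), 2, false⟩] :
    Fin 4 → Isom) i

/-- The frame of the `i`-th child supertile, of level `n` and in the orientation `d`, of the
supertile of level `n + 1` with frame `g`. -/
def childFrame (n : ℕ) (g : Isom) (i : Fin 4) (d : Digit) : Isom :=
  g.comp (Isom.comp ⟨(2 ^ n : ℤ) • (childBase i).c, (childBase i).east, (childBase i).flip⟩ (sym d))

/-- `FramedSupertile S n g C`: `C` is an `n`-level supertile of the substitution `σ_S` with frame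
`g`, recorded together with the levels and frames of all the supertiles it is composed of. An
`(n+1)`-level supertile consists of four `n`-level supertiles, each placed in one of the
orientations that `S` allows for it; all these choices are independent. -/
inductive FramedSupertile (S : Code) : ℕ → Isom → Set (ℕ × Isom) → Prop
  | zero (g : Isom) : FramedSupertile S 0 g {(0, g)}
  | succ (n : ℕ) (g : Isom) (d : Fin 4 → Digit) (C : Fin 4 → Set (ℕ × Isom))
      (hd : ∀ i, d i ∈ S i)
      (hC : ∀ i, FramedSupertile S n (childFrame n g i (d i)) (C i)) :
      FramedSupertile S (n + 1) g (insert (n + 1, g) (⋃ i, C i))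

/-- The (unmarked) dominoes of a set of framed supertiles. -/
def dominoes (C : Set (ℕ × Isom)) : Set Domino := {D | ∃ g : Isom, (0, g) ∈ C ∧ D = g.domino}

/-- The `n`-level supertiles of `σ_S`, as configurations of unmarked dominoes. -/
def IsSupertile (S : Code) (n : ℕ) (X : Set Domino) : Prop :=
  ∃ (g : Isom) (C : Set (ℕ × Isom)), FramedSupertile S n g C ∧ X = dominoes C

/-- The hierarchical tilings of `σ_S`: every domino lies in a nested sequence of supertiles of all
levels. -/
def IsHierarchical (S : Code) (X : Set Domino) : Prop :=
  IsDominoTiling X ∧ ∀ D ∈ X, ∃ C : ℕ → Set Domino, C 0 = {D} ∧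
    ∀ n, IsSupertile S n (C n) ∧ C n ⊆ C (n + 1) ∧ C n ⊆ X

/-- The substitution tilings of `σ_S`: every finite part lies in some supertile. -/
def IsSubstitutionTiling (S : Code) (X : Set Domino) : Prop :=
  IsDominoTiling X ∧ ∀ F ⊆ X, F.Finite → ∃ (n : ℕ) (C : Set Domino), IsSupertile S n C ∧ F ⊆ C

/-! ### Local maps and enforcement -/

/-- The data of a local map: finitely many distinct finite configurations of marked squares, with a
finite configuration of dominoes for each of them. -/
structure LocalRule where
  size : ℕ
  source : Fin size → Set ((ℤ × ℤ) × Tile)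
  target : Fin size → Set Domino
  source_injective : Function.Injective source
  source_finite : ∀ i, (source i).Finite
  target_finite : ∀ i, (target i).Finite

/-- The image under `g` of the `i`-th source configuration occurs in `τ`. -/
def LocalRule.Occurs (R : LocalRule) (τ : ℤ × ℤ → Tile) (i : Fin R.size) (g : Isom) : Prop :=
  ∀ x ∈ R.source i, τ (g.point x.1) = g.tile x.2

/-- The tiling `τ` is the union of copies of the source configurations. -/
def LocalRule.Covers (R : LocalRule) (τ : ℤ × ℤ → Tile) : Prop :=
  ∀ p, ∃ i g, R.Occurs τ i g ∧ ∃ x ∈ R.source i, g.point x.1 = p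

/-- The image of `τ` under the local map. -/
def LocalRule.apply (R : LocalRule) (τ : ℤ × ℤ → Tile) : Set Domino :=
  {D | ∃ i g, R.Occurs τ i g ∧ ∃ D' ∈ R.target i, D = g.moveDomino D'}

/-- The frame `g` of an `n`-level supertile is marked in `τ`. In the frame seen from its corner `d`
(that is, after the symmetry `d`) the upper left quarter carries an outer and an inner corner, which
are outward tiles with digit `d`, cornered for `n = 0` and uncornered for `n > 0`; their four signed
arms run straight for `2 ^ n` steps, half the way to the next corner of the frame. -/
def Marked (τ : ℤ × ℤ → Tile) (n : ℕ) (g : Isom) : Prop :=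
  ∀ d : Digit,
    let h := g.comp (sym d)
    let r : ℤ := 2 ^ n
    let o := outerCorner (n == 0) d
    let i := innerCorner (n == 0) d
    τ (h.point (-3 * r, r)) = h.tile o ∧
    τ (h.point (-r, r)) = h.tile i ∧
    ∀ k : ℤ, 0 ≤ k → k < r →
      (τ (h.point (-3 * r + k, r))).edge (h.dir 1) = h.mark (o.edge 1) ∧
      (τ (h.point (-3 * r, r - k))).edge (h.dir 2) = h.mark (o.edge 2) ∧
      (τ (h.point (-r + k, r))).edge (h.dir 1) = h.mark (i.edge 1) ∧
      (τ (h.point (-r - k, r))).edge (h.dir 3) = h.mark (i.edge 3)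

/-- All the supertile frames that are marked in `τ`. -/
def framing (τ : ℤ × ℤ → Tile) : Set (ℕ × Isom) := {x | Marked τ x.1 x.2}

/-- Erasing the markings: every marked block (a frame of level `0`, formed by eight cornered
tiles) is replaced by the unmarked domino it occupies. -/
def erase (τ : ℤ × ℤ → Tile) : Set Domino := dominoes (framing τ)

/-- The set of tiles `T` enforces the substitution `σ_S`. -/
structure Enforces (S : Code) (T : Set TileClass) : Prop where
  /-- On the tilings by `T`, erasing the markings is a local map ... -/
  isLocal : ∃ R : LocalRule, ∀ τ ∈ Tilings T, R.Covers τ ∧ R.apply τ = erase τ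
  /-- ... which takes each of them to a hierarchical tiling; -/
  hierarchical : ∀ τ ∈ Tilings T, IsHierarchical S (erase τ)
  /-- moreover the hierarchy of each domino is marked: the frames of all the supertiles (and of all
  the supertiles they are composed of) are marked in the tiling. -/
  framed : ∀ τ ∈ Tilings T, ∀ g, Marked τ 0 g → ∃ C : ℕ → Set (ℕ × Isom), C 0 = {(0, g)} ∧
    ∀ n, (∃ h, FramedSupertile S n h (C n)) ∧ C n ⊆ C (n + 1) ∧ C n ⊆ framing τ
  /-- Every substitution tiling is obtained, -/
  onto : ∀ X, IsSubstitutionTiling S X → ∃ τ ∈ Tilings T, erase τ = X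
  /-- and every supertile occurs with all its frames. -/
  realizes : ∀ n g C, FramedSupertile S n g C → ∃ τ ∈ Tilings T, C ⊆ framing τ

end DominoTiles

/-! An outward tile sends an arm in each of the four directions; a crossing tile lets one arm pass
and stops two arms that meet head on. A tiling is thus a system of straight arms. The digits of the
signed arms decide which arms may meet (`mate`), and the rules collected in `Crossing` decide what
may cross such a meeting.

Forcing. Every 2×2 block contains one cornered tile, so the cornered tiles stand in columns (or
rows) at distance two, where neighbouring columns may be shifted against each other (`k_column`). A
signed arm pointing into such a fault leads to a contradiction (`Fault.plain`). Hence every signed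
arm of a cornered tile meets the mate arm of another cornered tile, and the cornered tiles close up
to frames of dominoes (`exists_marked`), which tile the plane. Only unsided markings lie on one side
of a fault column, so the faults can be removed by sliding columns without damage to marked frames
(`exists_aligned`, `Sheared.framed`). In an aligned tiling the sites with even coordinates form a
tiling by the same tiles, in which the two ends of every domino play the part of cornered tiles
(`renorm_mem`), and a frame of this coarse tiling is a frame of the next level in the fine one
(`marked_of_renorm`). At a corner of such a frame the rules for key tiles determine in which
direction the domino extends, so the dominoes there are the four children in their places, and a key
tile beside each child displays its orientation (`exists_child`). A set of tiles that contains the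
outward tiles, and key tiles only for the digits of the code (`Good`), therefore forces the
hierarchy by iteration. The arms of marked frames of arbitrarily high level exclude periods.

Existence. Renormalisation can be inverted: the markings of a tiling are spread over the even sites,
and each of its frames is filled with four children in freely chosen orientations
(`Composed.inflate`). The tiles at the new sites depend only on the type of a child and on the type
of its parent, and the atomic sets and the pair sets list them (`Laid.legal_mid`). Repeated
inflation of an arbitrary arrangement leaves possibly illegal squares only at multiples of a high
power of two; a translation and compactness remove them. A prescribed supertile is the inflation of
a supertile half as large (`exists_realization`), and a substitution tiling is a limit of supertiles
(`exists_preimage`).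

Minimality. Each tile of the set occurs inside every marked supertile of level three whose
orientations are suitably chosen (`tiles_occur`). A set that realises all supertiles thus contains
all these tiles. For a deterministic code there is only one choice, and the forced hierarchy makes
all tiles occur in every tiling. -/

namespace DominoTiles

/-! ### The group of isometries -/

namespace Isom

/-- The linear part of an isometry. -/
def lin (g : Isom) (p : ℤ × ℤ) : ℤ × ℤ := p.1 • vec (g.dir 1) + p.2 • vec (g.dir 0)

theorem point_eq (g : Isom) (p : ℤ × ℤ) : g.point p = g.c + g.lin p := by
  simp [point, lin, add_assoc]

theorem lin_add (g : Isom) (p q : ℤ × ℤ) : g.lin (p + q) = g.lin p + g.lin q := by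
  simp only [lin, Prod.fst_add, Prod.snd_add, add_smul]; abel

theorem lin_smul (g : Isom) (k : ℤ) (p : ℤ × ℤ) : g.lin (k • p) = k • g.lin p := by
  simp [lin, mul_smul, smul_add]

/-- The centre plays no part in the linear action, so the claim concerns eight isometries and is
decidable. The same reduction to centre `0` recurs below whenever a statement about directions or
markings is checked by evaluation. -/
theorem lin_vec_aux : ∀ (e : Dir) (f : Bool) (j : Dir),
    (⟨0, e, f⟩ : Isom).lin (vec j) = vec ((⟨0, e, f⟩ : Isom).dir j) := by decide

theorem lin_vec (g : Isom) (j : Dir) : g.lin (vec j) = vec (g.dir j) := lin_vec_aux g.east g.flip j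

theorem point_add (g : Isom) (p q : ℤ × ℤ) : g.point (p + q) = g.point p + g.lin q := by
  simp only [point_eq, lin_add, add_assoc]

theorem point_add_vec (g : Isom) (p : ℤ × ℤ) (j : Dir) :
    g.point (p + vec j) = g.point p + vec (g.dir j) := by rw [point_add, lin_vec]

theorem dir_comp (g h : Isom) (j : Dir) : (g.comp h).dir j = g.dir (h.dir j) := by
  obtain ⟨c, e, f⟩ := g; obtain ⟨c', e', f'⟩ := h
  cases f <;> cases f' <;> simp [dir, comp] <;> ring

theorem lin_comp (g h : Isom) (p : ℤ × ℤ) : (g.comp h).lin p = g.lin (h.lin p) := by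
  rw [show h.lin p = p.1 • vec (h.dir 1) + p.2 • vec (h.dir 0) from rfl, lin_add, lin_smul,
    lin_smul, lin_vec, lin_vec, ← dir_comp, ← dir_comp]; rfl

theorem point_comp (g h : Isom) (p : ℤ × ℤ) : (g.comp h).point p = g.point (h.point p) := by
  rw [point_eq, lin_comp, point_eq h, point_add]; rfl

theorem dirInv_dir (g : Isom) (j : Dir) : g.dirInv (g.dir j) = j := by
  obtain ⟨c, e, f⟩ := g; cases f <;> simp [dir, dirInv]
  ring

theorem dir_dirInv (g : Isom) (j : Dir) : g.dir (g.dirInv j) = j := by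
  obtain ⟨c, e, f⟩ := g; cases f <;> simp [dir, dirInv]

theorem dir_injective (g : Isom) : Function.Injective g.dir :=
  Function.LeftInverse.injective g.dirInv_dir

theorem dir_add_two (g : Isom) (j : Dir) : g.dir (j + 2) = g.dir j + 2 := by
  obtain ⟨c, e, f⟩ := g
  cases f <;> simp only [dir, Bool.false_eq_true, if_true, if_false]
  · ring
  · have h4 : (4 : Dir) = 0 := by decide
    linear_combination -h4

theorem mark_comp (g h : Isom) (m : Marking) : (g.comp h).mark m = g.mark (h.mark m) := by
  obtain ⟨c, e, f⟩ := g; obtain ⟨c', e', f'⟩ := h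
  cases f <;> cases f' <;> simp [mark, comp, Marking.reflect]

theorem tile_edge_dir (g : Isom) (t : Tile) (j : Dir) :
    (g.tile t).edge (g.dir j) = g.mark (t.edge j) := by
  simp [tile, dirInv_dir]

theorem tile_ext_dir (g : Isom) {t t' : Tile} (hc : t.cornered = t'.cornered)
    (h : ∀ j, t.edge (g.dir j) = t'.edge (g.dir j)) : t = t' := by
  ext1
  · exact hc
  · funext j; simpa [dir_dirInv] using h (g.dirInv j)

theorem tile_comp (g h : Isom) (t : Tile) : (g.comp h).tile t = g.tile (h.tile t) := by
  refine tile_ext_dir (g.comp h) rfl ?_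
  intro j
  rw [tile_edge_dir, dir_comp, tile_edge_dir, tile_edge_dir, mark_comp]

theorem comp_assoc (g h k : Isom) : (g.comp h).comp k = g.comp (h.comp k) := by
  ext1
  · exact point_comp g h k.c
  · exact dir_comp g h k.east
  · simp [comp]

instance : One Isom := ⟨⟨0, 1, false⟩⟩
instance : Mul Isom := ⟨comp⟩
instance : Inv Isom := ⟨fun g =>
  ⟨-(⟨0, g.dirInv 1, g.flip⟩ : Isom).lin g.c, g.dirInv 1, g.flip⟩⟩

theorem comp_eq (g h : Isom) : g.comp h = g * h := rfl

theorem one_dir (j : Dir) : (1 : Isom).dir j = j := by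
  change (⟨0, 1, false⟩ : Isom).dir j = j; simp [dir]

theorem one_lin (p : ℤ × ℤ) : (1 : Isom).lin p = p := by
  rw [lin, one_dir, one_dir]; ext <;> simp [vec]

theorem one_point (p : ℤ × ℤ) : (1 : Isom).point p = p := by
  rw [point_eq, one_lin]; change 0 + p = p; simp

theorem one_mark (m : Marking) : (1 : Isom).mark m = m := rfl

theorem one_tile (t : Tile) : (1 : Isom).tile t = t := by
  refine tile_ext_dir 1 rfl ?_; intro j; rw [tile_edge_dir, one_mark, one_dir]

theorem inv_mul_east : ∀ (e : Dir) (f : Bool),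
    (⟨0, (⟨0, e, f⟩ : Isom).dirInv 1, f⟩ : Isom).dir e = 1 := by decide

instance : Group Isom where
  mul_assoc := comp_assoc
  one_mul g := by
    ext1
    · exact one_point _
    · exact one_dir _
    · exact Bool.false_xor _
  mul_one g := by
    change g.comp 1 = g
    ext1
    · change g.point 0 = g.c
      simp [point]
    · change g.dir 1 = g.east
      simp [dir]
    · exact Bool.xor_false _
  inv_mul_cancel g := by
    change (g⁻¹).comp g = 1
    ext1
    · change (g⁻¹).point g.c = 0
      rw [point_eq]; exact neg_add_cancel _
    · exact inv_mul_east g.east g.flip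
    · exact Bool.xor_self _

theorem mul_point (g h : Isom) (p : ℤ × ℤ) : (g * h).point p = g.point (h.point p) :=
  point_comp g h p
theorem mul_dir (g h : Isom) (j : Dir) : (g * h).dir j = g.dir (h.dir j) := dir_comp g h j
theorem mul_mark (g h : Isom) (m : Marking) : (g * h).mark m = g.mark (h.mark m) := mark_comp g h m
theorem mul_tile (g h : Isom) (t : Tile) : (g * h).tile t = g.tile (h.tile t) := tile_comp g h t
theorem mul_lin (g h : Isom) (p : ℤ × ℤ) : (g * h).lin p = g.lin (h.lin p) := lin_comp g h p

@[simp] theorem point_inv_point (g : Isom) (p : ℤ × ℤ) : g.point (g⁻¹.point p) = p := by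
  rw [← mul_point, mul_inv_cancel, one_point]
@[simp] theorem inv_point_point (g : Isom) (p : ℤ × ℤ) : g⁻¹.point (g.point p) = p := by
  rw [← mul_point, inv_mul_cancel, one_point]
@[simp] theorem tile_inv_tile (g : Isom) (t : Tile) : g.tile (g⁻¹.tile t) = t := by
  rw [← mul_tile, mul_inv_cancel, one_tile]
@[simp] theorem inv_tile_tile (g : Isom) (t : Tile) : g⁻¹.tile (g.tile t) = t := by
  rw [← mul_tile, inv_mul_cancel, one_tile]
@[simp] theorem dir_inv_dir (g : Isom) (j : Dir) : g.dir (g⁻¹.dir j) = j := by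
  rw [← mul_dir, mul_inv_cancel, one_dir]
@[simp] theorem inv_dir_dir (g : Isom) (j : Dir) : g⁻¹.dir (g.dir j) = j := by
  rw [← mul_dir, inv_mul_cancel, one_dir]

theorem point_injective (g : Isom) : Function.Injective g.point :=
  Function.LeftInverse.injective g.inv_point_point

theorem mark_a (g : Isom) (m : Marking) : (g.mark m).a = m.a := by
  unfold mark; split <;> rfl

theorem mark_involutive (g : Isom) (m : Marking) : g.mark (g.mark m) = m := by
  unfold mark; split <;> simp [Marking.reflect]

theorem mark_injective (g : Isom) : Function.Injective g.mark :=
  Function.LeftInverse.injective g.mark_involutive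

theorem tile_cls (g : Isom) (t : Tile) : (g.tile t).cls = t.cls :=
  (Quotient.sound (s := congruenceSetoid) (show Congruent t (g.tile t) from ⟨g, rfl⟩)).symm

end Isom

/-- The marking that fits with `m` along an edge. -/
def opp (m : Marking) : Marking := ⟨-m.a, -m.b, m.c, m.d⟩

theorem matches_iff (m m' : Marking) : m.Matches m' ↔ m' = opp m := by
  rw [Marking.ext_iff]; rfl

@[simp] theorem opp_opp (m : Marking) : opp (opp m) = m := by simp [opp]

theorem mark_opp (g : Isom) (m : Marking) : g.mark (opp m) = opp (g.mark m) := by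
  unfold Isom.mark; split <;> rfl

theorem matches_mark (g : Isom) {m m' : Marking} (h : m.Matches m') :
    (g.mark m).Matches (g.mark m') := by
  rw [matches_iff] at *; rw [h, mark_opp]

/-! ### The action of isometries on tilings and supertiles -/

/-- The image of an assignment of tiles under an isometry. -/
def act (g : Isom) (τ : ℤ × ℤ → Tile) : ℤ × ℤ → Tile := fun p => g.tile (τ (g⁻¹.point p))

theorem act_point (g : Isom) (τ : ℤ × ℤ → Tile) (p : ℤ × ℤ) :
    act g τ (g.point p) = g.tile (τ p) := by simp [act]

theorem act_inv_act (g : Isom) (τ : ℤ × ℤ → Tile) : act g⁻¹ (act g τ) = τ := by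
  funext p; simp [act]

theorem act_mul (g h : Isom) (τ : ℤ × ℤ → Tile) : act (g * h) τ = act g (act h τ) := by
  funext p; simp [act, Isom.mul_tile, Isom.mul_point]

theorem act_edge (g : Isom) (τ : ℤ × ℤ → Tile) (p : ℤ × ℤ) (j : Dir) :
    (act g τ (g.point p)).edge (g.dir j) = g.mark ((τ p).edge j) := by
  rw [act_point, Isom.tile_edge_dir]

/-- The four squares around the vertex whose lower left square is `p`. -/
def block (x y : ℤ) : Set (ℤ × ℤ) := {q | (q.1 = x ∨ q.1 = x + 1) ∧ (q.2 = y ∨ q.2 = y + 1)}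

theorem dir_vec_cases : ∀ (e : Dir) (f : Bool),
    let u := vec ((⟨0, e, f⟩ : Isom).dir 1)
    let w := vec ((⟨0, e, f⟩ : Isom).dir 0)
    (u = (1, 0) ∧ (w = (0, 1) ∨ w = (0, -1))) ∨ (u = (-1, 0) ∧ (w = (0, 1) ∨ w = (0, -1))) ∨
    (u = (0, 1) ∧ (w = (1, 0) ∨ w = (-1, 0))) ∨ (u = (0, -1) ∧ (w = (1, 0) ∨ w = (-1, 0))) := by
  decide

theorem Isom.vec_cases (g : Isom) :
    let u := vec (g.dir 1)
    let w := vec (g.dir 0)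
    (u = (1, 0) ∧ (w = (0, 1) ∨ w = (0, -1))) ∨ (u = (-1, 0) ∧ (w = (0, 1) ∨ w = (0, -1))) ∨
    (u = (0, 1) ∧ (w = (1, 0) ∨ w = (-1, 0))) ∨ (u = (0, -1) ∧ (w = (1, 0) ∨ w = (-1, 0))) :=
  dir_vec_cases g.east g.flip

/-- An isometry permutes the blocks. Where it reverses an axis, the far end of a block becomes the
near one, which explains the shifts by one in the witnesses. -/
theorem point_mem_block (g : Isom) (x y : ℤ) :
    ∃ x' y', ∀ p, g.point p ∈ block x y ↔ p ∈ block x' y' := by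
  rcases hc : g.c with ⟨a, b⟩
  rcases g.vec_cases with ⟨hu, hw | hw⟩ | ⟨hu, hw | hw⟩ | ⟨hu, hw | hw⟩ | ⟨hu, hw | hw⟩
  · refine ⟨x - a, y - b, fun p => ?_⟩
    simp only [Isom.point, block, Set.mem_ofPred_eq, hu, hw, hc, Prod.fst_add, Prod.snd_add,
      Prod.smul_fst, Prod.smul_snd, smul_eq_mul]; omega
  · refine ⟨x - a, b - y - 1, fun p => ?_⟩
    simp only [Isom.point, block, Set.mem_ofPred_eq, hu, hw, hc, Prod.fst_add, Prod.snd_add,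
      Prod.smul_fst, Prod.smul_snd, smul_eq_mul]; omega
  · refine ⟨a - x - 1, y - b, fun p => ?_⟩
    simp only [Isom.point, block, Set.mem_ofPred_eq, hu, hw, hc, Prod.fst_add, Prod.snd_add,
      Prod.smul_fst, Prod.smul_snd, smul_eq_mul]; omega
  · refine ⟨a - x - 1, b - y - 1, fun p => ?_⟩
    simp only [Isom.point, block, Set.mem_ofPred_eq, hu, hw, hc, Prod.fst_add, Prod.snd_add,
      Prod.smul_fst, Prod.smul_snd, smul_eq_mul]; omega
  · refine ⟨y - b, x - a, fun p => ?_⟩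
    simp only [Isom.point, block, Set.mem_ofPred_eq, hu, hw, hc, Prod.fst_add, Prod.snd_add,
      Prod.smul_fst, Prod.smul_snd, smul_eq_mul]; omega
  · refine ⟨y - b, a - x - 1, fun p => ?_⟩
    simp only [Isom.point, block, Set.mem_ofPred_eq, hu, hw, hc, Prod.fst_add, Prod.snd_add,
      Prod.smul_fst, Prod.smul_snd, smul_eq_mul]; omega
  · refine ⟨b - y - 1, x - a, fun p => ?_⟩
    simp only [Isom.point, block, Set.mem_ofPred_eq, hu, hw, hc, Prod.fst_add, Prod.snd_add,
      Prod.smul_fst, Prod.smul_snd, smul_eq_mul]; omega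
  · refine ⟨b - y - 1, a - x - 1, fun p => ?_⟩
    simp only [Isom.point, block, Set.mem_ofPred_eq, hu, hw, hc, Prod.fst_add, Prod.snd_add,
      Prod.smul_fst, Prod.smul_snd, smul_eq_mul]; omega

theorem IsTiling.unique_cornered {τ : ℤ × ℤ → Tile} (h : IsTiling τ) (x y : ℤ) :
    ∃! q, q ∈ block x y ∧ (τ q).cornered = true := by
  simpa only [block, Set.mem_ofPred_eq, and_assoc] using h.corners x y

theorem IsTiling.act {τ : ℤ × ℤ → Tile} (h : IsTiling τ) (g : Isom) : IsTiling (act g τ) where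
  fits p j := by
    obtain ⟨p, rfl⟩ : ∃ q, g.point q = p := ⟨g⁻¹.point p, by simp⟩
    obtain ⟨j, rfl⟩ : ∃ k, g.dir k = j := ⟨g⁻¹.dir j, by simp⟩
    rw [← Isom.point_add_vec, ← Isom.dir_add_two, act_edge, act_edge]
    exact matches_mark g (h.fits p j)
  corners x y := by
    obtain ⟨x', y', hb⟩ := point_mem_block g x y
    obtain ⟨q, ⟨hq, hk⟩, hu⟩ := h.unique_cornered x' y'
    have : ∃! q, q ∈ block x y ∧ (DominoTiles.act g τ q).cornered = true := by
      refine ⟨g.point q, ⟨(hb q).2 hq, by rw [act_point]; exact hk⟩, ?_⟩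
      rintro r ⟨hr, hr'⟩
      obtain ⟨r, rfl⟩ : ∃ q, g.point q = r := ⟨g⁻¹.point r, by simp⟩
      rw [act_point] at hr'
      rw [hu r ⟨(hb r).1 hr, hr'⟩]
    simpa only [block, Set.mem_ofPred_eq, and_assoc] using this

theorem act_mem_tilings {T : Set TileClass} {τ : ℤ × ℤ → Tile} (h : τ ∈ Tilings T) (g : Isom) :
    act g τ ∈ Tilings T :=
  ⟨h.1.act g, fun p => by rw [act, Isom.tile_cls]; exact h.2 _⟩

theorem Marked.act {τ : ℤ × ℤ → Tile} {n : ℕ} {h : Isom} (hm : Marked τ n h) (g : Isom) :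
    Marked (act g τ) n (g * h) := by
  intro d
  have key : (g * h).comp (sym d) = g * (h.comp (sym d)) := Isom.comp_assoc g h (sym d)
  obtain ⟨h1, h2, h3⟩ := hm d
  dsimp only at h1 h2 h3 ⊢
  rw [key]
  simp only [Isom.mul_point, Isom.mul_tile, Isom.mul_dir, Isom.mul_mark, act_point,
    Isom.tile_edge_dir]
  refine ⟨by rw [h1], by rw [h2], fun k hk hk' => ?_⟩
  obtain ⟨a, b, c, d⟩ := h3 k hk hk'
  exact ⟨by rw [a], by rw [b], by rw [c], by rw [d]⟩

theorem marked_act_iff {τ : ℤ × ℤ → Tile} {n : ℕ} {g h : Isom} :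
    Marked (act g τ) n h ↔ Marked τ n (g⁻¹ * h) := by
  constructor
  · intro hm; simpa [act_inv_act] using hm.act g⁻¹
  · intro hm; simpa using hm.act g

/-- The action of isometries on sets of frames. -/
def moveFrames (g : Isom) (C : Set (ℕ × Isom)) : Set (ℕ × Isom) := (fun x => (x.1, g * x.2)) '' C

theorem mem_moveFrames {g : Isom} {C : Set (ℕ × Isom)} {n : ℕ} {h : Isom} :
    (n, h) ∈ moveFrames g C ↔ (n, g⁻¹ * h) ∈ C := by
  constructor
  · rintro ⟨⟨m, k⟩, hk, e⟩
    obtain ⟨rfl, rfl⟩ := Prod.mk.inj e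
    simpa using hk
  · intro hk; exact ⟨_, hk, by simp⟩

theorem moveFrames_subset_framing {g : Isom} {C : Set (ℕ × Isom)} {τ : ℤ × ℤ → Tile} :
    moveFrames g C ⊆ framing (act g τ) ↔ C ⊆ framing τ := by
  constructor
  · rintro h ⟨n, k⟩ hk
    have : (n, g * k) ∈ framing (act g τ) := h (mem_moveFrames.2 (by simpa using hk))
    simpa [framing, marked_act_iff] using this
  · rintro h ⟨n, k⟩ hk
    have := h (mem_moveFrames.1 hk)
    simpa [framing, marked_act_iff] using this

theorem childFrame_mul (n : ℕ) (a g : Isom) (i : Fin 4) (d : Digit) :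
    childFrame n (a * g) i d = a * childFrame n g i d := Isom.comp_assoc _ _ _

theorem FramedSupertile.move {S : Code} {n : ℕ} {g : Isom} {C : Set (ℕ × Isom)}
    (h : FramedSupertile S n g C) (a : Isom) :
    FramedSupertile S n (a * g) (moveFrames a C) := by
  induction h with
  | zero g => simpa [moveFrames] using FramedSupertile.zero (S := S) (a * g)
  | succ n g d C hd hC ih =>
    have : moveFrames a (insert (n + 1, g) (⋃ i, C i)) =
        insert (n + 1, a * g) (⋃ i, moveFrames a (C i)) := by
      simp [moveFrames, Set.image_insert_eq, Set.image_iUnion]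
    rw [this]
    exact .succ n (a * g) d _ hd fun i => by rw [childFrame_mul]; exact ih i

end DominoTiles

namespace DominoTiles

/-! ### Local structure of the tiles -/

/-- The quarter turn to the side `s`. -/
def side (s : SignType) : Dir := match s with
  | 1 => 1
  | 0 => 0
  | -1 => 3

/-- The outgoing marking whose arm can meet an arm with marking `m` head on. -/
def mate (m : Marking) : Marking :=
  if m.b = 0 then m else
    ⟨m.a, -m.b, (![0, 2, 1, 3] : Fin 4 → Digit) m.c,
      (![nim m.d 2, m.d, m.d, nim m.d 1] : Fin 4 → Digit) m.c⟩

/-- The markings of an outward tile that has the signed marking `m` in the direction `j`. -/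
def outEdge (j : Dir) (m : Marking) (k : Dir) : Marking :=
  if k = j then m else
    if k = j + (if m.c = 0 ∨ m.c = 1 then side m.b else 2) then ⟨1, -m.b, nim m.c 1, m.d⟩ else plus

/-- The signed arms that may cross a meeting of a `1`-arm and a `2`-arm. -/
def IsKey (z w : Digit) : Prop :=
  (z = 0 ∧ (w = 0 ∨ w = 2)) ∨ (z ≠ 0 ∧ (w = 1 ∨ w = 3))

instance (z w : Digit) : Decidable (IsKey z w) := by unfold IsKey; infer_instance

/-- The properties of a crossing tile with its outward marking in the direction `j`. -/
structure Crossing (t : Tile) (j : Dir) : Prop where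
  uncornered : t.cornered = false
  out : (t.edge j).a = 1
  pass : t.edge (j + 2) = opp (t.edge j)
  proper : t.edge j = plus ∨ (t.edge j).b ≠ 0
  inward : ∀ s : SignType, s ≠ 0 → (t.edge (j + side s)).a = -1
  meet : ∀ s : SignType, s ≠ 0 → opp (t.edge (j + side (-s))) = mate (opp (t.edge (j + side s)))
  properIn : ∀ s : SignType, s ≠ 0 →
    t.edge (j + side s) = minus ∨ (t.edge (j + side s)).b ≠ 0
  away : ∀ s : SignType, s ≠ 0 → (t.edge (j + side s)).b ≠ 0 → (t.edge (j + side s)).c ≠ 3 →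
    (t.edge (j + side s)).b = s
  key0 : ∀ s : SignType, s ≠ 0 → (t.edge (j + side s)).b ≠ 0 → (t.edge (j + side s)).c = 0 →
    (t.edge j).b ≠ 0 → (t.edge j).c = 3 ∧ ((t.edge j).d = 0 ∨ (t.edge j).d = 2)
  key2 : ∀ s : SignType, s ≠ 0 → (t.edge (j + side s)).b ≠ 0 → (t.edge (j + side s)).c = 2 →
    (t.edge j).b ≠ 0 → (t.edge j).b = s ∧ IsKey (t.edge j).c (t.edge j).d

/-- A reflection exchanges clockwise and counterclockwise, so the sides of a direction change in
step with the signs of the markings. This is what makes `Crossing` and `outEdge` equivariant. -/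
theorem dir_add_side (g : Isom) (j : Dir) (s : SignType) :
    g.dir (j + side s) = g.dir j + side (if g.flip then -s else s) := by
  obtain ⟨c, e, f⟩ := g
  have h4 : (4 : Dir) = 0 := by decide
  have h3 : side (-1) = 3 := rfl
  have h1 : side 1 = 1 := rfl
  have h0 : side 0 = 0 := rfl
  cases f <;> cases s <;> simp [Isom.dir, h3, h1, h0]
  any_goals ring_nf
  · linear_combination -h4
  · linear_combination -h4

theorem mark_b (g : Isom) (m : Marking) : (g.mark m).b = if g.flip then -m.b else m.b := by
  unfold Isom.mark; split <;> rfl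
theorem mark_c (g : Isom) (m : Marking) : (g.mark m).c = m.c := by
  unfold Isom.mark; split <;> rfl
theorem mark_d (g : Isom) (m : Marking) : (g.mark m).d = m.d := by
  unfold Isom.mark; split <;> rfl

theorem mark_plus (g : Isom) : g.mark plus = plus := by unfold Isom.mark; split <;> rfl
theorem mark_minus (g : Isom) : g.mark minus = minus := by unfold Isom.mark; split <;> rfl

theorem mark_b_ne (g : Isom) (m : Marking) : (g.mark m).b ≠ 0 ↔ m.b ≠ 0 := by
  rw [mark_b]; split <;> simp

theorem mate_mark (g : Isom) (m : Marking) : mate (g.mark m) = g.mark (mate m) := by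
  by_cases h : m.b = 0
  · have : (g.mark m).b = 0 := by simpa using (mark_b_ne g m).not.2 (by simpa using h)
    simp [mate, h, this]
  · have : ¬ (g.mark m).b = 0 := (mark_b_ne g m).2 h
    unfold mate
    rw [if_neg h, if_neg this]
    unfold Isom.mark; split <;> rfl

theorem Crossing.tile {t : Tile} {j : Dir} (h : Crossing t j) (g : Isom) :
    Crossing (g.tile t) (g.dir j) := by
  have key : ∀ s : SignType, s ≠ 0 → ∃ s' : SignType, s' ≠ 0 ∧ s = (if g.flip then -s' else s') := by
    intro s hs
    cases g.flip
    · exact ⟨s, hs, rfl⟩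
    · exact ⟨-s, by simpa using hs, by simp⟩
  have hneg : ∀ s : SignType, (-(if g.flip then -s else s)) = (if g.flip then -(-s) else (-s)) := by
    intro s; split <;> rfl
  constructor
  · exact h.uncornered
  · rw [Isom.tile_edge_dir, Isom.mark_a, h.out]
  · rw [← Isom.dir_add_two, Isom.tile_edge_dir, Isom.tile_edge_dir, h.pass, mark_opp]
  · rw [Isom.tile_edge_dir, mark_b_ne]
    exact h.proper.imp (fun h => by rw [h, mark_plus]) id
  all_goals
    intro s hs
    obtain ⟨s, hs', rfl⟩ := key s hs
    try rw [hneg]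
    simp only [← dir_add_side, Isom.tile_edge_dir, Isom.mark_a, mark_b_ne, mark_c, mark_d,
      ← mark_opp, mate_mark]
  · exact h.inward s hs'
  · rw [h.meet s hs']
  · exact (h.properIn s hs').imp (fun h => by rw [h, mark_minus]) id
  · intro h1 h2; rw [mark_b, h.away s hs' h1 h2]
  · exact h.key0 s hs'
  · intro h1 h2 h3; rw [mark_b, (h.key2 s hs' h1 h2 h3).1]; exact ⟨rfl, (h.key2 s hs' h1 h2 h3).2⟩

/-- The crossing tile with given horizontal and vertical markings. -/
def crossTile (h v : Marking × Marking) : Tile :=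
  ⟨false, (![v.1, h.2, v.2, h.1] : Fin 4 → Marking)⟩

theorem cross_eq (h v : Marking × Marking) : cross h v = (crossTile h v).cls := rfl

theorem exists_isom_of_cls_eq {t t' : Tile} (h : t.cls = t'.cls) : ∃ g : Isom, t = g.tile t' :=
  Quotient.exact (s := congruenceSetoid) h.symm

/-- The conditions on a crossing tile that concern its side `s`. -/
def SideOK (t : Tile) (j : Dir) (s : SignType) : Prop :=
  (t.edge (j + side s)).a = -1 ∧
  opp (t.edge (j + side (-s))) = mate (opp (t.edge (j + side s))) ∧
  (t.edge (j + side s) = minus ∨ (t.edge (j + side s)).b ≠ 0) ∧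
  ((t.edge (j + side s)).b ≠ 0 → (t.edge (j + side s)).c ≠ 3 → (t.edge (j + side s)).b = s) ∧
  ((t.edge (j + side s)).b ≠ 0 → (t.edge (j + side s)).c = 0 →
    (t.edge j).b ≠ 0 → (t.edge j).c = 3 ∧ ((t.edge j).d = 0 ∨ (t.edge j).d = 2)) ∧
  ((t.edge (j + side s)).b ≠ 0 → (t.edge (j + side s)).c = 2 →
    (t.edge j).b ≠ 0 → (t.edge j).b = s ∧ IsKey (t.edge j).c (t.edge j).d)

instance (t : Tile) (j : Dir) (s : SignType) : Decidable (SideOK t j s) := by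
  unfold SideOK; infer_instance

theorem Crossing.of_side {t : Tile} {j : Dir} (h : t.cornered = false ∧ (t.edge j).a = 1 ∧
    t.edge (j + 2) = opp (t.edge j) ∧ (t.edge j = plus ∨ (t.edge j).b ≠ 0) ∧ SideOK t j 1 ∧
    SideOK t j (-1)) : Crossing t j := by
  obtain ⟨a, b, c, d, e, f⟩ := h
  have key : ∀ s : SignType, s ≠ 0 → SideOK t j s := by
    intro s hs; cases s
    exacts [absurd rfl hs, f, e]
  exact ⟨a, b, c, d, fun s hs => (key s hs).1, fun s hs => (key s hs).2.1,
      fun s hs => (key s hs).2.2.1, fun s hs => (key s hs).2.2.2.1, fun s hs => (key s hs).2.2.2.2.1,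
      fun s hs => (key s hs).2.2.2.2.2⟩

/-- The rules are verified by evaluation, family by family. The analysis of arbitrary tilings by the
master set then uses crossing tiles only through `Crossing`. -/
theorem crossing_hPlain (z w : Digit) : Crossing (crossTile hPlain (v z w)) 0 :=
  .of_side (by revert z w; decide)
set_option maxRecDepth 10000 in
theorem crossing_h3 (y z w : Digit) : Crossing (crossTile (h3 y) (v z w)) 0 :=
  .of_side (by revert y z w; decide)
set_option maxRecDepth 10000 in
theorem crossing_hNeg3 (y z w : Digit) : Crossing (crossTile (hNeg3 y) (v z w)) 0 :=
  .of_side (by revert y z w; decide)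
theorem crossing_plain (y : Digit) : Crossing (crossTile hPlain vPlain) 0 ∧
    Crossing (crossTile (h0 y) vPlain) 0 ∧ Crossing (crossTile (h1 y) vPlain) 0 ∧
    Crossing (crossTile (h3 y) vPlain) 0 ∧ Crossing (crossTile (hNeg3 y) vPlain) 0 :=
  ⟨.of_side (by decide), .of_side (by revert y; decide), .of_side (by revert y; decide),
    .of_side (by revert y; decide), .of_side (by revert y; decide)⟩
theorem crossing_h0 (y : Digit) : Crossing (crossTile (h0 y) (v 3 0)) 0 ∧
    Crossing (crossTile (h0 y) (v 3 2)) 0 :=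
  ⟨.of_side (by revert y; decide), .of_side (by revert y; decide)⟩
set_option maxRecDepth 10000 in
theorem crossing_h1 (y z w : Digit) (h : IsKey z w) : Crossing (crossTile (h1 y) (v z w)) 0 :=
  .of_side (by revert y z w; decide)

/-- The classes of the crossing tiles. -/
theorem mem_masterTiles_cases {c : TileClass} (h : c ∈ masterTiles) :
    (∃ k d, c = (outerCorner k d).cls ∨ c = (innerCorner k d).cls) ∨
    ∃ h v, c = cross h v ∧ Crossing (crossTile h v) 0 := by
  rcases h with (h | ⟨d, h⟩) | ((⟨y, z, w, h | h⟩ | ⟨z, w, h⟩) | h)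
  · exact .inl h
  · right
    rcases h with h | h | h | h | h | h | h | h | h | h
    · exact ⟨_, _, h, (crossing_h0 d).1⟩
    · exact ⟨_, _, h, (crossing_h0 d).2⟩
    all_goals exact ⟨_, _, h, crossing_h1 d _ _ (by decide)⟩
  · exact .inr ⟨_, _, h, crossing_h3 y z w⟩
  · exact .inr ⟨_, _, h, crossing_hNeg3 y z w⟩
  · exact .inr ⟨_, _, h, crossing_hPlain z w⟩
  · right
    rcases h with h | h | h | h | h | h | h | h | h | h | h
    · exact ⟨_, _, h, (crossing_plain 0).2.1⟩
    · exact ⟨_, _, h, (crossing_plain 1).2.1⟩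
    · exact ⟨_, _, h, (crossing_plain 0).2.2.1⟩
    · exact ⟨_, _, h, (crossing_plain 1).2.2.1⟩
    · exact ⟨_, _, h, (crossing_plain 2).2.2.1⟩
    · exact ⟨_, _, h, (crossing_plain 3).2.2.1⟩
    · exact ⟨_, _, h, (crossing_plain 0).2.2.2.1⟩
    · exact ⟨_, _, h, (crossing_plain 0).2.2.2.2⟩
    · exact ⟨_, _, h, (crossing_plain 2).2.2.2.1⟩
    · exact ⟨_, _, h, (crossing_plain 2).2.2.2.2⟩
    · exact ⟨_, _, h, (crossing_plain 0).1⟩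

/-- An outward tile, in any orientation. -/
structure Outward (t : Tile) : Prop where
  eq : ∃ (g : Isom) (k : Bool) (d : Digit), t = g.tile (outerCorner k d) ∨ t = g.tile (innerCorner k d)

theorem cls_cases {t : Tile} (h : t.cls ∈ masterTiles) : Outward t ∨ ∃ j, Crossing t j := by
  rcases mem_masterTiles_cases h with ⟨k, d, h | h⟩ | ⟨h, v, he, hc⟩
  · obtain ⟨g, rfl⟩ := exists_isom_of_cls_eq h; exact .inl ⟨g, k, d, .inl rfl⟩
  · obtain ⟨g, rfl⟩ := exists_isom_of_cls_eq h; exact .inl ⟨g, k, d, .inr rfl⟩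
  · rw [cross_eq] at he
    obtain ⟨g, rfl⟩ := exists_isom_of_cls_eq he
    exact .inr ⟨_, hc.tile g⟩

theorem Outward.tile {t : Tile} (h : Outward t) (a : Isom) : Outward (a.tile t) := by
  obtain ⟨g, k, d, rfl | rfl⟩ := h.eq
  · exact ⟨a * g, k, d, .inl (Isom.mul_tile _ _ _).symm⟩
  · exact ⟨a * g, k, d, .inr (Isom.mul_tile _ _ _).symm⟩

theorem Outward.a {t : Tile} (h : Outward t) (j : Dir) : (t.edge j).a = 1 := by
  obtain ⟨g, k, d, rfl | rfl⟩ := h.eq <;> clear h <;> rw [← g.dir_inv_dir j, Isom.tile_edge_dir, Isom.mark_a] <;>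
    generalize g⁻¹.dir j = i <;> clear g <;> decide +revert

theorem Outward.proper {t : Tile} (h : Outward t) (j : Dir) :
    t.edge j = plus ∨ (t.edge j).b ≠ 0 := by
  obtain ⟨g, k, d, rfl | rfl⟩ := h.eq <;> clear h <;> rw [← g.dir_inv_dir j, Isom.tile_edge_dir, mark_b_ne] <;>
    generalize g⁻¹.dir j = i <;> rw [← mark_plus g, g.mark_injective.eq_iff] <;> clear g <;>
    decide +revert

theorem outEdge_mark (g : Isom) (j k : Dir) (m : Marking) :
    outEdge (g.dir j) (g.mark m) (g.dir k) = g.mark (outEdge j m k) := by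
  unfold outEdge
  simp only [mark_c, mark_b, mark_d, g.dir_injective.eq_iff]
  have : (g.dir k = g.dir j + if m.c = 0 ∨ m.c = 1 then side (if g.flip = true then -m.b else m.b)
      else 2) ↔ k = j + (if m.c = 0 ∨ m.c = 1 then side m.b else 2) := by
    have h' : ∀ i, g.dir k = g.dir i ↔ k = i := fun i => g.dir_injective.eq_iff
    split
    · rw [← dir_add_side, h']
    · rw [← g.dir_add_two, h']
  simp only [this]
  by_cases h1 : k = j
  · simp only [h1, if_true]
  rw [if_neg h1, if_neg h1]
  split_ifs
  all_goals first | exact (mark_plus g).symm | (simp only [Isom.mark]; simp_all [Marking.reflect])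

/-- The two signed arms of an outward tile have types `0, 1` or `2, 3`, the same digit and opposite
signs. The second one is a quarter turn to the side of the offset at an outer corner, and opposite
at an inner corner. One signed arm therefore determines all four markings. -/
theorem Outward.edge {t : Tile} (h : Outward t) {j : Dir} {m : Marking} (hj : t.edge j = m)
    (hm : m.b ≠ 0) (k : Dir) : t.edge k = outEdge j m k := by
  subst hj
  obtain ⟨g, c, d, rfl | rfl⟩ := h.eq <;> clear h <;>
    rw [← g.dir_inv_dir j, ← g.dir_inv_dir k, Isom.tile_edge_dir, Isom.tile_edge_dir, outEdge_mark,
      g.mark_injective.eq_iff] <;>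
    rw [← g.dir_inv_dir j, Isom.tile_edge_dir, mark_b_ne] at hm <;>
    generalize g⁻¹.dir j = i at * <;> generalize g⁻¹.dir k = k at * <;> clear g <;>
    decide +revert

theorem Outward.exists_signed {t : Tile} (h : Outward t) : ∃ j, (t.edge j).b ≠ 0 := by
  obtain ⟨g, c, d, rfl | rfl⟩ := h.eq
  · exact ⟨g.dir 1, by rw [Isom.tile_edge_dir, mark_b_ne]; exact one_ne_zero⟩
  · exact ⟨g.dir 1, by rw [Isom.tile_edge_dir, mark_b_ne]; exact one_ne_zero⟩

theorem eq_or_eq_of_ne {b b' : SignType} (hb : b ≠ 0) (hb' : b' ≠ 0) : b' = b ∨ b' = -b := by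
  decide +revert

theorem Crossing.a {t : Tile} {j k : Dir} (h : Crossing t j) : (t.edge k).a = 1 ↔ k = j := by
  constructor
  · intro hk
    have key : ∀ k j : Dir, k = j ∨ k = j + side 1 ∨ k = j + 2 ∨ k = j + side (-1) := by decide
    have h1 : (1 : ℤˣ) ≠ -1 := by decide
    rcases key k j with rfl | rfl | rfl | rfl
    · rfl
    · rw [h.inward 1 (by decide)] at hk; exact absurd hk.symm h1
    · rw [h.pass] at hk; change -(t.edge j).a = 1 at hk; rw [h.out] at hk; exact absurd hk.symm h1
    · rw [h.inward (-1) (by decide)] at hk; exact absurd hk.symm h1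
  · rintro rfl; exact h.out

end DominoTiles

namespace DominoTiles

/-! ### Consequences of the local rules -/

/-- The tile at `p` is cornered. -/
def K (τ : ℤ × ℤ → Tile) (p : ℤ × ℤ) : Prop := (τ p).cornered = true

theorem IsTiling.fit {τ : ℤ × ℤ → Tile} (h : IsTiling τ) (p : ℤ × ℤ) (j : Dir) {q : ℤ × ℤ} {k : Dir}
    (hq : q = p + vec j := by first | rfl | (ext <;> simp [vec] <;> ring))
    (hk : k = j + 2 := by rfl) :
    (τ q).edge k = opp ((τ p).edge j) := by
  subst hq hk; exact (matches_iff _ _).1 (h.fits p j)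

/-! ### Columns of cornered tiles -/

theorem ex_k {τ : ℤ × ℤ → Tile} (h : IsTiling τ) (x y : ℤ) :
    K τ (x, y) ∨ K τ (x + 1, y) ∨ K τ (x, y + 1) ∨ K τ (x + 1, y + 1) := by
  obtain ⟨⟨a, b⟩, ⟨⟨h1, h2⟩, hk⟩, -⟩ := h.unique_cornered x y
  dsimp only at h1 h2
  rcases h1 with rfl | rfl <;> rcases h2 with rfl | rfl <;> simp [K, hk]

theorem k_near {τ : ℤ × ℤ → Tile} (h : IsTiling τ) {x y x' y' : ℤ} (hp : K τ (x, y))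
    (hq : K τ (x', y')) (h1 : x ≤ x' + 1) (h2 : x' ≤ x + 1) (h3 : y ≤ y' + 1) (h4 : y' ≤ y + 1) :
    x = x' ∧ y = y' := by
  have := (h.unique_cornered (min x x') (min y y')).unique
    (y₁ := (x, y)) (y₂ := (x', y'))
    ⟨⟨by dsimp only; omega, by dsimp only; omega⟩, hp⟩
    ⟨⟨by dsimp only; omega, by dsimp only; omega⟩, hq⟩
  exact Prod.mk.inj this

/-- The two blocks to the right of `(x, y)` can be served only from the column `x + 2`, at the
heights `y + 1` and `y - 1`. The blocks above and below then force `(x, y ± 2)`, so the misfit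
propagates along the whole column. -/
theorem k_shifted {τ : ℤ × ℤ → Tile} (h : IsTiling τ) {x y : ℤ} (hp : K τ (x, y))
    (hq : ¬ K τ (x + 2, y)) :
    (K τ (x + 2, y + 1) ∧ K τ (x, y + 2) ∧ ¬ K τ (x + 2, y + 2)) ∧
    (K τ (x + 2, y - 1) ∧ K τ (x, y - 2) ∧ ¬ K τ (x + 2, y - 2)) := by
  have n : ∀ x' y', K τ (x', y') → x ≤ x' + 1 → x' ≤ x + 1 → y ≤ y' + 1 → y' ≤ y + 1 →
      x = x' ∧ y = y' := fun x' y' => k_near h hp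
  have e1 : K τ (x + 2, y + 1) := by
    rcases ex_k h (x + 1) y with e | e | e | e
    · have := n _ _ e; omega
    · rw [add_assoc] at e; exact absurd e hq
    · have := n _ _ e; omega
    · rw [add_assoc] at e; exact e
  have e2 : K τ (x + 2, y - 1) := by
    rcases ex_k h (x + 1) (y - 1) with e | e | e | e
    · have := n _ _ e; omega
    · rw [add_assoc] at e; exact e
    · have := n _ _ e; omega
    · rw [add_assoc, sub_add_cancel] at e; exact absurd e hq
  refine ⟨⟨e1, ?_, fun e => ?_⟩, e2, ?_, fun e => ?_⟩
  · rcases ex_k h x (y + 1) with e | e | e | e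
    · have := n _ _ e; omega
    · have := n _ _ e; omega
    · rw [add_assoc] at e; exact e
    · have := k_near h e e1; omega
  · have := k_near h e e1; omega
  · rcases ex_k h x (y - 2) with e | e | e | e
    · exact e
    · have := k_near h e e2; omega
    · have := n _ _ e; omega
    · have := n _ _ e; omega
  · have := k_near h e e2; omega

theorem k_column {τ : ℤ × ℤ → Tile} (h : IsTiling τ) {x y : ℤ} (hp : K τ (x, y))
    (hq : ¬ K τ (x + 2, y)) (k : ℤ) : K τ (x, y + 2 * k) ∧ K τ (x + 2, y + 2 * k + 1) := by
  suffices H : K τ (x, y + 2 * k) ∧ ¬ K τ (x + 2, y + 2 * k) from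
    ⟨H.1, (k_shifted h H.1 H.2).1.1⟩
  induction k using Int.induction_on with
  | zero => simpa using ⟨hp, hq⟩
  | succ k ih =>
    have := (k_shifted h ih.1 ih.2).1.2
    rwa [show y + 2 * (k : ℤ) + 2 = y + 2 * (k + 1) by ring] at this
  | pred k ih =>
    have := (k_shifted h ih.1 ih.2).2.2
    rwa [show y + 2 * (-(k : ℤ)) - 2 = y + 2 * (-k - 1) by ring] at this

/-- A full column leaves no room for cornered tiles in the two adjacent columns. The blocks beyond
can then be served only at distance two, which forces a full column there. -/
theorem k_next_column {τ : ℤ × ℤ → Tile} (h : IsTiling τ) {x y : ℤ}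
    (hc : ∀ k, K τ (x, y + 2 * k)) {e : ℤ} (he : e = 2 ∨ e = -2) {y' : ℤ} (hq : K τ (x + e, y'))
    (k : ℤ) : K τ (x + e, y' + 2 * k) := by
  have none : ∀ x' y'', K τ (x', y'') → x' = x + 1 ∨ x' = x - 1 → False := by
    intro x' y'' hk hx
    have := k_near h hk (hc ((y'' - y) / 2))
    omega
  have step : ∀ y'', K τ (x + e, y'') → K τ (x + e, y'' + 2) ∧ K τ (x + e, y'' - 2) := by
    intro y'' hk
    have hn : ∀ y₁, K τ (x + e, y₁) → y'' ≤ y₁ + 1 → y₁ ≤ y'' + 1 → y'' = y₁ :=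
      fun y₁ h1 h2 h3 => (k_near h hk h1 (by omega) (by omega) h2 h3).2
    rcases he with rfl | rfl
    · constructor
      · rcases ex_k h (x + 1) (y'' + 1) with e | e | e | e
        · exact (none _ _ e (by omega)).elim
        · rw [add_assoc] at e; have := hn _ e; omega
        · exact (none _ _ e (by omega)).elim
        · rw [add_assoc, add_assoc] at e; exact e
      · rcases ex_k h (x + 1) (y'' - 2) with e | e | e | e
        · exact (none _ _ e (by omega)).elim
        · rw [add_assoc] at e; exact e
        · exact (none _ _ e (by omega)).elim
        · rw [add_assoc] at e; have := hn _ e; omega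
    · constructor
      · rcases ex_k h (x + -2) (y'' + 1) with e | e | e | e
        · have := hn _ e; omega
        · exact (none _ _ e (by omega)).elim
        · rw [add_assoc y''] at e; exact e
        · exact (none _ _ e (by omega)).elim
      · rcases ex_k h (x + -2) (y'' - 2) with e | e | e | e
        · exact e
        · exact (none _ _ e (by omega)).elim
        · have := hn _ e; omega
        · exact (none _ _ e (by omega)).elim
  induction k using Int.induction_on with
  | zero => simpa using hq
  | succ k ih =>
    have := (step _ ih).1
    rwa [show y' + 2 * (k : ℤ) + 2 = y' + 2 * (k + 1) by ring] at this
  | pred k ih =>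
    have := (step _ ih).2
    rwa [show y' + 2 * (-(k : ℤ)) - 2 = y' + 2 * (-k - 1) by ring] at this

/-! ### Tiles with known inward and outward markings -/

theorem neg_one_ne_one : (-1 : ℤˣ) ≠ 1 := by decide

theorem one_ne : (1 : SignType) ≠ 0 := by decide
theorem neg_one_ne : (-1 : SignType) ≠ 0 := by decide

theorem nim_zero (d : Digit) : nim d 0 = d := by revert d; decide
theorem nim_self (d : Digit) : nim d d = 0 := by revert d; decide
theorem nim_nim_cancel (d e : Digit) : nim d (nim d e) = e := by revert d e; decide

theorem crossing_of_in {t : Tile} (ht : t.cls ∈ masterTiles) {i : Dir} (hi : (t.edge i).a = -1) :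
    ∃ j, Crossing t j :=
  (cls_cases ht).resolve_left fun h => neg_one_ne_one (hi.symm.trans (h.a i))

theorem crossing_of {t : Tile} (ht : t.cls ∈ masterTiles) {i j : Dir} (hi : (t.edge i).a = -1)
    (hj : (t.edge j).a = 1) : Crossing t j := by
  obtain ⟨k, hk⟩ := crossing_of_in ht hi
  rwa [hk.a.1 hj]

theorem crossing_of_in3 {t : Tile} (ht : t.cls ∈ masterTiles) (j : Dir)
    (h1 : (t.edge (j + 1)).a = -1) (h2 : (t.edge (j + 2)).a = -1) (h3 : (t.edge (j + 3)).a = -1) :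
    Crossing t j := by
  obtain ⟨k, hk⟩ := crossing_of_in ht h1
  have key : ∀ k j : Dir, k = j ∨ k = j + 1 ∨ k = j + 2 ∨ k = j + 3 := by decide
  have := hk.out
  rcases key k j with rfl | rfl | rfl | rfl
  · exact hk
  · exact absurd (h1.symm.trans this) neg_one_ne_one
  · exact absurd (h2.symm.trans this) neg_one_ne_one
  · exact absurd (h3.symm.trans this) neg_one_ne_one

theorem outward_of {t : Tile} (ht : t.cls ∈ masterTiles) {i j : Dir} (hij : i ≠ j)
    (hi : (t.edge i).a = 1) (hj : (t.edge j).a = 1) : Outward t :=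
  (cls_cases ht).resolve_right fun ⟨_, h⟩ => hij ((h.a.1 hi).trans (h.a.1 hj).symm)

theorem Crossing.a_in {t : Tile} {j k : Dir} (h : Crossing t j) (hk : k ≠ j) :
    (t.edge k).a = -1 :=
  (Int.units_eq_one_or _).resolve_left fun e => hk (h.a.1 e)

theorem Crossing.unique {t : Tile} {j k : Dir} (h : Crossing t j) (h' : Crossing t k) : j = k :=
  h'.a.1 h.out

theorem crossing_of_meet {t : Tile} (ht : t.cls ∈ masterTiles) {j : Dir}
    (h1 : (t.edge j).a = -1) (h2 : (t.edge (j + 2)).a = -1) :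
    ∃ s : SignType, s ≠ 0 ∧ Crossing t (j + side s) := by
  obtain ⟨k, hk⟩ := crossing_of_in ht h1
  have key : ∀ k j : Dir, k = j ∨ k = j + side 1 ∨ k = j + 2 ∨ k = j + side (-1) := by decide
  have := hk.out
  rcases key k j with rfl | rfl | rfl | rfl
  · exact absurd (h1.symm.trans this) neg_one_ne_one
  · exact ⟨1, by decide, hk⟩
  · exact absurd (h2.symm.trans this) neg_one_ne_one
  · exact ⟨-1, by decide, hk⟩

theorem meet_mate {t : Tile} (ht : t.cls ∈ masterTiles) {j : Dir}
    (h1 : (t.edge j).a = -1) (h2 : (t.edge (j + 2)).a = -1) :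
    opp (t.edge (j + 2)) = mate (opp (t.edge j)) := by
  obtain ⟨s, hs, hc⟩ := crossing_of_meet ht h1 h2
  have e1 : j + side s + side (-s) = j := by clear h1 h2 hc ht; decide +revert
  have e2 : j + side s + side s = j + 2 := by clear h1 h2 hc ht; decide +revert
  have := hc.meet (-s) (by simpa using hs)
  rwa [neg_neg, e1, e2] at this

/-- Arms that meet are offset to one side, and the arm that crosses them leaves to the other side.
In a frame this means that its sides are crossed from the inside to the outside, except at the
meeting of two `3`-arms in the middle of a long side, where both directions are allowed. -/
theorem meet_away {t : Tile} (ht : t.cls ∈ masterTiles) {j k j' : Dir} {b : SignType} {c d : Digit}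
    (hm : t.edge j = ⟨-1, b, c, d⟩) (h2 : (t.edge j').a = -1) (hb : b ≠ 0 := by decide)
    (hcc : c ≠ 3 := by decide) (hj : j' = j + 2 := by rfl) (hk : k = j + side (-b) := by rfl) :
    Crossing t k := by
  subst hj
  obtain ⟨s, hs, hc⟩ := crossing_of_meet ht (by rw [hm]) h2
  have e1 : j + side s + side (-s) = j := by clear hk h2 hc ht hm; decide +revert
  have := hc.away (-s) (by simpa using hs)
  rw [e1, hm] at this
  rw [hk, show b = -s from this hb hcc, neg_neg]; exact hc

theorem outward_of_k {T : Set TileClass} (hT : T ⊆ masterTiles) {τ : ℤ × ℤ → Tile}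
    (h : τ ∈ Tilings T) {p : ℤ × ℤ} (hp : K τ p) : Outward (τ p) :=
  (cls_cases (hT (h.2 p))).resolve_right fun ⟨j, hj⟩ => by
    rw [K, hj.uncornered] at hp; exact Bool.false_ne_true hp

theorem IsTiling.in_iff {τ : ℤ × ℤ → Tile} (h : IsTiling τ) (p : ℤ × ℤ) (j : Dir) {q : ℤ × ℤ}
    {k : Dir} (hq : q = p + vec j := by first | rfl | (ext <;> simp [vec] <;> ring))
    (hk : k = j + 2 := by rfl) : ((τ q).edge k).a = -1 ↔ ((τ p).edge j).a = 1 := by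
  rw [h.fit p j hq hk]; exact neg_inj

theorem IsTiling.out_iff {τ : ℤ × ℤ → Tile} (h : IsTiling τ) (p : ℤ × ℤ) (j : Dir) {q : ℤ × ℤ}
    {k : Dir} (hq : q = p + vec j := by first | rfl | (ext <;> simp [vec] <;> ring))
    (hk : k = j + 2 := by rfl) : ((τ q).edge k).a = 1 ↔ ((τ p).edge j).a = -1 := by
  rw [h.fit p j hq hk]; exact neg_eq_iff_eq_neg

/-! ### Following arms -/

theorem IsTiling.edge_fit {τ : ℤ × ℤ → Tile} (h : IsTiling τ) {p : ℤ × ℤ} {j : Dir} {m : Marking}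
    (hm : (τ p).edge j = m) {q : ℤ × ℤ} {k : Dir} {m' : Marking}
    (hq : q = p + vec j := by first | rfl | (ext <;> simp [vec] <;> ring))
    (hk : k = j + 2 := by rfl) (hm' : opp m = m' := by rfl) : (τ q).edge k = m' := by
  rw [h.fit p j hq hk, hm, hm']

theorem Outward.edge_eq {t : Tile} (h : Outward t) {j : Dir} {b : SignType} {c d : Digit}
    (hj : t.edge j = ⟨1, b, c, d⟩) (k : Dir) {m' : Marking} (hb : b ≠ 0 := by decide)
    (hm' : outEdge j ⟨1, b, c, d⟩ k = m' := by rfl) : t.edge k = m' := by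
  rw [h.edge hj hb k, hm']

/-- The two arms that meet half way between two outward tiles are mates. -/
theorem pair_mate {τ : ℤ × ℤ → Tile} (h : τ ∈ Tilings masterTiles) {p r : ℤ × ℤ} {j k : Dir}
    {m m' : Marking} (hm : (τ p).edge j = m) (hp : (m.a = 1) := by rfl)
    (hr : ((τ r).edge k).a = 1)
    (hpr : r = p + vec j + vec j := by first | rfl | (ext <;> simp [vec] <;> ring))
    (hk : k = j + 2 := by rfl) (hm' : mate m = m' := by rfl) : (τ r).edge k = m' := by
  subst hk hpr hm hm'
  have e4 : j + 2 + 2 = j := by clear hp hr; decide +revert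
  have h1 := h.1.fit p j (q := p + vec j) (k := j + 2) rfl rfl
  have h2 := h.1.fit (p + vec j) j (q := p + vec j + vec j) (k := j + 2) rfl rfl
  have := meet_mate (h.2 (p + vec j)) (j := j + 2) (by rw [h1, ← hp]; rfl)
    (by rw [e4, ← neg_eq_iff_eq_neg, ← hr, h2]; rfl)
  rwa [h1, opp_opp, e4, ← h2] at this

/-- The direction of the outward arm of a tile where a signed `0`-, `1`- or `2`-arm is met. -/
theorem mid_away {τ : ℤ × ℤ → Tile} (h : τ ∈ Tilings masterTiles) {p q r : ℤ × ℤ} {j j' k : Dir}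
    {b : SignType} {c d : Digit} (hm : (τ p).edge j = ⟨1, b, c, d⟩)
    (hr : ((τ r).edge j').a = 1) (hb : b ≠ 0 := by decide) (hc : c ≠ 3 := by decide)
    (hq : q = p + vec j := by first | rfl | (ext <;> simp [vec] <;> ring))
    (hr' : r = q + vec j := by first | rfl | (ext <;> simp [vec] <;> ring))
    (hj : j' = j + 2 := by rfl) (hk : k = j + 2 + side b := by rfl) : Crossing (τ q) k := by
  subst hj hk hr' hq
  refine meet_away (j := j + 2) (h.2 _) (h.1.edge_fit hm) ?_ (hb := by simpa using hb) hc rfl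
    (by rw [neg_neg])
  rw [show j + 2 + 2 = j by clear hm hr; decide +revert, ← h.1.out_iff _ j rfl rfl, hr]

theorem Crossing.pass_eq {t : Tile} {j k : Dir} (h : Crossing t j) {m m' : Marking}
    (hm : t.edge k = m) (hk : k = j + 2 := by rfl) (hm' : opp m = m' := by rfl) :
    t.edge j = m' := by
  rw [← hm', ← hm, hk, h.pass, opp_opp]

/-! ### Shifted columns of cornered tiles -/

/-- The cornered tiles in the columns `0` and `2` are shifted relatively to each other. -/
structure Fault (τ : ℤ × ℤ → Tile) : Prop where
  mem : τ ∈ Tilings masterTiles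
  left : ∀ k, K τ (0, 2 * k)
  right : ∀ k, K τ (2, 2 * k + 1)

namespace Fault

variable {τ : ℤ × ℤ → Tile}

theorem master (h : Fault τ) (p : ℤ × ℤ) : (τ p).cls ∈ masterTiles := h.mem.2 p

theorem outward (h : Fault τ) {p : ℤ × ℤ} (hp : K τ p) : Outward (τ p) :=
  outward_of_k subset_rfl h.mem hp

theorem act_of (h : Fault τ) (g : Isom) (h1 : ∀ k, ∃ l, g.point (0, 2 * l) = (0, 2 * k) ∨
    g.point (2, 2 * l + 1) = (0, 2 * k)) (h2 : ∀ k, ∃ l, g.point (0, 2 * l) = (2, 2 * k + 1) ∨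
    g.point (2, 2 * l + 1) = (2, 2 * k + 1)) : Fault (act g τ) := by
  refine ⟨act_mem_tilings h.mem g, fun k => ?_, fun k => ?_⟩
  · obtain ⟨l, hl | hl⟩ := h1 k
    · rw [← hl, K, act_point]; exact h.left l
    · rw [← hl, K, act_point]; exact h.right l
  · obtain ⟨l, hl | hl⟩ := h2 k
    · rw [← hl, K, act_point]; exact h.left l
    · rw [← hl, K, act_point]; exact h.right l

/-- The reflection that exchanges the two sides of the fault. -/
def mirrorX : Isom := ⟨(2, 1), 3, true⟩
/-- The reflection in the horizontal axis at height `k`. -/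
def mirrorY (k : ℤ) : Isom := ⟨(0, 2 * k), 1, true⟩
/-- The vertical translation by `2 * k`. -/
def upY (k : ℤ) : Isom := ⟨(0, 2 * k), 1, false⟩

theorem mirrorX_point (x y : ℤ) : mirrorX.point (x, y) = (2 - x, y + 1) := by
  change ((2, 1) : ℤ × ℤ) + x • ((-1 : ℤ), (0 : ℤ)) + y • ((0 : ℤ), (1 : ℤ)) = _
  ext <;> simp <;> ring
theorem mirrorY_point (k x y : ℤ) : (mirrorY k).point (x, y) = (x, 2 * k - y) := by
  change ((0, 2 * k) : ℤ × ℤ) + x • ((1 : ℤ), (0 : ℤ)) + y • ((0 : ℤ), (-1 : ℤ)) = _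
  ext <;> (simp; try ring)
theorem upY_point (k x y : ℤ) : (upY k).point (x, y) = (x, 2 * k + y) := by
  change ((0, 2 * k) : ℤ × ℤ) + x • ((1 : ℤ), (0 : ℤ)) + y • ((0 : ℤ), (1 : ℤ)) = _
  ext <;> simp

theorem flipX (h : Fault τ) : Fault (act mirrorX τ) :=
  h.act_of _ (fun k => ⟨k - 1, .inr (by rw [mirrorX_point]; ext <;> simp; ring)⟩)
    (fun k => ⟨k, .inl (by rw [mirrorX_point]; ext <;> simp)⟩)
theorem flipY (h : Fault τ) (k : ℤ) : Fault (act (mirrorY k) τ) :=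
  h.act_of _ (fun l => ⟨k - l, .inl (by rw [mirrorY_point]; ext <;> simp; ring)⟩)
    (fun l => ⟨k - 1 - l, .inr (by rw [mirrorY_point]; ext <;> simp; ring)⟩)
theorem shiftY (h : Fault τ) (k : ℤ) : Fault (act (upY k) τ) :=
  h.act_of _ (fun l => ⟨l - k, .inl (by rw [upY_point]; ext <;> simp; ring)⟩)
    (fun l => ⟨l - k, .inr (by rw [upY_point]; ext <;> simp; ring)⟩)

theorem in_west (h : Fault τ) (k : ℤ) : ((τ (1, 2 * k)).edge 3).a = -1 :=
  (h.mem.1.in_iff (0, 2 * k) 1).2 ((h.outward (h.left k)).a 1)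

theorem in_east (h : Fault τ) (k : ℤ) : ((τ (1, 2 * k + 1)).edge 1).a = -1 :=
  (h.mem.1.in_iff (2, 2 * k + 1) 3).2 ((h.outward (h.right k)).a 3)

theorem crossing (h : Fault τ) (y : ℤ) : ∃ j, Crossing (τ (1, y)) j := by
  rcases Int.even_or_odd' y with ⟨k, rfl | rfl⟩
  · exact crossing_of_in (h.master _) (h.in_west k)
  · exact crossing_of_in (h.master _) (h.in_east k)

/-- An arm passes through the fault at height `y`. -/
def Pass (τ : ℤ × ℤ → Tile) (y : ℤ) : Prop := Crossing (τ (1, y)) 1 ∨ Crossing (τ (1, y)) 3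

theorem not_pass (h : Fault τ) {y : ℤ} (hy : ¬ Pass τ y) :
    Crossing (τ (1, y)) 0 ∨ Crossing (τ (1, y)) 2 := by
  obtain ⟨j, hj⟩ := h.crossing y
  have key : ∀ j : Dir, j = 0 ∨ j = 1 ∨ j = 2 ∨ j = 3 := by decide
  rcases key j with rfl | rfl | rfl | rfl
  exacts [.inl hj, absurd (.inl hj) hy, .inr hj, absurd (.inr hj) hy]

theorem in_of_not_pass (h : Fault τ) {y : ℤ} (hy : ¬ Pass τ y) :
    ((τ (1, y)).edge 1).a = -1 ∧ ((τ (1, y)).edge 3).a = -1 := by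
  rcases h.not_pass hy with hj | hj <;> exact ⟨hj.a_in (by decide), hj.a_in (by decide)⟩

theorem crossing_south (h : Fault τ) {y : ℤ} (hy : ((τ (1, y)).edge 0).a = -1) :
    Crossing (τ (1, y + 1)) 2 := by
  obtain ⟨j, hj⟩ := h.crossing (y + 1)
  have : ((τ (1, y + 1)).edge 2).a = 1 := (h.mem.1.out_iff (1, y) 0).2 hy
  rwa [hj.a.1 this]

/-- A passing tile has an inward marking in the north, so the tile above it points south, and so on
upwards. All arms above a passage run towards it, which leaves no room for a second passage. -/
theorem pass_up (h : Fault τ) {y : ℤ} (hy : Pass τ y) (n : ℕ) : Crossing (τ (1, y + 1 + n)) 2 := by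
  induction n with
  | zero =>
    rw [Nat.cast_zero, add_zero]
    apply h.crossing_south
    rcases hy with hj | hj <;> exact hj.a_in (by decide)
  | succ n ih =>
    have := h.crossing_south (ih.a_in (by decide))
    rwa [show y + 1 + ((n + 1 : ℕ) : ℤ) = y + 1 + n + 1 by push_cast; ring]

theorem pass_unique (h : Fault τ) {y y' : ℤ} (hy : Pass τ y) (hy' : Pass τ y') : y = y' := by
  have key : ∀ y y', Pass τ y → Pass τ y' → ¬ y < y' := by
    intro y y' hy hy' hlt
    have := h.pass_up hy (y' - y - 1).toNat
    rw [show y + 1 + ((y' - y - 1).toNat : ℤ) = y' by omega] at this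
    rcases hy' with hj | hj <;> exact absurd (hj.unique this) (by decide)
  exact le_antisymm (not_lt.1 (key _ _ hy' hy)) (not_lt.1 (key _ _ hy hy'))

theorem k00 (h : Fault τ) : K τ (0, 0) := h.left 0
theorem k02 (h : Fault τ) : K τ (0, 2) := h.left 1

theorem act_upY (k : ℤ) (τ : ℤ × ℤ → Tile) (x y : ℤ) : act (upY k) τ (x, y) = τ (x, y - 2 * k) := by
  have : (x, y) = (upY k).point (x, y - 2 * k) := by rw [upY_point]; ext <;> simp
  rw [this, act_point]; exact Isom.one_tile _

theorem act_mirrorX (τ : ℤ × ℤ → Tile) (x y : ℤ) (j : Dir) :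
    (act mirrorX τ (x, y)).edge j = ((τ (2 - x, y - 1)).edge (-j)).reflect := by
  have : (x, y) = mirrorX.point (2 - x, y - 1) := by rw [mirrorX_point]; ext <;> simp
  rw [this, act_point]
  change ((τ (2 - x, y - 1)).edge (4 - j)).reflect = _
  rw [show (4 : Dir) = 0 by decide, zero_sub]

theorem act_mirrorY (k : ℤ) (τ : ℤ × ℤ → Tile) (x y : ℤ) (j : Dir) :
    (act (mirrorY k) τ (x, y)).edge j = ((τ (x, 2 * k - y)).edge (2 - j)).reflect := by
  have : (x, y) = (mirrorY k).point (x, 2 * k - y) := by rw [mirrorY_point]; ext <;> simp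
  rw [this, act_point]; rfl

theorem edge_a (h : Fault τ) {p : ℤ × ℤ} (hp : K τ p) (j : Dir) : ((τ p).edge j).a = 1 :=
  (h.outward hp).a j

/-- The companion of the arm runs north and must be crossed westwards at `(0, 1)`. The crossing arm
comes through `(1, 1)`, so the fault is passed at height `1`, and `(1, 0)` below it points north.
But the arm from `(0, 0)` is offset to the north and can be crossed only southwards. -/
theorem outer_aux (h : Fault τ) {c d : Digit} (hm : (τ (0, 0)).edge 1 = ⟨1, -1, c, d⟩)
    (hc : c = 0 ∨ c = 1) : False := by
  have hc3 : nim c 1 ≠ 3 ∧ c ≠ 3 := by rcases hc with rfl | rfl <;> decide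
  have e0 : (τ (0, 0)).edge 0 = ⟨1, 1, nim c 1, d⟩ :=
    (h.outward h.k00).edge_eq hm 0 (hm' := by rcases hc with rfl | rfl <;> rfl)
  have c1 : Crossing (τ (0, 1)) 3 := mid_away h.mem e0 (r := (0, 2)) (h.edge_a h.k02 2) one_ne (hc := hc3.1)
  have c2 : Crossing (τ (1, 1)) 3 :=
    crossing_of (h.master _) (h.in_east 0) ((h.mem.1.out_iff (0, 1) 1).2 (c1.a_in (by decide)))
  have c3 : Crossing (τ (1, 0)) 0 :=
    crossing_of (h.master _) (h.in_west 0) ((h.mem.1.out_iff (1, 1) 2).2 (c2.a_in (by decide)))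
  have f3 : (τ (1, 0)).edge 3 = ⟨-1, 1, c, d⟩ := h.mem.1.edge_fit hm
  have c4 : Crossing (τ (1, 0)) 2 := meet_away (h.master _) f3 (c3.a_in (j := 0) (k := 1) (by decide)) one_ne hc3.2
  exact absurd (c3.unique c4) (by decide)

/-- Away from the at most one passage, the column between receives arms from both sides. The default
`0` serves when there is no passage at all. -/
theorem exists_row (h : Fault τ) : ∃ Y, ∀ y, y ≠ Y →
    ((τ (0, y)).edge 1).a = 1 ∧ ((τ (2, y)).edge 3).a = 1 := by
  have key : ∀ y, ¬ Pass τ y → ((τ (0, y)).edge 1).a = 1 ∧ ((τ (2, y)).edge 3).a = 1 := fun y hy =>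
    ⟨(h.mem.1.in_iff (0, y) 1).1 (h.in_of_not_pass hy).2,
      (h.mem.1.in_iff (2, y) 3).1 (h.in_of_not_pass hy).1⟩
  by_cases hY : ∃ Y, Pass τ Y
  · obtain ⟨Y, hY⟩ := hY
    exact ⟨Y, fun y hy => key y fun hp => hy (h.pass_unique hp hY)⟩
  · exact ⟨0, fun y _ => key y fun hp => hY ⟨y, hp⟩⟩

/-- The reflection in the vertical axis at `k`. -/
def mirrorAt (k : ℤ) : Isom := ⟨(2 * k, 0), 3, true⟩

theorem mirrorAt_point (k x y : ℤ) : (mirrorAt k).point (x, y) = (2 * k - x, y) := by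
  change ((2 * k, 0) : ℤ × ℤ) + x • ((-1 : ℤ), (0 : ℤ)) + y • ((0 : ℤ), (1 : ℤ)) = _
  ext <;> simp; ring

theorem exists_row_mirrorAt (h : τ ∈ Tilings masterTiles) {x : ℤ} (hc : ∀ k, K τ (2 * x, 2 * k))
    (hn : ¬ K τ (2 * x - 2, 0)) : ∃ Y, ∀ y, y ≠ Y → ((τ (2 * x, y)).edge 3).a = 1 := by
  have hp : ∀ x' y, act (mirrorAt x) τ (x', y) = (mirrorAt x).tile (τ (2 * x - x', y)) := fun x' y => by
    rw [← act_point, mirrorAt_point]; simp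
  have hk : ∀ x' y, K (act (mirrorAt x) τ) (x', y) ↔ K τ (2 * x - x', y) := fun x' y => by
    rw [K, hp]; rfl
  have hF : Fault (act (mirrorAt x) τ) := by
    refine ⟨act_mem_tilings h _, fun k => (hk _ _).2 (by simpa using hc k), fun k => ?_⟩
    have := (k_column (h.1.act (mirrorAt x)) (x := 0) (y := 0) ((hk _ _).2 (by simpa using hc 0))
      (by rw [hk]; simpa using hn) k).2
    simpa using this
  obtain ⟨Y, hY⟩ := hF.exists_row
  refine ⟨Y, fun y hy => ?_⟩
  have := (hY y hy).1
  rw [hp, sub_zero] at this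
  change ((mirrorAt x).mark ((τ (2 * x, y)).edge (4 - 1))).a = 1 at this
  rwa [Isom.mark_a] at this

theorem cross_odd (h : τ ∈ Tilings masterTiles) {x : ℤ} (hc : ∀ k, K τ (x, 2 * k)) (k : ℤ) :
    ((τ (x, 2 * k + 1)).edge 0).a = -1 ∧ ((τ (x, 2 * k + 1)).edge 2).a = -1 := by
  constructor
  · refine (h.1.in_iff (x, 2 * (k + 1)) 2 (by ext <;> simp [vec]; ring)).2
      ((outward_of_k subset_rfl h (hc _)).a 2)
  · exact (h.1.in_iff (x, 2 * k) 0).2 ((outward_of_k subset_rfl h (hc _)).a 0)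

/-- With faults on both sides of the column `0`, in almost all rows its tiles would have outward
markings to the east and to the west. Between two cornered tiles of the column such a tile also has
inward markings, which no tile allows. -/
theorem k_west (h : Fault τ) (k : ℤ) : K τ (-2, 2 * k) := by
  suffices H : K τ (-2, 0) by
    have := k_next_column h.mem.1 (x := 0) (y := 0) (by simpa using h.left) (e := -2) (.inr rfl)
      (y' := 0) (by simpa using H) k
    simpa using this
  by_contra hn
  obtain ⟨Y, hY⟩ := h.exists_row
  obtain ⟨Z, hZ⟩ := exists_row_mirrorAt h.mem (x := 0) (by simpa using h.left) (by simpa using hn)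
  obtain ⟨k, h1, h2⟩ : ∃ k, 2 * k + 1 ≠ Y ∧ 2 * k + 1 ≠ Z := ⟨Y.natAbs + Z.natAbs, by omega, by omega⟩
  have := outward_of (h.master (0, 2 * k + 1)) (i := 1) (j := 3) (by decide) (hY _ h1).1
    (by simpa using hZ _ h2)
  exact neg_one_ne_one ((cross_odd h.mem h.left k).1.symm.trans (this.a 0))

/-- If the next fault were to the west of the column `-2`, then in almost all odd rows the arms
would leave the columns `0` and `-2` outwards, and the tiles of the column `-1` would be outward.
The tile between two of them would have four inward markings. The resulting three unshifted columns
give room to follow a frame around in `no_two_aux`. -/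
theorem k_west_west (h : Fault τ) (k : ℤ) : K τ (-4, 2 * k) := by
  suffices H : K τ (-4, 0) by
    have := k_next_column h.mem.1 (x := -2) (y := 0) (by simpa using h.k_west) (e := -2) (.inr rfl)
      (y' := 0) (by simpa using H) k
    simpa using this
  by_contra hn
  obtain ⟨Y, hY⟩ := h.exists_row
  obtain ⟨Z, hZ⟩ := exists_row_mirrorAt h.mem (x := -1) (by simpa using h.k_west)
    (by simpa using hn)
  have key : ∀ k, 2 * k + 1 ≠ Y → 2 * k + 1 ≠ Z → Outward (τ (-1, 2 * k + 1)) := by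
    intro k h1 h2
    have cE : Crossing (τ (0, 2 * k + 1)) 1 :=
      crossing_of (h.master _) (cross_odd h.mem h.left k).1 (hY _ h1).1
    have cW : Crossing (τ (-2, 2 * k + 1)) 3 :=
      crossing_of (h.master _) (cross_odd h.mem h.k_west k).1 (by simpa using hZ _ h2)
    refine outward_of (h.master _) (i := 1) (j := 3) (by decide) ?_ ?_
    · exact (h.mem.1.out_iff (0, 2 * k + 1) 3).2 (cE.a_in (by decide))
    · exact (h.mem.1.out_iff (-2, 2 * k + 1) 1).2 (cW.a_in (by decide))
  obtain ⟨k, h1, h2, h3, h4⟩ : ∃ k, 2 * k + 1 ≠ Y ∧ 2 * k + 1 ≠ Z ∧ 2 * (k + 1) + 1 ≠ Y ∧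
    2 * (k + 1) + 1 ≠ Z := ⟨Y.natAbs + Z.natAbs, by omega, by omega, by omega, by omega⟩
  have o1 := key k h1 h2
  have o2 := key _ h3 h4
  have iS : ((τ (-1, 2 * (k + 1))).edge 2).a = -1 :=
    (h.mem.1.in_iff (-1, 2 * k + 1) 0 (by ext <;> simp [vec]; ring)).2 (o1.a 0)
  have iN : ((τ (-1, 2 * (k + 1))).edge 0).a = -1 := (h.mem.1.in_iff (-1, 2 * (k + 1) + 1) 2).2 (o2.a 2)
  have iW : ((τ (-1, 2 * (k + 1))).edge 3).a = -1 :=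
    (h.mem.1.in_iff (-2, 2 * (k + 1)) 1).2 (h.edge_a (h.k_west _) 1)
  have iE : ((τ (-1, 2 * (k + 1))).edge 1).a = -1 :=
    (h.mem.1.in_iff (0, 2 * (k + 1)) 3).2 (h.edge_a (h.left _) 3)
  have := crossing_of_in3 (h.master _) 0 iE iS iW
  exact neg_one_ne_one (iN.symm.trans this.out)

/-- A `2`-arm into the fault belongs to an inner corner, from which the frame can be followed around
through the columns `-2` and `-4` to a second `2`-arm into the fault at height `2`, offset towards
the first. Neither can be crossed from outside by an arm of the column `1`, so `(1, 1)` has outward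
markings to the north and the south, contrary to the inward one from the east. -/
theorem no_two_aux (h : Fault τ) {d : Digit} : (τ (0, 0)).edge 1 ≠ ⟨1, -1, 2, d⟩ := by
  intro e1
  have kk := h.left; have k2 := h.k_west; have k4 := h.k_west_west
  have o0 := h.outward h.k00; have o2 := h.outward h.k02
  have e2 : (τ (0, 0)).edge 3 = ⟨1, 1, 3, d⟩ := o0.edge_eq e1 3
  have p20 : Outward (τ (-2, 0)) := h.outward (k2 0)
  have p22 : Outward (τ (-2, 2)) := h.outward (k2 1)
  have p40 : Outward (τ (-4, 0)) := h.outward (k4 0)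
  have p42 : Outward (τ (-4, 2)) := h.outward (k4 1)
  have e3 : (τ (-2, 0)).edge 1 = ⟨1, -1, 3, nim d 1⟩ := pair_mate h.mem e2 (hr := p20.a 1)
  have e4 : (τ (-2, 0)).edge 3 = ⟨1, 1, 2, nim d 1⟩ := p20.edge_eq e3 3
  have e5 : (τ (-4, 0)).edge 1 = ⟨1, -1, 1, nim d 1⟩ := pair_mate h.mem e4 (hr := p40.a 1)
  have e6 : (τ (-4, 0)).edge 0 = ⟨1, 1, 0, nim d 1⟩ := p40.edge_eq e5 0
  have e7 : (τ (-4, 2)).edge 2 = ⟨1, -1, 0, nim (nim d 1) 2⟩ := pair_mate h.mem e6 (hr := p42.a 2)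
  have e8 : (τ (-4, 2)).edge 1 = ⟨1, 1, 1, nim (nim d 1) 2⟩ := p42.edge_eq e7 1
  have e9 : (τ (-2, 2)).edge 3 = ⟨1, -1, 2, nim (nim d 1) 2⟩ := pair_mate h.mem e8 (hr := p22.a 3)
  have e10 : (τ (-2, 2)).edge 1 = ⟨1, 1, 3, nim (nim d 1) 2⟩ := p22.edge_eq e9 1
  have e11 : (τ (0, 2)).edge 3 = ⟨1, -1, 3, nim (nim (nim d 1) 2) 1⟩ :=
    pair_mate h.mem e10 (hr := o2.a 3)
  have e12 : (τ (0, 2)).edge 1 = ⟨1, 1, 2, nim (nim (nim d 1) 2) 1⟩ := o2.edge_eq e11 1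
  have f0 : (τ (1, 0)).edge 3 = ⟨-1, 1, 2, d⟩ := h.mem.1.edge_fit e1
  have f2 : (τ (1, 2)).edge 3 = ⟨-1, -1, 2, nim (nim (nim d 1) 2) 1⟩ := h.mem.1.edge_fit e12
  have w0 : ((τ (1, 0)).edge 0).a = -1 := by
    refine (Int.units_eq_one_or _).resolve_left fun hx => ?_
    have c := crossing_of (h.master (1, 0)) (h.in_west 0) hx
    have := meet_away (h.master (1, 0)) f0 (j' := 1) (k := 2) (c.a_in (by decide))
    exact absurd (c.unique this) (by decide)
  have w2 : ((τ (1, 2)).edge 2).a = -1 := by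
    refine (Int.units_eq_one_or _).resolve_left fun hx => ?_
    have c := crossing_of (h.master (1, 2)) (h.in_west 1) hx
    have := meet_away (h.master (1, 2)) f2 (j' := 1) (k := 0) (c.a_in (by decide))
    exact absurd (c.unique this) (by decide)
  have := outward_of (h.master (1, 1)) (i := 0) (j := 2) (by decide)
    ((h.mem.1.out_iff (1, 2) 2).2 w2) ((h.mem.1.out_iff (1, 0) 0).2 w0)
  exact neg_one_ne_one ((h.in_east 0).symm.trans (this.a 1))

/-- Every arm towards the fault is unsided or a `3`-arm. -/
theorem plus_or_three (h : Fault τ) :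
    (τ (0, 0)).edge 1 = plus ∨ ∃ b d, b ≠ 0 ∧ (τ (0, 0)).edge 1 = ⟨1, b, 3, d⟩ := by
  have key : ∀ {τ'}, Fault τ' → ∀ c d, (τ' (0, 0)).edge 1 = ⟨1, -1, c, d⟩ → c = 3 := by
    intro τ' h' c d e
    have : ∀ c : Digit, c = 0 ∨ c = 1 ∨ c = 2 ∨ c = 3 := by decide
    rcases this c with rfl | rfl | rfl | rfl
    · exact (h'.outer_aux e (.inl rfl)).elim
    · exact (h'.outer_aux e (.inr rfl)).elim
    · exact (h'.no_two_aux e).elim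
    · rfl
  refine ((h.outward h.k00).proper 1).imp_right fun hb => ?_
  have ha := h.edge_a h.k00 1
  rcases hm : (τ (0, 0)).edge 1 with ⟨a, b, c, d⟩
  rw [hm] at hb ha
  obtain rfl : a = 1 := ha
  suffices c = 3 by subst this; exact ⟨b, d, hb, rfl⟩
  cases b with
  | zero => exact absurd rfl hb
  | neg => exact key h c d hm
  | pos => exact key (h.flipY 0) c d (by rw [act_mirrorY]; exact congrArg Marking.reflect hm)

theorem plus_or_three_left (h : Fault τ) (k : ℤ) :
    (τ (0, 2 * k)).edge 1 = plus ∨ ∃ b d, b ≠ 0 ∧ (τ (0, 2 * k)).edge 1 = ⟨1, b, 3, d⟩ := by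
  have := (h.shiftY (-k)).plus_or_three
  rw [act_upY] at this
  simpa using this

theorem plus_or_three_right (h : Fault τ) (k : ℤ) :
    (τ (2, 2 * k + 1)).edge 3 = plus ∨ ∃ b d, b ≠ 0 ∧ (τ (2, 2 * k + 1)).edge 3 = ⟨1, b, 3, d⟩ := by
  have := h.flipX.plus_or_three_left (k + 1)
  rw [act_mirrorX, show (2 : ℤ) * (k + 1) - 1 = 2 * k + 1 by ring] at this
  have inv : ∀ m m' : Marking, m.reflect = m' → m = m'.reflect := by
    rintro m _ rfl; simp [Marking.reflect]
  rcases this with e | ⟨b, d, hb, e⟩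
  · exact .inl (inv _ _ e)
  · exact .inr ⟨-b, d, by simpa using hb, inv _ _ e⟩

/-- A `3`-arm into the fault would be the cut through the middle of a frame whose left half is
intact: the half frame is followed from `(0, 0)` through the column `-2` back to `(0, 2)`. Its end
`(-1, 1)` is outward, because the long sides are crossed away from it. -/
theorem three_row (h : Fault τ) {d : Digit} (e1 : (τ (0, 0)).edge 1 = ⟨1, -1, 3, d⟩) :
    (τ (0, 2)).edge 1 = ⟨1, 1, 3, nim d 2⟩ ∧ (τ (0, 2)).edge 0 = plus ∧
    (τ (-2, 0)).edge 0 = ⟨1, 1, 0, d⟩ ∧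
    (τ (0, 0)).edge 3 = ⟨1, 1, 2, d⟩ ∧ (τ (0, 2)).edge 3 = ⟨1, -1, 2, nim d 2⟩ ∧
    Crossing (τ (-2, 1)) 3 ∧ Crossing (τ (-1, 0)) 2 ∧ Crossing (τ (-1, 2)) 0 ∧
    Outward (τ (-1, 1)) := by
  have k2 := h.k_west
  have o0 := h.outward h.k00; have o2 := h.outward h.k02
  have e2 : (τ (0, 0)).edge 3 = ⟨1, 1, 2, d⟩ := o0.edge_eq e1 3
  have p20 : Outward (τ (-2, 0)) := h.outward (k2 0)
  have p22 : Outward (τ (-2, 2)) := h.outward (k2 1)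
  have e3 : (τ (-2, 0)).edge 1 = ⟨1, -1, 1, d⟩ := pair_mate h.mem e2 (hr := p20.a 1)
  have e4 : (τ (-2, 0)).edge 0 = ⟨1, 1, 0, d⟩ := p20.edge_eq e3 0
  have e5 : (τ (-2, 2)).edge 2 = ⟨1, -1, 0, nim d 2⟩ := pair_mate h.mem e4 (hr := p22.a 2)
  have e6 : (τ (-2, 2)).edge 1 = ⟨1, 1, 1, nim d 2⟩ := p22.edge_eq e5 1
  have e7 : (τ (0, 2)).edge 3 = ⟨1, -1, 2, nim d 2⟩ := pair_mate h.mem e6 (hr := o2.a 3)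
  have e8 : (τ (0, 2)).edge 1 = ⟨1, 1, 3, nim d 2⟩ := o2.edge_eq e7 1
  have e9 : (τ (0, 2)).edge 0 = plus := o2.edge_eq e7 0
  have c1 : Crossing (τ (-2, 1)) 3 := mid_away h.mem e4 (r := (-2, 2)) (p22.a 2)
  have c2 : Crossing (τ (-1, 0)) 2 := mid_away h.mem e2 (r := (-2, 0)) (p20.a 1)
  have c3 : Crossing (τ (-1, 2)) 0 := mid_away h.mem e7 (r := (-2, 2)) (p22.a 1)
  exact ⟨e8, e9, e4, e2, e7, c1, c2, c3, outward_of (h.master _) (i := 0) (j := 2) (by decide)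
    ((h.mem.1.out_iff (-1, 2) 2).2 (c3.a_in (by decide)))
    ((h.mem.1.out_iff (-1, 0) 0).2 (c2.a_in (by decide)))⟩

/-- The `2`-arm runs north through `(-1, 2)` and meets a `1`-arm at `(-1, 3)`, which comes from the
outward tile `(-1, 5)`. The companion of this `1`-arm is a `0`-arm that runs east through the column
`0` and requires a `0`-arm from `(2, 5)`, against `plus_or_three_right`. -/
theorem three_north (h : Fault τ) {d w : Digit} (e1 : (τ (0, 0)).edge 1 = ⟨1, -1, 3, d⟩)
    (eN : (τ (-1, 1)).edge 0 = ⟨1, 1, 2, w⟩) : False := by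
  obtain ⟨r1, r2, -, -, -, -, -, c3, oL⟩ := h.three_row e1
  have o4 : Outward (τ (0, 4)) := h.outward (h.left 2)
  have s4 : (τ (0, 4)).edge 2 = plus := pair_mate h.mem r2 (hr := o4.a 2)
  have hN4 := h.outward (h.left 3)
  have p24 : Outward (τ (-2, 4)) := h.outward (h.k_west 2)
  -- the tile `(-1, 5)` is outward, the tile `(-1, 4)` passes an arm to the south
  obtain ⟨oM, cM⟩ : Outward (τ (-1, 5)) ∧ Crossing (τ (-1, 4)) 2 := by
    -- If the arm of `(0, 4)` into the fault is plain, then so is its southern arm, so it is an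
    -- outer corner with signed arms to the north and the west. If it is a `3`-arm offset to the
    -- north, there is another half frame above. Offset to the south, it would force a half frame
    -- below, in conflict with the arm of `(0, 2)`.
    rcases h.plus_or_three_left 2 with e4 | ⟨b, d', hb, e4⟩
    · have e4 : (τ (0, 4)).edge 1 = plus := e4
      have k6 : Outward (τ (0, 6)) := h.outward (h.left 3)
      have key : ∃ c d', (c = 0 ∨ c = 1) ∧ (τ (0, 4)).edge 0 = ⟨1, -1, c, d'⟩ ∧
          (τ (0, 4)).edge 3 = ⟨1, 1, nim c 1, d'⟩ := by
        rcases hm : (τ (0, 4)).edge 0 with ⟨a, b, c, d'⟩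
        obtain rfl : a = 1 := by have := o4.a 0; rwa [hm] at this
        obtain ⟨j, hj⟩ := o4.exists_signed
        have hj03 : j = 0 ∨ j = 3 := by
          have : ∀ j : Dir, j = 0 ∨ j = 1 ∨ j = 2 ∨ j = 3 := by decide
          rcases this j with rfl | rfl | rfl | rfl
          · exact .inl rfl
          · rw [e4] at hj; exact absurd rfl hj
          · rw [s4] at hj; exact absurd rfl hj
          · exact .inr rfl
        have main : ∀ b c, b ≠ 0 → ((∀ k, (τ (0, 4)).edge k = outEdge 0 ⟨1, b, c, d'⟩ k)) →
            b = -1 ∧ (c = 0 ∨ c = 1) ∧ outEdge 0 ⟨1, b, c, d'⟩ 3 = ⟨1, 1, nim c 1, d'⟩ := by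
          intro b c hb' hk
          have x1 := hk 1; have x2 := hk 2
          rw [e4] at x1; rw [s4] at x2
          clear hk hm
          revert b c d'; decide
        rcases hj03 with rfl | rfl
        · rw [hm] at hj
          obtain ⟨rfl, hc, h3⟩ := main b c hj fun k => o4.edge hm hj k
          exact ⟨c, d', hc, rfl, by rw [o4.edge hm hj 3, h3]⟩
        · rcases hm3 : (τ (0, 4)).edge 3 with ⟨a', b', c', d''⟩
          obtain rfl : a' = 1 := by have := o4.a 3; rwa [hm3] at this
          rw [hm3] at hj
          have x0 := o4.edge hm3 hj 0
          have x1 := o4.edge hm3 hj 1; have x2 := o4.edge hm3 hj 2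
          rw [e4] at x1; rw [s4] at x2; rw [hm] at x0
          clear hm hm3 main
          revert b c d' b' c' d''; decide
      obtain ⟨c, d', hc, e0, e3⟩ := key
      have hc3 : nim c 1 ≠ 3 ∧ c ≠ 3 := by rcases hc with rfl | rfl <;> decide
      have c1 : Crossing (τ (0, 5)) 1 := mid_away h.mem e0 (r := (0, 6)) (k6.a 2) (hc := hc3.2)
      have c2 : Crossing (τ (-1, 4)) 2 :=
        mid_away h.mem e3 (r := (-2, 4)) (p24.a 1) (hc := hc3.1)
      exact ⟨outward_of (h.master _) (i := 1) (j := 2) (by decide)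
        ((h.mem.1.out_iff (0, 5) 3).2 (c1.a_in (by decide)))
        ((h.mem.1.out_iff (-1, 4) 0).2 (c2.a_in (by decide))), c2⟩
    · have e4 : (τ (0, 4)).edge 1 = ⟨1, b, 3, d'⟩ := e4
      cases b with
      | zero => exact absurd rfl hb
      | neg =>
        have := (h.shiftY (-2)).three_row (d := d') (by rw [act_upY]; exact e4)
        simp only [act_upY] at this
        exact ⟨this.2.2.2.2.2.2.2.2, this.2.2.2.2.2.2.1⟩
      | pos =>
        have := ((h.flipY 2).three_row (d := d') (by
          rw [act_mirrorY]; exact congrArg Marking.reflect e4)).1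
        rw [act_mirrorY] at this
        have e : (1 : SignType) = -1 :=
          congrArg Marking.b (this.symm.trans (congrArg Marking.reflect r1))
        exact absurd e (by decide)
  have f0 : (τ (-1, 2)).edge 2 = ⟨-1, -1, 2, w⟩ := h.mem.1.edge_fit eN
  have f1 : (τ (-1, 2)).edge 0 = ⟨1, 1, 2, w⟩ := c3.pass_eq f0
  have x1 : ((τ (-1, 3)).edge 2) = ⟨-1, -1, 2, w⟩ := h.mem.1.edge_fit f1
  have m1 := meet_mate (h.master (-1, 3)) (j := 2) (by rw [x1])
    (show ((τ (-1, 3)).edge 0).a = -1 from (h.mem.1.in_iff (-1, 4) 2).2 cM.out)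
  have m2 : (τ (-1, 3)).edge 0 = ⟨-1, 1, 1, w⟩ := by
    have := congrArg opp m1; rw [opp_opp, x1] at this; exact this
  have m4 : (τ (-1, 4)).edge 2 = ⟨1, -1, 1, w⟩ := h.mem.1.edge_fit m2
  have m5 : (τ (-1, 4)).edge 0 = ⟨-1, 1, 1, w⟩ := by
    have := cM.pass; rw [m4] at this; exact this
  have m6 : (τ (-1, 5)).edge 2 = ⟨1, -1, 1, w⟩ := h.mem.1.edge_fit m5
  have m7 : (τ (-1, 5)).edge 1 = ⟨1, 1, 0, w⟩ := oM.edge_eq m6 1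
  have m8 : (τ (0, 5)).edge 3 = ⟨-1, -1, 0, w⟩ := h.mem.1.edge_fit m7
  have o6 := cross_odd h.mem h.left 2
  have c5 : Crossing (τ (0, 5)) 1 :=
    crossing_of_in3 (h.master _) 1 o6.2 (show ((τ (0, 5)).edge 3).a = -1 by rw [m8]) o6.1
  have m9 : (τ (0, 5)).edge 1 = ⟨1, 1, 0, w⟩ := c5.pass_eq m8
  have m10 : (τ (2, 5)).edge 3 = ⟨1, -1, 0, nim w 2⟩ :=
    pair_mate h.mem m9 (hr := h.edge_a (h.right 2) 3)
  rcases h.plus_or_three_right 2 with e | ⟨b, d', -, e⟩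
  · have : (0 : SignType) = -1 :=
      congrArg Marking.b ((show (τ (2, 5)).edge 3 = _ from e).symm.trans m10)
    exact absurd this (by decide)
  · have : (3 : Digit) = 0 :=
      congrArg Marking.c ((show (τ (2, 5)).edge 3 = _ from e).symm.trans m10)
    exact absurd this (by decide)

/-- The outward tile `(-1, 1)` in the half frame has signed arms. To the east they must match the
arms from the other side of the fault, to the west they must pass the short side of the half frame,
and to the north and the south its long sides. The only corner tiles left send a `2`-arm north or
south, and both are excluded by `three_north` and its mirror image. -/
theorem no_three (h : Fault τ) {d : Digit} : (τ (0, 0)).edge 1 ≠ ⟨1, -1, 3, d⟩ := by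
  intro e1
  obtain ⟨r1, r2, r3, r4, r5, c1, c2, c3, oL⟩ := h.three_row e1
  have o1 := cross_odd h.mem h.left 0
  have cE : Crossing (τ (0, 1)) 1 := crossing_of_in3 (h.master _) 1 o1.2
    ((h.mem.1.in_iff (-1, 1) 1).2 (oL.a 1)) o1.1
  have hE : ((τ (-1, 1)).edge 1).b ≠ 0 → ((τ (-1, 1)).edge 1).c = 3 := by
    intro hb
    have f1 : (τ (0, 1)).edge 3 = opp ((τ (-1, 1)).edge 1) := h.mem.1.fit (-1, 1) 1
    have f2 : (τ (0, 1)).edge 1 = (τ (-1, 1)).edge 1 := cE.pass_eq f1 (hm' := opp_opp _)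
    have f3 : (τ (2, 1)).edge 3 = mate ((τ (-1, 1)).edge 1) :=
      pair_mate h.mem f2 (hp := oL.a 1) (hr := h.edge_a (h.right 0) 3)
    have key : ∀ m : Marking, m.b ≠ 0 → (mate m = plus ∨ ∃ b d, b ≠ 0 ∧ mate m = ⟨1, b, 3, d⟩) →
        m.c = 3 := by
      rintro ⟨a, b, c, d⟩ hb (hm | ⟨b', d', -, hm⟩)
      · rw [mate, if_neg hb] at hm
        have : -b = 0 := congrArg Marking.b hm
        exact absurd (show b = 0 by clear hm hb; decide +revert) hb
      · rw [mate, if_neg hb] at hm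
        have : (![0, 2, 1, 3] : Fin 4 → Digit) c = 3 := congrArg Marking.c hm
        change c = 3
        clear hm hb; decide +revert
    exact key _ hb (f3 ▸ h.plus_or_three_right 0)
  have hW : ((τ (-1, 1)).edge 3).b ≠ 0 → ((τ (-1, 1)).edge 3).c = 3 := by
    intro hb
    have f1 : (τ (-2, 1)).edge 1 = opp ((τ (-1, 1)).edge 3) := h.mem.1.fit (-1, 1) 3
    have f2 : (τ (-2, 1)).edge 3 = (τ (-1, 1)).edge 3 := c1.pass_eq f1 (hm' := opp_opp _)
    have f3 : (τ (-2, 1)).edge (3 + side (-1)) = ⟨-1, -1, 0, d⟩ := h.mem.1.edge_fit r3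
    have := c1.key0 (-1) (by decide) (by rw [f3]; exact neg_one_ne) (by rw [f3]) (by rwa [f2])
    rw [f2] at this; exact this.1
  have hN : ((τ (-1, 1)).edge 0).b ≠ 0 → ((τ (-1, 1)).edge 0).b = 1 := by
    intro hb
    have f1 : (τ (-1, 2)).edge 2 = opp ((τ (-1, 1)).edge 0) := h.mem.1.fit (-1, 1) 0
    have f2 : (τ (-1, 2)).edge 0 = (τ (-1, 1)).edge 0 := c3.pass_eq f1 (hm' := opp_opp _)
    have f3 : (τ (-1, 2)).edge (0 + side 1) = ⟨-1, 1, 2, nim d 2⟩ := h.mem.1.edge_fit r5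
    have := c3.key2 1 (by decide) (by rw [f3]; exact one_ne) (by rw [f3]) (by rwa [f2])
    rw [f2] at this; exact this.1
  have hS : ((τ (-1, 1)).edge 2).b ≠ 0 → ((τ (-1, 1)).edge 2).b = -1 := by
    intro hb
    have f1 : (τ (-1, 0)).edge 0 = opp ((τ (-1, 1)).edge 2) := h.mem.1.fit (-1, 1) 2
    have f2 : (τ (-1, 0)).edge 2 = (τ (-1, 1)).edge 2 := c2.pass_eq f1 (hm' := opp_opp _)
    have f3 : (τ (-1, 0)).edge (2 + side (-1)) = ⟨-1, -1, 2, d⟩ := h.mem.1.edge_fit r4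
    have := c2.key2 (-1) (by decide) (by rw [f3]; exact neg_one_ne) (by rw [f3]) (by rwa [f2])
    rw [f2] at this; exact this.1
  have south : ∀ w, (τ (-1, 1)).edge 2 = ⟨1, -1, 2, w⟩ → False := fun w hw =>
    (h.flipY 1).three_north (d := nim d 2) (w := w)
      (by rw [act_mirrorY]; exact congrArg Marking.reflect r1)
      (by rw [act_mirrorY]; exact congrArg Marking.reflect hw)
  obtain ⟨j, hj⟩ := oL.exists_signed
  rcases hm : (τ (-1, 1)).edge j with ⟨a, b, c, w⟩
  obtain rfl : a = 1 := by have := oL.a j; rwa [hm] at this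
  rw [hm] at hj
  have x0 := oL.edge hm hj 0
  have x1 := oL.edge hm hj 1
  have x2 := oL.edge hm hj 2
  have x3 := oL.edge hm hj 3
  have key : ∀ (j : Dir) (b : SignType) (c w : Digit), b ≠ 0 →
      ((outEdge j ⟨1, b, c, w⟩ 1).b ≠ 0 → (outEdge j ⟨1, b, c, w⟩ 1).c = 3) →
      ((outEdge j ⟨1, b, c, w⟩ 3).b ≠ 0 → (outEdge j ⟨1, b, c, w⟩ 3).c = 3) →
      ((outEdge j ⟨1, b, c, w⟩ 0).b ≠ 0 → (outEdge j ⟨1, b, c, w⟩ 0).b = 1) →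
      ((outEdge j ⟨1, b, c, w⟩ 2).b ≠ 0 → (outEdge j ⟨1, b, c, w⟩ 2).b = -1) →
      outEdge j ⟨1, b, c, w⟩ 0 = ⟨1, 1, 2, w⟩ ∨ outEdge j ⟨1, b, c, w⟩ 2 = ⟨1, -1, 2, w⟩ := by
    decide
  rw [x1] at hE; rw [x3] at hW; rw [x0] at hN; rw [x2] at hS
  rcases key j b c w hj hE hW hN hS with hw | hw
  · exact h.three_north e1 (x0.trans hw)
  · exact south w (x2.trans hw)

/-- The arms towards the fault are unsided. -/
theorem plain (h : Fault τ) : (τ (0, 0)).edge 1 = plus := by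
  refine h.plus_or_three.resolve_right ?_
  rintro ⟨b, d, hb, e⟩
  cases b with
  | zero => exact hb rfl
  | neg => exact h.no_three e
  | pos =>
    refine (h.flipY 0).no_three (d := d) ?_
    rw [act_mirrorY]; exact congrArg Marking.reflect e

end Fault

/-! ### Cornered tiles form frames -/

/-- After moving `p` to the origin and `j` to the east, the missing cornered tile creates a fault.
-/
theorem edge_plus_of_not_k {τ : ℤ × ℤ → Tile} (h : τ ∈ Tilings masterTiles) {p : ℤ × ℤ} {j : Dir}
    (hp : K τ p) (hn : ¬ K τ (p + vec j + vec j)) : (τ p).edge j = plus := by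
  let g : Isom := ⟨p, j, false⟩
  have e0 : g.point (0, 0) = p := by simp [Isom.point, g]
  have e1 : g.dir 1 = j := by simp [Isom.dir, g]
  have e2 : g.point (2, 0) = p + vec j + vec j := by
    rw [show ((2, 0) : ℤ × ℤ) = (0, 0) + vec 1 + vec 1 from rfl, g.point_add_vec, g.point_add_vec,
      e0, e1]
  have hpt : ∀ q, act g⁻¹ τ q = g⁻¹.tile (τ (g.point q)) := fun q => by
    rw [← act_point, Isom.inv_point_point]
  have hK : ∀ q, K (act g⁻¹ τ) q ↔ K τ (g.point q) := fun q => by rw [K, hpt]; rfl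
  have hF : Fault (act g⁻¹ τ) := by
    have := k_column (h.1.act g⁻¹) (x := 0) (y := 0) (by rw [hK]; exact e0.symm ▸ hp)
      (by rw [hK]; exact e2.symm ▸ hn)
    exact ⟨act_mem_tilings h _, fun k => by simpa using (this k).1,
      fun k => by simpa using (this k).2⟩
  have := hF.plain
  rw [hpt, e0] at this
  have e3 := Isom.tile_edge_dir g (g⁻¹.tile (τ p)) 1
  rw [this, mark_plus, Isom.tile_inv_tile, e1] at e3
  exact e3

/-- Opposite to a signed arm of a cornered tile is another cornered tile, with the mate arm. -/
theorem next_corner {τ : ℤ × ℤ → Tile} (h : τ ∈ Tilings masterTiles) {p r : ℤ × ℤ} {j k : Dir}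
    {m m' : Marking} (hp : K τ p) (hm : (τ p).edge j = m) (hb : m.b ≠ 0)
    (hr : r = p + vec j + vec j := by first | rfl | (ext <;> simp [vec] <;> ring))
    (hk : k = j + 2 := by rfl) (hm' : mate m = m' := by rfl) :
    K τ r ∧ Outward (τ r) ∧ (τ r).edge k = m' := by
  have hK : K τ r := by
    by_contra hn
    subst hr
    rw [edge_plus_of_not_k h hp hn] at hm
    rw [← hm] at hb; exact hb rfl
  have ho := outward_of_k subset_rfl h hK
  exact ⟨hK, ho, pair_mate h hm (hm ▸ (outward_of_k subset_rfl h hp).a j) (ho.a k) hr hk hm'⟩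

/-- An upper left quarter of a marked frame of level `0`, with the digit `d`. -/
def Quarter (τ : ℤ × ℤ → Tile) (d : Digit) : Prop :=
  τ (-3, 1) = outerCorner true d ∧ τ (-1, 1) = innerCorner true d

theorem act_inv_point (g : Isom) (τ : ℤ × ℤ → Tile) (p : ℤ × ℤ) :
    act g⁻¹ τ p = g⁻¹.tile (τ (g.point p)) := by
  rw [← act_point, Isom.inv_point_point]

theorem act_inv_eq_iff (g : Isom) (τ : ℤ × ℤ → Tile) (p : ℤ × ℤ) (t : Tile) :
    act g⁻¹ τ p = t ↔ τ (g.point p) = g.tile t := by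
  rw [act_inv_point]
  exact ⟨fun h => by rw [← h, Isom.tile_inv_tile], fun h => by rw [h, Isom.inv_tile_tile]⟩

theorem marked_zero_iff {τ : ℤ × ℤ → Tile} {g : Isom} :
    Marked τ 0 g ↔ ∀ d, Quarter (act (g * sym d)⁻¹ τ) d := by
  simp only [Quarter, act_inv_eq_iff]
  constructor
  · intro h d
    obtain ⟨h1, h2, -⟩ := h d
    simpa [Isom.comp_eq] using And.intro h1 h2
  · intro h d
    obtain ⟨h1, h2⟩ := h d
    have h1 : τ ((g.comp (sym d)).point (-3, 1)) = (g.comp (sym d)).tile (outerCorner true d) := h1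
    have h2 : τ ((g.comp (sym d)).point (-1, 1)) = (g.comp (sym d)).tile (innerCorner true d) := h2
    dsimp only
    refine ⟨by simpa using h1, by simpa using h2, fun k hk hk' => ?_⟩
    obtain rfl : k = 0 := by simp at hk'; omega
    simp only [pow_zero, mul_one, add_zero, sub_zero, h1, h2, Isom.tile_edge_dir]
    exact ⟨rfl, rfl, rfl, rfl⟩

theorem tile_ext4 {t t' : Tile} (hc : t.cornered = t'.cornered) (h0 : t.edge 0 = t'.edge 0)
    (h1 : t.edge 1 = t'.edge 1) (h2 : t.edge 2 = t'.edge 2) (h3 : t.edge 3 = t'.edge 3) :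
    t = t' := by
  ext1
  · exact hc
  · funext j
    have : ∀ j : Dir, j = 0 ∨ j = 1 ∨ j = 2 ∨ j = 3 := by decide
    rcases this j with rfl | rfl | rfl | rfl <;> assumption

theorem Outward.eq_outer {t : Tile} (h : Outward t) {k : Bool} (hk : t.cornered = k) {d : Digit}
    (e : t.edge 1 = ⟨1, 1, 1, d⟩ ∨ t.edge 2 = ⟨1, -1, 0, d⟩) : t = outerCorner k d := by
  rcases e with e | e
  · exact tile_ext4 hk (h.edge_eq e 0) (h.edge_eq e 1) (h.edge_eq e 2) (h.edge_eq e 3)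
  · exact tile_ext4 hk (h.edge_eq e 0) (h.edge_eq e 1) (h.edge_eq e 2) (h.edge_eq e 3)

theorem Outward.eq_inner {t : Tile} (h : Outward t) {k : Bool} (hk : t.cornered = k) {d : Digit}
    (e : t.edge 1 = ⟨1, 1, 3, d⟩ ∨ t.edge 3 = ⟨1, -1, 2, d⟩) : t = innerCorner k d := by
  rcases e with e | e
  · exact tile_ext4 hk (h.edge_eq e 0) (h.edge_eq e 1) (h.edge_eq e 2) (h.edge_eq e 3)
  · exact tile_ext4 hk (h.edge_eq e 0) (h.edge_eq e 1) (h.edge_eq e 2) (h.edge_eq e 3)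

theorem quarter_of_outer {τ : ℤ × ℤ → Tile} (h : τ ∈ Tilings masterTiles) {d : Digit}
    (ho : τ (-3, 1) = outerCorner true d) : Quarter τ d := by
  obtain ⟨hK, hO, he⟩ := next_corner h (p := (-3, 1)) (r := (-1, 1)) (j := 1) (k := 3)
    (m := ⟨1, 1, 1, d⟩) (m' := ⟨1, -1, 2, d⟩) (by rw [K, ho]; rfl) (by rw [ho]; rfl) one_ne_zero
  exact ⟨ho, hO.eq_inner hK (.inr he)⟩

theorem quarter_of_inner {τ : ℤ × ℤ → Tile} (h : τ ∈ Tilings masterTiles) {d : Digit}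
    (hi : τ (-1, 1) = innerCorner true d) : Quarter τ d := by
  obtain ⟨hK, hO, he⟩ := next_corner h (p := (-1, 1)) (r := (-3, 1)) (j := 3) (k := 1)
    (m := ⟨1, -1, 2, d⟩) (m' := ⟨1, 1, 1, d⟩) (by rw [K, hi]; rfl) (by rw [hi]; rfl)
    (show (-1 : SignType) ≠ 0 by decide)
  exact ⟨hO.eq_outer hK (.inl he), hi⟩

theorem sym_inv (d : Digit) : (sym d)⁻¹ = sym d := by revert d; decide
theorem sym_mul_sym (d e : Digit) : sym d * sym e = sym (nim d e) := by revert d e; decide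

theorem Quarter.sym_one {τ : ℤ × ℤ → Tile} (h : τ ∈ Tilings masterTiles) {d : Digit}
    (hq : Quarter τ d) : Quarter (act (sym 1) τ) (nim d 1) := by
  refine quarter_of_inner (act_mem_tilings h _) ?_
  obtain ⟨hK, hO, he⟩ := next_corner h (p := (-1, 1)) (r := (1, 1)) (j := 1) (k := 3)
    (m := ⟨1, 1, 3, d⟩) (m' := ⟨1, -1, 3, nim d 1⟩) (by rw [K, hq.2]; rfl) (by rw [hq.2]; rfl)
    one_ne_zero
  have e : act (sym 1) τ (-1, 1) = (sym 1).tile (τ (1, 1)) := act_point (sym 1) τ (1, 1)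
  rw [e]
  refine (hO.tile _).eq_inner hK (.inl ?_)
  change ((τ (1, 1)).edge 3).reflect = _
  rw [he]; rfl

theorem Quarter.sym_two {τ : ℤ × ℤ → Tile} (h : τ ∈ Tilings masterTiles) {d : Digit}
    (hq : Quarter τ d) : Quarter (act (sym 2) τ) (nim d 2) := by
  refine quarter_of_outer (act_mem_tilings h _) ?_
  obtain ⟨hK, hO, he⟩ := next_corner h (p := (-3, 1)) (r := (-3, -1)) (j := 2) (k := 0)
    (m := ⟨1, -1, 0, d⟩) (m' := ⟨1, 1, 0, nim d 2⟩) (by rw [K, hq.1]; rfl) (by rw [hq.1]; rfl)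
    (show (-1 : SignType) ≠ 0 by decide)
  have e : act (sym 2) τ (-3, 1) = (sym 2).tile (τ (-3, -1)) := by
    rw [← act_point, show (sym 2).point (-3, -1) = (-3, 1) by decide]
  rw [e]
  refine (hO.tile _).eq_outer hK (.inr ?_)
  change ((τ (-3, -1)).edge 0).reflect = _
  rw [he]; rfl

theorem one_act (τ : ℤ × ℤ → Tile) : act 1 τ = τ := by
  funext p; simp [act, Isom.one_tile, Isom.one_point]

/-- The `3`-arm leads across the vertical axis to a corner with digit `d + 1`, and the `0`-arm
across the horizontal axis to one with digit `d + 2`. Nim addition of the digits is the composition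
of the symmetries of the domino, so one quarter forces all four. -/
theorem Quarter.sym {τ : ℤ × ℤ → Tile} (h : τ ∈ Tilings masterTiles) {d : Digit}
    (hq : Quarter τ d) (e : Digit) : Quarter (act (sym e) τ) (nim d e) := by
  have : ∀ e : Digit, e = 0 ∨ e = 1 ∨ e = 2 ∨ e = 3 := by decide
  rcases this e with rfl | rfl | rfl | rfl
  · rw [show DominoTiles.sym 0 = 1 from rfl, one_act, nim_zero]; exact hq
  · exact hq.sym_one h
  · exact hq.sym_two h
  · have := (hq.sym_one h).sym_two (act_mem_tilings h _)
    rw [← act_mul, sym_mul_sym] at this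
    rwa [show nim d 3 = nim (nim d 1) 2 by clear this hq; revert d; decide]

theorem Quarter.marked {τ : ℤ × ℤ → Tile} (h : τ ∈ Tilings masterTiles) {g : Isom} {d : Digit}
    (hq : Quarter (act g⁻¹ τ) d) : Marked τ 0 (g * DominoTiles.sym d) := by
  rw [marked_zero_iff]
  intro e
  have := hq.sym (act_mem_tilings h _) (nim d e)
  rw [← act_mul, nim_nim_cancel] at this
  rwa [mul_assoc, sym_mul_sym, mul_inv_rev, sym_inv]

/-- Every cornered tile is a corner of a marked frame of level `0`. -/
theorem exists_marked {τ : ℤ × ℤ → Tile} (h : τ ∈ Tilings masterTiles) {p : ℤ × ℤ} (hp : K τ p) :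
    ∃ g d, Marked τ 0 g ∧ (p = (g * sym d).point (-3, 1) ∨ p = (g * sym d).point (-1, 1)) := by
  -- The action on a single tile ignores translations, so the isometry that shows the tile as a
  -- corner can be translated to put that corner at `p`.
  have tr : ∀ (g : Isom) (q : ℤ × ℤ), ∃ g' : Isom, g'.point q = p ∧ ∀ t, g'.tile t = g.tile t := by
    intro g q
    refine ⟨⟨p - g.lin q, g.east, g.flip⟩, ?_, fun t => rfl⟩
    rw [Isom.point_eq]; exact sub_add_cancel _ _
  have hk : (τ p).cornered = true := hp
  obtain ⟨g, k, d, e | e⟩ := (outward_of_k subset_rfl h hp).eq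
  · obtain ⟨g', hg, ht⟩ := tr g (-3, 1)
    obtain rfl : k = true := by rw [e] at hk; exact hk
    refine ⟨g' * sym d, d, Quarter.marked h (quarter_of_outer (act_mem_tilings h _) ?_), .inl ?_⟩
    · rw [act_inv_eq_iff, hg, ht, e]
    · rw [mul_assoc, sym_mul_sym, nim_self, ← hg, show sym 0 = 1 from rfl, mul_one]
  · obtain ⟨g', hg, ht⟩ := tr g (-1, 1)
    obtain rfl : k = true := by rw [e] at hk; exact hk
    refine ⟨g' * sym d, d, Quarter.marked h (quarter_of_inner (act_mem_tilings h _) ?_), .inr ?_⟩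
    · rw [act_inv_eq_iff, hg, ht, e]
    · rw [mul_assoc, sym_mul_sym, nim_self, ← hg, show sym 0 = 1 from rfl, mul_one]

end DominoTiles

namespace DominoTiles

/-! ### Erasing the markings -/

instance : Finite Marking :=
  Finite.of_injective (fun m : Marking => (m.a, m.b, m.c, m.d)) fun m m' h => by
    simpa [Marking.ext_iff] using h

/-- The finiteness yields both the finitely many patterns of the local map and the compactness of
the space of configurations. -/
instance : Finite Tile :=
  Finite.of_injective (fun t : Tile => (t.cornered, t.edge)) fun t t' h => by
    simpa [Tile.ext_iff] using h

theorem tile_outer_aux : ∀ (e : Dir) (f : Bool) (d d' : Digit),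
    (∀ j, ((⟨0, e, f⟩ : Isom).tile (outerCorner true d)).edge j = (outerCorner true d').edge j) →
    e = 1 ∧ f = false ∧ d = d' := by decide

theorem tile_inner_aux : ∀ (e : Dir) (f : Bool) (d d' : Digit),
    (∀ j, ((⟨0, e, f⟩ : Isom).tile (innerCorner true d)).edge j = (innerCorner true d').edge j) →
    e = 1 ∧ f = false ∧ d = d' := by decide

theorem tile_outer_inner_aux : ∀ (e : Dir) (f : Bool) (d d' : Digit),
    ¬ (∀ j, ((⟨0, e, f⟩ : Isom).tile (outerCorner true d)).edge j =
      (innerCorner true d').edge j) := by decide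

theorem tile_corner_eq {k : Bool} {g g' : Isom} {d d' : Digit}
    (h : g.tile (outerCorner k d) = g'.tile (outerCorner k d') ∨
      g.tile (innerCorner k d) = g'.tile (innerCorner k d')) :
    g.east = g'.east ∧ g.flip = g'.flip ∧ d = d' := by
  have key : (g'⁻¹ * g).east = 1 ∧ (g'⁻¹ * g).flip = false ∧ d = d' := by
    rcases h with h | h
    · have := congrArg (g'⁻¹).tile h
      rw [Isom.inv_tile_tile, ← Isom.mul_tile] at this
      exact tile_outer_aux _ _ d d' fun j => congrFun (congrArg Tile.edge this) j
    · have := congrArg (g'⁻¹).tile h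
      rw [Isom.inv_tile_tile, ← Isom.mul_tile] at this
      exact tile_inner_aux _ _ d d' fun j => congrFun (congrArg Tile.edge this) j
  have e : g = g' * (g'⁻¹ * g) := by group
  refine ⟨?_, ?_, key.2.2⟩
  · rw [e]; change g'.dir (g'⁻¹ * g).east = _
    rw [key.1]; simp [Isom.dir]
  · rw [e]; change xor g'.flip (g'⁻¹ * g).flip = _
    rw [key.2.1]; exact Bool.xor_false _

theorem tile_outer_ne_inner {k : Bool} {g g' : Isom} {d d' : Digit} :
    g.tile (outerCorner k d) ≠ g'.tile (innerCorner k d') := by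
  intro h
  have := congrArg (g'⁻¹).tile h
  rw [Isom.inv_tile_tile, ← Isom.mul_tile] at this
  exact tile_outer_inner_aux _ _ d d' fun j => congrFun (congrArg Tile.edge this) j

theorem isom_eq_of_point {g g' : Isom} (he : g.east = g'.east) (hf : g.flip = g'.flip) {p : ℤ × ℤ}
    (hp : g.point p = g'.point p) : g = g' := by
  obtain ⟨c, e, f⟩ := g
  obtain ⟨c', e', f'⟩ := g'
  obtain rfl : e = e' := he
  obtain rfl : f = f' := hf
  simp only [Isom.point_eq] at hp
  exact Isom.ext (add_right_cancel hp) rfl rfl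

/-- The positions of the eight outward tiles that mark a frame of level `0`. -/
def corners (g : Isom) : Set (ℤ × ℤ) :=
  {p | ∃ d, p = (g * sym d).point (-3, 1) ∨ p = (g * sym d).point (-1, 1)}

theorem marked_corner {τ : ℤ × ℤ → Tile} {g : Isom} (h : Marked τ 0 g) (d : Digit) :
    τ ((g * sym d).point (-3, 1)) = (g * sym d).tile (outerCorner true d) ∧
    τ ((g * sym d).point (-1, 1)) = (g * sym d).tile (innerCorner true d) := by
  have := marked_zero_iff.1 h d
  simpa only [Quarter, act_inv_eq_iff] using this

theorem k_of_corner {τ : ℤ × ℤ → Tile} {g : Isom} (h : Marked τ 0 g) {p : ℤ × ℤ}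
    (hp : p ∈ corners g) : K τ p := by
  obtain ⟨d, rfl | rfl⟩ := hp
  · rw [K, (marked_corner h d).1]; rfl
  · rw [K, (marked_corner h d).2]; rfl

/-- A corner tile has no symmetries and displays its digit, and an outer corner is never an inner
one. A single corner thus determines the frame. -/
theorem frame_unique {τ : ℤ × ℤ → Tile} {g g' : Isom} (h : Marked τ 0 g) (h' : Marked τ 0 g')
    {p : ℤ × ℤ} (hp : p ∈ corners g) (hp' : p ∈ corners g') : g = g' := by
  have fin : ∀ d d' q, (g * sym d).east = (g' * sym d').east ∧
      (g * sym d).flip = (g' * sym d').flip ∧ d = d' → (g * sym d).point q = (g' * sym d').point q →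
      g = g' := by
    rintro d _ q ⟨h1, h2, rfl⟩ hq
    exact mul_right_cancel (isom_eq_of_point h1 h2 hq)
  obtain ⟨d, rfl | rfl⟩ := hp
  · obtain ⟨d', e | e⟩ := hp'
    · have := (marked_corner h d).1
      rw [e, (marked_corner h' d').1] at this
      exact fin _ _ _ (tile_corner_eq (.inl this.symm)) e
    · have := (marked_corner h d).1
      rw [e, (marked_corner h' d').2] at this
      exact (tile_outer_ne_inner this.symm).elim
  · obtain ⟨d', e | e⟩ := hp'
    · have := (marked_corner h d).2
      rw [e, (marked_corner h' d').1] at this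
      exact (tile_outer_ne_inner this).elim
    · have := (marked_corner h d).2
      rw [e, (marked_corner h' d').2] at this
      exact fin _ _ _ (tile_corner_eq (.inr this.symm)) e

theorem sym_points : (∀ d, ((sym d).point (-3, 1) = (-3, 1) ∨ (sym d).point (-3, 1) = (3, 1) ∨
      (sym d).point (-3, 1) = (-3, -1) ∨ (sym d).point (-3, 1) = (3, -1)) ∧
    ((sym d).point (-1, 1) = (-1, 1) ∨ (sym d).point (-1, 1) = (1, 1) ∨
      (sym d).point (-1, 1) = (-1, -1) ∨ (sym d).point (-1, 1) = (1, -1))) := by decide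

theorem mem_corners {g : Isom} {p : ℤ × ℤ} : p ∈ corners g ↔
    ∃ x y : ℤ, (x = -3 ∨ x = -1 ∨ x = 1 ∨ x = 3) ∧ (y = -1 ∨ y = 1) ∧ p = g.point (x, y) := by
  simp only [corners, Isom.mul_point]
  constructor
  · rintro ⟨d, rfl | rfl⟩
    · rcases (sym_points d).1 with h | h | h | h <;> rw [h] <;> exact ⟨_, _, by simp, by simp, rfl⟩
    · rcases (sym_points d).2 with h | h | h | h <;> rw [h] <;> exact ⟨_, _, by simp, by simp, rfl⟩
  · rintro ⟨x, y, rfl | rfl | rfl | rfl, rfl | rfl, rfl⟩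
    · exact ⟨2, .inl (congrArg g.point (by decide))⟩
    · exact ⟨0, .inl (congrArg g.point (by decide))⟩
    · exact ⟨2, .inr (congrArg g.point (by decide))⟩
    · exact ⟨0, .inr (congrArg g.point (by decide))⟩
    · exact ⟨3, .inr (congrArg g.point (by decide))⟩
    · exact ⟨1, .inr (congrArg g.point (by decide))⟩
    · exact ⟨3, .inl (congrArg g.point (by decide))⟩
    · exact ⟨1, .inl (congrArg g.point (by decide))⟩

/-- Half the width of a domino. -/
def Domino.halfWidth (D : Domino) : ℤ := if D.horizontal then 4 else 2
/-- Half the height of a domino. -/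
def Domino.halfHeight (D : Domino) : ℤ := if D.horizontal then 2 else 4

theorem east_cases : ∀ (e : Dir) (f : Bool),
    let u := vec ((⟨0, e, f⟩ : Isom).dir 1)
    let w := vec ((⟨0, e, f⟩ : Isom).dir 0)
    (e = 1 ∨ e = 3) ∧ (u = (1, 0) ∨ u = (-1, 0)) ∧ (w = (0, 1) ∨ w = (0, -1)) ∨
    ¬ (e = 1 ∨ e = 3) ∧ (u = (0, 1) ∨ u = (0, -1)) ∧ (w = (1, 0) ∨ w = (-1, 0)) := by
  decide

theorem domino_centre (g : Isom) : g.domino.centre = g.c := by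
  simp [Isom.domino, Isom.moveDomino, Isom.point]

theorem Isom.domino_cases (g : Isom) :
    let u := vec (g.dir 1)
    let w := vec (g.dir 0)
    (g.domino.halfWidth = 4 ∧ g.domino.halfHeight = 2) ∧
      (u = (1, 0) ∨ u = (-1, 0)) ∧ (w = (0, 1) ∨ w = (0, -1)) ∨
    (g.domino.halfWidth = 2 ∧ g.domino.halfHeight = 4) ∧
      (u = (0, 1) ∨ u = (0, -1)) ∧ (w = (1, 0) ∨ w = (-1, 0)) := by
  refine (east_cases g.east g.flip).imp ?_ ?_
  · rintro ⟨h, h'⟩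
    exact ⟨by simp [Domino.halfWidth, Domino.halfHeight, Isom.domino, Isom.moveDomino, h], h'⟩
  · rintro ⟨h, h'⟩
    exact ⟨by simp [Domino.halfWidth, Domino.halfHeight, Isom.domino, Isom.moveDomino, h], h'⟩

/-- The corners occupy all positions of the domino at odd distances from both axes, so every block
inside the domino contains one. The witnesses round the offset to an odd number, with a sign for
each reversed axis. -/
theorem exists_corner_mem_block {g : Isom} {x y : ℤ}
    (hx : g.c.1 - g.domino.halfWidth ≤ x) (hx' : x < g.c.1 + g.domino.halfWidth)
    (hy : g.c.2 - g.domino.halfHeight ≤ y) (hy' : y < g.c.2 + g.domino.halfHeight) :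
    ∃ q ∈ corners g, q ∈ block x y := by
  obtain ⟨⟨a, b⟩, e, f⟩ := g
  obtain ⟨u, v, hu, hv, hq⟩ : ∃ u v : ℤ, (u = -3 ∨ u = -1 ∨ u = 1 ∨ u = 3) ∧ (v = -1 ∨ v = 1) ∧
      (⟨(a, b), e, f⟩ : Isom).point (u, v) ∈ block x y := by
    simp only [block, Set.mem_ofPred_eq, Isom.point, Prod.fst_add, Prod.snd_add, Prod.smul_fst,
      Prod.smul_snd, smul_eq_mul]
    rcases Isom.domino_cases ⟨(a, b), e, f⟩ with ⟨⟨h1, h2⟩, hu | hu, hw | hw⟩ | ⟨⟨h1, h2⟩, hu | hu, hw | hw⟩ <;>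
      rw [h1] at hx hx' <;> rw [h2] at hy hy' <;> rw [hu, hw] <;> dsimp only at * <;> clear hu hw h1 h2
    · refine ⟨2 * ((x - a + 4) / 2) - 3, 2 * ((y - b + 2) / 2) - 1, ?_, ?_, ?_, ?_⟩ <;> omega
    · refine ⟨2 * ((x - a + 4) / 2) - 3, -(2 * ((y - b + 2) / 2) - 1), ?_, ?_, ?_, ?_⟩ <;> omega
    · refine ⟨-(2 * ((x - a + 4) / 2) - 3), 2 * ((y - b + 2) / 2) - 1, ?_, ?_, ?_, ?_⟩ <;> omega
    · refine ⟨-(2 * ((x - a + 4) / 2) - 3), -(2 * ((y - b + 2) / 2) - 1), ?_, ?_, ?_, ?_⟩ <;> omega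
    · refine ⟨2 * ((y - b + 4) / 2) - 3, 2 * ((x - a + 2) / 2) - 1, ?_, ?_, ?_, ?_⟩ <;> omega
    · refine ⟨2 * ((y - b + 4) / 2) - 3, -(2 * ((x - a + 2) / 2) - 1), ?_, ?_, ?_, ?_⟩ <;> omega
    · refine ⟨-(2 * ((y - b + 4) / 2) - 3), 2 * ((x - a + 2) / 2) - 1, ?_, ?_, ?_, ?_⟩ <;> omega
    · refine ⟨-(2 * ((y - b + 4) / 2) - 3), -(2 * ((x - a + 2) / 2) - 1), ?_, ?_, ?_, ?_⟩ <;> omega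
  exact ⟨_, mem_corners.2 ⟨u, v, hu, hv, rfl⟩, hq⟩

theorem corner_bounds {g : Isom} {q : ℤ × ℤ} (hq : q ∈ corners g) :
    g.c.1 - g.domino.halfWidth ≤ q.1 - 1 ∧ q.1 + 1 ≤ g.c.1 + g.domino.halfWidth ∧
    g.c.2 - g.domino.halfHeight ≤ q.2 - 1 ∧ q.2 + 1 ≤ g.c.2 + g.domino.halfHeight := by
  obtain ⟨x, y, hx, hy, rfl⟩ := mem_corners.1 hq
  obtain ⟨⟨a, b⟩, e, f⟩ := g
  simp only [Isom.point, Prod.fst_add, Prod.snd_add, Prod.smul_fst,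
      Prod.smul_snd, smul_eq_mul]
  rcases Isom.domino_cases ⟨(a, b), e, f⟩ with ⟨⟨h1, h2⟩, hu | hu, hw | hw⟩ | ⟨⟨h1, h2⟩, hu | hu, hw | hw⟩ <;>
    rw [h1, h2, hu, hw] <;> dsimp only <;> omega

theorem Domino.region_eq (D : Domino) : D.region =
    Set.Icc ((D.centre.1 - D.halfWidth : ℤ) : ℝ) ((D.centre.1 + D.halfWidth : ℤ) : ℝ) ×ˢ
    Set.Icc ((D.centre.2 - D.halfHeight : ℤ) : ℝ) ((D.centre.2 + D.halfHeight : ℤ) : ℝ) := by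
  rw [Set.Icc_prod_Icc]
  unfold Domino.region Domino.halfWidth Domino.halfHeight
  dsimp only
  split_ifs <;> push_cast <;> rfl

theorem exists_int_of_Ioo {a b a' b' : ℤ} {u : ℝ} (h : u ∈ Set.Ioo (a : ℝ) b)
    (h' : u ∈ Set.Ioo (a' : ℝ) b') : ∃ x : ℤ, a ≤ x ∧ x < b ∧ a' ≤ x ∧ x < b' := by
  refine ⟨⌊u⌋, Int.le_floor.2 h.1.le, Int.floor_lt.2 h.2, Int.le_floor.2 h'.1.le,
    Int.floor_lt.2 h'.2⟩

/-- The vertex blocks carry the whole argument. The unit square that belongs to a block is covered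
by the domino of its cornered tile. If two dominoes overlap, they share a block, in which each has a
corner; the two corners coincide, and then so do the frames. -/
theorem erase_isDominoTiling {τ : ℤ × ℤ → Tile} (h : τ ∈ Tilings masterTiles) :
    IsDominoTiling (erase τ) := by
  constructor
  · rw [Set.eq_univ_iff_forall]
    rintro ⟨u, v⟩
    obtain ⟨q, ⟨⟨h1, h2⟩, hk⟩, -⟩ := h.1.unique_cornered ⌊u⌋ ⌊v⌋
    obtain ⟨g, d, hg, hq⟩ := exists_marked h hk
    have hb := corner_bounds (g := g) (q := q) ⟨d, hq⟩
    refine Set.mem_iUnion₂.2 ⟨g.domino, ⟨g, hg, rfl⟩, ?_⟩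
    rw [Domino.region_eq, domino_centre]
    have f1 := Int.floor_le u; have f2 := (Int.lt_floor_add_one u).le
    have f3 := Int.floor_le v; have f4 := (Int.lt_floor_add_one v).le
    refine ⟨⟨?_, ?_⟩, ?_, ?_⟩ <;> dsimp only
    · refine le_trans ?_ f1; exact_mod_cast (by omega : g.c.1 - g.domino.halfWidth ≤ ⌊u⌋)
    · refine f2.trans ?_; exact_mod_cast (by omega : ⌊u⌋ + 1 ≤ g.c.1 + g.domino.halfWidth)
    · refine le_trans ?_ f3; exact_mod_cast (by omega : g.c.2 - g.domino.halfHeight ≤ ⌊v⌋)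
    · refine f4.trans ?_; exact_mod_cast (by omega : ⌊v⌋ + 1 ≤ g.c.2 + g.domino.halfHeight)
  · rintro _ ⟨g, hg, rfl⟩ _ ⟨g', hg', rfl⟩ hne
    rw [Set.disjoint_left]
    rintro ⟨u, v⟩ hu hu'
    apply hne
    rw [Domino.region_eq, interior_prod_eq, interior_Icc, interior_Icc] at hu hu'
    obtain ⟨x, hx⟩ := exists_int_of_Ioo hu.1 hu'.1
    obtain ⟨y, hy⟩ := exists_int_of_Ioo hu.2 hu'.2
    rw [domino_centre, domino_centre] at hx hy
    obtain ⟨q, hq, hb⟩ := exists_corner_mem_block hx.1 hx.2.1 hy.1 hy.2.1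
    obtain ⟨q', hq', hb'⟩ := exists_corner_mem_block hx.2.2.1 hx.2.2.2 hy.2.2.1 hy.2.2.2
    have : q = q' := (h.1.unique_cornered x y).unique ⟨hb, k_of_corner hg hq⟩
      ⟨hb', k_of_corner hg' hq'⟩
    subst this
    have e : g = g' := frame_unique hg hg' hq hq'
    rw [e]

/-- The eight outward tiles of the standard frame of level `0`. -/
def frameTiles : Set ((ℤ × ℤ) × Tile) :=
  ⋃ d, {((sym d).point (-3, 1), (sym d).tile (outerCorner true d)),
    ((sym d).point (-1, 1), (sym d).tile (innerCorner true d))}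

theorem marked_zero_iff_frameTiles {τ : ℤ × ℤ → Tile} {g : Isom} :
    Marked τ 0 g ↔ ∀ x ∈ frameTiles, τ (g.point x.1) = g.tile x.2 := by
  simp only [marked_zero_iff, Quarter, act_inv_eq_iff, frameTiles, Set.mem_iUnion, Isom.mul_point,
    Isom.mul_tile]
  constructor
  · rintro h x ⟨d, rfl | rfl⟩
    exacts [(h d).1, (h d).2]
  · exact fun h d => ⟨h _ ⟨d, .inl rfl⟩, h _ ⟨d, .inr rfl⟩⟩

/-- Besides the pattern of a frame, every single tile is a source with empty image, so that the
covering condition is automatic. These sources sit at the origin, where the frame has no corner,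
hence they are different from it. -/
theorem exists_localRule : ∃ R : LocalRule, ∀ τ, R.Covers τ ∧ R.apply τ = erase τ := by
  obtain ⟨n, ⟨e⟩⟩ := Finite.exists_equiv_fin (Option Tile)
  let src : Option Tile → Set ((ℤ × ℤ) × Tile) := fun o => o.elim frameTiles fun t => {(0, t)}
  have hne : ∀ t, frameTiles ≠ {(0, t)} := by
    intro t h
    have : ((sym 0).point (-3, 1), (sym 0).tile (outerCorner true 0)) ∈ frameTiles :=
      Set.mem_iUnion.2 ⟨0, .inl rfl⟩
    rw [h] at this
    have : (sym 0).point (-3, 1) = (0 : ℤ × ℤ) := congrArg Prod.fst (Set.mem_singleton_iff.1 this)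
    exact absurd this (by decide)
  have hinj : Function.Injective src := by
    rintro (_ | t) (_ | t') h
    · rfl
    · exact absurd h (hne t')
    · exact absurd h.symm (hne t)
    · have h : ({(0, t)} : Set ((ℤ × ℤ) × Tile)) = {(0, t')} := h
      rw [Set.singleton_eq_singleton_iff] at h
      rw [(Prod.mk.inj h).2]
  let R : LocalRule :=
    { size := n
      source := fun i => src (e.symm i)
      target := fun i => (e.symm i).elim {⟨0, true⟩} fun _ => ∅
      source_injective := hinj.comp e.symm.injective
      source_finite := fun i => by
        rcases e.symm i with _ | t
        · exact Set.finite_iUnion fun d => Set.toFinite _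
        · exact Set.finite_singleton _
      target_finite := fun i => by
        rcases e.symm i with _ | t
        · exact Set.finite_singleton _
        · exact Set.finite_empty }
  refine ⟨R, fun τ => ⟨fun p => ?_, ?_⟩⟩
  · have hp : (⟨p, 1, false⟩ : Isom).point 0 = p := by simp [Isom.point]
    refine ⟨e (some (τ p)), ⟨p, 1, false⟩, ?_, ((0, τ p) : (ℤ × ℤ) × Tile), ?_, hp⟩
    · intro x hx
      obtain rfl : x = (0, τ p) := by simpa [R, src] using hx
      rw [hp]; exact (Isom.one_tile _).symm
    · simp [R, src]
  · ext D
    constructor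
    · rintro ⟨i, g, ho, D', hD', rfl⟩
      rcases hi : e.symm i with _ | t
      · simp only [R, hi, Option.elim] at hD'
        obtain rfl := Set.mem_singleton_iff.1 hD'
        refine ⟨g, ?_, rfl⟩
        refine marked_zero_iff_frameTiles.2 fun x hx => ho x ?_
        simpa [R, src, hi] using hx
      · simp [R, hi] at hD'
    · rintro ⟨g, hg, rfl⟩
      refine ⟨e none, g, fun x hx => ?_, ⟨0, true⟩, by simp [R], rfl⟩
      exact marked_zero_iff_frameTiles.1 hg x (by simpa [R, src] using hx)

end DominoTiles

namespace DominoTiles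

/-! ### Aligning the columns of cornered tiles -/

theorem exists_next_column {τ : ℤ × ℤ → Tile} (h : IsTiling τ) {x y : ℤ}
    (hc : ∀ k, K τ (x, y + 2 * k)) {e : ℤ} (he : e = 2 ∨ e = -2) :
    ∃ y', ∀ k, K τ (x + e, y' + 2 * k) := by
  have none : ∀ x' y'', K τ (x', y'') → x' = x + 1 ∨ x' = x - 1 → False := by
    intro x' y'' hk hx
    have := k_near h hk (hc ((y'' - y) / 2))
    omega
  suffices ∃ y', K τ (x + e, y') by
    obtain ⟨y', hy'⟩ := this
    exact ⟨y', k_next_column h hc he hy'⟩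
  rcases he with rfl | rfl
  · rcases ex_k h (x + 1) y with e | e | e | e
    · exact (none _ _ e (.inl rfl)).elim
    · exact ⟨_, by rwa [add_assoc] at e⟩
    · exact (none _ _ e (.inl rfl)).elim
    · exact ⟨_, by rwa [add_assoc] at e⟩
  · rcases ex_k h (x + -2) y with e | e | e | e
    · exact ⟨_, e⟩
    · exact (none _ _ e (.inr (by ring))).elim
    · exact ⟨_, e⟩
    · exact (none _ _ e (.inr (by ring))).elim

theorem exists_columns {τ : ℤ × ℤ → Tile} (h : IsTiling τ) (hc : ∀ k, K τ (1, 2 * k + 1)) (n : ℤ) :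
    ∃ s : ℤ, ∀ k, K τ (2 * n + 1, 2 * k + 1 + s) := by
  induction n using Int.induction_on with
  | zero => exact ⟨0, by simpa using hc⟩
  | succ n ih =>
    obtain ⟨s, hs⟩ := ih
    obtain ⟨y, hy⟩ := exists_next_column h (x := 2 * n + 1) (y := 1 + s)
      (fun k => by rw [show 1 + s + 2 * k = 2 * k + 1 + s by ring]; exact hs k) (.inl rfl)
    refine ⟨y - 1, fun k => ?_⟩
    rw [show 2 * k + 1 + (y - 1) = y + 2 * k by ring, show 2 * ((n : ℤ) + 1) + 1 = 2 * n + 1 + 2 by ring]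
    exact hy k
  | pred n ih =>
    obtain ⟨s, hs⟩ := ih
    obtain ⟨y, hy⟩ := exists_next_column h (x := 2 * -n + 1) (y := 1 + s)
      (fun k => by rw [show 1 + s + 2 * k = 2 * k + 1 + s by ring]; exact hs k) (.inr rfl)
    refine ⟨y - 1, fun k => ?_⟩
    rw [show 2 * k + 1 + (y - 1) = y + 2 * k by ring,
      show 2 * (-(n : ℤ) - 1) + 1 = 2 * -n + 1 + -2 by ring]
    exact hy k

/-- The frame with centre `p` and the direction `j` as east. -/
def turnTo (p : ℤ × ℤ) (j : Dir) : Isom := ⟨p, j, false⟩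

theorem turnTo_point (p : ℤ × ℤ) (x y : ℤ) : (turnTo p 1).point (x, y) = p + (x, y) := by
  change p + x • ((1 : ℤ), (0 : ℤ)) + y • ((0 : ℤ), (1 : ℤ)) = _
  ext <;> simp

theorem k_act_inv (g : Isom) (τ : ℤ × ℤ → Tile) (p : ℤ × ℤ) :
    K (act g⁻¹ τ) p ↔ K τ (g.point p) := by rw [K, act_inv_point]; rfl

/-- If some cornered tile lacks its neighbour at distance two in some direction, there is a fault,
which forces a full column perpendicular to this direction. Otherwise all cornered tiles are in
phase. -/
theorem exists_column {τ : ℤ × ℤ → Tile} (h : IsTiling τ) :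
    ∃ g : Isom, ∀ k, K (act g⁻¹ τ) (1, 2 * k + 1) := by
  suffices H : ∃ g : Isom, ∀ k, K (act g⁻¹ τ) (0, 2 * k) by
    obtain ⟨g, hg⟩ := H
    refine ⟨g * turnTo (-1, -1) 1, fun k => ?_⟩
    have := hg k
    rw [k_act_inv] at this ⊢
    rw [Isom.mul_point, turnTo_point]
    simpa using this
  by_cases hf : ∃ p j, K τ p ∧ ¬ K τ (p + vec j + vec j)
  · obtain ⟨p, j, hp, hn⟩ := hf
    have e0 : (turnTo p j).point (0, 0) = p := by simp [Isom.point, turnTo]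
    have e1 : (turnTo p j).dir 1 = j := by simp [Isom.dir, turnTo]
    have e2 : (turnTo p j).point (2, 0) = p + vec j + vec j := by
      rw [show ((2, 0) : ℤ × ℤ) = (0, 0) + vec 1 + vec 1 from rfl, Isom.point_add_vec,
        Isom.point_add_vec, e0, e1]
    refine ⟨turnTo p j, fun k => ?_⟩
    have := (k_column (h.act (turnTo p j)⁻¹) (x := 0) (y := 0) (by rwa [k_act_inv, e0])
      (by rwa [k_act_inv, zero_add, e2]) k).1
    simpa using this
  · push Not at hf
    obtain ⟨p, hp⟩ : ∃ p, K τ p := by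
      rcases ex_k h 0 0 with e | e | e | e <;> exact ⟨_, e⟩
    refine ⟨turnTo p 1, fun k => ?_⟩
    rw [k_act_inv, turnTo_point]
    induction k using Int.induction_on with
    | zero => exact (add_zero p).symm ▸ hp
    | succ k ih =>
      have := hf _ 0 ih
      convert this using 1
      ext <;> simp [vec]; ring
    | pred k ih =>
      have := hf _ 2 ih
      convert this using 1
      ext <;> simp [vec]; ring

/-- The arms into the fault are plain, and so are their mates on the other side of the fault column,
except at the passage. The passing arm leaves one side of the fault column plain throughout. Along
this side the tiling can be cut and slid. -/
theorem Fault.fault_edges {τ : ℤ × ℤ → Tile} (h : Fault τ) :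
    ((∃ y, Crossing (τ (1, y)) 1) → ∀ y, (τ (1, y)).edge 3 = minus) ∧
    ((¬ ∃ y, Crossing (τ (1, y)) 1) → ∀ y, (τ (1, y)).edge 1 = minus) := by
  have hl : ∀ k, (τ (1, 2 * k)).edge 3 = minus := fun k =>
    h.mem.1.edge_fit (edge_plus_of_not_k h.mem (j := 1) (h.left k) (by
      change ¬ K τ (0 + 1 + 1, 2 * k + 0 + 0)
      intro hk
      have := k_near h.mem.1 hk (h.right k); omega))
  have hr : ∀ k, (τ (1, 2 * k + 1)).edge 1 = minus := fun k =>
    h.mem.1.edge_fit (edge_plus_of_not_k h.mem (j := 3) (h.right k) (by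
      change ¬ K τ (2 + -1 + -1, 2 * k + 1 + 0 + 0)
      intro hk
      have := k_near h.mem.1 hk (h.left k); omega))
  have mid : ∀ y, ¬ Pass τ y → (τ (1, y)).edge 1 = minus ∧ (τ (1, y)).edge 3 = minus := by
    intro y hy
    obtain ⟨h1, h3⟩ := h.in_of_not_pass hy
    rcases Int.even_or_odd' y with ⟨k, rfl | rfl⟩
    · have := meet_mate (h.master (1, 2 * k)) (j := 3) h3 h1
      rw [hl] at this
      have e := congrArg opp this
      rw [opp_opp] at e
      exact ⟨e, hl k⟩
    · have := meet_mate (h.master (1, 2 * k + 1)) (j := 1) h1 h3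
      rw [hr] at this
      have e := congrArg opp this
      rw [opp_opp] at e
      exact ⟨hr k, e⟩
  constructor
  · rintro ⟨Y, hY⟩ y
    by_cases hp : Pass τ y
    · obtain rfl := h.pass_unique hp (.inl hY)
      rcases Int.even_or_odd' y with ⟨k, rfl | rfl⟩
      · exact hl k
      · exact absurd ((h.in_east k).symm.trans hY.out) neg_one_ne_one
    · exact (mid y hp).2
  · intro hn y
    by_cases hp : Pass τ y
    · rcases hp with hp | hp
      · exact absurd ⟨y, hp⟩ hn
      rcases Int.even_or_odd' y with ⟨k, rfl | rfl⟩
      · exact absurd ((h.in_west k).symm.trans hp.out) neg_one_ne_one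
      · exact hr k
    · exact (mid y hp).1

theorem turnTo_act (p : ℤ × ℤ) (τ : ℤ × ℤ → Tile) (x y : ℤ) :
    act (turnTo p 1)⁻¹ τ (x, y) = τ (p + (x, y)) := by
  rw [act_inv_eq_iff, turnTo_point]; exact (Isom.one_tile _).symm

theorem fault_edges {τ : ℤ × ℤ → Tile} (h : τ ∈ Tilings masterTiles) {x y : ℤ} (hp : K τ (x, y))
    (hn : ¬ K τ (x + 2, y)) :
    ((∃ z, Crossing (τ (x + 1, z)) 1) → ∀ z, (τ (x + 1, z)).edge 3 = minus) ∧
    ((¬ ∃ z, Crossing (τ (x + 1, z)) 1) → ∀ z, (τ (x + 1, z)).edge 1 = minus) := by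
  have hF : Fault (act (turnTo (x, y) 1)⁻¹ τ) := by
    refine ⟨act_mem_tilings h _, fun k => ?_, fun k => ?_⟩
    · rw [K, turnTo_act]; simpa [K] using (k_column h.1 hp hn k).1
    · rw [K, turnTo_act]; simpa [K, add_assoc] using (k_column h.1 hp hn k).2
  have hz : ∀ z, act (turnTo (x, y) 1)⁻¹ τ (1, z - y) = τ (x + 1, z) := fun z => by
    rw [turnTo_act]; simp
  obtain ⟨h1, h2⟩ := hF.fault_edges
  constructor
  · rintro ⟨z, hc⟩ z'
    rw [← hz]
    exact h1 ⟨z - y, by rwa [hz]⟩ _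
  · intro hc z'
    rw [← hz]
    refine h2 ?_ _
    rintro ⟨z, hc'⟩
    refine hc ⟨z + y, ?_⟩
    rwa [← hz, add_sub_cancel_right]

theorem isTiling_of_fits {τ : ℤ × ℤ → Tile}
    (h0 : ∀ p, (τ (p + vec 0)).edge 2 = opp ((τ p).edge 0))
    (h1 : ∀ p, (τ (p + vec 1)).edge 3 = opp ((τ p).edge 1))
    (hc : ∀ x y : ℤ, ∃! q : ℤ × ℤ, q ∈ block x y ∧ (τ q).cornered = true) : IsTiling τ where
  fits p j := by
    rw [matches_iff]
    have : ∀ j : Dir, j = 0 ∨ j = 1 ∨ j = 2 ∨ j = 3 := by decide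
    rcases this j with rfl | rfl | rfl | rfl
    · exact h0 p
    · exact h1 p
    · have := h0 (p + vec 2)
      rw [show p + vec 2 + vec 0 = p by ext <;> simp [vec]] at this
      rw [this, opp_opp]; rfl
    · have := h1 (p + vec 3)
      rw [show p + vec 3 + vec 1 = p by ext <;> simp [vec]] at this
      rw [this, opp_opp]; rfl
  corners x y := by simpa only [block, Set.mem_ofPred_eq, and_assoc] using hc x y

/-- The cornered tiles are those with two odd coordinates. -/
def Aligned (τ : ℤ × ℤ → Tile) : Prop := ∀ x y, K τ (x, y) ↔ x % 2 = 1 ∧ y % 2 = 1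

theorem Aligned.unique {τ : ℤ × ℤ → Tile} (h : Aligned τ) (x y : ℤ) :
    ∃! q : ℤ × ℤ, q ∈ block x y ∧ (τ q).cornered = true := by
  refine ⟨(2 * (x / 2) + 1, 2 * (y / 2) + 1), ⟨?_, ?_⟩, ?_⟩
  · simp only [block, Set.mem_ofPred_eq]; omega
  · exact (h _ _).2 (by omega)
  · rintro ⟨a, b⟩ ⟨hq, hk⟩
    have := (h a b).1 hk
    simp only [block, Set.mem_ofPred_eq] at hq
    ext <;> dsimp only <;> omega

/-- The columns of `τ'` are shifted columns of `τ`, and where two neighbouring columns are shifted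
differently there are no signed markings between them. -/
structure Sheared (τ τ' : ℤ × ℤ → Tile) (σ : ℤ → ℤ) : Prop where
  eq : ∀ x y, τ' (x, y) = τ (x, y + σ x)
  unsided : ∀ x, σ x = σ (x + 1) ∨ ∀ y, ((τ' (x, y)).edge 1).b = 0

theorem Sheared.symm {τ τ' : ℤ × ℤ → Tile} {σ : ℤ → ℤ} (h : Sheared τ τ' σ) :
    Sheared τ' τ (fun x => -σ x) where
  eq x y := by rw [h.eq]; congr 2; ring
  unsided x := by
    refine (h.unsided x).imp (fun e => by rw [e]) fun e y => ?_
    have := e (y - σ x)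
    rwa [h.eq, sub_add_cancel] at this

/-- The columns are slid against each other until all cornered tiles have odd coordinates. Every cut
runs along a line of equal unsided markings, so the result is still a tiling. -/
theorem exists_aligned {T : Set TileClass} (hT : T ⊆ masterTiles) {τ : ℤ × ℤ → Tile}
    (h : τ ∈ Tilings T) : ∃ (g : Isom) (σ : ℤ → ℤ) (τ' : ℤ × ℤ → Tile), τ' ∈ Tilings T ∧
      Aligned τ' ∧ Sheared (act g⁻¹ τ) τ' σ := by
  obtain ⟨g, hg⟩ := exists_column h.1
  have h' := act_mem_tilings h g⁻¹
  refine ⟨g, ?_⟩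
  generalize act g⁻¹ τ = τ₀ at *
  have hM : τ₀ ∈ Tilings masterTiles := ⟨h'.1, fun p => hT (h'.2 p)⟩
  choose s hs using exists_columns h'.1 hg
  let pass : ℤ → Prop := fun x => ∃ z, Crossing (τ₀ (x, z)) 1
  classical
  -- An intermediate column moves with its right neighbour if some arm passes it to the east, and
  -- otherwise with its left one; `fault_edges` then puts the cut on the plain side.
  let σ : ℤ → ℤ := fun x => if x % 2 = 1 then s ((x - 1) / 2) else
    if pass x then s (x / 2) else s (x / 2 - 1)
  have σodd : ∀ n, σ (2 * n + 1) = s n := by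
    intro n
    simp only [σ]
    rw [if_pos (by omega)]; congr 1; omega
  have σeven : ∀ n, σ (2 * n) = if pass (2 * n) then s n else s (n - 1) := by
    intro n
    simp only [σ]
    rw [if_neg (by omega), show 2 * n / 2 = n by omega]
  have hfault : ∀ n, s (n - 1) % 2 = s n % 2 ∨
      ((pass (2 * n) → ∀ z, (τ₀ (2 * n, z)).edge 3 = minus) ∧
      (¬ pass (2 * n) → ∀ z, (τ₀ (2 * n, z)).edge 1 = minus)) := by
    intro n
    by_cases he : s (n - 1) % 2 = s n % 2
    · exact .inl he
    right
    have hp := hs (n - 1) 0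
    rw [show 2 * (n - 1) + 1 = 2 * n - 1 by ring] at hp
    have := fault_edges hM hp (by
      intro hk
      rw [show 2 * n - 1 + 2 = 2 * n + 1 by ring] at hk
      have := k_near h'.1 hk (hs n ((s (n - 1) - s n) / 2))
      omega)
    rw [show 2 * n - 1 + 1 = 2 * n by ring] at this
    exact this
  obtain ⟨s', hs', hss⟩ : ∃ s' : ℤ → ℤ, (∀ n, s' n = 0 ∨ s' n = 1) ∧ ∀ n, s' n = s n % 2 :=
    ⟨fun n => s n % 2, fun n => by have := Int.emod_two_eq (s n); simpa using this, fun _ => rfl⟩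
  -- Only the parity of a shift matters for the alignment. Reducing it makes the shifts equal where
  -- neighbouring columns are in phase, since signed markings may cross there and no cut is allowed.
  let σ' : ℤ → ℤ := fun x => σ x % 2
  have hK : ∀ n k, K τ₀ (2 * n + 1, 2 * k + 1 + σ' (2 * n + 1)) := by
    intro n k
    have := hs n (k - s n / 2)
    rwa [show 2 * (k - s n / 2) + 1 + s n = 2 * k + 1 + σ' (2 * n + 1) by
      simp only [σ', σodd]; omega] at this
  have hσ : ∀ x, σ' x = σ' (x + 1) ∨ ∃ m : Marking, m.b = 0 ∧ ∀ y, (τ₀ (x, y)).edge 1 = m := by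
    intro x
    rcases Int.even_or_odd' x with ⟨n, rfl | rfl⟩
    · simp only [σ', σodd, σeven]
      rcases hfault n with e | e
      · left; split_ifs <;> omega
      · by_cases hp : pass (2 * n)
        · left; rw [if_pos hp]
        · exact .inr ⟨minus, rfl, e.2 hp⟩
    · simp only [σ', σodd]
      rw [show 2 * n + 1 + 1 = 2 * (n + 1) by ring, σeven, add_sub_cancel_right]
      rcases hfault (n + 1) with e | e
      · left; rw [add_sub_cancel_right] at e; split_ifs <;> omega
      · by_cases hp : pass (2 * (n + 1))
        · refine .inr ⟨plus, rfl, fun y => ?_⟩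
          have := h'.1.fit (2 * (n + 1), y) 3 (q := (2 * n + 1, y)) (k := 1)
          rw [this, e.1 hp]; rfl
        · left; rw [if_neg hp]
  let τ' : ℤ × ℤ → Tile := fun p => τ₀ (p.1, p.2 + σ' p.1)
  have hA : Aligned τ' := by
    intro x y
    have key : ∀ n k, K τ' (2 * n + 1, 2 * k + 1) := fun n k => hK n k
    constructor
    · intro hk
      rcases Int.even_or_odd' x with ⟨n, rfl | rfl⟩
      · have hk : K τ₀ (2 * n, y + σ' (2 * n)) := hk
        have := k_near h'.1 hk (hK n ((y + σ' (2 * n) - σ' (2 * n + 1)) / 2))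
        omega
      · have hk : K τ₀ (2 * n + 1, y + σ' (2 * n + 1)) := hk
        have := k_near h'.1 hk (hK n (y / 2))
        omega
    · rintro ⟨h1, h2⟩
      have := key (x / 2) (y / 2)
      rwa [show 2 * (x / 2) + 1 = x by omega, show 2 * (y / 2) + 1 = y by omega] at this
  refine ⟨σ', τ', ⟨isTiling_of_fits ?_ ?_ hA.unique, fun p => h'.2 _⟩, hA, fun x y => rfl, fun x => ?_⟩
  · rintro ⟨x, y⟩
    exact h'.1.fit (x, y + σ' x) 0 (by ext <;> simp [vec]; ring)
  · rintro ⟨x, y⟩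
    rcases hσ x with e | ⟨m, -, e⟩
    · exact h'.1.fit (x, y + σ' x) 1 (by ext <;> simp [vec, e])
    · have e1 : (τ' (x, y)).edge 1 = m := e _
      have e2 := h'.1.fit (x, y + 0 + σ' (x + 1)) 1 (q := (x + 1, y + 0 + σ' (x + 1))) (k := 3)
      rw [e] at e2
      rw [e1]; exact e2
  · exact (hσ x).imp id fun ⟨m, hm, e⟩ y => by rw [show (τ' (x, y)).edge 1 = m from e _, hm]

/-! ### Frames in sheared tilings -/

/-- There is a signed marking on the edge of `p` in the direction `j`. -/
def Signed (τ : ℤ × ℤ → Tile) (p : ℤ × ℤ) (j : Dir) : Prop := ((τ p).edge j).b ≠ 0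

theorem Signed.opp {τ : ℤ × ℤ → Tile} (h : IsTiling τ) {p q : ℤ × ℤ} {j k : Dir}
    (hs : Signed τ p j) (hq : q = p + vec j) (hk : k = j + 2) : Signed τ q k := by
  rw [Signed, h.fit p j hq hk]
  simpa [DominoTiles.opp, Signed] using hs

theorem signed_of_edge {τ : ℤ × ℤ → Tile} {p : ℤ × ℤ} {j : Dir} {g : Isom} {m : Marking}
    (h : (τ p).edge j = g.mark m) (hm : m.b ≠ 0) : Signed τ p j := by
  rw [Signed, h, mark_b_ne]; exact hm

theorem signed_act {τ : ℤ × ℤ → Tile} {g : Isom} {p : ℤ × ℤ} {j : Dir} :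
    Signed (act g⁻¹ τ) p j ↔ Signed τ (g.point p) (g.dir j) := by
  have := act_edge g⁻¹ τ (g.point p) (g.dir j)
  rw [Isom.inv_point_point, Isom.inv_dir_dir] at this
  rw [Signed, this, mark_b_ne]; rfl

theorem sym_point : ∀ d : Digit, ∀ x y : ℤ, (sym d).point (x, y) =
    (if d = 0 ∨ d = 2 then x else -x, if d = 0 ∨ d = 1 then y else -y) := by
  intro d x y
  have h1 : ∀ d : Digit, vec ((sym d).dir 1) = (if d = 0 ∨ d = 2 then 1 else -1, 0) := by decide
  have h0 : ∀ d : Digit, vec ((sym d).dir 0) = (0, if d = 0 ∨ d = 1 then 1 else -1) := by decide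
  have hc : ∀ d : Digit, (sym d).c = 0 := by decide
  rw [Isom.point, h1, h0, hc]
  ext <;> simp

/-- The long side of the frame is covered by six arms of length `2 ^ n`, three from each half. On an
arm that runs west, an edge is read from the square on its other side, whence the `t + 1`. -/
theorem Marked.signed_x {τ : ℤ × ℤ → Tile} (h : IsTiling τ) {n : ℕ} (hm : Marked τ n 1) {t : ℤ}
    (h1 : -(3 * 2 ^ n) ≤ t) (h2 : t < 3 * 2 ^ n) : Signed τ (t, 2 ^ n) 1 := by
  have hr : (0 : ℤ) < 2 ^ n := by positivity
  obtain ⟨-, -, m0⟩ := hm 0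
  obtain ⟨-, -, m1⟩ := hm 1
  simp only [Isom.comp_eq, one_mul, sym_point] at m0 m1
  generalize hR : (2 : ℤ) ^ n = r at *
  simp only [true_or, or_true, if_true, if_neg (show ¬((1 : Digit) = 0 ∨ (1 : Digit) = 2) by decide)]
    at m0 m1
  by_cases c1 : t < -2 * r
  · obtain ⟨a, -, -, -⟩ := m0 (t + 3 * r) (by omega) (by omega)
    rw [show -3 * r + (t + 3 * r) = t by ring] at a
    exact signed_of_edge a one_ne
  by_cases c2 : t < -r
  · obtain ⟨-, -, -, a⟩ := m0 (-r - 1 - t) (by omega) (by omega)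
    rw [show -r - (-r - 1 - t) = t + 1 by ring] at a
    exact (signed_of_edge a neg_one_ne).opp h (by ext <;> simp [vec, sym, Isom.dir]) (by decide)
  by_cases c3 : t < 0
  · obtain ⟨-, -, a, -⟩ := m0 (t + r) (by omega) (by omega)
    rw [show -r + (t + r) = t by ring] at a
    exact signed_of_edge a one_ne
  by_cases c4 : t < r
  · obtain ⟨-, -, a, -⟩ := m1 (r - 1 - t) (by omega) (by omega)
    rw [show -(-r + (r - 1 - t)) = t + 1 by ring] at a
    exact (signed_of_edge a one_ne).opp h (by ext <;> simp [vec, sym, Isom.dir]) (by decide)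
  by_cases c5 : t < 2 * r
  · obtain ⟨-, -, -, a⟩ := m1 (t - r) (by omega) (by omega)
    rw [show -(-r - (t - r)) = t by ring] at a
    exact signed_of_edge a neg_one_ne
  · obtain ⟨a, -, -, -⟩ := m1 (3 * r - 1 - t) (by omega) (by omega)
    rw [show -(-3 * r + (3 * r - 1 - t)) = t + 1 by ring] at a
    exact (signed_of_edge a one_ne).opp h (by ext <;> simp [vec, sym, Isom.dir]) (by decide)

theorem Marked.signed_y {τ : ℤ × ℤ → Tile} (h : IsTiling τ) {n : ℕ} (hm : Marked τ n 1) {t : ℤ}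
    (h1 : -2 ^ n ≤ t) (h2 : t < 2 ^ n) : Signed τ (-(3 * 2 ^ n), t) 0 := by
  have hr : (0 : ℤ) < 2 ^ n := by positivity
  obtain ⟨-, -, m0⟩ := hm 0
  obtain ⟨-, -, m1⟩ := hm 2
  simp only [Isom.comp_eq, one_mul, sym_point] at m0 m1
  generalize hR : (2 : ℤ) ^ n = r at *
  simp only [true_or, or_true, if_true, if_neg (show ¬((2 : Digit) = 0 ∨ (2 : Digit) = 1) by decide)]
    at m0 m1
  by_cases c1 : t < 0
  · obtain ⟨-, a, -, -⟩ := m1 (t + r) (by omega) (by omega)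
    rw [show -(r - (t + r)) = t by ring, neg_mul] at a
    exact signed_of_edge a neg_one_ne
  · obtain ⟨-, a, -, -⟩ := m0 (r - 1 - t) (by omega) (by omega)
    rw [show r - (r - 1 - t) = t + 1 by ring, neg_mul] at a
    exact (signed_of_edge a neg_one_ne).opp h (by ext <;> simp [vec, sym, Isom.dir]) (by decide)

/-- Half the width of the rectangle of the arms of a frame of level `n`. -/
def reach (n : ℕ) (g : Isom) : ℤ := if g.east = 1 ∨ g.east = 3 then 3 * 2 ^ n else 2 ^ n

theorem dir_cases : ∀ (e : Dir) (f : Bool),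
    (e = 1 ∨ e = 3) ∧ ((⟨0, e, f⟩ : Isom).dir 1 = 1 ∨ (⟨0, e, f⟩ : Isom).dir 1 = 3) ∧
      ((⟨0, e, f⟩ : Isom).dir 0 = 0 ∨ (⟨0, e, f⟩ : Isom).dir 0 = 2) ∨
    ¬ (e = 1 ∨ e = 3) ∧ ((⟨0, e, f⟩ : Isom).dir 1 = 0 ∨ (⟨0, e, f⟩ : Isom).dir 1 = 2) ∧
      ((⟨0, e, f⟩ : Isom).dir 0 = 1 ∨ (⟨0, e, f⟩ : Isom).dir 0 = 3) := by decide

theorem Isom.dir_cases (g : Isom) :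
    (∀ n, reach n g = 3 * 2 ^ n) ∧ (g.dir 1 = 1 ∨ g.dir 1 = 3) ∧ (g.dir 0 = 0 ∨ g.dir 0 = 2) ∨
    (∀ n, reach n g = 2 ^ n) ∧ (g.dir 1 = 0 ∨ g.dir 1 = 2) ∧ (g.dir 0 = 1 ∨ g.dir 0 = 3) := by
  rcases DominoTiles.dir_cases g.east g.flip with ⟨h, h'⟩ | ⟨h, h'⟩
  · exact .inl ⟨fun n => if_pos h, h'⟩
  · exact .inr ⟨fun n => if_neg h, h'⟩

/-- A long side of a horizontal frame, or a short side of a vertical one, crosses every vertical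
line within reach. -/
theorem Marked.exists_signed {τ : ℤ × ℤ → Tile} (h : IsTiling τ) {n : ℕ} {g : Isom}
    (hm : Marked τ n g) {x : ℤ} (h1 : g.c.1 - reach n g ≤ x) (h2 : x < g.c.1 + reach n g) :
    ∃ y, Signed τ (x, y) 1 := by
  have hm1 : Marked (DominoTiles.act g⁻¹ τ) n 1 := by simpa using hm.act g⁻¹
  have sx : ∀ t : ℤ, -(3 * 2 ^ n) ≤ t → t < 3 * 2 ^ n → Signed τ (g.point (t, 2 ^ n)) (g.dir 1) :=
    fun t ht ht' => signed_act.1 (hm1.signed_x (h.act _) ht ht')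
  have sy : ∀ t : ℤ, -2 ^ n ≤ t → t < 2 ^ n → Signed τ (g.point (-(3 * 2 ^ n), t)) (g.dir 0) :=
    fun t ht ht' => signed_act.1 (hm1.signed_y (h.act _) ht ht')
  have v0 : vec 0 = (0, 1) := rfl
  have v1 : vec 1 = (1, 0) := rfl
  have v2 : vec 2 = (0, -1) := rfl
  have v3 : vec 3 = (-1, 0) := rfl
  rcases g.dir_cases with ⟨hr, hu, hw⟩ | ⟨hr, hu, hw⟩ <;> rw [hr] at h1 h2 <;>
    generalize (2 : ℤ) ^ n = r at *
  · obtain ⟨b, hw⟩ : ∃ b, vec (g.dir 0) = (0, b) := by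
      rcases hw with hw | hw <;> rw [hw] <;> exact ⟨_, rfl⟩
    rcases hu with hu | hu
    · have := sx (x - g.c.1) (by omega) (by omega)
      rw [Isom.point, hw, hu, v1] at this
      exact ⟨_, by convert this using 1; ext <;> simp; rfl⟩
    · have := sx (g.c.1 - x - 1) (by omega) (by omega)
      rw [Isom.point, hw, hu, v3] at this
      refine ⟨_, this.opp h (q := (x, ?_)) (k := 1) ?_ rfl⟩
      swap
      · ext
        · simp [v3]; ring
        · rfl
  · obtain ⟨b, hu⟩ : ∃ b, vec (g.dir 1) = (0, b) := by
      rcases hu with hu | hu <;> rw [hu] <;> exact ⟨_, rfl⟩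
    rcases hw with hw | hw
    · have := sy (x - g.c.1) (by omega) (by omega)
      rw [Isom.point, hu, hw, v1] at this
      exact ⟨_, by convert this using 1; ext <;> simp; rfl⟩
    · have := sy (g.c.1 - x - 1) (by omega) (by omega)
      rw [Isom.point, hu, hw, v3] at this
      refine ⟨_, this.opp h (q := (x, ?_)) (k := 1) ?_ rfl⟩
      swap
      · ext
        · simp [v3]; ring
        · rfl

/-- A cut meets only unsided markings, but the sides of a marked frame put a signed one on every
vertical line through it. Hence no cut passes through a marked frame. -/
theorem Sheared.const {τ τ' : ℤ × ℤ → Tile} {σ : ℤ → ℤ} (h : Sheared τ τ' σ) (ht : IsTiling τ')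
    {n : ℕ} {g : Isom} (hm : Marked τ' n g) {x : ℤ} (h1 : g.c.1 - reach n g ≤ x)
    (h2 : x ≤ g.c.1 + reach n g) : σ x = σ g.c.1 := by
  have step : ∀ k : ℕ, g.c.1 - reach n g + k ≤ g.c.1 + reach n g →
      σ (g.c.1 - reach n g + k) = σ (g.c.1 - reach n g) := by
    intro k
    induction k with
    | zero => simp
    | succ k ih =>
      intro hk
      push_cast at hk ⊢
      rw [← ih (by omega), ← add_assoc]
      refine ((h.unsided _).resolve_right fun hn => ?_).symm
      obtain ⟨y, hy⟩ := hm.exists_signed ht (x := g.c.1 - reach n g + k) (by omega) (by omega)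
      exact hy (hn y)
  have e1 := step (x - (g.c.1 - reach n g)).toNat (by omega)
  have e2 := step (g.c.1 - (g.c.1 - reach n g)).toNat (by omega)
  rw [Int.toNat_of_nonneg (by omega), add_sub_cancel] at e1 e2
  rw [e1, e2]

theorem reach_bound {n : ℕ} (g : Isom) {q : ℤ × ℤ} (h1 : -(3 * 2 ^ n) ≤ q.1) (h2 : q.1 ≤ 3 * 2 ^ n)
    (h3 : -2 ^ n ≤ q.2) (h4 : q.2 ≤ 2 ^ n) :
    g.c.1 - reach n g ≤ (g.point q).1 ∧ (g.point q).1 ≤ g.c.1 + reach n g := by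
  have v0 : vec 0 = (0, 1) := rfl
  have v1 : vec 1 = (1, 0) := rfl
  have v2 : vec 2 = (0, -1) := rfl
  have v3 : vec 3 = (-1, 0) := rfl
  rcases g.dir_cases with ⟨hr, hu | hu, hw | hw⟩ | ⟨hr, hu | hu, hw | hw⟩ <;> rw [hr] <;>
    simp only [Isom.point, hu, hw, v0, v1, v2, v3, Prod.fst_add, Prod.smul_fst, smul_eq_mul] <;>
    generalize (2 : ℤ) ^ n = r at * <;> omega

/-- The vertical translation by `s`. -/
def lift (s : ℤ) : Isom := turnTo (0, s) 1

theorem lift_point (s x y : ℤ) : (lift s).point (x, y) = (x, y + s) := by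
  rw [lift, turnTo_point]; ext <;> simp [add_comm]

theorem lift_dir (s : ℤ) (j : Dir) : (lift s).dir j = j := Isom.one_dir j
theorem lift_mark (s : ℤ) (m : Marking) : (lift s).mark m = m := rfl
theorem lift_tile (s : ℤ) (t : Tile) : (lift s).tile t = t := Isom.one_tile t
theorem lift_inv (s : ℤ) : (lift s)⁻¹ = lift (-s) := by
  rw [inv_eq_iff_mul_eq_one]
  refine isom_eq_of_point (g := lift s * lift (-s)) (lift_dir s 1) rfl (p := (0, 0)) ?_
  rw [Isom.mul_point, lift_point, lift_point, Isom.one_point]; simp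

theorem Sheared.marked {τ τ' : ℤ × ℤ → Tile} {σ : ℤ → ℤ} (h : Sheared τ τ' σ) (ht : IsTiling τ')
    {n : ℕ} {g : Isom} (hm : Marked τ' n g) : Marked τ n (lift (σ g.c.1) * g) := by
  have key : ∀ q : ℤ × ℤ, -(3 * 2 ^ n) ≤ q.1 → q.1 ≤ 3 * 2 ^ n → -2 ^ n ≤ q.2 → q.2 ≤ 2 ^ n →
      τ ((lift (σ g.c.1)).point (g.point q)) = τ' (g.point q) := by
    intro q h1 h2 h3 h4
    have hb := reach_bound g h1 h2 h3 h4
    obtain ⟨⟨x, y⟩, hxy⟩ : ∃ p, p = g.point q := ⟨_, rfl⟩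
    rw [← hxy] at hb ⊢
    rw [lift_point, h.eq, h.const ht hm hb.1 hb.2]
  have hr : (0 : ℤ) < 2 ^ n := by positivity
  have key' : ∀ d : Digit, ∀ x y : ℤ, -(3 * 2 ^ n) ≤ x → x ≤ 3 * 2 ^ n → -2 ^ n ≤ y → y ≤ 2 ^ n →
      τ ((lift (σ g.c.1)).point (g.point ((DominoTiles.sym d).point (x, y)))) =
        τ' (g.point ((DominoTiles.sym d).point (x, y))) := by
    intro d x y h1 h2 h3 h4
    rw [sym_point]
    generalize (2 : ℤ) ^ n = r at *
    refine key _ ?_ ?_ ?_ ?_ <;> dsimp only <;> split_ifs <;> omega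
  intro d
  obtain ⟨h1, h2, h3⟩ := hm d
  dsimp only at h1 h2 h3 ⊢
  simp only [Isom.comp_eq, Isom.mul_point, Isom.mul_tile, Isom.mul_dir, Isom.mul_mark, lift_dir,
    lift_mark, lift_tile] at h1 h2 h3 ⊢
  rw [key', key']
  · refine ⟨h1, h2, fun k hk hk' => ?_⟩
    rw [key', key', key', key']
    · exact h3 k hk hk'
    all_goals generalize (2 : ℤ) ^ n = r at *; omega
  all_goals generalize (2 : ℤ) ^ n = r at *; omega

theorem FramedSupertile.root {S : Code} {n : ℕ} {g : Isom} {C : Set (ℕ × Isom)}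
    (h : FramedSupertile S n g C) : (n, g) ∈ C := by
  cases h with
  | zero => exact rfl
  | succ => exact Set.mem_insert _ _

theorem childBase_c (i : Fin 4) : (childBase i).c = (-4, 2) ∨ (childBase i).c = (-4, -2) ∨
    (childBase i).c = (2, 0) ∨ (childBase i).c = (6, 0) := by revert i; decide

theorem childFrame_c (n : ℕ) (g : Isom) (i : Fin 4) (d : Digit) :
    (childFrame n g i d).c = g.point ((2 : ℤ) ^ n • (childBase i).c) := by
  have : ∀ d, (sym d).c = 0 := by decide
  change g.point (Isom.point _ (sym d).c) = _
  rw [this]; congr 1; simp [Isom.point]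

theorem child_reach (n : ℕ) (g : Isom) (i : Fin 4) (d : Digit) :
    g.c.1 - reach (n + 1) g ≤ (childFrame n g i d).c.1 ∧
    (childFrame n g i d).c.1 ≤ g.c.1 + reach (n + 1) g := by
  have hr : (0 : ℤ) < 2 ^ n := by positivity
  rw [childFrame_c]
  refine reach_bound g ?_ ?_ ?_ ?_ <;> rw [pow_succ] <;> generalize (2 : ℤ) ^ n = r at * <;>
    rcases childBase_c i with e | e | e | e <;> rw [e] <;> simp <;> omega

/-- The centres of the children lie within reach of the parent, so all frames of a marked supertile
are shifted by the same amount. -/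
theorem Sheared.framed {S : Code} {τ τ' : ℤ × ℤ → Tile} {σ : ℤ → ℤ} (h : Sheared τ τ' σ)
    (ht : IsTiling τ') {n : ℕ} {g : Isom} {C : Set (ℕ × Isom)} (hC : FramedSupertile S n g C)
    (hm : C ⊆ framing τ') :
    (∀ x ∈ C, σ x.2.c.1 = σ g.c.1) ∧ moveFrames (lift (σ g.c.1)) C ⊆ framing τ := by
  have h1 : ∀ x ∈ C, σ x.2.c.1 = σ g.c.1 := by
    induction hC with
    | zero g => rintro _ rfl; rfl
    | succ n g d C hd hC ih =>
      rintro x (rfl | hx)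
      · rfl
      · obtain ⟨i, hi⟩ := Set.mem_iUnion.1 hx
        rw [ih i (fun y hy => hm (.inr (Set.mem_iUnion.2 ⟨i, hy⟩))) x hi]
        have : Marked τ' (n + 1) g := hm (Set.mem_insert _ _)
        exact h.const ht this (child_reach n g i (d i)).1 (child_reach n g i (d i)).2
  refine ⟨h1, ?_⟩
  rintro _ ⟨⟨m, k⟩, hk, rfl⟩
  have := h.marked ht (hm hk : Marked τ' m k)
  rw [show σ k.c.1 = σ g.c.1 from h1 _ hk] at this
  exact this

end DominoTiles

namespace DominoTiles

/-! ### Renormalisation -/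

/-- The frame `g`, magnified by the factor two. -/
def scale (g : Isom) : Isom := ⟨2 • g.c, g.east, g.flip⟩

theorem scale_dir (g : Isom) (j : Dir) : (scale g).dir j = g.dir j := rfl
theorem scale_mark (g : Isom) (m : Marking) : (scale g).mark m = g.mark m := rfl
theorem scale_tile (g : Isom) (t : Tile) : (scale g).tile t = g.tile t := rfl
theorem scale_lin (g : Isom) (p : ℤ × ℤ) : (scale g).lin p = g.lin p := rfl

theorem scale_point (g : Isom) (p : ℤ × ℤ) : (scale g).point (2 • p) = 2 • g.point p := by
  have := Isom.lin_smul g 2 p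
  rw [Isom.point_eq, Isom.point_eq, scale_lin, smul_add, scale]
  congr 1

theorem scale_mul (g h : Isom) : scale (g * h) = scale g * scale h := by
  refine Isom.ext ?_ rfl rfl
  exact (scale_point g h.c).symm

theorem scale_sym (d : Digit) : scale (sym d) = sym d := by revert d; decide

/-- The frame of the `i`-th child in its orientation `0`, relatively to the parent. -/
def childAt (n : ℕ) (i : Fin 4) : Isom :=
  ⟨(2 ^ n : ℤ) • (childBase i).c, (childBase i).east, (childBase i).flip⟩

theorem childFrame_eq (n : ℕ) (g : Isom) (i : Fin 4) (d : Digit) :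
    childFrame n g i d = g * (childAt n i * sym d) := rfl

theorem scale_childFrame (n : ℕ) (g : Isom) (i : Fin 4) (d : Digit) :
    scale (childFrame n g i d) = childFrame (n + 1) (scale g) i d := by
  rw [childFrame_eq, childFrame_eq, scale_mul, scale_mul, scale_sym]
  congr 2
  refine Isom.ext ?_ rfl rfl
  simp only [scale, childAt, pow_succ]
  ext <;> simp <;> ring

/-- The two points half way between the middle and the ends of a domino. -/
def ends (g : Isom) : Set (ℤ × ℤ) := {p | ∃ d, p = (g * sym d).point (-2, 0)}

/-- Diagonal neighbours. -/
def Diag (p q : ℤ × ℤ) : Prop :=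
  (p.1 = q.1 + 1 ∨ p.1 = q.1 - 1) ∧ (p.2 = q.2 + 1 ∨ p.2 = q.2 - 1)

theorem diag_point (g : Isom) (p q : ℤ × ℤ) : Diag (g.point p) (g.point q) ↔ Diag p q := by
  unfold Diag Isom.point
  rcases g.vec_cases with ⟨hu, hw | hw⟩ | ⟨hu, hw | hw⟩ | ⟨hu, hw | hw⟩ | ⟨hu, hw | hw⟩ <;>
    simp only [hu, hw, Prod.fst_add, Prod.snd_add, Prod.smul_fst, Prod.smul_snd, smul_eq_mul] <;>
    omega

theorem corners_mul_sym (g : Isom) (d : Digit) : corners (g * sym d) = corners g := by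
  have key : ∀ (g : Isom) (d : Digit), corners (g * sym d) ⊆ corners g := by
    rintro g d p ⟨e, he⟩
    rw [mul_assoc, sym_mul_sym] at he
    exact ⟨_, he⟩
  refine (key g d).antisymm ?_
  have := key (g * sym d) d
  rwa [mul_assoc, sym_mul_sym, nim_self, show sym 0 = 1 from rfl, mul_one] at this

theorem mem_corners_of_diag {g : Isom} {p q : ℤ × ℤ} (hp : p ∈ ends g) (h : Diag p q) :
    q ∈ corners g := by
  obtain ⟨d, rfl⟩ := hp
  rw [← corners_mul_sym g d, mem_corners]
  generalize g * sym d = G at *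
  obtain ⟨⟨x, y⟩, rfl⟩ : ∃ r, G.point r = q := ⟨G⁻¹.point q, by simp⟩
  rw [diag_point] at h
  refine ⟨x, y, ?_, ?_, rfl⟩ <;> simp only [Diag] at h <;> omega

/-- The tiling half as fine that the even sites of an aligned tiling form. -/
noncomputable def renorm (τ : ℤ × ℤ → Tile) (p : ℤ × ℤ) : Tile :=
  open Classical in ⟨decide (∃ g, Marked τ 0 g ∧ 2 • p ∈ ends g), (τ (2 • p)).edge⟩

theorem k_renorm {τ : ℤ × ℤ → Tile} {p : ℤ × ℤ} :
    K (renorm τ) p ↔ ∃ g, Marked τ 0 g ∧ 2 • p ∈ ends g := by simp [K, renorm]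

theorem dir_add_two_two : ∀ j : Dir, j + 2 + 2 = j := by decide

theorem pass_of_in {t : Tile} (ht : t.cls ∈ masterTiles) {j : Dir}
    (h1 : (t.edge (j + 1)).a = -1) (h3 : (t.edge (j + 3)).a = -1) :
    t.edge j = opp (t.edge (j + 2)) := by
  obtain ⟨k, hk⟩ := crossing_of_in ht h1
  have key : ∀ k j : Dir, k = j ∨ k = j + 1 ∨ k = j + 2 ∨ k = j + 3 := by decide
  have := hk.out
  rcases key k j with rfl | rfl | rfl | rfl
  · rw [hk.pass, opp_opp]
  · exact absurd (h1.symm.trans this) neg_one_ne_one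
  · have := hk.pass
    rwa [dir_add_two_two] at this
  · exact absurd (h3.symm.trans this) neg_one_ne_one

/-- `j` is the direction of an arm that leaves an even site. -/
theorem Aligned.edge_mid {τ : ℤ × ℤ → Tile} (h : τ ∈ Tilings masterTiles) (hA : Aligned τ)
    (p : ℤ × ℤ) (j : Dir) : (τ (2 • p + vec j)).edge j = (τ (2 • p)).edge j := by
  obtain ⟨x, y⟩ := p
  -- The two lateral neighbours of the square half way between two even sites have odd coordinates.
  -- They are cornered tiles and send arms into it, so the arm from the even site can only be the
  -- straight one.
  have side : ∀ k : Dir, k = j + 1 ∨ k = j + 3 → ((τ (2 • (x, y) + vec j)).edge k).a = -1 := by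
    intro k hk
    have hk4 : K τ (2 • (x, y) + vec j + vec k) := by
      have : ∀ j k : Dir, k = j + 1 ∨ k = j + 3 →
          ((vec j).1 + (vec k).1) % 2 = 1 ∧ ((vec j).2 + (vec k).2) % 2 = 1 := by decide
      have := this j k hk
      refine (hA _ _).2 ?_
      simp only [nsmul_eq_mul, Nat.cast_ofNat, Prod.fst_add, Prod.fst_mul, Prod.fst_ofNat,
        Prod.snd_add, Prod.snd_mul, Prod.snd_ofNat]
      omega
    have h2 : k + 2 + 2 = k := by clear hk hk4; decide +revert
    refine (h.1.in_iff (2 • (x, y) + vec j + vec k) (k + 2) ?_ h2.symm).2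
      ((outward_of_k subset_rfl h hk4).a (k + 2))
    have : ∀ k : Dir, vec k + vec (k + 2) = 0 := by decide
    rw [add_assoc, this, add_zero]
  rw [pass_of_in (h.2 _) (side _ (.inl rfl)) (side _ (.inr rfl)),
    h.1.fit (2 • (x, y)) j rfl rfl, opp_opp]

theorem Aligned.even_cornered {τ : ℤ × ℤ → Tile} (hA : Aligned τ) (p : ℤ × ℤ) :
    (τ (2 • p)).cornered = false := by
  rw [← Bool.not_eq_true]
  intro hk
  have := (hA _ _).1 hk
  simp at this

/-- The conditions on the tile at an end of a domino, in the frame where it is the left end. -/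
def EndRule (t : Tile) : Prop :=
  ((t.edge 0).b ≠ 0 → (t.edge 0).b = 1 ∧ IsKey (t.edge 0).c (t.edge 0).d) ∧
  ((t.edge 2).b ≠ 0 → (t.edge 2).b = -1 ∧ IsKey (t.edge 2).c (t.edge 2).d) ∧
  ((t.edge 3).b ≠ 0 → (t.edge 3).c = 3 ∧ ((t.edge 3).d = 0 ∨ (t.edge 3).d = 2))

instance (t : Tile) : Decidable (EndRule t) := by unfold EndRule; infer_instance

theorem Quarter.k {τ : ℤ × ℤ → Tile} {d : Digit} (hq : Quarter τ d) : K τ (-3, 1) ∧ K τ (-1, 1) :=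
  ⟨by rw [K, hq.1]; rfl, by rw [K, hq.2]; rfl⟩

/-- The `1`-arm and the `2`-arm of the quarter meet above the end of the domino, offset to the
inside, so the end must send an arm outwards there. The crossing tile at the meeting displays both
the digit of the quarter and this arm. -/
theorem Quarter.north {τ : ℤ × ℤ → Tile} (h : τ ∈ Tilings masterTiles) {d : Digit}
    (hq : Quarter τ d) : Crossing (τ (-2, 1)) 0 ∧ ((τ (-2, 0)).edge 0).a = 1 ∧
      τ (-2, 1) = crossTile (h1 d) ((τ (-2, 0)).edge 0, opp ((τ (-2, 0)).edge 0)) := by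
  have e1 : (τ (-3, 1)).edge 1 = ⟨1, 1, 1, d⟩ := by rw [hq.1]; rfl
  have e2 : (τ (-1, 1)).edge 3 = ⟨1, -1, 2, d⟩ := by rw [hq.2]; rfl
  have c : Crossing (τ (-2, 1)) 0 := mid_away h e1 (r := (-1, 1)) (j' := 3) (by rw [e2])
  have f2 : (τ (-2, 1)).edge 2 = opp ((τ (-2, 0)).edge 0) := h.1.fit (-2, 0) 0
  refine ⟨c, (h.1.out_iff (-2, 1) 2).2 (c.a_in (by decide)), ?_⟩
  exact tile_ext4 c.uncornered (c.pass_eq f2 (hm' := opp_opp _)) (h.1.edge_fit e2) f2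
    (h.1.edge_fit e1)

theorem Quarter.north_rule {τ : ℤ × ℤ → Tile} (h : τ ∈ Tilings masterTiles) {d : Digit}
    (hq : Quarter τ d) (hb : ((τ (-2, 0)).edge 0).b ≠ 0) :
    ((τ (-2, 0)).edge 0).b = 1 ∧ IsKey ((τ (-2, 0)).edge 0).c ((τ (-2, 0)).edge 0).d := by
  obtain ⟨c, -, e⟩ := hq.north h
  have := c.key2 1 (by decide) (by rw [e]; exact one_ne) (by rw [e]; rfl) (by rw [e]; exact hb)
  rw [e] at this
  exact this

/-- Both long sides are crossed outwards next to the end, which is therefore an outward tile. Its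
signed arms obey the rules for crossing a meeting of a `1`-arm and a `2`-arm (north and south) or of
two `0`-arms (west). -/
theorem Quarter.end {τ : ℤ × ℤ → Tile} (h : τ ∈ Tilings masterTiles) {d : Digit}
    (hq : Quarter τ d) : Outward (τ (-2, 0)) ∧ EndRule (τ (-2, 0)) := by
  have hq2 := hq.sym h 2
  have h2 := act_mem_tilings h (DominoTiles.sym 2)
  have hp : ∀ x y, act (DominoTiles.sym 2) τ (x, y) = (DominoTiles.sym 2).tile (τ (x, -y)) := by
    intro x y
    rw [← act_point, sym_point]; simp
  have a0 := (hq.north h).2.1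
  have e2 : (act (DominoTiles.sym 2) τ (-2, 0)).edge 0 = ((τ (-2, 0)).edge 2).reflect := by
    rw [hp]; rfl
  have a2 : ((τ (-2, 0)).edge 2).a = 1 := by
    have := (hq2.north h2).2.1
    rwa [e2] at this
  have e3 : (τ (-3, 1)).edge 2 = ⟨1, -1, 0, d⟩ := by rw [hq.1]; rfl
  have k3 : K τ (-3, -1) := by
    have := hq2.k.1
    rwa [K, hp] at this
  have c3 : Crossing (τ (-3, 0)) 3 := mid_away h e3 (r := (-3, -1)) (j' := 0)
    ((outward_of_k subset_rfl h k3).a 0)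
  refine ⟨outward_of (h.2 _) (i := 0) (j := 2) (by decide) a0 a2, hq.north_rule h, ?_, ?_⟩
  · intro hb
    have := hq2.north_rule h2
    rw [e2] at this
    obtain ⟨h1, h2⟩ := this (by simpa [Marking.reflect] using hb)
    exact ⟨neg_eq_iff_eq_neg.1 h1, h2⟩
  · intro hb
    have f1 : (τ (-3, 0)).edge 1 = opp ((τ (-2, 0)).edge 3) := h.1.fit (-2, 0) 3
    have f3 : (τ (-3, 0)).edge 3 = (τ (-2, 0)).edge 3 := c3.pass_eq f1 (hm' := opp_opp _)
    have f0 : (τ (-3, 0)).edge (3 + side 1) = ⟨-1, 1, 0, d⟩ := h.1.edge_fit e3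
    have := c3.key0 1 (by decide) (by rw [f0]; exact one_ne) (by rw [f0]) (by rwa [f3])
    rwa [f3] at this

theorem marked_quarter {τ : ℤ × ℤ → Tile} {g : Isom} (h : Marked τ 0 g) (d : Digit) :
    Quarter (act (g * sym d)⁻¹ τ) d := marked_zero_iff.1 h d

theorem outward_of_end {τ : ℤ × ℤ → Tile} (h : τ ∈ Tilings masterTiles) {g : Isom}
    (hg : Marked τ 0 g) {p : ℤ × ℤ} (hp : p ∈ ends g) : Outward (τ p) := by
  obtain ⟨d, rfl⟩ := hp
  have := ((marked_quarter hg d).end (act_mem_tilings h _)).1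
  rw [act_inv_point] at this
  have := this.tile (g * sym d)
  rwa [Isom.tile_inv_tile] at this

theorem Outward.cls_mem {t : Tile} (h : Outward t) (k : Bool) :
    (⟨k, t.edge⟩ : Tile).cls ∈ outwardTiles := by
  obtain ⟨g, k', d, rfl | rfl⟩ := h.eq
  · exact ⟨k, d, .inl (Isom.tile_cls g (outerCorner k d))⟩
  · exact ⟨k, d, .inr (Isom.tile_cls g (innerCorner k d))⟩

theorem two_smul_diag {x y : ℤ} {p : ℤ × ℤ} : p ∈ block x y ↔ Diag (2 • p) (2 * x + 1, 2 * y + 1) := by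
  obtain ⟨a, b⟩ := p
  simp only [block, Diag, Set.mem_ofPred_eq, Prod.smul_mk, nsmul_eq_mul, Nat.cast_ofNat]
  omega

/-- Arms between even sites pass the squares in between unchanged, so markings fit. A block of even
sites surrounds a cornered tile, which is a corner of a unique domino, and exactly one end of this
domino is in the block. The ends are outward tiles, for which the flag may be changed within `T`;
all other even sites keep their tile. -/
theorem renorm_mem {T : Set TileClass} (hT : T ⊆ masterTiles) (hO : outwardTiles ⊆ T)
    {τ : ℤ × ℤ → Tile} (h : τ ∈ Tilings T) (hA : Aligned τ) : renorm τ ∈ Tilings T := by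
  have hM : τ ∈ Tilings masterTiles := ⟨h.1, fun p => hT (h.2 p)⟩
  have fits : ∀ j : Dir, ∀ p, (renorm τ (p + vec j)).edge (j + 2) = opp ((renorm τ p).edge j) := by
    intro j p
    change (τ (2 • (p + vec j))).edge (j + 2) = opp ((τ (2 • p)).edge j)
    rw [← hA.edge_mid hM p j]
    exact h.1.fit (2 • p + vec j) j (by rw [add_assoc, ← two_nsmul, ← nsmul_add]) rfl
  refine ⟨isTiling_of_fits (fits 0) (fits 1) fun x y => ?_, fun p => ?_⟩
  · have hq : K τ (2 * x + 1, 2 * y + 1) := (hA _ _).2 (by omega)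
    obtain ⟨g, d, hg, hd⟩ := exists_marked hM hq
    have hqg : ((2 * x + 1, 2 * y + 1) : ℤ × ℤ) ∈ corners g := ⟨d, hd⟩
    have hdiag : Diag ((g * sym d).point (-2, 0)) (2 * x + 1, 2 * y + 1) := by
      rcases hd with hd | hd <;> rw [hd, diag_point] <;> simp [Diag]
    obtain ⟨p, hp⟩ : ∃ p, (g * sym d).point (-2, 0) = 2 • p := by
      generalize (g * sym d).point (-2, 0) = r at hdiag
      obtain ⟨a, b⟩ := r
      refine ⟨(a / 2, b / 2), ?_⟩
      simp only [Diag] at hdiag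
      ext <;> simp <;> omega
    rw [hp] at hdiag
    refine ⟨p, ⟨two_smul_diag.2 hdiag, k_renorm.2 ⟨g, hg, d, hp.symm⟩⟩, ?_⟩
    rintro p' ⟨hb, hk⟩
    obtain ⟨g', hg', hp'⟩ := k_renorm.1 hk
    have hdiag' := two_smul_diag.1 hb
    obtain rfl := frame_unique hg hg' hqg (mem_corners_of_diag hp' hdiag')
    have hinj : ∀ a b : ℤ × ℤ, 2 • a = 2 • b → a = b := by
      rintro ⟨a, b⟩ ⟨a', b'⟩ e
      simp only [Prod.smul_mk, Prod.mk.injEq, nsmul_eq_mul] at e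
      ext <;> simp at e ⊢ <;> omega
    apply hinj
    rw [← hp]
    obtain ⟨d', hd'⟩ := hp'
    have e2 : ∃ x y : ℤ, (x = -2 ∨ x = 2) ∧ y = 0 ∧ (g * sym d').point (-2, 0) =
        (g * sym d).point (x, y) := by
      refine ⟨((sym (nim d d')).point (-2, 0)).1, ((sym (nim d d')).point (-2, 0)).2, ?_, ?_, ?_⟩
      · rw [sym_point]; dsimp only; split_ifs <;> omega
      · rw [sym_point]; simp
      · rw [Prod.mk.eta, ← Isom.mul_point, mul_assoc, sym_mul_sym, nim_nim_cancel]
    obtain ⟨x', y', hx', rfl, e2⟩ := e2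
    rw [hd', e2] at hdiag' ⊢
    -- The two ends of a domino are at distance four, so they cannot both be diagonal neighbours of
    -- the same corner.
    rcases hx' with rfl | rfl
    · rfl
    · exfalso
      rcases hd with hd | hd <;> rw [hd, diag_point] at hdiag' <;> simp [Diag] at hdiag'
  · by_cases hk : ∃ g, Marked τ 0 g ∧ 2 • p ∈ ends g
    · obtain ⟨g, hg, hp⟩ := hk
      exact hO ((outward_of_end hM hg hp).cls_mem _)
    · have : renorm τ p = τ (2 • p) := by
        ext1
        · rw [hA.even_cornered]; simpa [renorm] using hk
        · rfl
      rw [this]; exact h.2 _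

theorem renorm_edge {τ : ℤ × ℤ → Tile} (h : τ ∈ Tilings masterTiles) (hA : Aligned τ) {p q : ℤ × ℤ}
    {j : Dir} {m : Marking} (hm : (renorm τ p).edge j = m) (hq : q = 2 • p ∨ q = 2 • p + vec j) :
    (τ q).edge j = m := by
  rcases hq with rfl | rfl
  · exact hm
  · rw [hA.edge_mid h]; exact hm

theorem Aligned.eq_of_renorm {τ : ℤ × ℤ → Tile} (hA : Aligned τ) {p : ℤ × ℤ} {t : Tile}
    (ht : renorm τ p = t) : τ (2 • p) = ⟨false, t.edge⟩ := by
  subst ht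
  ext1
  · exact hA.even_cornered p
  · rfl

/-- Each step of an arm between even sites becomes two steps of the same arm, the second one
starting half way. An even `k` below belongs to an even site, an odd `k` to a square in between. -/
theorem marked_of_renorm {τ : ℤ × ℤ → Tile} (h : τ ∈ Tilings masterTiles) (hA : Aligned τ) {n : ℕ}
    {g : Isom} (hm : Marked (renorm τ) n g) : Marked τ (n + 1) (scale g) := by
  intro d
  obtain ⟨h1, h2, h3⟩ := hm d
  have hs : (scale g).comp (sym d) = scale (g.comp (sym d)) := by
    rw [Isom.comp_eq, Isom.comp_eq, scale_mul, scale_sym]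
  dsimp only at h1 h2 h3 ⊢
  rw [hs]
  generalize g.comp (sym d) = G at *
  simp only [scale_tile, scale_dir, scale_mark]
  rw [pow_succ]
  generalize (2 : ℤ) ^ n = r at *
  have pt : ∀ x y x' y' : ℤ, x' = 2 * x → y' = 2 * y →
      (scale G).point (x', y') = 2 • G.point (x, y) := by
    rintro x y _ _ rfl rfl
    rw [← scale_point]; congr 1
  have ptv : ∀ x y x' y' : ℤ, ∀ j : Dir, (x', y') = (2 * x + (vec j).1, 2 * y + (vec j).2) →
      (scale G).point (x', y') = 2 • G.point (x, y) + vec (G.dir j) := by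
    intro x y _ _ j e
    rw [e, ← pt x y _ _ rfl rfl, ← scale_dir, ← Isom.point_add_vec]; rfl
  refine ⟨?_, ?_, fun k hk hk' => ?_⟩
  · rw [pt (-3 * r) r _ _ (by ring) (by ring), hA.eq_of_renorm h1]; rfl
  · rw [pt (-r) r _ _ (by ring) (by ring), hA.eq_of_renorm h2]; rfl
  · obtain ⟨a1, a2, a3, a4⟩ := h3 (k / 2) (by omega) (by omega)
    refine ⟨renorm_edge h hA a1 ?_, renorm_edge h hA a2 ?_, renorm_edge h hA a3 ?_,
      renorm_edge h hA a4 ?_⟩ <;> rcases Int.even_or_odd' k with ⟨l, rfl | rfl⟩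
    · left; apply pt <;> omega
    · right; apply ptv; ext <;> simp [vec] <;> omega
    · left; apply pt <;> omega
    · right; apply ptv; ext <;> simp [vec] <;> omega
    · left; apply pt <;> omega
    · right; apply ptv; ext <;> simp [vec] <;> omega
    · left; apply pt <;> omega
    · right; apply ptv; ext <;> simp [vec] <;> omega

end DominoTiles

namespace DominoTiles

/-! ### The children of a marked frame of level `1` -/

/-- The key tile that belongs to the atomic symbol with the child `i` and the digit `d`. -/
def keyTile (i : Fin 4) (d : Digit) : TileClass :=
  (![cross (h1 (nim d 2)) (v 0 0), cross (h1 (nim d 3)) (v 0 2), cross (h1 (nim d 1)) (v 3 1),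
    cross (h1 (nim d 2)) (v 1 1)] : Fin 4 → TileClass) i

/-- Here the digits fix the positions of the children. Of the eight ways in which an outer corner
could stand at an end of a domino, `EndRule` admits only those where the domino extends along the
`1`-arm for the digits `0` and `2`, and along the `0`-arm for `1` and `3`. -/
theorem end_outer_aux : ∀ (e : Dir) (f : Bool) (d : Digit),
    EndRule ((⟨0, e, f⟩ : Isom).tile (outerCorner false d)) →
    ((d = 0 ∨ d = 2) → (⟨0, e, f⟩ : Isom).dir 1 = 1) ∧
    ((d = 1 ∨ d = 3) → (⟨0, e, f⟩ : Isom).dir 2 = 1) := by decide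

/-- For the digits `1` and `3` the domino extends along the plain arm into the frame, so it is
vertical. The digits `0` and `2` are not needed, as these corners lie at the second ends of the
horizontal children. -/
theorem end_inner_aux : ∀ (e : Dir) (f : Bool) (d : Digit),
    EndRule ((⟨0, e, f⟩ : Isom).tile (innerCorner false d)) →
    (d = 1 ∨ d = 3) → (⟨0, e, f⟩ : Isom).dir 2 = 1 := by decide

theorem eq_mul_sym_aux : ∀ (e e' : Dir) (f f' : Bool),
    ((⟨0, e, f⟩ : Isom).dir 1 = (⟨0, e', f'⟩ : Isom).dir 1 ∨
      (⟨0, e, f⟩ : Isom).dir 1 = (⟨0, e', f'⟩ : Isom).dir 1 + 2) →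
    ∃ d, (⟨0, e, f⟩ : Isom) = ⟨0, e', f'⟩ * sym d := by decide

theorem eq_mul_sym {g g' : Isom} (hc : g.c = g'.c)
    (hd : g.dir 1 = g'.dir 1 ∨ g.dir 1 = g'.dir 1 + 2) : ∃ d, g = g' * sym d := by
  obtain ⟨d, hd⟩ := eq_mul_sym_aux g.east g'.east g.flip g'.flip hd
  have h1 : g.east = (g' * sym d).east := by
    have := congrArg Isom.east hd
    exact this
  have h2 : g.flip = (g' * sym d).flip := by
    have := congrArg Isom.flip hd
    exact this
  refine ⟨d, Isom.ext ?_ h1 h2⟩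
  have : ∀ d, (sym d).c = 0 := by decide
  change g.c = g'.point (sym d).c
  rw [this, hc]; simp [Isom.point]

/-- The frame whose arm in the direction `j` at the point `p` leads to the centre. -/
theorem centre_of_end {g k : Isom} {p : ℤ × ℤ} {j : Dir} (hp : g.point (-2, 0) = k.point p)
    (hj : (g⁻¹ * k).dir j = 1) : g.c = k.point (p + vec j + vec j) ∧ g.dir 1 = k.dir j := by
  have h1 : g.dir 1 = k.dir j := by rw [← hj, Isom.mul_dir, Isom.dir_inv_dir]
  refine ⟨?_, h1⟩
  rw [Isom.point_add_vec, Isom.point_add_vec, ← hp, ← h1, ← Isom.point_add_vec,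
    ← Isom.point_add_vec]
  simp [Isom.point, vec]

theorem mem_end {τ : ℤ × ℤ → Tile} (h : τ ∈ Tilings masterTiles) {g : Isom} (hg : Marked τ 0 g)
    {d : Digit} {k : Isom} {p : ℤ × ℤ} (hp : k.point p = (g * sym d).point (-2, 0)) {t : Tile}
    (ht : τ (k.point p) = k.tile t) : EndRule (((g * sym d)⁻¹ * k).tile t) := by
  have := ((marked_quarter hg d).end (act_mem_tilings h _)).2
  rwa [act_inv_point, ← hp, ht, ← Isom.mul_tile] at this

theorem key_of_child {τ : ℤ × ℤ → Tile} (h : τ ∈ Tilings masterTiles) {g : Isom}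
    (hg : Marked τ 0 g) (e : Digit) : (τ ((g * sym e).point (-2, 1))).cls =
      cross (h1 e) ((g * sym e).mark ((τ ((g * sym e).point (-2, 0))).edge ((g * sym e).dir 0)),
        opp ((g * sym e).mark ((τ ((g * sym e).point (-2, 0))).edge ((g * sym e).dir 0)))) := by
  have hn := ((marked_quarter hg e).north (act_mem_tilings h _)).2.2
  have he : (act (g * sym e)⁻¹ τ (-2, 0)).edge 0 =
      (g * sym e).mark ((τ ((g * sym e).point (-2, 0))).edge ((g * sym e).dir 0)) := by
    have := act_edge (g * sym e)⁻¹ τ ((g * sym e).point (-2, 0)) ((g * sym e).dir 0)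
    rw [Isom.inv_point_point, Isom.inv_dir_dir] at this
    exact this
  rw [he, act_inv_eq_iff] at hn
  rw [hn, Isom.tile_cls, cross_eq]

/-- A frame of level `1` is marked, and its eight corners are ends of marked frames of level `0`. -/
structure Parent (τ : ℤ × ℤ → Tile) : Prop where
  mem : τ ∈ Tilings masterTiles
  outer : ∀ e, τ ((sym e).point (-6, 2)) = (sym e).tile (outerCorner false e)
  inner : ∀ e, τ ((sym e).point (-2, 2)) = (sym e).tile (innerCorner false e)
  outer_end : ∀ e, ∃ g, Marked τ 0 g ∧ (sym e).point (-6, 2) ∈ ends g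
  inner_end : ∀ e, ∃ g, Marked τ 0 g ∧ (sym e).point (-2, 2) ∈ ends g

theorem Parent.child_aux {τ : ℤ × ℤ → Tile} {g : Isom} (hm : Marked τ 0 g) {d : Digit} {i : Fin 4}
    {k : Isom} {p : ℤ × ℤ} {j : Dir} (hp : k.point p = (g * sym d).point (-2, 0))
    (hj : ((g * sym d)⁻¹ * k).dir j = 1) (hc : k.point (p + vec j + vec j) = (childAt 0 i).c)
    (hi : k.dir j = (childAt 0 i).dir 1 ∨ k.dir j = (childAt 0 i).dir 1 + 2) :
    ∃ d, Marked τ 0 (childAt 0 i * sym d) := by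
  obtain ⟨c1, c2⟩ := centre_of_end hp.symm hj
  obtain ⟨d', hd'⟩ := eq_mul_sym (g := g * sym d) (g' := childAt 0 i) (c1.trans hc) (by rwa [c2])
  refine ⟨nim d' d, ?_⟩
  have : g = childAt 0 i * sym (nim d' d) := by
    rw [← sym_mul_sym, ← mul_assoc, ← hd', mul_assoc, sym_mul_sym, nim_self,
      show sym 0 = 1 from rfl, mul_one]
  rwa [← this]

/-- Each child is found from the parent's corner at one of its ends: the outer corners `0`, `2` and
`1` for `s`, `t` and `v`, and the inner corner `1` for `u`. The end rule gives the direction to the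
centre, and a frame with the right centre and axis differs from `childAt` by a symmetry of the
domino. -/
theorem Parent.child {τ : ℤ × ℤ → Tile} (h : Parent τ) (i : Fin 4) :
    ∃ d, Marked τ 0 (childAt 0 i * sym d) := by
  have hi : ∀ i : Fin 4, i = 0 ∨ i = 1 ∨ i = 2 ∨ i = 3 := by decide
  rcases hi i with rfl | rfl | rfl | rfl
  · obtain ⟨g, hg, d, hd⟩ := h.outer_end 0
    exact child_aux hg hd ((end_outer_aux _ _ 0 (mem_end h.mem hg hd (h.outer 0))).1 (by decide))
      (by decide) (by decide)
  · obtain ⟨g, hg, d, hd⟩ := h.outer_end 2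
    exact child_aux hg hd ((end_outer_aux _ _ 2 (mem_end h.mem hg hd (h.outer 2))).1 (by decide))
      (by decide) (by decide)
  · obtain ⟨g, hg, d, hd⟩ := h.inner_end 1
    exact child_aux hg hd (end_inner_aux _ _ 1 (mem_end h.mem hg hd (h.inner 1)) (by decide))
      (by decide) (by decide)
  · obtain ⟨g, hg, d, hd⟩ := h.outer_end 1
    exact child_aux hg hd ((end_outer_aux _ _ 1 (mem_end h.mem hg hd (h.outer 1))).2 (by decide))
      (by decide) (by decide)

theorem Parent.key_aux {τ : ℤ × ℤ → Tile} (h : Parent τ) {i : Fin 4} {d f : Digit}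
    (hm : Marked τ 0 (childAt 0 i * sym d)) {q : ℤ × ℤ} {t : Tile}
    (hq : (childAt 0 i * sym f).point (-2, 0) = q) (ht : τ q = t) :
    ∃ p, (τ p).cls = cross (h1 (nim d f))
      ((childAt 0 i * sym f).mark (t.edge ((childAt 0 i * sym f).dir 0)),
        opp ((childAt 0 i * sym f).mark (t.edge ((childAt 0 i * sym f).dir 0)))) := by
  have := key_of_child h.mem hm (nim d f)
  rw [mul_assoc, sym_mul_sym, nim_nim_cancel, hq, ht] at this
  exact ⟨_, this⟩

/-- The crossing tile beside an end of the child shows the digit of a quarter of the child together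
with an arm of the parent's corner, hence the orientation of the child relative to the parent. The
`f` below select an end and a side where this arm is signed. -/
theorem Parent.key {τ : ℤ × ℤ → Tile} (h : Parent τ) {i : Fin 4} {d : Digit}
    (hm : Marked τ 0 (childAt 0 i * sym d)) : ∃ p, (τ p).cls = keyTile i d := by
  have hi : ∀ i : Fin 4, i = 0 ∨ i = 1 ∨ i = 2 ∨ i = 3 := by decide
  rcases hi i with rfl | rfl | rfl | rfl
  · exact h.key_aux hm (f := 2) (by decide) (h.outer 0)
  · exact h.key_aux hm (f := 3) (by decide) (h.outer 2)
  · exact h.key_aux hm (f := 1) (by decide) (h.inner 1)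
  · exact h.key_aux hm (f := 2) (by decide) (h.outer 1)

theorem mem_ends_act {a g : Isom} {p : ℤ × ℤ} : a⁻¹.point p ∈ ends (a⁻¹ * g) ↔ p ∈ ends g := by
  simp only [ends, Set.mem_ofPred_eq, mul_assoc, Isom.mul_point, (Isom.point_injective _).eq_iff]

theorem two_smul_pair (x y : ℤ) : (2 • ((x, y) : ℤ × ℤ)) = (2 * x, 2 * y) := by
  ext <;> simp

theorem parent_of_renorm {τ : ℤ × ℤ → Tile} (h : τ ∈ Tilings masterTiles) (hA : Aligned τ) {g : Isom}
    (hm : Marked (renorm τ) 0 g) : Parent (act (scale g)⁻¹ τ) := by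
  have hc : ∀ d p t, renorm τ ((g * sym d).point p) = (g * sym d).tile t → t.cornered = true →
      act (scale g)⁻¹ τ ((sym d).point (2 • p)) = (sym d).tile ⟨false, t.edge⟩ ∧
      ∃ k, Marked (act (scale g)⁻¹ τ) 0 k ∧ (sym d).point (2 • p) ∈ ends k := by
    intro d p t ht hk
    have e : 2 • (g * sym d).point p = (scale g).point ((sym d).point (2 • p)) := by
      rw [← Isom.mul_point, ← scale_sym d, ← scale_mul, scale_point, scale_sym]
    constructor
    · rw [act_inv_eq_iff, ← e, hA.eq_of_renorm ht, scale_tile, ← Isom.mul_tile]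
      rfl
    · obtain ⟨k, hk, hk'⟩ := k_renorm.1 (show K (renorm τ) ((g * sym d).point p) by rw [K, ht]; exact hk)
      refine ⟨(scale g)⁻¹ * k, hk.act _, ?_⟩
      rw [e] at hk'
      have := mem_ends_act (a := scale g) |>.2 hk'
      rwa [Isom.inv_point_point] at this
  have h1 := fun d => hc d _ _ (marked_corner hm d).1 rfl
  have h2 := fun d => hc d _ _ (marked_corner hm d).2 rfl
  simp only [two_smul_pair] at h1 h2
  exact ⟨act_mem_tilings h _, fun e => (h1 e).1, fun e => (h2 e).1, fun e => (h1 e).2, fun e => (h2 e).2⟩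

theorem exists_child {τ : ℤ × ℤ → Tile} (h : τ ∈ Tilings masterTiles) (hA : Aligned τ) {g : Isom}
    (hm : Marked (renorm τ) 0 g) (i : Fin 4) :
    ∃ d, Marked τ 0 (childFrame 0 (scale g) i d) ∧ ∃ p, (τ p).cls = keyTile i d := by
  have hP := parent_of_renorm h hA hm
  obtain ⟨d, hd⟩ := hP.child i
  obtain ⟨p, hp⟩ := hP.key hd
  refine ⟨d, ?_, (scale g).point p, ?_⟩
  · rwa [marked_act_iff, inv_inv, ← childFrame_eq] at hd
  · rwa [act_inv_point, Isom.tile_cls] at hp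

theorem childFrame_injective {n : ℕ} {g : Isom} {i : Fin 4} :
    Function.Injective (childFrame n g i) := by
  intro d d' h
  rw [childFrame_eq, childFrame_eq] at h
  have := mul_left_cancel (mul_left_cancel h)
  clear h; revert this; revert d d'; decide

theorem child_unique {τ : ℤ × ℤ → Tile} {n : ℕ} {g : Isom} {i : Fin 4} {d d' : Digit}
    (h : Marked τ 0 (childFrame n g i d)) (h' : Marked τ 0 (childFrame n g i d')) : d = d' := by
  apply childFrame_injective (n := n) (g := g) (i := i)
  rw [childFrame_eq, ← mul_assoc] at h h' ⊢
  rw [childFrame_eq, ← mul_assoc]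
  refine frame_unique h h' (p := (g * childAt n i).point (-3, 1)) ?_ ?_ <;>
    rw [corners_mul_sym, mem_corners] <;> exact ⟨_, _, by simp, by simp, rfl⟩

/-! ### Expanding sets of frames -/

/-- The frames of the renormalised tiling, magnified, and their marked children of level `0`. -/
def expand (τ : ℤ × ℤ → Tile) (C : Set (ℕ × Isom)) : Set (ℕ × Isom) :=
  {x | ∃ y ∈ C, x = (y.1 + 1, scale y.2) ∨
    (y.1 = 0 ∧ ∃ i d, x = (0, childFrame 0 (scale y.2) i d) ∧ Marked τ 0 x.2)}

theorem expand_mono (τ : ℤ × ℤ → Tile) {C C' : Set (ℕ × Isom)} (h : C ⊆ C') :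
    expand τ C ⊆ expand τ C' := fun _ ⟨y, hy, hx⟩ => ⟨y, h hy, hx⟩

theorem expand_subset {τ : ℤ × ℤ → Tile} (h : τ ∈ Tilings masterTiles) (hA : Aligned τ)
    {C : Set (ℕ × Isom)} (hC : C ⊆ framing (renorm τ)) : expand τ C ⊆ framing τ := by
  rintro _ ⟨y, hy, rfl | ⟨-, i, d, rfl, hm⟩⟩
  · exact marked_of_renorm h hA (hC hy)
  · exact hm

/-- Magnification raises all levels by one and makes room for a new level `0`, filled by the marked
children. Their key tiles occur in the tiling, so `hS` shows that the orientations are allowed. -/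
theorem expand_framed {S : Code} {τ : ℤ × ℤ → Tile} (h : τ ∈ Tilings masterTiles) (hA : Aligned τ)
    (hS : ∀ i d p, (τ p).cls = keyTile i d → d ∈ S i) {n : ℕ} {g : Isom} {C : Set (ℕ × Isom)}
    (hC : FramedSupertile S n g C) (hm : C ⊆ framing (renorm τ)) :
    FramedSupertile S (n + 1) (scale g) (expand τ C) := by
  induction hC with
  | zero g =>
    have hmem : ((0 : ℕ), g) ∈ framing (renorm τ) := hm (Set.mem_singleton _)
    have hg : Marked (renorm τ) 0 g := hmem
    clear hm hmem
    have hex := exists_child h hA hg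
    choose d hd p hp using hex
    have e : expand τ {(0, g)} = insert (0 + 1, scale g)
        (⋃ i, {(0, childFrame 0 (scale g) i (d i))}) := by
      ext x
      simp only [expand, Set.mem_singleton_iff, exists_eq_left, Set.mem_ofPred_eq,
        Set.mem_insert_iff, Set.mem_iUnion, true_and]
      refine or_congr_right ⟨?_, ?_⟩
      · rintro ⟨i, d', rfl, h'⟩
        exact ⟨i, by rw [child_unique (hd i) h']⟩
      · rintro ⟨i, rfl⟩
        exact ⟨i, d i, rfl, hd i⟩
    rw [e]
    exact .succ 0 (scale g) d _ (fun i => hS i _ _ (hp i)) fun i => .zero _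
  | succ n g d C hd hC ih =>
    have e : expand τ (insert (n + 1, g) (⋃ i, C i)) =
        insert (n + 1 + 1, scale g) (⋃ i, expand τ (C i)) := by
      ext x
      constructor
      · rintro ⟨y, rfl | hy, hx⟩
        · rcases hx with rfl | ⟨h0, -⟩
          · exact .inl rfl
          · exact absurd h0 (Nat.succ_ne_zero n)
        · obtain ⟨i, hi⟩ := Set.mem_iUnion.1 hy
          exact .inr (Set.mem_iUnion.2 ⟨i, y, hi, hx⟩)
      · rintro (rfl | hx)
        · exact ⟨_, .inl rfl, .inl rfl⟩
        · obtain ⟨i, y, hy, hx⟩ := Set.mem_iUnion.1 hx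
          exact ⟨y, .inr (Set.mem_iUnion.2 ⟨i, hy⟩), hx⟩
    rw [e]
    refine .succ (n + 1) (scale g) d _ hd fun i => ?_
    rw [← scale_childFrame]
    exact ih i fun x hx => hm (.inr (Set.mem_iUnion.2 ⟨i, hx⟩))

theorem ends_table : ∀ e : Digit,
    (∃ i f, (childAt 0 i * sym f).point (-2, 0) = (sym e).point (-6, 2)) ∧
    ∃ i f, (childAt 0 i * sym f).point (-2, 0) = (sym e).point (-2, 2) := by decide

theorem mem_ends_child {g : Isom} {p : ℤ × ℤ} (hp : p ∈ corners g) :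
    ∃ i, ∀ d, 2 • p ∈ ends (childFrame 0 (scale g) i d) := by
  have key : ∀ e q i f, p = (g * sym e).point q →
      (childAt 0 i * sym f).point (-2, 0) = (sym e).point (2 • q) →
      ∃ i, ∀ d, 2 • p ∈ ends (childFrame 0 (scale g) i d) := by
    rintro e q i f rfl h
    refine ⟨i, fun d => ⟨nim d f, ?_⟩⟩
    rw [← scale_point, scale_mul, scale_sym, Isom.mul_point, ← h, childFrame_eq, mul_assoc, mul_assoc,
      sym_mul_sym, nim_nim_cancel]
    simp only [Isom.mul_point]
  obtain ⟨e, he | he⟩ := hp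
  · obtain ⟨i, f, h⟩ := (ends_table e).1
    exact key e _ i f he (by rw [h, two_smul_pair]; rfl)
  · obtain ⟨i, f, h⟩ := (ends_table e).2
    exact key e _ i f he (by rw [h, two_smul_pair]; rfl)

/-- Every marked frame of level `0` is a child of a marked frame of the renormalised tiling. -/
theorem exists_parent {τ : ℤ × ℤ → Tile} (h : τ ∈ Tilings masterTiles) (hA : Aligned τ)
    (hR : renorm τ ∈ Tilings masterTiles) {g : Isom} (hg : Marked τ 0 g) :
    ∃ k, Marked (renorm τ) 0 k ∧ (0, g) ∈ expand τ {(0, k)} := by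
  have he : (g * sym 0).point (-2, 0) ∈ ends g := ⟨0, rfl⟩
  have hd : Diag ((g * sym 0).point (-2, 0)) ((g * sym 0).point (-3, 1)) := by
    rw [diag_point]; simp [Diag]
  have hodd : ((g * sym 0).point (-3, 1)).1 % 2 = 1 ∧ ((g * sym 0).point (-3, 1)).2 % 2 = 1 :=
    (hA _ _).1 (k_of_corner hg ⟨0, .inl rfl⟩)
  generalize (g * sym 0).point (-2, 0) = q at *
  obtain ⟨p, rfl⟩ : ∃ p, 2 • p = q := by
    refine ⟨(q.1 / 2, q.2 / 2), ?_⟩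
    generalize (g * sym 0).point (-3, 1) = q' at *
    obtain ⟨a, b⟩ := q
    obtain ⟨a', b'⟩ := q'
    simp only [Diag] at hd
    simp only at hodd
    rw [two_smul_pair, Prod.mk.injEq]
    dsimp only
    omega
  -- An end of `g` is a cornered tile of the renormalised tiling, hence a corner of a marked frame
  -- `k` there. The child of `k` that has an end at this place shares a corner with `g` and is
  -- therefore equal to it.
  obtain ⟨k, d, hk, hp⟩ := exists_marked hR (k_renorm.2 ⟨g, hg, he⟩)
  obtain ⟨i, hi⟩ := mem_ends_child (g := k) ⟨d, hp⟩
  obtain ⟨e, hm, -⟩ := exists_child h hA hk i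
  refine ⟨k, hk, _, rfl, .inr ⟨rfl, i, e, ?_, hg⟩⟩
  rw [frame_unique hg hm (mem_corners_of_diag he hd) (mem_corners_of_diag (hi e) hd)]

/-! ### The hierarchy in a tiling -/

theorem moveFrames_mul (a b : Isom) (C : Set (ℕ × Isom)) :
    moveFrames (a * b) C = moveFrames a (moveFrames b C) := by
  ext ⟨n, h⟩; simp [mem_moveFrames, mul_assoc]

theorem moveFrames_mono (a : Isom) {C C' : Set (ℕ × Isom)} (h : C ⊆ C') :
    moveFrames a C ⊆ moveFrames a C' := Set.image_mono h

/-- A set of tiles with what the hierarchy needs. -/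
structure Good (S : Code) (T : Set TileClass) : Prop where
  master : T ⊆ masterTiles
  outward : outwardTiles ⊆ T
  key : ∀ i d, keyTile i d ∈ T → d ∈ S i

/-- One step of the hierarchy: the tiling is aligned and renormalised, and `E` carries frames back
by adding the children and undoing the shear and the alignment. As the next tiling is again one by
`T`, the step can be iterated. -/
theorem Good.exists_lift {S : Code} {T : Set TileClass} (hT : Good S T) {τ : ℤ × ℤ → Tile}
    (h : τ ∈ Tilings T) {g : Isom} (hg : Marked τ 0 g) :
    ∃ τ' ∈ Tilings T, ∃ k, Marked τ' 0 k ∧ ∃ E : Set (ℕ × Isom) → Set (ℕ × Isom),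
      (∀ C C', C ⊆ C' → E C ⊆ E C') ∧ (0, g) ∈ E {(0, k)} ∧
      ∀ n h C, FramedSupertile S n h C → (0, k) ∈ C → C ⊆ framing τ' →
        (∃ h', FramedSupertile S (n + 1) h' (E C)) ∧ E C ⊆ framing τ := by
  obtain ⟨a, σ, τ₁, h₁, hA, hσ⟩ := exists_aligned hT.master h
  have hM : τ₁ ∈ Tilings masterTiles := ⟨h₁.1, fun p => hT.master (h₁.2 p)⟩
  have hR := renorm_mem hT.master hT.outward h₁ hA
  have hRM : renorm τ₁ ∈ Tilings masterTiles := ⟨hR.1, fun p => hT.master (hR.2 p)⟩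
  have g1 : Marked (act a⁻¹ τ) 0 (a⁻¹ * g) := hg.act _
  obtain ⟨s, hs⟩ : ∃ s, s = σ (a⁻¹ * g).c.1 := ⟨_, rfl⟩
  have g2 : Marked τ₁ 0 (lift (-s) * (a⁻¹ * g)) := by
    have := hσ.symm.marked (h.1.act _) g1
    rwa [← hs] at this
  have c2 : (lift (-s) * (a⁻¹ * g)).c.1 = (a⁻¹ * g).c.1 := by
    change ((lift (-s)).point ((a⁻¹ * g).c.1, (a⁻¹ * g).c.2)).1 = _
    rw [lift_point]
  obtain ⟨k, hk, hgk⟩ := exists_parent hM hA hRM g2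
  refine ⟨renorm τ₁, hR, k, hk, fun C => moveFrames (a * lift s) (expand τ₁ C),
    fun C C' hC => moveFrames_mono _ (expand_mono _ hC), ?_, ?_⟩
  · rw [mem_moveFrames]
    convert hgk using 2
    rw [mul_inv_rev, lift_inv, mul_assoc]
  · intro n h' C hC hkC hCR
    have hF := expand_framed hM hA (fun i d p hp => hT.key i d (hp ▸ h₁.2 p)) hC hCR
    refine ⟨⟨_, hF.move _⟩, ?_⟩
    obtain ⟨e1, e2⟩ := hσ.framed h₁.1 hF (expand_subset hM hA hCR)
    -- The expanded supertile contains the frame that came from `g`, so its common shift is the one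
    -- of `g`. This allows `E` to use one translation, independent of the supertile.
    have e3 := e1 _ (expand_mono τ₁ (Set.singleton_subset_iff.2 hkC) hgk)
    rw [show σ (scale h').c.1 = s by rw [← e3, hs]; exact congrArg σ c2] at e2
    show moveFrames (a * lift s) (expand τ₁ C) ⊆ framing τ
    rw [moveFrames_mul]
    have := (moveFrames_subset_framing (g := a)).2 e2
    rwa [← act_mul, mul_inv_cancel, one_act] at this

/-- Every marked frame of level `0` lies in a nested sequence of marked supertiles. -/
theorem Good.exists_hierarchy {S : Code} {T : Set TileClass} (hT : Good S T) {τ : ℤ × ℤ → Tile}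
    (h : τ ∈ Tilings T) {g : Isom} (hg : Marked τ 0 g) :
    ∃ C : ℕ → Set (ℕ × Isom), C 0 = {(0, g)} ∧
      ∀ n, (∃ h, FramedSupertile S n h (C n)) ∧ C n ⊆ C (n + 1) ∧ C n ⊆ framing τ := by
  let X := {x : (ℤ × ℤ → Tile) × Isom // x.1 ∈ Tilings T ∧ Marked x.1 0 x.2}
  have step : ∀ x : X, ∃ (y : X) (E : Set (ℕ × Isom) → Set (ℕ × Isom)),
      (∀ C C', C ⊆ C' → E C ⊆ E C') ∧ (0, x.1.2) ∈ E {(0, y.1.2)} ∧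
      ∀ n h C, FramedSupertile S n h C → (0, y.1.2) ∈ C → C ⊆ framing y.1.1 →
        (∃ h', FramedSupertile S (n + 1) h' (E C)) ∧ E C ⊆ framing x.1.1 := by
    rintro ⟨⟨τ, g⟩, h1, h2⟩
    obtain ⟨τ', h3, k, h4, E, hE⟩ := hT.exists_lift h1 h2
    exact ⟨⟨(τ', k), h3, h4⟩, E, hE⟩
  choose next E hE using step
  -- The supertile of level `n` around the given frame is the singleton frame `n` renormalisation
  -- steps later, carried back `n` times. Its growth with `n` follows from the monotonicity of every
  -- `E`.
  let F : ℕ → X → Set (ℕ × Isom) := fun n =>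
    Nat.rec (fun x => {(0, x.1.2)}) (fun _ f x => E x (f (next x))) n
  have h1 : ∀ n x, (0, x.1.2) ∈ F n x := by
    intro n
    induction n with
    | zero => exact fun x => rfl
    | succ n ih =>
      exact fun x => (hE x).1 _ _ (Set.singleton_subset_iff.2 (ih (next x))) (hE x).2.1
  have h2 : ∀ n x, (∃ h, FramedSupertile S n h (F n x)) ∧ F n x ⊆ framing x.1.1 := by
    intro n
    induction n with
    | zero =>
      intro x
      exact ⟨⟨_, .zero _⟩, Set.singleton_subset_iff.2 x.2.2⟩
    | succ n ih =>
      intro x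
      obtain ⟨⟨k, hk⟩, hs⟩ := ih (next x)
      exact (hE x).2.2 n k _ hk (h1 n _) hs
  have h3 : ∀ n x, F n x ⊆ F (n + 1) x := by
    intro n
    induction n with
    | zero => exact fun x => Set.singleton_subset_iff.2 (h1 1 x)
    | succ n ih => exact fun x => (hE x).1 _ _ (ih (next x))
  let x : X := ⟨(τ, g), h, hg⟩
  exact ⟨fun n => F n x, rfl, fun n => ⟨(h2 n x).1, h3 n x, (h2 n x).2⟩⟩

theorem dominoes_mono {C C' : Set (ℕ × Isom)} (h : C ⊆ C') : dominoes C ⊆ dominoes C' :=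
  fun _ ⟨g, hg, e⟩ => ⟨g, h hg, e⟩

theorem Good.hierarchical {S : Code} {T : Set TileClass} (hT : Good S T) {τ : ℤ × ℤ → Tile}
    (h : τ ∈ Tilings T) : IsHierarchical S (erase τ) := by
  refine ⟨erase_isDominoTiling ⟨h.1, fun p => hT.master (h.2 p)⟩, ?_⟩
  rintro _ ⟨g, hg, rfl⟩
  obtain ⟨C, h0, hC⟩ := hT.exists_hierarchy h hg
  refine ⟨fun n => dominoes (C n), ?_, fun n => ⟨?_, dominoes_mono (hC n).2.1,
    dominoes_mono (hC n).2.2⟩⟩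
  · ext D; simp [h0, dominoes]
  · obtain ⟨k, hk⟩ := (hC n).1
    exact ⟨k, _, hk, rfl⟩

end DominoTiles

namespace DominoTiles

/-! ### Tilings made of a coarse tiling and of dominoes -/

/-- Unsided markings carry no digits. -/
def Proper (m : Marking) : Prop := m.b = 0 → m.c = 0 ∧ m.d = 0

theorem Proper.opp {m : Marking} (h : Proper m) : Proper (opp m) := fun hb =>
  h ((by decide : ∀ s : SignType, -s = 0 → s = 0) _ hb)

theorem proper_mark {g : Isom} {m : Marking} : Proper (g.mark m) ↔ Proper m := by
  have := mark_b_ne g m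
  unfold Proper
  rw [mark_c, mark_d, ← not_iff_not.1 this]

theorem proper_corner {g : Isom} {d : Digit} {j : Dir} : Proper ((g.tile (outerCorner true d)).edge j) ∧
    Proper ((g.tile (innerCorner true d)).edge j) := by
  rw [← g.dir_inv_dir j, Isom.tile_edge_dir, Isom.tile_edge_dir, proper_mark, proper_mark]
  generalize g⁻¹.dir j = i
  clear g
  revert d i
  unfold Proper
  decide

/-- An aligned tiling whose cornered tiles are those of the marked frames in `F`. -/
structure Laid (τ : ℤ × ℤ → Tile) (F : Set Isom) : Prop where
  tiling : IsTiling τ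
  aligned : Aligned τ
  marked : ∀ k ∈ F, Marked τ 0 k
  cover : ∀ q, K τ q → ∃ k ∈ F, q ∈ corners k
  mid : ∀ p j, (τ (2 • p + vec j)).edge j = (τ (2 • p)).edge j
  proper : ∀ p j, Proper ((τ p).edge j)

/-- The tile at the corner `q` of the frame `k`. -/
def CornerTile (k : Isom) (q : ℤ × ℤ) (t : Tile) : Prop :=
  ∃ d, (q = (k * sym d).point (-3, 1) ∧ t = (k * sym d).tile (outerCorner true d)) ∨
    (q = (k * sym d).point (-1, 1) ∧ t = (k * sym d).tile (innerCorner true d))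

theorem CornerTile.unique {k : Isom} {q : ℤ × ℤ} {t t' : Tile} (h : CornerTile k q t)
    (h' : CornerTile k q t') : t' = t := by
  have aux : ∀ d d', ((sym d).point (-3, 1) = (sym d').point (-3, 1) → d = d') ∧
      ((sym d).point (-1, 1) = (sym d').point (-1, 1) → d = d') ∧
      (sym d).point (-3, 1) ≠ (sym d').point (-1, 1) := by decide
  simp only [CornerTile, Isom.mul_point] at h h'
  obtain ⟨d, ⟨rfl, rfl⟩ | ⟨rfl, rfl⟩⟩ := h <;> obtain ⟨d', ⟨e, rfl⟩ | ⟨e, rfl⟩⟩ := h'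
  · rw [(aux d d').1 (k.point_injective e)]
  · exact absurd (k.point_injective e) (aux d d').2.2
  · exact absurd (k.point_injective e).symm (aux d' d).2.2
  · rw [(aux d d').2.1 (k.point_injective e)]

theorem exists_cornerTile {k : Isom} {q : ℤ × ℤ} (h : q ∈ corners k) : ∃ t, CornerTile k q t := by
  obtain ⟨d, h | h⟩ := h
  · exact ⟨_, d, .inl ⟨h, rfl⟩⟩
  · exact ⟨_, d, .inr ⟨h, rfl⟩⟩

theorem vec_parity : ∀ j : Dir, ((vec j).1 + (vec j).2) % 2 = 1 := by decide
theorem vec_add_vec : ∀ j : Dir, vec j + vec (j + 2) = 0 := by decide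

/-- The sites with two even coordinates carry the coarse markings, those with two odd coordinates
the corners of the frames. Every other square lies between such sites and copies what it needs from
its neighbours. Matching is automatic; whether the squares are legal tiles is a separate question.
-/
theorem exists_laid (c : ℤ × ℤ → Dir → Marking)
    (hc : ∀ p j, c (p + vec j) (j + 2) = opp (c p j)) (hp : ∀ p j, Proper (c p j)) (F : Set Isom)
    (odd : ∀ k ∈ F, ∀ q ∈ corners k, q.1 % 2 = 1 ∧ q.2 % 2 = 1)
    (cover : ∀ x y : ℤ, x % 2 = 1 → y % 2 = 1 → ∃ k ∈ F, (x, y) ∈ corners k)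
    (unique : ∀ k ∈ F, ∀ k' ∈ F, ∀ q, q ∈ corners k → q ∈ corners k' → k = k') :
    ∃ τ, Laid τ F ∧ ∀ p, τ (2 • p) = ⟨false, c p⟩ := by
  have ex : ∀ q, ∃ t, ∀ k ∈ F, q ∈ corners k → CornerTile k q t := by
    intro q
    by_cases h : ∃ k ∈ F, q ∈ corners k
    · obtain ⟨k, hk, hq⟩ := h
      obtain ⟨t, ht⟩ := exists_cornerTile hq
      refine ⟨t, fun k' hk' hq' => ?_⟩
      rwa [← unique k hk k' hk' q hq hq']
    · exact ⟨⟨false, c 0⟩, fun k hk hq => absurd ⟨k, hk, hq⟩ h⟩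
  choose T hT using ex
  -- `site` is meaningful only where the two coordinates have the same parity; elsewhere its value
  -- is not used.
  let site : ℤ × ℤ → Tile := fun q => if q.1 % 2 = 1 then T q else ⟨false, c (q.1 / 2, q.2 / 2)⟩
  let τ : ℤ × ℤ → Tile := fun q =>
    if (q.1 + q.2) % 2 = 0 then site q else ⟨false, fun j => opp ((site (q + vec j)).edge (j + 2))⟩
  have τ_even : ∀ q : ℤ × ℤ, (q.1 + q.2) % 2 = 0 → τ q = site q := fun q h => if_pos h
  have τ_odd : ∀ q : ℤ × ℤ, (q.1 + q.2) % 2 = 1 →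
      τ q = ⟨false, fun j => opp ((site (q + vec j)).edge (j + 2))⟩ := fun q h => if_neg (by omega)
  have site_two : ∀ p, site (2 • p) = ⟨false, c p⟩ := by
    rintro ⟨x, y⟩
    simp only [site, two_smul_pair]
    rw [if_neg (by omega), show 2 * x / 2 = x by omega, show 2 * y / 2 = y by omega]
  have τ_two : ∀ p, τ (2 • p) = ⟨false, c p⟩ := by
    intro p
    rw [τ_even _ (by obtain ⟨x, y⟩ := p; rw [two_smul_pair]; dsimp only; omega), site_two]
  have τ_corner : ∀ k ∈ F, ∀ q ∈ corners k, CornerTile k q (τ q) := by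
    intro k hk q hq
    have h := odd k hk q hq
    have : τ q = T q := by
      rw [τ_even q (by omega)]; exact if_pos h.1
    rw [this]; exact hT q k hk hq
  have fits : ∀ p j, (τ (p + vec j)).edge (j + 2) = opp ((τ p).edge j) := by
    intro p j
    have hj := vec_parity j
    rcases Int.emod_two_eq_zero_or_one (p.1 + p.2) with h | h
    · rw [τ_odd (p + vec j) (by rw [Prod.fst_add, Prod.snd_add]; omega), τ_even p h]
      dsimp only
      rw [add_assoc, vec_add_vec, add_zero, dir_add_two_two]
    · rw [τ_odd p h, τ_even (p + vec j) (by rw [Prod.fst_add, Prod.snd_add]; omega), opp_opp]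
  have aligned : Aligned τ := by
    intro x y
    constructor
    · intro h
      rcases Int.emod_two_eq_zero_or_one (x + y) with h1 | h1
      · rcases Int.emod_two_eq_zero_or_one x with h2 | h2
        · rw [K, τ_even _ h1] at h
          have : site (x, y) = ⟨false, c (x / 2, y / 2)⟩ := if_neg (by dsimp only; omega)
          rw [this] at h
          exact absurd h (by simp)
        · omega
      · rw [K, τ_odd _ h1] at h
        exact absurd h (by simp)
    · rintro ⟨hx, hy⟩
      obtain ⟨k, hk, hq⟩ := cover x y hx hy
      obtain ⟨d, ⟨-, h⟩ | ⟨-, h⟩⟩ := τ_corner k hk _ hq <;> rw [K, h] <;> rfl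
  have marked : ∀ k ∈ F, Marked τ 0 k := by
    intro k hk
    rw [marked_zero_iff]
    intro d
    rw [Quarter, act_inv_eq_iff, act_inv_eq_iff]
    have h1 : (k * sym d).point (-3, 1) ∈ corners k := ⟨d, .inl rfl⟩
    have h2 : (k * sym d).point (-1, 1) ∈ corners k := ⟨d, .inr rfl⟩
    exact ⟨CornerTile.unique ⟨d, .inl ⟨rfl, rfl⟩⟩ (τ_corner k hk _ h1),
      CornerTile.unique ⟨d, .inr ⟨rfl, rfl⟩⟩ (τ_corner k hk _ h2)⟩
  have proper_even : ∀ (q : ℤ × ℤ) j, (q.1 + q.2) % 2 = 0 → Proper ((τ q).edge j) := by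
    intro q j h
    rcases Int.emod_two_eq_zero_or_one q.1 with h2 | h2
    · have e : τ q = ⟨false, c (q.1 / 2, q.2 / 2)⟩ := by
        rw [τ_even _ h]; exact if_neg (by omega)
      rw [e]; exact hp _ _
    · obtain ⟨k, hk, hq⟩ := cover q.1 q.2 h2 (by omega)
      obtain ⟨d, ⟨-, e⟩ | ⟨-, e⟩⟩ := τ_corner k hk _ hq
      · rw [show τ q = _ from e]; exact proper_corner.1
      · rw [show τ q = _ from e]; exact proper_corner.2
  refine ⟨τ, ⟨isTiling_of_fits (fun p => fits p 0) (fun p => fits p 1) aligned.unique, aligned, marked,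
    fun q hq => ?_, fun p j => ?_, fun q j => ?_⟩, τ_two⟩
  · obtain ⟨hx, hy⟩ := (aligned q.1 q.2).1 hq
    exact cover _ _ hx hy
  · have h := fits (2 • p + vec j) j
    rw [add_assoc, ← two_nsmul, ← nsmul_add, τ_two] at h
    rw [τ_two, ← opp_opp ((τ (2 • p + vec j)).edge j), ← h]
    dsimp only
    rw [hc, opp_opp]
  · rcases Int.emod_two_eq_zero_or_one (q.1 + q.2) with h | h
    · exact proper_even q j h
    · have hj := vec_parity j
      have := (proper_even (q + vec j) (j + 2) (by rw [Prod.fst_add, Prod.snd_add]; omega)).opp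
      rwa [fits, opp_opp] at this

theorem Laid.mem {τ : ℤ × ℤ → Tile} {F : Set Isom} (h : Laid τ F) {k : Isom} (hk : Marked τ 0 k) :
    k ∈ F := by
  have hq : (k * sym 0).point (-3, 1) ∈ corners k := ⟨0, .inl rfl⟩
  obtain ⟨k', hk', hq'⟩ := h.cover _ (k_of_corner hk hq)
  rwa [frame_unique hk (h.marked k' hk') hq hq']

/-- A tiling in which every cornered tile belongs to a marked frame. -/
structure Composed (τ : ℤ × ℤ → Tile) : Prop where
  tiling : IsTiling τ
  proper : ∀ p j, Proper ((τ p).edge j)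
  frame : ∀ q, K τ q → ∃ g, Marked τ 0 g ∧ q ∈ corners g

theorem Laid.composed {τ : ℤ × ℤ → Tile} {F : Set Isom} (h : Laid τ F) : Composed τ where
  tiling := h.tiling
  proper := h.proper
  frame q hq := by
    obtain ⟨k, hk, hq⟩ := h.cover q hq
    exact ⟨k, h.marked k hk, hq⟩

/-- A seed for inflation: frames in a rectangular lattice and the same plain markings at all even
sites. The squares at the even sites need not be legal. -/
theorem exists_composed : ∃ τ, Composed τ := by
  obtain ⟨s, hs, hp⟩ : ∃ s : Dir → Marking, (∀ j, s (j + 2) = opp (s j)) ∧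
      ∀ j, (s j).c = 0 ∧ (s j).d = 0 :=
    ⟨(![plus, plus, minus, minus] : Fin 4 → Marking), by decide, by decide⟩
  have pt : ∀ (c p : ℤ × ℤ), (⟨c, 1, false⟩ : Isom).point p = c + p := by
    intro c p
    rw [Isom.point_eq]
    congr 1
    exact Isom.one_lin p
  suffices h : ∃ τ, Laid τ {k | ∃ a b : ℤ, k = ⟨(8 * a, 4 * b), 1, false⟩} ∧
      ∀ p, τ (2 • p) = ⟨false, s⟩ by
    obtain ⟨τ, h, -⟩ := h
    exact ⟨τ, h.composed⟩
  refine exists_laid (fun _ => s) (fun _ => hs) (fun _ j _ => hp j) _ ?_ ?_ ?_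
  · rintro _ ⟨a, b, rfl⟩ q hq
    obtain ⟨x, y, hx, hy, rfl⟩ := mem_corners.1 hq
    rw [pt]; simp only [Prod.mk_add_mk]; omega
  · intro x y hx hy
    refine ⟨_, ⟨(x + 4) / 8, (y + 2) / 4, rfl⟩, mem_corners.2 ⟨x - 8 * ((x + 4) / 8),
      y - 4 * ((y + 2) / 4), by omega, by omega, ?_⟩⟩
    rw [pt]; ext <;> simp
  · rintro _ ⟨a, b, rfl⟩ _ ⟨a', b', rfl⟩ q hq hq'
    obtain ⟨x, y, hx, hy, rfl⟩ := mem_corners.1 hq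
    obtain ⟨x', y', hx', hy', e⟩ := mem_corners.1 hq'
    rw [pt, pt, Prod.mk_add_mk, Prod.mk_add_mk, Prod.mk.injEq] at e
    obtain ⟨e1, e2⟩ := e
    obtain rfl : a = a' := by omega
    obtain rfl : b = b' := by omega
    rfl

/-! ### Inflation -/

/-- The corner of the parent at which an end of a child lies. -/
def endCorner (i : Fin 4) (f : Digit) : Digit × Bool :=
  (![![(0, true), (0, false), (0, true), (0, false)], ![(2, false), (2, true), (2, false), (2, true)],
    ![(3, false), (1, false), (3, false), (1, false)], ![(1, true), (3, true), (1, true), (3, true)]] :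
    Fin 4 → Fin 4 → Digit × Bool) i f

/-- The position of a corner in its quarter of the frame. -/
def cornerPos (o : Bool) : ℤ × ℤ := if o then (-3, 1) else (-1, 1)

/-- The outward tile at a corner of a frame. -/
def corner (k o : Bool) (e : Digit) : Tile := if o then outerCorner k e else innerCorner k e

/-- The markings at the end of a child, in the frame of the child for which it is the left end. -/
def endEdge (i : Fin 4) (f : Digit) (j : Dir) : Marking :=
  (childAt 0 i * sym f).mark (((sym (endCorner i f).1).tile
    (corner true (endCorner i f).2 (endCorner i f).1)).edge ((childAt 0 i * sym f).dir j))

theorem endCorner_point : ∀ i f, (childAt 0 i * sym f).point (-2, 0) =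
    (sym (endCorner i f).1).point (2 • cornerPos (endCorner i f).2) := by decide

theorem marked_corner' {τ : ℤ × ℤ → Tile} {g : Isom} (h : Marked τ 0 g) (o : Bool) (e : Digit) :
    τ ((g * sym e).point (cornerPos o)) = (g * sym e).tile (corner true o e) := by
  cases o
  · exact (marked_corner h e).2
  · exact (marked_corner h e).1

/-- The arms at the ends of the marked frame `g` are those of the child `i` in orientation `d`. -/
structure Typed (τ : ℤ × ℤ → Tile) (g : Isom) (i : Fin 4) (d : Digit) : Prop where
  ends : ∀ f j, (τ ((g * sym f).point (-2, 0))).edge ((g * sym f).dir j) =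
    (g * sym f).mark (endEdge i (nim d f) j)
  north : ∀ f, (τ ((g * sym f).point (-2, 1))).edge ((g * sym f).dir 0) =
    (g * sym f).mark (endEdge i (nim d f) 0)
  east : ∀ f, (τ ((g * sym f).point (-1, 0))).edge ((g * sym f).dir 1) =
    (g * sym f).mark (endEdge i (nim d f) 1)
  west : ∀ f, (τ ((g * sym f).point (-3, 0))).edge ((g * sym f).dir 3) =
    (g * sym f).mark (endEdge i (nim d f) 3)

theorem child_end (g : Isom) (i : Fin 4) (d f : Digit) :
    (childFrame 0 (scale g) i d * sym f).point (-2, 0) =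
      2 • (g * sym (endCorner i (nim d f)).1).point (cornerPos (endCorner i (nim d f)).2) := by
  rw [childFrame_eq, mul_assoc, mul_assoc, sym_mul_sym, Isom.mul_point, endCorner_point, ← scale_point,
    scale_mul, scale_sym, Isom.mul_point]

theorem Laid.typed {τ τ' : ℤ × ℤ → Tile} {F : Set Isom} (h : Laid τ F)
    (he : ∀ p, (τ (2 • p)).edge = (τ' p).edge) {g : Isom} (hg : Marked τ' 0 g) (i : Fin 4)
    (d : Digit) : Typed τ (childFrame 0 (scale g) i d) i d := by
  have ends : ∀ f j, (τ ((childFrame 0 (scale g) i d * sym f).point (-2, 0))).edge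
      ((childFrame 0 (scale g) i d * sym f).dir j) =
      (childFrame 0 (scale g) i d * sym f).mark (endEdge i (nim d f) j) := by
    intro f j
    rw [child_end, he, marked_corner' hg, childFrame_eq, mul_assoc, mul_assoc, sym_mul_sym,
      Isom.mul_dir, scale_dir, Isom.mul_tile, Isom.tile_edge_dir, Isom.mul_mark (scale g), scale_mark,
      endEdge, Isom.mark_involutive]
  have mids : ∀ f j, (τ ((childFrame 0 (scale g) i d * sym f).point (-2, 0) +
      vec ((childFrame 0 (scale g) i d * sym f).dir j))).edge
      ((childFrame 0 (scale g) i d * sym f).dir j) =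
      (childFrame 0 (scale g) i d * sym f).mark (endEdge i (nim d f) j) := by
    intro f j
    rw [← ends f j, child_end, h.mid]
  refine ⟨ends, fun f => ?_, fun f => ?_, fun f => ?_⟩
  · rw [← mids f 0, ← Isom.point_add_vec]; rfl
  · rw [← mids f 1, ← Isom.point_add_vec]; rfl
  · rw [← mids f 3, ← Isom.point_add_vec]; rfl

theorem ends_child {g : Isom} {i : Fin 4} {d : Digit} {p : ℤ × ℤ}
    (hp : p ∈ ends (childFrame 0 (scale g) i d)) : ∃ f, p = 2 • (g * sym (endCorner i f).1).point
      (cornerPos (endCorner i f).2) := by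
  obtain ⟨f, rfl⟩ := hp
  exact ⟨_, child_end g i d f⟩

theorem endCorner_child : ∀ i i' f f', (sym (endCorner i f).1).point (cornerPos (endCorner i f).2) =
    (sym (endCorner i' f').1).point (cornerPos (endCorner i' f').2) → i = i' := by decide

theorem mem_corners' (g : Isom) (e : Digit) (o : Bool) :
    (g * sym e).point (cornerPos o) ∈ corners g := by
  cases o
  · exact ⟨e, .inr rfl⟩
  · exact ⟨e, .inl rfl⟩

theorem exists_end {g : Isom} {q : ℤ × ℤ} (hq : q ∈ corners g) : ∃ p ∈ ends g, Diag p q := by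
  obtain ⟨d, rfl | rfl⟩ := hq <;>
    exact ⟨_, ⟨d, rfl⟩, (diag_point _ _ _).2 (by simp [Diag])⟩

/-- Every composed tiling can be inflated, with arbitrary orientations of the children. -/
theorem Composed.inflate {τ' : ℤ × ℤ → Tile} (h : Composed τ') (χ : Isom → Fin 4 → Digit) :
    ∃ τ, Laid τ {k | ∃ g i, Marked τ' 0 g ∧ k = childFrame 0 (scale g) i (χ g i)} ∧
      ∀ p, τ (2 • p) = ⟨false, (τ' p).edge⟩ := by
  apply exists_laid
  · exact fun p j => h.tiling.fit p j
  · exact h.proper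
  · rintro _ ⟨g, i, hg, rfl⟩ q hq
    obtain ⟨p, hp, hd⟩ := exists_end hq
    obtain ⟨f, rfl⟩ := ends_child hp
    generalize Isom.point _ _ = r at hd
    obtain ⟨x, y⟩ := r
    obtain ⟨a, b⟩ := q
    rw [two_smul_pair] at hd
    simp only [Diag] at hd
    dsimp only
    omega
  · intro x y hx hy
    -- Around a site with odd coordinates exactly one of the four coarse sites is cornered. It is a
    -- corner of a coarse frame and so the end of one of its children, of which the given site is a
    -- corner, whatever the orientation.
    obtain ⟨p, ⟨hp, hk⟩, -⟩ := h.tiling.unique_cornered (x / 2) (y / 2)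
    obtain ⟨g, hg, hpg⟩ := h.frame p hk
    obtain ⟨i, hi⟩ := mem_ends_child hpg
    refine ⟨_, ⟨g, i, hg, rfl⟩, mem_corners_of_diag (hi _) ?_⟩
    have := two_smul_diag.1 hp
    rwa [show 2 * (x / 2) + 1 = x by omega, show 2 * (y / 2) + 1 = y by omega] at this
  · rintro _ ⟨g, i, hg, rfl⟩ _ ⟨g', i', hg', rfl⟩ ⟨x, y⟩ hq hq'
    obtain ⟨p, hp, hd⟩ := exists_end hq
    obtain ⟨f, rfl⟩ := ends_child hp
    obtain ⟨p', hp', hd'⟩ := exists_end hq'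
    obtain ⟨f', rfl⟩ := ends_child hp'
    have c1 := mem_corners' g (endCorner i f).1 (endCorner i f).2
    have c2 := mem_corners' g' (endCorner i' f').1 (endCorner i' f').2
    have hxy : x = 2 * (x / 2) + 1 ∧ y = 2 * (y / 2) + 1 := by
      generalize Isom.point _ _ = r at hd
      obtain ⟨a, b⟩ := r
      rw [two_smul_pair] at hd
      simp only [Diag] at hd
      omega
    rw [hxy.1, hxy.2] at hd hd'
    have e := (h.tiling.unique_cornered (x / 2) (y / 2)).unique
      ⟨two_smul_diag.2 hd, k_of_corner hg c1⟩ ⟨two_smul_diag.2 hd', k_of_corner hg' c2⟩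
    rw [← e] at c2
    obtain rfl := frame_unique hg hg' c1 c2
    rw [Isom.mul_point, Isom.mul_point] at e
    rw [endCorner_child _ _ _ _ (g.point_injective e)]

theorem Composed.renorm_eq {τ τ' : ℤ × ℤ → Tile} (h : Composed τ') {χ : Isom → Fin 4 → Digit}
    (hL : Laid τ {k | ∃ g i, Marked τ' 0 g ∧ k = childFrame 0 (scale g) i (χ g i)})
    (he : ∀ p, τ (2 • p) = ⟨false, (τ' p).edge⟩) : renorm τ = τ' := by
  funext p
  ext1
  · have key : K (renorm τ) p ↔ K τ' p := by
      rw [k_renorm]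
      constructor
      · rintro ⟨k, hk, hp⟩
        obtain ⟨g, i, hg, rfl⟩ := hL.mem hk
        obtain ⟨f, hf⟩ := ends_child hp
        have : p = (g * sym (endCorner i f).1).point (cornerPos (endCorner i f).2) := by
          generalize Isom.point _ _ = r at hf
          obtain ⟨a, b⟩ := p
          obtain ⟨a', b'⟩ := r
          rw [two_smul_pair, two_smul_pair, Prod.mk.injEq] at hf
          ext <;> dsimp only <;> omega
        rw [this]
        exact k_of_corner hg (mem_corners' _ _ _)
      · intro hk
        obtain ⟨g, hg, hp⟩ := h.frame p hk
        obtain ⟨i, hi⟩ := mem_ends_child hp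
        exact ⟨_, hL.marked _ ⟨g, i, hg, rfl⟩, hi _⟩
    exact Bool.eq_iff_iff.2 key
  · change (τ (2 • p)).edge = _
    rw [he]

end DominoTiles

namespace DominoTiles

/-! ### The tiles of an inflated tiling -/

/-- The lists of the sets `atomTiles`, by their horizontal and vertical parts. -/
def atomList (i : Fin 4) (d : Digit) : List ((Marking × Marking) × (Marking × Marking)) :=
  let b := nim d 1
  let q := nim d 2
  let p := nim d 3
  (![[(h1 q, v 0 0), (h0 b, v 3 0), (h1 d, vPlain), (h1 b, vPlain), (h1 p, vPlain)],
      [(h0 d, v 3 2), (h1 p, v 0 2), (h1 d, vPlain), (h1 b, vPlain), (h1 q, vPlain)],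
      [(h1 d, v 3 3), (h1 b, v 3 1), (h1 q, v 2 3), (h1 p, v 2 1)],
      [(h1 q, v 1 1), (h1 p, v 1 3), (h1 d, vPlain), (h1 b, vPlain)]] :
    Fin 4 → List ((Marking × Marking) × (Marking × Marking))) i

theorem mem_atomTiles {t : TileClass} {α : Atom} :
    t ∈ atomTiles α ↔ ∃ x ∈ atomList α.child α.digit, t = cross x.1 x.2 := by
  obtain ⟨i, d⟩ := α
  have hi : ∀ i : Fin 4, i = 0 ∨ i = 1 ∨ i = 2 ∨ i = 3 := by decide
  rcases hi i with rfl | rfl | rfl | rfl <;> simp [atomTiles, atomList]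

theorem act_inv_edge {G : Isom} {τ : ℤ × ℤ → Tile} {p : ℤ × ℤ} {j : Dir} {m : Marking}
    (h : (τ (G.point p)).edge (G.dir j) = G.mark m) : (act G⁻¹ τ p).edge j = m := by
  apply G.mark_injective
  rw [← h, act_inv_point, ← Isom.tile_edge_dir, Isom.tile_inv_tile]

theorem marked_view {τ : ℤ × ℤ → Tile} {k : Isom} (h : Marked τ 0 k) (d e : Digit) (o : Bool) :
    act (k * sym d)⁻¹ τ ((sym e).point (cornerPos o)) = (sym e).tile (corner true o (nim d e)) := by
  rw [act_inv_eq_iff, ← Isom.mul_point, ← Isom.mul_tile, mul_assoc, sym_mul_sym]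
  exact marked_corner' h o _

theorem cls_of_view {τ : ℤ × ℤ → Tile} {G : Isom} {p : ℤ × ℤ} {t : Tile} (h : act G⁻¹ τ p = t) :
    (τ (G.point p)).cls = t.cls := by
  rw [(act_inv_eq_iff _ _ _ _).1 h, Isom.tile_cls]

theorem uncornered_view {τ : ℤ × ℤ → Tile} {G : Isom} {p : ℤ × ℤ}
    (h : (τ (G.point p)).cornered = false) : (act G⁻¹ τ p).cornered = false := by
  rw [act_inv_point]; exact h

theorem cls_north {τ : ℤ × ℤ → Tile} (h : IsTiling τ) {k : Isom} (hk : Marked τ 0 k) {d : Digit}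
    {m : Marking} (hc : (τ ((k * sym d).point (-2, 1))).cornered = false)
    (h0 : (τ ((k * sym d).point (-2, 1))).edge ((k * sym d).dir 0) = (k * sym d).mark m)
    (h2 : (τ ((k * sym d).point (-2, 0))).edge ((k * sym d).dir 0) = (k * sym d).mark m) :
    (τ ((k * sym d).point (-2, 1))).cls = cross (h1 d) (m, opp m) := by
  have hσ := h.act (k * sym d)⁻¹
  have v1 : act (k * sym d)⁻¹ τ (-3, 1) = outerCorner true d := (marked_quarter hk d).1
  have v2 : act (k * sym d)⁻¹ τ (-1, 1) = innerCorner true d := (marked_quarter hk d).2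
  rw [cross_eq]
  refine cls_of_view (tile_ext4 (uncornered_view hc) (act_inv_edge h0) ?_ ?_ ?_)
  · exact hσ.edge_fit (p := (-1, 1)) (j := 3) (m := ⟨1, -1, 2, d⟩) (by rw [v2]; rfl)
  · exact hσ.edge_fit (p := (-2, 0)) (j := 0) (act_inv_edge h2)
  · exact hσ.edge_fit (p := (-3, 1)) (j := 1) (m := ⟨1, 1, 1, d⟩) (by rw [v1]; rfl)

/-- A reflection exchanges the two meeting `0`-arms and hence the digits `y` and `y + 2`. This is
why two representatives suffice for the four plain tiles of this kind. -/
theorem cross_h0_reflect (y : Digit) (m m' : Marking) :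
    cross (h0 y) (m, m') = cross (h0 (nim y 2)) (m.reflect, m'.reflect) := by
  rw [cross_eq, cross_eq, ← Isom.tile_cls (sym 1)]
  have : nim (nim y 2) 2 = y := by revert y; decide
  refine congrArg _ (tile_ext4 rfl rfl ?_ rfl rfl)
  change (⟨-1, 1, 0, y⟩ : Marking) = ⟨-1, 1, 0, nim (nim y 2) 2⟩
  rw [this]

theorem cls_west {τ : ℤ × ℤ → Tile} (h : IsTiling τ) {k : Isom} (hk : Marked τ 0 k) {d : Digit}
    {m : Marking} (hc : (τ ((k * sym d).point (-3, 0))).cornered = false)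
    (h0 : (τ ((k * sym d).point (-3, 0))).edge ((k * sym d).dir 3) = (k * sym d).mark m)
    (h2 : (τ ((k * sym d).point (-2, 0))).edge ((k * sym d).dir 3) = (k * sym d).mark m) :
    (τ ((k * sym d).point (-3, 0))).cls = cross (DominoTiles.h0 (nim d 2)) (m, opp m) := by
  have hσ := h.act (k * sym d)⁻¹
  have v1 : act (k * sym d)⁻¹ τ (-3, 1) = outerCorner true d := (marked_quarter hk d).1
  have v2 : act (k * sym d)⁻¹ τ (-3, -1) = (sym 2).tile (outerCorner true (nim d 2)) :=
    marked_view hk d 2 true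
  -- The outward marking points west here, so the standard crossing tile appears after a quarter
  -- turn.
  rw [cross_eq, ← Isom.tile_cls ⟨0, 0, false⟩ (crossTile _ _)]
  have e3 := act_inv_edge h0
  refine cls_of_view (tile_ext4 (uncornered_view hc) ?_ ?_ ?_ ?_)
  · exact hσ.edge_fit (p := (-3, 1)) (j := 2) (m := ⟨1, -1, 0, d⟩) (by rw [v1]; rfl)
      (hm' := (by decide : ∀ d, opp ⟨1, -1, 0, d⟩ = ⟨-1, 1, 0, nim (nim d 2) 2⟩) d)
  · exact hσ.edge_fit (p := (-2, 0)) (j := 3) (act_inv_edge h2)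
  · exact hσ.edge_fit (p := (-3, -1)) (j := 0) (m := ⟨1, 1, 0, nim d 2⟩) (by rw [v2]; rfl)
  · exact e3

theorem cls_centre {τ : ℤ × ℤ → Tile} (h : IsTiling τ) {k : Isom} (hk : Marked τ 0 k) {d : Digit}
    {x : Marking × Marking} (hx : x.2 = opp x.1)
    (hc : ∀ y, y = 1 ∨ y = -1 → (τ ((k * sym d).point (0, y))).cornered = false)
    (e0 : ∀ y, y = 0 ∨ y = 1 → (τ ((k * sym d).point (0, y))).edge ((k * sym d).dir 0) =
      (k * sym d).mark x.1)
    (e2 : ∀ y, y = 0 ∨ y = -1 → (τ ((k * sym d).point (0, y))).edge ((k * sym d).dir 2) =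
      (k * sym d).mark x.2) :
    (τ ((k * sym d).point (0, 1))).cls = cross (h3 d) x ∧
    (τ ((k * sym d).point (0, -1))).cls = cross (hNeg3 (nim d 2)) x := by
  have hσ := h.act (k * sym d)⁻¹
  have v0 : act (k * sym d)⁻¹ τ (-1, 1) = innerCorner true d := (marked_quarter hk d).2
  have v1 : act (k * sym d)⁻¹ τ (1, 1) = (sym 1).tile (innerCorner true (nim d 1)) :=
    marked_view hk d 1 false
  have v2 : act (k * sym d)⁻¹ τ (-1, -1) = (sym 2).tile (innerCorner true (nim d 2)) :=
    marked_view hk d 2 false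
  have v3 : act (k * sym d)⁻¹ τ (1, -1) = (sym 3).tile (innerCorner true (nim d 3)) :=
    marked_view hk d 3 false
  rw [cross_eq, cross_eq]
  constructor
  · refine cls_of_view (tile_ext4 (uncornered_view (hc _ (.inl rfl))) (act_inv_edge (e0 1 (.inr rfl))) ?_ ?_ ?_)
    · exact hσ.edge_fit (p := (1, 1)) (j := 3) (m := ⟨1, -1, 3, nim d 1⟩) (by rw [v1]; rfl)
    · exact hσ.edge_fit (p := (0, 0)) (j := 0) (act_inv_edge (e0 0 (.inl rfl))) (hm' := hx.symm)
    · exact hσ.edge_fit (p := (-1, 1)) (j := 1) (m := ⟨1, 1, 3, d⟩) (by rw [v0]; rfl)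
  · refine cls_of_view (tile_ext4 (uncornered_view (hc _ (.inr rfl))) ?_ ?_ (act_inv_edge (e2 (-1) (.inr rfl))) ?_)
    · exact hσ.edge_fit (p := (0, 0)) (j := 2) (act_inv_edge (e2 0 (.inl rfl)))
        (hm' := by rw [hx]; exact opp_opp _)
    · exact hσ.edge_fit (p := (1, -1)) (j := 3) (m := ⟨1, 1, 3, nim d 3⟩) (by rw [v3]; rfl)
        (hm' := (by decide : ∀ d, opp ⟨1, 1, 3, nim d 3⟩ = ⟨-1, -1, 3, nim (nim d 2) 1⟩) d)
    · exact hσ.edge_fit (p := (-1, -1)) (j := 1) (m := ⟨1, -1, 3, nim d 2⟩) (by rw [v2]; rfl)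

theorem cross_hPlain_mem {m : Marking} (ha : m.a = 1) (hm : Proper m) :
    cross hPlain (m, opp m) ∈ commonTiles := by
  obtain ⟨a, b, z, w⟩ := m
  obtain rfl : a = 1 := ha
  have hb : ∀ b : SignType, b = 0 ∨ b = 1 ∨ b = -1 := by decide
  rcases hb b with rfl | rfl | rfl
  · obtain ⟨rfl, rfl⟩ : z = 0 ∧ w = 0 := hm rfl
    exact .inl (.inl rfl)
  · exact .inr ⟨z, w, rfl⟩
  · refine .inr ⟨z, w, ?_⟩
    rw [cross_eq, cross_eq, ← Isom.tile_cls (sym 1)]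
    exact congrArg _ (tile_ext4 rfl rfl rfl rfl rfl)

theorem plain_cls_mem {t : Tile} (hc : t.cornered = false) {j : Dir} (h1 : t.edge (j + 1) = minus)
    (h3 : t.edge (j + 3) = minus) (h : t.edge (j + 2) = opp (t.edge j)) (hp : Proper (t.edge j)) :
    t.cls ∈ commonTiles := by
  have key : ∀ j : Dir, t.edge (j + 1) = minus → t.edge (j + 3) = minus →
      t.edge (j + 2) = opp (t.edge j) → Proper (t.edge j) → (t.edge j).a = 1 → t.cls ∈ commonTiles := by
    intro j h1 h3 h hp ha
    have e : t = (turnTo 0 (j + 1)).tile (crossTile hPlain (t.edge j, opp (t.edge j))) := by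
      refine Isom.tile_ext_dir (turnTo 0 (j + 1)) hc fun i => ?_
      rw [Isom.tile_edge_dir]
      have hi : ∀ i j : Dir, (turnTo 0 (j + 1)).dir i = j + i := by decide
      rw [hi]
      have : ∀ i : Dir, i = 0 ∨ i = 1 ∨ i = 2 ∨ i = 3 := by decide
      rcases this i with rfl | rfl | rfl | rfl
      · rw [add_zero]; rfl
      · exact h1
      · exact h
      · exact h3
    rw [e, Isom.tile_cls]
    exact cross_hPlain_mem ha hp
  rcases Int.units_eq_one_or (t.edge j).a with ha | ha
  · exact key j h1 h3 h hp ha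
  · have a1 : ∀ j : Dir, j + 2 + 1 = j + 3 ∧ j + 2 + 3 = j + 1 := by decide
    refine key (j + 2) ?_ ?_ ?_ ?_ ?_
    · rw [(a1 j).1, h3]
    · rw [(a1 j).2, h1]
    · rw [dir_add_two_two, h, opp_opp]
    · rw [h]; exact hp.opp
    · rw [h]; change -(t.edge j).a = 1
      rw [ha, neg_neg]

/-- Every signed arm of a corner leads to another corner of the same frame. -/
theorem edge_plain_or {τ : ℤ × ℤ → Tile} {k : Isom} (h : Marked τ 0 k) {q : ℤ × ℤ}
    (hq : q ∈ corners k) (j : Dir) : (τ q).edge j = plus ∨ q + vec j + vec j ∈ corners k := by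
  have key : ∀ d (o : Bool) j, (corner true o d).edge j = plus ∨
      ∃ e o', cornerPos o + vec j + vec j = (sym e).point (cornerPos o') := by decide
  obtain ⟨d, o, rfl⟩ : ∃ d o, q = (k * sym d).point (cornerPos o) := by
    obtain ⟨d, hd | hd⟩ := hq
    · exact ⟨d, true, hd⟩
    · exact ⟨d, false, hd⟩
  rw [marked_corner' h, ← (k * sym d).dir_inv_dir j]
  rcases key d o ((k * sym d)⁻¹.dir j) with e | ⟨e, o', he⟩
  · rw [Isom.tile_edge_dir, e, mark_plus]; exact .inl rfl
  · rw [← Isom.point_add_vec, ← Isom.point_add_vec, he, ← Isom.mul_point, ← corners_mul_sym k d]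
    exact .inr (mem_corners' _ _ _)

theorem Laid.even_of_diag {τ : ℤ × ℤ → Tile} {F : Set Isom} (h : Laid τ F) {k : Isom} (hk : k ∈ F)
    {p q : ℤ × ℤ} (hq : q ∈ corners k) (hd : Diag p q) : ∃ r, p = 2 • r := by
  have := (h.aligned q.1 q.2).1 (k_of_corner (h.marked k hk) hq)
  obtain ⟨a, b⟩ := p
  refine ⟨(a / 2, b / 2), ?_⟩
  simp only [Diag] at hd
  rw [two_smul_pair]
  ext <;> dsimp only <;> omega

theorem Laid.pass {τ : ℤ × ℤ → Tile} {F : Set Isom} (h : Laid τ F) {k : Isom} (hk : k ∈ F)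
    {p q : ℤ × ℤ} (hq : q ∈ corners k) (hd : Diag p q) (j : Dir) :
    (τ (p + vec j)).edge j = (τ p).edge j := by
  obtain ⟨r, rfl⟩ := h.even_of_diag hk hq hd
  exact h.mid r j

/-- Between corners of different frames only plain arms meet, and within a frame this is the
hypothesis `hs`. The third arm passes straight, and every proper arm may cross a plain meeting. -/
theorem Laid.plain_mid {τ : ℤ × ℤ → Tile} {F : Set Isom} (h : Laid τ F) {k : Isom} (hk : k ∈ F)
    {q : ℤ × ℤ} (hq : q ∈ corners k) {j : Dir} (e : (τ q).edge j = plus)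
    (hs : q + vec j + vec j ∈ corners k → (τ (q + vec j + vec j)).edge (j + 2) = plus) :
    (τ (q + vec j)).cls ∈ commonTiles := by
  have hqo := (h.aligned q.1 q.2).1 (k_of_corner (h.marked k hk) hq)
  have vp : ∀ j : Dir, ((vec j).1 % 2 = 0 ∧ (vec j).2 % 2 = 1 ∨ (vec j).1 % 2 = 1 ∧ (vec j).2 % 2 = 0) ∧
      (vec (j + 1)).1 % 2 = (vec j).2 % 2 ∧ (vec (j + 1)).2 % 2 = (vec j).1 % 2 := by decide
  have hK : K τ (q + vec j + vec j) := by
    refine (h.aligned _ _).2 ?_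
    simp only [Prod.fst_add, Prod.snd_add]
    have := (vp j).1
    omega
  have e' : (τ (q + vec j + vec j)).edge (j + 2) = plus := by
    obtain ⟨k', hk', hq'⟩ := h.cover _ hK
    rcases edge_plain_or (h.marked k' hk') hq' (j + 2) with e' | e'
    · exact e'
    · rw [add_assoc _ (vec j) (vec (j + 2)), vec_add_vec, add_zero, add_assoc, vec_add_vec,
        add_zero] at e'
      obtain rfl := frame_unique (h.marked k hk) (h.marked k' hk') hq e'
      exact hs hq'
  obtain ⟨p, hp⟩ : ∃ p, q + vec j = 2 • p + vec (j + 1) := by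
    refine ⟨((q.1 + (vec j).1 - (vec (j + 1)).1) / 2, (q.2 + (vec j).2 - (vec (j + 1)).2) / 2), ?_⟩
    have := vp j
    rw [two_smul_pair]
    ext <;> simp only [Prod.fst_add, Prod.snd_add] <;> omega
  have m0 : (τ (q + vec j)).edge (j + 1) = (τ (2 • p)).edge (j + 1) := by rw [hp, h.mid]
  have m2 : (τ (q + vec j)).edge (j + 1 + 2) = opp ((τ (2 • p)).edge (j + 1)) :=
    h.tiling.fit _ _ (by rw [hp]) rfl
  have j1 : ∀ j : Dir, j + 1 + 1 = j + 2 ∧ j + 1 + 3 = j := by decide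
  refine plain_cls_mem (j := j + 1) ?_ ?_ ?_ (by rw [m2, m0]) (h.proper _ _)
  · rw [← Bool.not_eq_true]
    intro hc
    have := (h.aligned _ _).1 (show K τ ((q + vec j).1, (q + vec j).2) from hc)
    simp only [Prod.fst_add, Prod.snd_add] at this
    have := (vp j).1
    omega
  · rw [(j1 j).1]
    exact h.tiling.edge_fit e
  · rw [(j1 j).2]
    refine h.tiling.edge_fit e' (hk := (dir_add_two_two j).symm) (hq := ?_)
    rw [add_assoc, add_assoc, vec_add_vec, add_zero]

/-- The pass arm through the centre of the frame `k` is as in the entry `x` of the table. -/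
structure Centred (τ : ℤ × ℤ → Tile) (k : Isom) (d : Digit) (x : Digit × (Marking × Marking)) : Prop where
  north : (τ ((k * sym (nim d x.1)).point (0, 0))).edge ((k * sym (nim d x.1)).dir 0) =
    (k * sym (nim d x.1)).mark x.2.1
  south : (τ ((k * sym (nim d x.1)).point (0, 0))).edge ((k * sym (nim d x.1)).dir 2) =
    (k * sym (nim d x.1)).mark x.2.2

theorem pairTable_opp : ∀ i d i', (pairTable i d i').2.2 = opp (pairTable i d i').2.1 := by decide

/-- A check of the tables: the arms that leave the ends of a child across its long sides are
corners' arms of the parent, and the resulting crossing tiles are those listed for the atomic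
symbol. -/
theorem north_mem : ∀ i D d, (h1 d, (endEdge i (nim D d) 0, opp (endEdge i (nim D d) 0))) ∈
    atomList i D := by decide

theorem west_mem : ∀ i D d, let m := endEdge i (nim D d) 3
    ((h0 (nim d 2), (m, opp m)) ∈ atomList i D ∨ (h0 d, (m.reflect, (opp m).reflect)) ∈ atomList i D) ∨
    ((nim d 2 = 0 ∨ nim d 2 = 1) ∧ m = plus) ∨ ((d = 0 ∨ d = 1) ∧ m = plus) := by decide

theorem corner_edges (d : Digit) : (outerCorner true d).edge 0 = plus ∧
    (outerCorner true d).edge 3 = plus ∧ (innerCorner true d).edge 0 = plus ∧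
    (innerCorner true d).edge 2 = plus := ⟨rfl, rfl, rfl, rfl⟩

/-- Each of these squares is next to a corner of a frame. Beside an end, across a long or a short
side, the tile belongs to the atomic set or has a plain passing arm; in the middle of a long side it
belongs to the pair set; all others lie between plain arms. -/
theorem Laid.legal_mid {S : Code} {τ : ℤ × ℤ → Tile} {F : Set Isom} (h : Laid τ F)
    (hT : ∀ k ∈ F, ∃ i, ∃ d ∈ S i, Typed τ k i d ∧ ∃ β, S.Has β ∧
      Centred τ k d (pairTable β.child β.digit i)) {m : ℤ × ℤ} (hm : (m.1 + m.2) % 2 = 1) :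
    (τ m).cls ∈ tileSet S := by
  have hc : (τ m).cornered = false := by
    rw [← Bool.not_eq_true]
    intro hc
    have := (h.aligned _ _).1 (show K τ (m.1, m.2) from hc)
    omega
  obtain ⟨q, j, hq, rfl⟩ : ∃ q j, K τ q ∧ m = q + vec j := by
    obtain ⟨x, y⟩ := m
    rcases Int.emod_two_eq_zero_or_one x with hx | hx
    · exact ⟨(x - 1, y), 1, (h.aligned _ _).2 (by omega), by ext <;> simp [vec]⟩
    · exact ⟨(x, y - 1), 0, (h.aligned _ _).2 (by omega), by ext <;> simp [vec]⟩
  obtain ⟨k, hk, hqk⟩ := h.cover q hq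
  have hM := h.marked k hk
  obtain ⟨i, D, hD, hty, β, hβ, hce⟩ := hT k hk
  have common : ∀ {t}, t ∈ commonTiles → t ∈ tileSet S := fun ht => .inl (.inl (.inr ht))
  have atom : ∀ x ∈ atomList i D, cross x.1 x.2 ∈ tileSet S := fun x hx =>
    .inl (.inr ⟨⟨i, D⟩, hD, mem_atomTiles.2 ⟨x, hx, rfl⟩⟩)
  have north : ∀ d, (τ ((k * sym d).point (-2, 1))).cornered = false →
      (τ ((k * sym d).point (-2, 1))).cls ∈ tileSet S := by
    intro d hc
    rw [cls_north h.tiling hM hc (hty.north d) (hty.ends d 0)]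
    exact atom _ (north_mem i D d)
  have plain : ∀ d (p : ℤ × ℤ) (j : Dir), (k * sym d).point p ∈ corners k →
      (τ ((k * sym d).point p)).edge ((k * sym d).dir j) = plus → (p + vec j + vec j).1 < -3 ∨
      (p + vec j + vec j).2 > 1 → (τ ((k * sym d).point (p + vec j))).cls ∈ tileSet S := by
    intro d p j hq he hp
    rw [Isom.point_add_vec]
    refine common (h.plain_mid hk hq he fun hq' => ?_)
    rw [← Isom.point_add_vec, ← Isom.point_add_vec, ← corners_mul_sym k d] at hq'
    obtain ⟨x, y, hx, hy, e⟩ := mem_corners.1 hq'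
    rw [Isom.point_injective _ e] at hp
    dsimp only at hp
    omega
  have centre : ∀ d, (τ ((k * sym d).point (0, 1))).cls ∈ tileSet S := by
    intro d
    have hx := pairTable_opp β.child β.digit i
    have mem : ∀ t ∈ pair3 (nim D (pairTable β.child β.digit i).1) (pairTable β.child β.digit i).2,
        t ∈ tileSet S := fun t ht => .inr ⟨⟨i, D⟩, β, hD, hβ, ht⟩
    generalize pairTable β.child β.digit i = x at *
    -- The table describes the arm through the middle as seen from one corner of the frame. The
    -- symmetry `e` to the given corner takes the square to the upper or to the lower one of the two
    -- tiles of the pair.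
    obtain ⟨e, rfl⟩ : ∃ e, d = nim (nim D x.1) e := ⟨nim (nim D x.1) d, (nim_nim_cancel _ _).symm⟩
    have cor : ∀ y, y = 1 ∨ y = -1 → (k * sym (nim D x.1)).point (-1, y) ∈ corners k := by
      intro y hy
      rw [← corners_mul_sym k (nim D x.1), mem_corners]
      exact ⟨-1, y, by omega, by omega, rfl⟩
    have dg : ∀ y, y = 1 ∨ y = -1 → Diag ((k * sym (nim D x.1)).point (0, 0))
        ((k * sym (nim D x.1)).point (-1, y)) := by
      intro y hy
      rw [diag_point]
      simp only [Diag]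
      omega
    have ps := fun j => h.pass hk (cor 1 (.inl rfl)) (dg 1 (.inl rfl)) j
    obtain ⟨r, hr⟩ := h.even_of_diag hk (cor 1 (.inl rfl)) (dg 1 (.inl rfl))
    have un : ∀ j, (τ ((k * sym (nim D x.1)).point (0, 0) + vec j)).cornered = false := by
      intro j
      rw [← Bool.not_eq_true]
      intro hc
      have := (h.aligned _ _).1 (show K τ (((k * sym (nim D x.1)).point (0, 0) + vec j).1,
        ((k * sym (nim D x.1)).point (0, 0) + vec j).2) from hc)
      have hj := vec_parity j
      obtain ⟨a, b⟩ := r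
      rw [hr, two_smul_pair] at this
      simp only [Prod.fst_add, Prod.snd_add] at this
      omega
    have pt0 : (k * sym (nim D x.1)).point (0, 0) + vec ((k * sym (nim D x.1)).dir 0) =
        (k * sym (nim D x.1)).point (0, 1) := by rw [← Isom.point_add_vec]; rfl
    have pt2 : (k * sym (nim D x.1)).point (0, 0) + vec ((k * sym (nim D x.1)).dir 2) =
        (k * sym (nim D x.1)).point (0, -1) := by rw [← Isom.point_add_vec]; rfl
    have key := cls_centre h.tiling hM (d := nim D x.1) hx ?_ ?_ ?_
    · rw [← sym_mul_sym, ← mul_assoc, Isom.mul_point (k * sym (nim D x.1))]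
      have : ∀ e, (sym e).point (0, 1) = (0, 1) ∨ (sym e).point (0, 1) = (0, -1) := by decide
      rcases this e with he | he <;> rw [he]
      · rw [key.1]; exact mem _ (.inl rfl)
      · rw [key.2]; exact mem _ (.inr rfl)
    · rintro y (rfl | rfl)
      · rw [← pt0]; exact un _
      · rw [← pt2]; exact un _
    · rintro y (rfl | rfl)
      · exact hce.north
      · rw [← pt0, ps, hce.north]
    · rintro y (rfl | rfl)
      · exact hce.south
      · rw [← pt2, ps, hce.south]
  have h4 : ∀ j : Dir, j = 0 ∨ j = 1 ∨ j = 2 ∨ j = 3 := by decide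
  obtain ⟨d, hd⟩ := id hqk
  obtain ⟨j, rfl⟩ : ∃ i, (k * sym d).dir i = j := ⟨_, (k * sym d).dir_inv_dir j⟩
  have hd' := marked_corner hM d
  rcases hd with rfl | rfl <;> rw [← Isom.point_add_vec] at hc ⊢ <;> rcases h4 j with rfl | rfl | rfl | rfl
  · exact plain d _ 0 hqk (by rw [hd'.1, Isom.tile_edge_dir, (corner_edges d).1, mark_plus]) (by decide)
  · exact north d hc
  · have := cls_west h.tiling hM hc (hty.west d) (hty.ends d 3)
    change (τ ((k * sym d).point (-3, 0))).cls ∈ _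
    rw [this]
    have hr := cross_h0_reflect (nim d 2) (endEdge i (nim D d) 3) (opp (endEdge i (nim D d) 3))
    rw [show nim (nim d 2) 2 = d by clear * -; revert d; decide] at hr
    rcases west_mem i D d with (h1 | h1) | ⟨h1 | h1, h2⟩ | ⟨h1 | h1, h2⟩
    · exact atom _ h1
    · rw [hr]; exact atom _ h1
    · rw [h1, h2]; exact common (.inl (.inr (.inl rfl)))
    · rw [h1, h2]; exact common (.inl (.inr (.inr rfl)))
    · rw [hr, h2, h1]; exact common (.inl (.inr (.inl rfl)))
    · rw [hr, h2, h1]; exact common (.inl (.inr (.inr rfl)))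
  · exact plain d _ 3 hqk (by rw [hd'.1, Isom.tile_edge_dir, (corner_edges d).2.1, mark_plus]) (by decide)
  · exact plain d _ 0 hqk (by rw [hd'.2, Isom.tile_edge_dir, (corner_edges d).2.2.1, mark_plus]) (by decide)
  · exact centre d
  · rw [Isom.point_add_vec]
    have e2 : (k * sym d).point (-1, -1) = (k * sym (nim d 2)).point (-1, 1) := by
      rw [← sym_mul_sym, ← mul_assoc, Isom.mul_point (k * sym d)]; rfl
    refine common (h.plain_mid hk hqk ?_ fun _ => ?_)
    · rw [hd'.2, Isom.tile_edge_dir, (corner_edges d).2.2.2, mark_plus]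
    · have e3 : (k * sym d).dir 2 + 2 = (k * sym (nim d 2)).dir 2 := by
        rw [← Isom.dir_add_two, ← sym_mul_sym, ← mul_assoc, Isom.mul_dir (k * sym d)]; rfl
      rw [← Isom.point_add_vec, ← Isom.point_add_vec, e3]
      change (τ ((k * sym d).point (-1, -1))).edge _ = _
      rw [e2, (marked_corner hM _).2, Isom.tile_edge_dir, (corner_edges _).2.2.2, mark_plus]
  · exact north d hc

end DominoTiles

namespace DominoTiles

/-! ### Existence of tilings -/

theorem cross_h3_reflect (y : Digit) (m m' : Marking) :
    cross (h3 y) (m, m') = cross (h3 (nim y 1)) (m.reflect, m'.reflect) ∧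
    cross (hNeg3 y) (m, m') = cross (hNeg3 (nim y 1)) (m.reflect, m'.reflect) := by
  have : nim (nim y 1) 1 = y := by revert y; decide
  constructor
  · rw [cross_eq, cross_eq, ← Isom.tile_cls (sym 1) (crossTile (h3 y) _)]
    refine congrArg _ (tile_ext4 rfl rfl ?_ rfl rfl)
    change (⟨-1, 1, 3, y⟩ : Marking) = ⟨-1, 1, 3, nim (nim y 1) 1⟩
    rw [this]
  · rw [cross_eq, cross_eq, ← Isom.tile_cls (sym 1) (crossTile (hNeg3 y) _)]
    refine congrArg _ (tile_ext4 rfl rfl ?_ rfl rfl)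
    change (⟨-1, -1, 3, y⟩ : Marking) = ⟨-1, -1, 3, nim (nim y 1) 1⟩
    rw [this]

theorem cross_h3_vPlain_mem (y : Digit) : cross (h3 y) vPlain ∈ otherTiles ∧
    cross (hNeg3 y) vPlain ∈ otherTiles := by
  have h4 : ∀ y : Digit, y = 0 ∨ y = 1 ∨ y = 2 ∨ y = 3 := by decide
  have e1 : cross (h3 1) vPlain = cross (h3 0) vPlain := (cross_h3_reflect 1 _ _).1
  have e3 : cross (h3 3) vPlain = cross (h3 2) vPlain := (cross_h3_reflect 3 _ _).1
  have f1 : cross (hNeg3 1) vPlain = cross (hNeg3 0) vPlain := (cross_h3_reflect 1 _ _).2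
  have f3 : cross (hNeg3 3) vPlain = cross (hNeg3 2) vPlain := (cross_h3_reflect 3 _ _).2
  rcases h4 y with rfl | rfl | rfl | rfl
  · exact ⟨.inr (by simp), .inr (by simp)⟩
  · rw [e1, f1]; exact ⟨.inr (by simp), .inr (by simp)⟩
  · exact ⟨.inr (by simp), .inr (by simp)⟩
  · rw [e3, f3]; exact ⟨.inr (by simp), .inr (by simp)⟩

theorem pairTable_vertical : ∀ i d i', (pairTable i d i').2 = vPlain ∨
    ∃ z w, (pairTable i d i').2 = v z w := by decide

theorem tileSet_subset (S : Code) : tileSet S ⊆ masterTiles := by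
  rintro t (((h | h) | ⟨⟨i, d⟩, -, h⟩) | ⟨α, β, -, -, h⟩)
  · exact .inl (.inl h)
  · rcases h with h | ⟨z, w, rfl⟩
    · refine .inr (.inr ?_)
      rcases h with rfl | rfl | rfl <;> simp
    · exact .inr (.inl (.inr ⟨z, w, rfl⟩))
  · have key : ∀ i d, ∀ x ∈ atomList i d, (∃ y, x = (h1 y, vPlain)) ∨ ∃ y, x ∈
        ([(h0 y, v 3 0), (h0 y, v 3 2), (h1 y, v 0 0), (h1 y, v 0 2), (h1 y, v 1 1), (h1 y, v 1 3),
          (h1 y, v 2 1), (h1 y, v 2 3), (h1 y, v 3 1), (h1 y, v 3 3)] :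
            List ((Marking × Marking) × (Marking × Marking))) := by decide
    obtain ⟨x, hx, rfl⟩ := mem_atomTiles.1 h
    rcases key i d x hx with ⟨y, rfl⟩ | ⟨y, hy⟩
    · have h4 : ∀ y : Digit, y = 0 ∨ y = 1 ∨ y = 2 ∨ y = 3 := by decide
      refine .inr (.inr ?_)
      rcases h4 y with rfl | rfl | rfl | rfl <;> simp
    · refine .inl (.inr ⟨y, ?_⟩)
      simp only [List.mem_cons, List.not_mem_nil, or_false] at hy
      rcases hy with rfl | rfl | rfl | rfl | rfl | rfl | rfl | rfl | rfl | rfl <;> simp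
  · refine .inr ?_
    rcases pairTable_vertical β.child β.digit α.child with e | ⟨z, w, e⟩
    · rcases h with rfl | rfl <;> rw [e]
      · exact (cross_h3_vPlain_mem _).1
      · exact (cross_h3_vPlain_mem _).2
    · rcases h with rfl | rfl <;> rw [e]
      · exact .inl (.inl ⟨_, z, w, .inl rfl⟩)
      · exact .inl (.inl ⟨_, z, w, .inr rfl⟩)

theorem outward_subset (S : Code) : outwardTiles ⊆ tileSet S := fun _ h => .inl (.inl (.inl h))

/-- The corner of the parent next to the centre of a child, and the direction to it from the end. -/
def centreCorner (i : Fin 4) : Digit × Dir :=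
  (![(0, 0), (2, 0), (1, 1), (1, 3)] : Fin 4 → Digit × Dir) i

theorem centreCorner_point : ∀ i f, (childAt 0 i * sym f).point (0, 0) =
    2 • (sym (centreCorner i).1).point ((-2, 0) + vec (centreCorner i).2) := by decide

theorem centreCorner_dir : ∀ b e i, (childAt 0 i * sym (pairTable b e i).1).dir 0 =
    (sym (centreCorner i).1).dir (centreCorner i).2 := by decide

/-- The meaning of the pair table: the middle of a child is crossed by an arm that leaves an end of
its parent. This end is a corner of the grandparent, so the arm depends only on the type `(b, e)` of
the parent and on which child is crossed. -/
theorem centreCorner_mark : ∀ b e i, (childAt 0 i * sym (pairTable b e i).1).mark (pairTable b e i).2.1 =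
    (sym (centreCorner i).1).mark (endEdge b (nim e (centreCorner i).1) (centreCorner i).2) := by decide

theorem Typed.mid {τ : ℤ × ℤ → Tile} {g : Isom} {b : Fin 4} {e : Digit} (h : Typed τ g b e) (i : Fin 4) :
    (τ ((g * sym (centreCorner i).1).point ((-2, 0) + vec (centreCorner i).2))).edge
      ((g * sym (centreCorner i).1).dir (centreCorner i).2) = (g * sym (centreCorner i).1).mark
        (endEdge b (nim e (centreCorner i).1) (centreCorner i).2) := by
  have h4 : ∀ i : Fin 4, i = 0 ∨ i = 1 ∨ i = 2 ∨ i = 3 := by decide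
  rcases h4 i with rfl | rfl | rfl | rfl
  exacts [h.north 0, h.north 2, h.east 1, h.west 1]

theorem Laid.centred {τ τ' : ℤ × ℤ → Tile} (he : ∀ p, (τ (2 • p)).edge = (τ' p).edge)
    (hτ' : IsTiling τ') {g : Isom} {b : Fin 4} {e : Digit} (ht : Typed τ' g b e) (i : Fin 4)
    (d : Digit) : Centred τ (childFrame 0 (scale g) i d) d (pairTable b e i) := by
  have hG : childFrame 0 (scale g) i d * sym (nim d (pairTable b e i).1) =
      scale g * (childAt 0 i * sym (pairTable b e i).1) := by
    rw [childFrame_eq, mul_assoc, mul_assoc, sym_mul_sym, nim_nim_cancel]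
  have hp : (scale g * (childAt 0 i * sym (pairTable b e i).1)).point (0, 0) =
      2 • (g * sym (centreCorner i).1).point ((-2, 0) + vec (centreCorner i).2) := by
    rw [Isom.mul_point, centreCorner_point, scale_point, Isom.mul_point]
  have hd : (scale g * (childAt 0 i * sym (pairTable b e i).1)).dir 0 =
      (g * sym (centreCorner i).1).dir (centreCorner i).2 := by
    rw [Isom.mul_dir, centreCorner_dir, scale_dir, Isom.mul_dir]
  have hm : (scale g * (childAt 0 i * sym (pairTable b e i).1)).mark (pairTable b e i).2.1 =
      (g * sym (centreCorner i).1).mark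
        (endEdge b (nim e (centreCorner i).1) (centreCorner i).2) := by
    rw [Isom.mul_mark, centreCorner_mark, scale_mark, Isom.mul_mark]
  constructor
  · rw [hG, hp, he, hd, hm, ht.mid]
  · rw [hG, hp, he, show (2 : Dir) = 0 + 2 from rfl, Isom.dir_add_two, hd, pairTable_opp, mark_opp, hm,
      ← ht.ends, Isom.point_add_vec]
    exact hτ'.fit _ _

/-- Every marked frame of level `0` looks like a child that the code allows. -/
def AllTyped (S : Code) (τ : ℤ × ℤ → Tile) : Prop :=
  ∀ k, Marked τ 0 k → ∃ i, ∃ d ∈ S i, Typed τ k i d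

theorem corner_cls_mem (k : Bool) (o : Bool) (d : Digit) : (corner k o d).cls ∈ outwardTiles := by
  cases o
  · exact ⟨k, d, .inr rfl⟩
  · exact ⟨k, d, .inl rfl⟩

theorem exists_corner {g : Isom} {q : ℤ × ℤ} (hq : q ∈ corners g) :
    ∃ o d, q = (g * sym d).point (cornerPos o) := by
  obtain ⟨d, h | h⟩ := hq
  · exact ⟨true, d, h⟩
  · exact ⟨false, d, h⟩

/-- The orientations of all frames of the inflated tiling are known. If this also holds in the
coarse tiling, then all new squares are legal, and illegal squares can only be inherited, at doubled
coordinates. A first inflation of any composed tiling provides the missing knowledge. -/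
theorem Composed.exists_inflation {S : Code} {τ' : ℤ × ℤ → Tile} (h : Composed τ')
    (χ : Isom → Fin 4 → Digit) (hχ : ∀ g i, χ g i ∈ S i) : ∃ τ, Composed τ ∧ Aligned τ ∧ renorm τ = τ' ∧
      (∀ g i, Marked τ' 0 g → Marked τ 0 (childFrame 0 (scale g) i (χ g i))) ∧ AllTyped S τ ∧
      (AllTyped S τ' → ∀ q, (∀ p, q = 2 • p → (τ' p).cls ∈ tileSet S) → (τ q).cls ∈ tileSet S) := by
  obtain ⟨τ, hL, he⟩ := h.inflate χ
  have he' : ∀ p, (τ (2 • p)).edge = (τ' p).edge := fun p => by rw [he]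
  refine ⟨τ, hL.composed, hL.aligned, h.renorm_eq hL he, fun g i hg => hL.marked _ ⟨g, i, hg, rfl⟩,
    fun k hk => ?_, fun hT q hq => ?_⟩
  · obtain ⟨g, i, hg, rfl⟩ := hL.mem hk
    exact ⟨i, _, hχ g i, hL.typed he' hg i _⟩
  · rcases Int.emod_two_eq_zero_or_one (q.1 + q.2) with h0 | h1
    · rcases Int.emod_two_eq_zero_or_one q.1 with h2 | h2
      · obtain ⟨p, rfl⟩ : ∃ p, q = 2 • p := by
          refine ⟨(q.1 / 2, q.2 / 2), ?_⟩
          rw [two_smul_pair]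
          ext <;> dsimp only <;> omega
        rw [he]
        by_cases hk : K τ' p
        · obtain ⟨g, hg, hp⟩ := h.frame p hk
          obtain ⟨o, d, rfl⟩ := exists_corner hp
          rw [marked_corner' hg]
          have e : (⟨false, ((g * sym d).tile (corner true o d)).edge⟩ : Tile) =
              (g * sym d).tile (corner false o d) := by cases o <;> rfl
          rw [e, Isom.tile_cls]
          exact outward_subset S (corner_cls_mem _ _ _)
        · have e : (⟨false, (τ' p).edge⟩ : Tile) = τ' p := by
            ext1
            · exact (Bool.not_eq_true _ ▸ hk : (τ' p).cornered = false).symm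
            · rfl
          rw [e]; exact hq p rfl
      · obtain ⟨k, hk, hqk⟩ := hL.cover q ((hL.aligned q.1 q.2).2 (by omega))
        obtain ⟨o, d, rfl⟩ := exists_corner hqk
        rw [marked_corner' (hL.marked k hk), Isom.tile_cls]
        exact outward_subset S (corner_cls_mem _ _ _)
    · refine hL.legal_mid ?_ h1
      rintro _ ⟨g, i, hg, rfl⟩
      obtain ⟨b, e, he1, ht⟩ := hT g hg
      exact ⟨i, _, hχ g i, hL.typed he' hg i _, ⟨b, e⟩, he1, Laid.centred he' h.tiling ht i _⟩

/-! ### Limits of inflated tilings -/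

theorem act_edge_dir (a : Isom) (τ : ℤ × ℤ → Tile) (p : ℤ × ℤ) (j : Dir) :
    (act a τ (a.point p)).edge (a.dir j) = a.mark ((τ p).edge j) := act_edge a τ p j

theorem Typed.act {τ : ℤ × ℤ → Tile} {g : Isom} {b : Fin 4} {e : Digit} (h : Typed τ g b e) (a : Isom) :
    Typed (act a τ) (a * g) b e := by
  constructor <;> intros <;>
    simp only [mul_assoc, Isom.mul_point a, Isom.mul_dir a, act_edge_dir, Isom.mul_mark a] <;> congr 1
  exacts [h.ends _ _, h.north _, h.east _, h.west _]

theorem AllTyped.act {S : Code} {τ : ℤ × ℤ → Tile} (h : AllTyped S τ) (a : Isom) :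
    AllTyped S (act a τ) := by
  intro k hk
  obtain ⟨i, d, hd, ht⟩ := h _ (marked_act_iff.1 hk)
  refine ⟨i, d, hd, ?_⟩
  have := ht.act a
  rwa [mul_inv_cancel_left] at this

/-- The sites near a point. -/
def near (c : ℤ × ℤ) : Set (ℤ × ℤ) := Set.Icc (c - (4, 4)) (c + (4, 4))

theorem near_finite (c : ℤ × ℤ) : (near c).Finite := Set.finite_Icc _ _

theorem point_mem_near (g : Isom) {p : ℤ × ℤ} (hp : p ∈ near 0) : g.point p ∈ near g.c := by
  obtain ⟨x, y⟩ := p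
  simp only [near, Set.mem_Icc, Prod.le_def, Prod.fst_sub, Prod.fst_add, Prod.snd_sub, Prod.snd_add,
    Isom.point, Prod.smul_fst, Prod.smul_snd, smul_eq_mul, Prod.fst_zero, Prod.snd_zero] at hp ⊢
  rcases g.vec_cases with ⟨hu, hw | hw⟩ | ⟨hu, hw | hw⟩ | ⟨hu, hw | hw⟩ | ⟨hu, hw | hw⟩ <;>
    rw [hu, hw] <;> dsimp only <;> omega

theorem sym_mem_near : ∀ d, (sym d).point (-3, 1) ∈ near 0 ∧ (sym d).point (-1, 1) ∈ near 0 ∧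
    (sym d).point (-2, 0) ∈ near 0 ∧ (sym d).point (-2, 1) ∈ near 0 ∧ (sym d).point (-1, 0) ∈ near 0 ∧
    (sym d).point (-3, 0) ∈ near 0 := by
  simp only [near, Set.mem_Icc, Prod.le_def]; decide

theorem marked_congr {τ τ' : ℤ × ℤ → Tile} {g : Isom} (h : ∀ p ∈ near g.c, τ p = τ' p)
    (hm : Marked τ 0 g) : Marked τ' 0 g := by
  rw [marked_zero_iff]
  intro d
  rw [Quarter, act_inv_eq_iff, act_inv_eq_iff, ← (marked_corner hm d).1, ← (marked_corner hm d).2,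
    Isom.mul_point, Isom.mul_point, h _ (point_mem_near g (sym_mem_near d).1),
    h _ (point_mem_near g (sym_mem_near d).2.1)]
  exact ⟨rfl, rfl⟩

theorem typed_congr {τ τ' : ℤ × ℤ → Tile} {g : Isom} (h : ∀ p ∈ near g.c, τ p = τ' p) {b : Fin 4}
    {e : Digit} (hm : Typed τ g b e) : Typed τ' g b e := by
  have h' : ∀ p d, (sym d).point p ∈ near 0 → τ' ((g * sym d).point p) = τ ((g * sym d).point p) :=
    fun p d hp => (h _ (by rw [Isom.mul_point]; exact point_mem_near g hp)).symm
  constructor <;> intro f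
  · rw [h' _ f (sym_mem_near f).2.2.1]; exact hm.ends f
  · rw [h' _ f (sym_mem_near f).2.2.2.1]; exact hm.north f
  · rw [h' _ f (sym_mem_near f).2.2.2.2.1]; exact hm.east f
  · rw [h' _ f (sym_mem_near f).2.2.2.2.2]; exact hm.west f

/-- The compactness of the space of all configurations of tiles. -/
theorem exists_limit (σ : ℕ → ℤ × ℤ → Tile) : ∃ τ : ℤ × ℤ → Tile, ∀ A : Set (ℤ × ℤ), A.Finite →
    ∀ N, ∃ n, N ≤ n ∧ ∀ p ∈ A, σ n p = τ p := by
  have h : ∀ p, ∃ t, ∀ᶠ n in (Filter.hyperfilter ℕ : Filter ℕ), σ n p = t := by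
    intro p
    obtain ⟨t, ht⟩ := Ultrafilter.eq_pure_of_finite ((Filter.hyperfilter ℕ).map fun n => σ n p)
    refine ⟨t, ?_⟩
    have : {t} ∈ (Filter.hyperfilter ℕ).map fun n => σ n p := by
      rw [ht]; exact Ultrafilter.mem_pure.2 rfl
    exact this
  choose τ hτ using h
  refine ⟨τ, fun A hA N => ?_⟩
  have h1 : ∀ᶠ n in (Filter.hyperfilter ℕ : Filter ℕ), ∀ p ∈ A, σ n p = τ p :=
    (Filter.eventually_all_finite hA).2 fun p _ => hτ p
  have h2 : ∀ᶠ n in (Filter.hyperfilter ℕ : Filter ℕ), N ≤ n :=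
    Nat.hyperfilter_le_atTop (Filter.eventually_ge_atTop N)
  exact (h2.and h1).exists

/-- A limit of tilings, which are legal in larger and larger regions. -/
theorem limit_mem {S : Code} {σ : ℕ → ℤ × ℤ → Tile} {τ : ℤ × ℤ → Tile}
    (h : ∀ A : Set (ℤ × ℤ), A.Finite → ∀ N, ∃ n, N ≤ n ∧ ∀ p ∈ A, σ n p = τ p)
    (h1 : ∀ n, IsTiling (σ n)) (h2 : ∀ n, AllTyped S (σ n))
    (h3 : ∀ p, ∃ N, ∀ n, N ≤ n → (σ n p).cls ∈ tileSet S) : τ ∈ Tilings (tileSet S) ∧ AllTyped S τ := by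
  have fits : ∀ p j, (τ (p + vec j)).edge (j + 2) = opp ((τ p).edge j) := by
    intro p j
    obtain ⟨n, -, hn⟩ := h {p, p + vec j} (Set.toFinite _) 0
    rw [← hn p (.inl rfl), ← hn (p + vec j) (.inr rfl)]
    exact (h1 n).fit p j
  refine ⟨⟨isTiling_of_fits (fun p => fits p 0) (fun p => fits p 1) fun x y => ?_, fun p => ?_⟩,
    fun k hk => ?_⟩
  · have hfin : (block x y).Finite := by
      refine (Set.finite_Icc (x, y) (x + 1, y + 1)).subset ?_
      rintro ⟨a, b⟩ hab
      simp only [block, Set.mem_ofPred_eq] at hab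
      simp only [Set.mem_Icc, Prod.le_def]
      omega
    obtain ⟨n, -, hn⟩ := h _ hfin 0
    obtain ⟨q, ⟨hq, hk⟩, hu⟩ := (h1 n).unique_cornered x y
    refine ⟨q, ⟨hq, by rw [← hn q hq]; exact hk⟩, ?_⟩
    rintro q' ⟨hq', hk'⟩
    exact hu q' ⟨hq', by rw [hn q' hq']; exact hk'⟩
  · obtain ⟨N, hN⟩ := h3 p
    obtain ⟨n, hn, e⟩ := h {p} (Set.finite_singleton p) N
    rw [← e p rfl]
    exact hN n hn
  · obtain ⟨n, -, hn⟩ := h _ (near_finite k.c) 0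
    obtain ⟨i, d, hd, ht⟩ := h2 n k (marked_congr (fun p hp => (hn p hp).symm) hk)
    exact ⟨i, d, hd, typed_congr hn ht⟩

/-- Each inflation doubles the coordinates of the possibly illegal squares. The base case inflates
the seed once to make its frames typed and promises nothing about legality. -/
theorem exists_nearly_legal {S : Code} (hS : S.Full) (n : ℕ) : ∃ τ, Composed τ ∧ AllTyped S τ ∧
    ∀ p : ℤ × ℤ, ¬ ((2 : ℤ) ^ n ∣ p.1 ∧ (2 : ℤ) ^ n ∣ p.2) → (τ p).cls ∈ tileSet S := by
  choose χ hχ using hS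
  induction n with
  | zero =>
    obtain ⟨τ', h⟩ := exists_composed
    obtain ⟨τ, h1, -, -, -, h2, -⟩ := h.exists_inflation (fun _ => χ) fun _ => hχ
    exact ⟨τ, h1, h2, fun p hp => absurd (by simp) hp⟩
  | succ n ih =>
    obtain ⟨τ', h, hT, hl⟩ := ih
    obtain ⟨τ, h1, -, -, -, h2, h3⟩ := h.exists_inflation (fun _ => χ) fun _ => hχ
    refine ⟨τ, h1, h2, fun q hq => h3 hT q ?_⟩
    rintro ⟨a, b⟩ rfl
    refine hl _ fun hab => hq ?_
    rw [two_smul_pair, pow_succ, mul_comm _ (2 : ℤ)]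
    exact ⟨mul_dvd_mul_left _ hab.1, mul_dvd_mul_left _ hab.2⟩

theorem exists_typed_tiling {S : Code} (hS : S.Full) :
    ∃ τ ∈ Tilings (tileSet S), AllTyped S τ := by
  have h : ∀ n : ℕ, ∃ σ : ℤ × ℤ → Tile, IsTiling σ ∧ AllTyped S σ ∧
      ∀ p : ℤ × ℤ, |p.1| < n → (σ p).cls ∈ tileSet S := by
    intro n
    obtain ⟨τ, h1, h2, h3⟩ := exists_nearly_legal hS (n + 1)
    -- The bad columns are among the multiples of `2 ^ (n + 1)`. The translation by `2 ^ n` moves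
    -- them to odd multiples of `2 ^ n`, outside the strip `|x| < n` because `n < 2 ^ n`.
    refine ⟨act (turnTo (2 ^ n, 0) 1)⁻¹ τ, h1.tiling.act _, h2.act _, fun p hp => ?_⟩
    rw [act_inv_point, Isom.tile_cls]
    obtain ⟨x, y⟩ := p
    rw [turnTo_point]
    refine h3 _ fun hd => ?_
    have h4 : (n : ℤ) < 2 ^ n := by exact_mod_cast n.lt_two_pow_self
    obtain ⟨c, hc⟩ := hd.1
    dsimp only [Prod.mk_add_mk] at hc hp
    rw [pow_succ] at hc
    generalize (2 : ℤ) ^ n = r at *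
    rw [abs_lt] at hp
    have h5 : 0 < r * (2 * c) := by nlinarith
    have h6 : r * (2 * c) < r * 2 := by nlinarith
    have h7 : 0 < 2 * c := by nlinarith
    have h8 : 2 * c < 2 := by nlinarith
    omega
  choose σ h1 h2 h3 using h
  obtain ⟨τ, hτ⟩ := exists_limit σ
  refine ⟨τ, limit_mem hτ h1 h2 fun p => ⟨p.1.natAbs + 1, fun n hn => h3 n p ?_⟩⟩
  rw [abs_lt]
  omega

end DominoTiles

namespace DominoTiles

/-! ### Realising supertiles -/

theorem childAt_point (n : ℕ) (x y : ℤ) :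
    (childAt n 0).point (x, y) = (-4 * 2 ^ n + x, 2 * 2 ^ n + y) ∧
    (childAt n 1).point (x, y) = (-4 * 2 ^ n - x, -2 * 2 ^ n - y) ∧
    (childAt n 2).point (x, y) = (2 * 2 ^ n - y, x) ∧
    (childAt n 3).point (x, y) = (6 * 2 ^ n + y, -x) := by
  have key : ∀ i c u w, (childAt n i).c = (2 ^ n : ℤ) • c → vec ((childAt n i).dir 1) = u →
      vec ((childAt n i).dir 0) = w → (childAt n i).point (x, y) = (2 ^ n : ℤ) • c + x • u + y • w := by
    rintro i c _ _ h rfl rfl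
    rw [Isom.point, h]
  refine ⟨?_, ?_, ?_, ?_⟩
  · rw [key 0 (-4, 2) (1, 0) (0, 1) rfl rfl rfl]; ext <;> simp <;> ring
  · rw [key 1 (-4, -2) (-1, 0) (0, -1) rfl rfl rfl]; ext <;> simp <;> ring
  · rw [key 2 (2, 0) (0, 1) (-1, 0) rfl rfl rfl]; ext <;> simp; ring
  · rw [key 3 (6, 0) (0, -1) (1, 0) rfl rfl rfl]; ext <;> simp; ring

/-- The quarter of a supertile that is covered by the `i`-th child. -/
def InChild (r : ℤ) (i : Fin 4) (p : ℤ × ℤ) : Prop :=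
  (![-8 * r < p.1 ∧ p.1 < 0 ∧ 0 < p.2 ∧ p.2 < 4 * r, -8 * r < p.1 ∧ p.1 < 0 ∧ -4 * r < p.2 ∧ p.2 < 0,
    0 < p.1 ∧ p.1 < 4 * r ∧ -4 * r < p.2 ∧ p.2 < 4 * r,
    4 * r < p.1 ∧ p.1 < 8 * r ∧ -4 * r < p.2 ∧ p.2 < 4 * r] : Fin 4 → Prop) i

theorem childFrame_point {n : ℕ} {g : Isom} {i : Fin 4} {d : Digit} {x y : ℤ}
    (h : -(4 * 2 ^ n) < x ∧ x < 4 * 2 ^ n ∧ -(2 * 2 ^ n) < y ∧ y < 2 * 2 ^ n) :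
    ∃ p, (childFrame n g i d).point (x, y) = g.point p ∧ InChild (2 ^ n) i p := by
  rw [childFrame_eq, Isom.mul_point]
  refine ⟨_, rfl, ?_⟩
  rw [Isom.mul_point]
  obtain ⟨x', y', e, h'⟩ : ∃ x' y', (sym d).point (x, y) = (x', y') ∧
      (-(4 * 2 ^ n) < x' ∧ x' < 4 * 2 ^ n ∧ -(2 * 2 ^ n) < y' ∧ y' < 2 * 2 ^ n) := by
    rw [sym_point]
    refine ⟨_, _, rfl, ?_⟩
    generalize (2 : ℤ) ^ n = r at *
    split_ifs <;> omega
  rw [e]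
  have hc := childAt_point n x' y'
  have h4 : ∀ i : Fin 4, i = 0 ∨ i = 1 ∨ i = 2 ∨ i = 3 := by decide
  generalize (2 : ℤ) ^ n = r at *
  rcases h4 i with rfl | rfl | rfl | rfl
  · rw [hc.1]; change _ ∧ _ ∧ _ ∧ _; dsimp only; omega
  · rw [hc.2.1]; change _ ∧ _ ∧ _ ∧ _; dsimp only; omega
  · rw [hc.2.2.1]; change _ ∧ _ ∧ _ ∧ _; dsimp only; omega
  · rw [hc.2.2.2]; change _ ∧ _ ∧ _ ∧ _; dsimp only; omega

theorem FramedSupertile.centre_bounds {S : Code} {n : ℕ} {g : Isom} {C : Set (ℕ × Isom)}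
    (h : FramedSupertile S n g C) {k : Isom} (hk : (0, k) ∈ C) : ∃ x y : ℤ, k.c = g.point (x, y) ∧
      -(4 * 2 ^ n) < x ∧ x < 4 * 2 ^ n ∧ -(2 * 2 ^ n) < y ∧ y < 2 * 2 ^ n := by
  induction h with
  | zero g =>
    obtain rfl : k = g := congrArg Prod.snd hk
    exact ⟨0, 0, by simp [Isom.point], by simp⟩
  | succ n g d C hd hC ih =>
    rcases hk with hk | hk
    · exact absurd (congrArg Prod.fst hk) (by simp)
    · obtain ⟨i, hi⟩ := Set.mem_iUnion.1 hk
      obtain ⟨x, y, e, h⟩ := ih i hi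
      obtain ⟨⟨x', y'⟩, e', h'⟩ := childFrame_point (g := g) (i := i) (d := d i) h
      refine ⟨x', y', e.trans e', ?_⟩
      clear e e' h ih
      rw [pow_succ]
      generalize (2 : ℤ) ^ n = r at *
      have h4 : ∀ i : Fin 4, i = 0 ∨ i = 1 ∨ i = 2 ∨ i = 3 := by decide
      rcases h4 i with rfl | rfl | rfl | rfl <;> change _ ∧ _ ∧ _ ∧ _ at h' <;> dsimp only at h' <;> omega

/-- The four children occupy disjoint open rectangles. This is needed to combine orientation choices
in different children into a single function of the frame in `FramedSupertile.deflate`. -/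
theorem child_disjoint {S : Code} {n : ℕ} {g : Isom} {i j : Fin 4} {d e : Digit}
    {C C' : Set (ℕ × Isom)} (h : FramedSupertile S n (childFrame n g i d) C)
    (h' : FramedSupertile S n (childFrame n g j e) C') {k : Isom} (hk : (0, k) ∈ C)
    (hk' : (0, k) ∈ C') : i = j := by
  obtain ⟨x, y, e1, h1⟩ := h.centre_bounds hk
  obtain ⟨x', y', e2, h2⟩ := h'.centre_bounds hk'
  obtain ⟨p, e3, h3⟩ := childFrame_point (g := g) (i := i) (d := d) h1
  obtain ⟨p', e4, h4⟩ := childFrame_point (g := g) (i := j) (d := e) h2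
  obtain rfl : p = p' := g.point_injective (by rw [← e3, ← e4, ← e1, ← e2])
  clear h1 h2 e1 e2 e3 e4 h h' hk hk'
  generalize (2 : ℤ) ^ n = r at *
  have h5 : ∀ i : Fin 4, i = 0 ∨ i = 1 ∨ i = 2 ∨ i = 3 := by decide
  rcases h5 i with rfl | rfl | rfl | rfl <;> rcases h5 j with rfl | rfl | rfl | rfl <;>
    first
      | rfl
      | (exfalso
         change _ ∧ _ ∧ _ ∧ _ at h3
         change _ ∧ _ ∧ _ ∧ _ at h4
         omega)

/-- The frames of positive level of a framed supertile form a supertile half as large, of which the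
frames of level `0` are the children. -/
theorem FramedSupertile.deflate {S : Code} {n : ℕ} :
    ∀ {g : Isom} {C : Set (ℕ × Isom)}, FramedSupertile S (n + 1) (scale g) C →
    ∃ (C' : Set (ℕ × Isom)) (χ : Isom → Fin 4 → Digit), FramedSupertile S n g C' ∧
      (∀ k i, χ k i ∈ S i) ∧ ∀ x ∈ C, (∃ y ∈ C', x = (y.1 + 1, scale y.2)) ∨
        ∃ k i, (0, k) ∈ C' ∧ x = (0, childFrame 0 (scale k) i (χ k i)) := by
  induction n with
  | zero =>
    intro g C h
    cases h with
    | succ _ _ d C hd hC =>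
      refine ⟨{(0, g)}, fun _ => d, .zero g, fun _ => hd, ?_⟩
      rintro x (rfl | hx)
      · exact .inl ⟨_, rfl, rfl⟩
      · obtain ⟨i, hi⟩ := Set.mem_iUnion.1 hx
        have hCi := hC i
        generalize C i = D at hCi hi
        cases hCi with
        | zero => exact .inr ⟨g, i, rfl, hi⟩
  | succ n ih =>
    intro g C h
    cases h with
    | succ _ _ d C hd hC =>
      have h1 : ∀ i, FramedSupertile S (n + 1) (scale (childFrame n g i (d i))) (C i) := by
        intro i; rw [scale_childFrame]; exact hC i
      choose C' χ hC' hχ hx using fun i => ih (h1 i)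
      classical
      -- A frame of level `0` takes its orientations from the child in which it lies; for all other
      -- frames any allowed value will do.
      refine ⟨insert (n + 1, g) (⋃ i, C' i), fun k =>
        if h : ∃ i, (0, k) ∈ C' i then χ h.choose k else χ 0 k, .succ n g d C' hd hC', ?_, ?_⟩
      · intro k i
        dsimp only
        split_ifs
        · exact hχ _ k i
        · exact hχ 0 k i
      · rintro x (rfl | hx')
        · exact .inl ⟨_, .inl rfl, rfl⟩
        · obtain ⟨i, hi⟩ := Set.mem_iUnion.1 hx'
          rcases hx i x hi with ⟨y, hy, e⟩ | ⟨k, j, hk, e⟩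
          · exact .inl ⟨y, .inr (Set.mem_iUnion.2 ⟨i, hy⟩), e⟩
          · refine .inr ⟨k, j, .inr (Set.mem_iUnion.2 ⟨i, hk⟩), ?_⟩
            have h : ∃ i, (0, k) ∈ C' i := ⟨i, hk⟩
            have hi' : h.choose = i := child_disjoint (hC' _) (hC' i) h.choose_spec hk
            dsimp only
            rw [dif_pos h, hi']
            exact e

theorem composed_of_mem {τ : ℤ × ℤ → Tile} (h : τ ∈ Tilings masterTiles) : Composed τ where
  tiling := h.1
  proper p j := by
    have pm : Proper plus ∧ Proper minus := ⟨fun _ => ⟨rfl, rfl⟩, fun _ => ⟨rfl, rfl⟩⟩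
    have of : ∀ {m : Marking}, m = plus ∨ m.b ≠ 0 → Proper m := by
      rintro m (rfl | hb)
      · exact pm.1
      · exact fun h => absurd h hb
    have of' : ∀ {m : Marking}, m = minus ∨ m.b ≠ 0 → Proper m := by
      rintro m (rfl | hb)
      · exact pm.2
      · exact fun h => absurd h hb
    rcases cls_cases (h.2 p) with ho | ⟨i, hc⟩
    · exact of (ho.proper j)
    · have key : ∀ i j : Dir, j = i ∨ j = i + 2 ∨ j = i + side 1 ∨ j = i + side (-1) := by decide
      rcases key i j with rfl | rfl | rfl | rfl
      · exact of hc.proper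
      · rw [hc.pass]; exact (of hc.proper).opp
      · exact of' (hc.properIn 1 one_ne)
      · exact of' (hc.properIn (-1) neg_one_ne)
  frame q hq := by
    obtain ⟨g, d, hg, h⟩ := exists_marked h hq
    exact ⟨g, hg, d, h⟩

theorem tilings_master {S : Code} {τ : ℤ × ℤ → Tile} (h : τ ∈ Tilings (tileSet S)) :
    τ ∈ Tilings masterTiles := ⟨h.1, fun p => tileSet_subset S (h.2 p)⟩

/-- A supertile is obtained by inflating one of half its size with prescribed orientations, and a
tiling that realises the smaller one inflates to a tiling that realises the larger one. That all
frames are typed is carried along, since inflation preserves legality only then. At level `0` any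
marked frame of any tiling is moved into place. -/
theorem exists_realization {S : Code} (hS : S.Full) {n : ℕ} : ∀ {g : Isom} {C : Set (ℕ × Isom)},
    FramedSupertile S n g C → ∃ τ ∈ Tilings (tileSet S), AllTyped S τ ∧ C ⊆ framing τ := by
  induction n with
  | zero =>
    intro g C h
    obtain ⟨τ, hτ, hT⟩ := exists_typed_tiling hS
    obtain ⟨q, ⟨-, hq⟩, -⟩ := hτ.1.unique_cornered 0 0
    obtain ⟨k, d, hk, -⟩ := exists_marked (tilings_master hτ) hq
    refine ⟨act (g * k⁻¹) τ, act_mem_tilings hτ _, hT.act _, ?_⟩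
    cases h with
    | zero =>
      rintro _ rfl
      have := hk.act (g * k⁻¹)
      rwa [inv_mul_cancel_right] at this
  | succ n ih =>
    intro g C h
    -- A translation brings the centre to the origin, where every frame is a magnified one.
    obtain ⟨a, k, rfl⟩ : ∃ a k, g = a * scale k := by
      refine ⟨turnTo g.c 1, ⟨0, g.east, g.flip⟩, Isom.ext ?_ ?_ ?_⟩
      · change g.c = (turnTo g.c 1).point (2 • 0)
        simp [Isom.point, turnTo]
      · change g.east = (turnTo g.c 1).dir g.east
        exact (Isom.one_dir _).symm
      · exact (Bool.false_xor _).symm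
    have h1 := h.move a⁻¹
    rw [inv_mul_cancel_left] at h1
    obtain ⟨C', χ, hC', hχ, hx⟩ := h1.deflate
    obtain ⟨τ', hτ', hT', hC''⟩ := ih hC'
    obtain ⟨τ, h2, h3, h4, h5, h6, h7⟩ :=
      (composed_of_mem (tilings_master hτ')).exists_inflation χ hχ
    have hτ : τ ∈ Tilings (tileSet S) := ⟨h2.tiling, fun q => h7 hT' q fun p _ => hτ'.2 p⟩
    refine ⟨act a τ, act_mem_tilings hτ a, h6.act a, ?_⟩
    have key : moveFrames a⁻¹ C ⊆ framing τ := by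
      intro x hxC
      rcases hx x hxC with ⟨y, hy, rfl⟩ | ⟨k, i, hk, rfl⟩
      · refine marked_of_renorm (tilings_master hτ) h3 ?_
        rw [h4]
        exact hC'' hy
      · exact h5 k i (hC'' hk)
    have := (moveFrames_subset_framing (g := a)).2 key
    rwa [← moveFrames_mul, mul_inv_cancel, show moveFrames 1 C = C by
      ext ⟨n, k⟩; rw [mem_moveFrames, inv_one, one_mul]] at this

/-! ### Substitution tilings as limits of supertiles -/

theorem mem_erase_congr {τ τ' : ℤ × ℤ → Tile} {D : Domino} (h : ∀ p ∈ near D.centre, τ p = τ' p)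
    (hD : D ∈ erase τ) : D ∈ erase τ' := by
  obtain ⟨g, hg, rfl⟩ := hD
  rw [domino_centre] at h
  exact ⟨g, marked_congr h hg, rfl⟩

theorem Domino.exists_interior (D : Domino) : ∃ x y : ℤ, ((x : ℝ) + 1 / 2, (y : ℝ) + 1 / 2) ∈
    interior D.region := by
  refine ⟨D.centre.1, D.centre.2, ?_⟩
  rw [Domino.region_eq, interior_prod_eq, interior_Icc, interior_Icc]
  unfold Domino.halfWidth Domino.halfHeight
  refine ⟨⟨?_, ?_⟩, ?_, ?_⟩ <;> dsimp only <;> split_ifs <;> push_cast <;> linarith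

theorem Domino.mem_interior {D : Domino} {x y : ℤ} (h : ((x : ℝ) + 1 / 2, (y : ℝ) + 1 / 2) ∈ D.region) :
    ((x : ℝ) + 1 / 2, (y : ℝ) + 1 / 2) ∈ interior D.region := by
  have key : ∀ a b z : ℤ, (z : ℝ) + 1 / 2 ∈ Set.Icc (a : ℝ) b → (z : ℝ) + 1 / 2 ∈ Set.Ioo (a : ℝ) b := by
    rintro a b z ⟨h1, h2⟩
    have h3 : (a : ℝ) ≤ z := by
      have : (a : ℝ) < (z + 1 : ℤ) := by push_cast; linarith
      exact_mod_cast Int.lt_add_one_iff.1 (by exact_mod_cast this)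
    have h4 : (z : ℝ) + 1 ≤ b := by
      have : (z : ℝ) < b := by linarith
      exact_mod_cast Int.add_one_le_iff.2 (by exact_mod_cast this)
    exact ⟨by linarith, by linarith⟩
  rw [Domino.region_eq] at h ⊢
  rw [interior_prod_eq, interior_Icc, interior_Icc]
  exact ⟨key _ _ _ h.1, key _ _ _ h.2⟩

/-- The domino that covers a half-integer point contains it in its interior, since the boundaries
lie on integer lines. A further domino of `Y` would overlap with the one of `X` there. -/
theorem IsDominoTiling.eq_of_subset {X Y : Set Domino} (hX : IsDominoTiling X) (hY : IsDominoTiling Y)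
    (h : X ⊆ Y) : Y = X := by
  refine Set.Subset.antisymm (fun D hD => ?_) h
  obtain ⟨x, y, hi⟩ := D.exists_interior
  have : ((x : ℝ) + 1 / 2, (y : ℝ) + 1 / 2) ∈ ⋃ D ∈ X, D.region := by rw [hX.1]; trivial
  obtain ⟨D', hD', hm⟩ := Set.mem_iUnion₂.1 this
  by_cases e : D = D'
  · rwa [e]
  · exact absurd (Domino.mem_interior hm) (Set.disjoint_left.1 (hY.2 hD (h hD') e) hi)

theorem dominoes_subset {C : Set (ℕ × Isom)} {τ : ℤ × ℤ → Tile} (h : C ⊆ framing τ) :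
    dominoes C ⊆ erase τ := dominoes_mono h

/-- Each finite part of `X` lies in a supertile, which is realised in a tiling. A limit of these
tilings contains all dominoes of `X`, and no others, because its erasure is a domino tiling as well.
-/
theorem exists_preimage {S : Code} (hS : S.Full) {X : Set Domino} (hX : IsSubstitutionTiling S X) :
    ∃ τ ∈ Tilings (tileSet S), erase τ = X := by
  let F : ℕ → Set Domino := fun n => {D ∈ X | |D.centre.1| ≤ n ∧ |D.centre.2| ≤ n}
  have hF : ∀ n, (F n).Finite := by
    intro n
    have h1 : ((Set.Icc (-(n : ℤ), -(n : ℤ)) ((n : ℤ), (n : ℤ))) ×ˢ (Set.univ : Set Bool)).Finite :=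
      (Set.finite_Icc _ _).prod Set.finite_univ
    refine (h1.image fun x => (⟨x.1, x.2⟩ : Domino)).subset ?_
    rintro D ⟨-, h2, h3⟩
    rw [abs_le] at h2 h3
    exact ⟨(D.centre, D.horizontal), ⟨⟨⟨h2.1, h3.1⟩, h2.2, h3.2⟩, trivial⟩, rfl⟩
  have h : ∀ n, ∃ τ ∈ Tilings (tileSet S), AllTyped S τ ∧ F n ⊆ erase τ := by
    intro n
    obtain ⟨m, _, ⟨g, C, hC, rfl⟩, hFC⟩ := hX.2 (F n) (fun D hD => hD.1) (hF n)
    obtain ⟨τ, h1, h2, h3⟩ := exists_realization hS hC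
    exact ⟨τ, h1, h2, hFC.trans (dominoes_subset h3)⟩
  choose σ h1 h2 h3 using h
  obtain ⟨τ, hτ⟩ := exists_limit σ
  have hm := (limit_mem hτ (fun n => (h1 n).1) h2 fun p => ⟨0, fun n _ => (h1 n).2 p⟩).1
  refine ⟨τ, hm, hX.1.eq_of_subset (erase_isDominoTiling (tilings_master hm)) fun D hD => ?_⟩
  obtain ⟨n, hn, e⟩ := hτ _ (near_finite D.centre) (D.centre.1.natAbs + D.centre.2.natAbs)
  refine mem_erase_congr e (h3 n ⟨hD, ?_, ?_⟩) <;> rw [abs_le] <;> omega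

end DominoTiles

namespace DominoTiles

/-! ### Aperiodicity -/

/-- The corner `d` of a marked frame and the directions of the arms that leave it. -/
theorem Marked.arms {τ : ℤ × ℤ → Tile} (h : IsTiling τ) {n : ℕ} {g : Isom} (hm : Marked τ n g)
    (d : Digit) : let σ := DominoTiles.act (g * sym d)⁻¹ τ
    (∀ j, ((σ (-3 * 2 ^ n, 2 ^ n)).edge j).a = 1) ∧ ∀ k : ℤ, 0 < k → k < 2 ^ n →
      ((σ (-3 * 2 ^ n + k, 2 ^ n)).edge 1).a = 1 ∧ ((σ (-3 * 2 ^ n + k, 2 ^ n)).edge 3).a = -1 ∧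
      ((σ (-3 * 2 ^ n, 2 ^ n - k)).edge 2).a = 1 ∧ ((σ (-3 * 2 ^ n, 2 ^ n - k)).edge 0).a = -1 := by
  intro σ
  have hσ : IsTiling σ := h.act _
  obtain ⟨h1, -, h3⟩ := hm d
  rw [Isom.comp_eq] at h1 h3
  have e1 : ∀ k, 0 ≤ k → k < 2 ^ n → (σ (-3 * 2 ^ n + k, 2 ^ n)).edge 1 = ⟨1, 1, 1, d⟩ :=
    fun k hk hk' => act_inv_edge (h3 k hk hk').1
  have e2 : ∀ k, 0 ≤ k → k < 2 ^ n → (σ (-3 * 2 ^ n, 2 ^ n - k)).edge 2 = ⟨1, -1, 0, d⟩ :=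
    fun k hk hk' => act_inv_edge (h3 k hk hk').2.1
  have e0 : σ (-3 * 2 ^ n, 2 ^ n) = outerCorner (n == 0) d := (act_inv_eq_iff _ _ _ _).2 h1
  refine ⟨fun j => ?_, fun k hk hk' => ⟨?_, ?_, ?_, ?_⟩⟩
  · rw [e0]
    exact (by decide : ∀ (k : Bool) (d : Digit) (j : Dir), ((outerCorner k d).edge j).a = 1) _ _ _
  · rw [e1 k hk.le hk']
  · rw [hσ.fit (-3 * 2 ^ n + (k - 1), 2 ^ n) 1, e1 (k - 1) (by omega) (by omega)]; rfl
  · rw [e2 k hk.le hk']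
  · rw [hσ.fit (-3 * 2 ^ n, 2 ^ n - (k - 1)) 2, e2 (k - 1) (by omega) (by omega)]; rfl

theorem exists_sym_nonneg (w : ℤ × ℤ) : ∃ d a b, 0 ≤ a ∧ 0 ≤ b ∧ (sym d).lin (a, b) = w ∧
    a = |w.1| ∧ b = |w.2| := by
  have hl : ∀ d (x y : ℤ), (sym d).lin (x, y) = (sym d).point (x, y) := by
    intro d x y
    have : ∀ d, (sym d).c = 0 := by decide
    rw [Isom.point_eq, this, zero_add]
  obtain ⟨x, y⟩ := w
  simp only [hl, sym_point]
  rcases le_total 0 x with hx | hx <;> rcases le_total 0 y with hy | hy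
  · exact ⟨0, x, y, hx, hy, by simp, (abs_of_nonneg hx).symm, (abs_of_nonneg hy).symm⟩
  · exact ⟨2, x, -y, hx, by omega, by simp, (abs_of_nonneg hx).symm, (abs_of_nonpos hy).symm⟩
  · exact ⟨1, -x, y, by omega, hy, by simp, (abs_of_nonpos hx).symm, (abs_of_nonneg hy).symm⟩
  · exact ⟨3, -x, -y, by omega, by omega, by simp, (abs_of_nonpos hx).symm, (abs_of_nonpos hy).symm⟩

theorem lin_abs_le (g : Isom) (v : ℤ × ℤ) : |(g.lin v).1| ≤ |v.1| + |v.2| ∧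
    |(g.lin v).2| ≤ |v.1| + |v.2| := by
  have h1 := abs_nonneg v.1
  have h2 := abs_nonneg v.2
  unfold Isom.lin
  rcases g.vec_cases with ⟨hu, hw | hw⟩ | ⟨hu, hw | hw⟩ | ⟨hu, hw | hw⟩ | ⟨hu, hw | hw⟩ <;>
    rw [hu, hw] <;> simp

/-- A symmetry of the frame makes the coordinates `a`, `b` of the period nonnegative. If one of them
is zero, the period takes the corner, which is outward on all sides, to a point of one of its arms,
or conversely, where an inward marking is required. Otherwise it takes a point of the vertical arm
to a point of the horizontal one, and a crossing tile would have two outward markings. -/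
theorem Marked.not_periodic {τ : ℤ × ℤ → Tile} (h : τ ∈ Tilings masterTiles) {n : ℕ} {g : Isom}
    (hm : Marked τ n g) {v : ℤ × ℤ} (hv : v ≠ 0) (hn : |v.1| + |v.2| < 2 ^ n) :
    ¬ ∀ p, τ (p + v) = τ p := by
  intro hp
  obtain ⟨d, a, b, ha, hb, hw, ha', hb'⟩ := exists_sym_nonneg (g⁻¹.lin v)
  have hl := lin_abs_le g⁻¹ v
  rw [← ha', ← hb'] at hl
  have hlin : (g * sym d).lin (a, b) = v := by
    rw [Isom.mul_lin, hw, ← Isom.mul_lin, mul_inv_cancel, Isom.one_lin]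
  have hab : (a, b) ≠ ((0, 0) : ℤ × ℤ) := by
    intro e
    rw [e] at hlin
    apply hv
    rw [← hlin]
    simp [Isom.lin]
  have hσ : ∀ x y x' y' : ℤ, x' = x + a → y' = y + b →
      DominoTiles.act (g * sym d)⁻¹ τ (x', y') = DominoTiles.act (g * sym d)⁻¹ τ (x, y) := by
    rintro x y _ _ rfl rfl
    rw [act_inv_point, act_inv_point, ← hp ((g * sym d).point (x, y)), ← hlin, ← Isom.point_add]
    rfl
  obtain ⟨h1, h2⟩ := hm.arms h.1 d
  have hM := (act_mem_tilings h (g * sym d)⁻¹).2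
  generalize DominoTiles.act (g * sym d)⁻¹ τ = σ at *
  generalize (2 : ℤ) ^ n = r at *
  rcases ha.eq_or_lt with rfl | ha
  · rcases hb.eq_or_lt with rfl | hb
    · exact hab rfl
    · have e := (h2 b hb (by omega)).2.2.2
      rw [← hσ _ _ (-3 * r) r (by ring) (by ring), h1] at e
      exact neg_one_ne_one e.symm
  · obtain ⟨e1, e2, -, -⟩ := h2 a ha (by omega)
    rcases hb.eq_or_lt with rfl | hb
    · rw [hσ (-3 * r) r (-3 * r + a) r rfl (by ring), h1] at e2
      exact neg_one_ne_one e2.symm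
    · obtain ⟨-, -, e3, e4⟩ := h2 b hb (by omega)
      rw [← hσ (-3 * r) (r - b) (-3 * r + a) r rfl (by ring)] at e3 e4
      rcases cls_cases (hM (-3 * r + a, r)) with ho | ⟨j, hc⟩
      · rw [ho.a] at e2
        exact neg_one_ne_one e2.symm
      · have := (hc.a.1 e1).trans (hc.a.1 e3).symm
        exact absurd this (by decide)

/-! ### The tiles of a code -/

/-- The single outward marking fixes the north of a crossing tile, which leaves the identity and the
left–right reflection. -/
theorem cross_injective {h v h' v' : Marking × Marking} (e : cross h v = cross h' v')
    (h1 : h.1.a = -1) (h2 : h.2.a = -1) (h3 : v.2.a = -1) (h4 : v'.1.a = 1) :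
    (h, v) = (h', v') ∨
      (h, v) = ((h'.2.reflect, h'.1.reflect), (v'.1.reflect, v'.2.reflect)) := by
  rw [cross_eq, cross_eq] at e
  obtain ⟨g, hg⟩ := exists_isom_of_cls_eq e
  have key : ∀ e f, (⟨0, e, f⟩ : Isom).dir 0 = 0 → (f = false ∧ ∀ j, (⟨0, e, f⟩ : Isom).dirInv j = j) ∨
      (f = true ∧ ∀ j, (⟨0, e, f⟩ : Isom).dirInv j = -j) := by decide
  have hd : g.dir 0 = 0 := by
    have ha : ((crossTile h v).edge (g.dir 0)).a = 1 := by
      rw [hg, Isom.tile_edge_dir, Isom.mark_a]; exact h4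
    have h5 : ∀ j : Dir, j = 0 ∨ j = 1 ∨ j = 2 ∨ j = 3 := by decide
    rcases h5 (g.dir 0) with e | e | e | e <;> rw [e] at ha
    · exact e
    · exact absurd (h2.symm.trans ha) neg_one_ne_one
    · exact absurd (h3.symm.trans ha) neg_one_ne_one
    · exact absurd (h1.symm.trans ha) neg_one_ne_one
  have he : ∀ j, (crossTile h v).edge j = g.mark ((crossTile h' v').edge (g.dirInv j)) := by
    intro j; rw [hg]; rfl
  rcases key g.east g.flip hd with ⟨hf, hj⟩ | ⟨hf, hj⟩
  · left
    have hm : ∀ m, g.mark m = m := fun m => by rw [Isom.mark, hf]; rfl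
    simp only [hm] at he
    have he' : ∀ j, (crossTile h v).edge j = (crossTile h' v').edge j := fun j => by
      rw [he]; exact congrArg _ (hj j)
    exact Prod.ext (Prod.ext (he' 3) (he' 1)) (Prod.ext (he' 0) (he' 2))
  · right
    have hm : ∀ m, g.mark m = m.reflect := fun m => by rw [Isom.mark, hf]; rfl
    simp only [hm] at he
    have he' : ∀ j, (crossTile h v).edge j = ((crossTile h' v').edge (-j)).reflect := fun j => by
      rw [he]; exact congrArg (fun i => ((crossTile h' v').edge i).reflect) (hj j)
    exact Prod.ext (Prod.ext (he' 3) (he' 1)) (Prod.ext (he' 0) (he' 2))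

theorem cross_ne_outward {h v : Marking × Marking} (h1 : h.1.a = -1) : cross h v ∉ outwardTiles := by
  rintro ⟨k, d, e | e⟩ <;> rw [cross_eq] at e <;> obtain ⟨g, hg⟩ := exists_isom_of_cls_eq e
  · have ho : Outward (crossTile h v) := ⟨g, k, d, .inl hg⟩
    exact neg_one_ne_one (h1.symm.trans (ho.a 3))
  · have ho : Outward (crossTile h v) := ⟨g, k, d, .inr hg⟩
    exact neg_one_ne_one (h1.symm.trans (ho.a 3))

/-- The chosen key tile is listed for no other atomic symbol. Its presence in `tileSet S` therefore
shows that its digit belongs to the code. -/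
theorem exists_keyTile : ∀ i d, ∃ y z w, keyTile i d = cross (h1 y) (v z w) ∧
    ∀ i' d', (h1 y, v z w) ∈ atomList i' d' → i = i' ∧ d = d' := by
  have h4 : ∀ i : Fin 4, i = 0 ∨ i = 1 ∨ i = 2 ∨ i = 3 := by decide
  intro i d
  rcases h4 i with rfl | rfl | rfl | rfl
  · exact ⟨_, _, _, rfl, by revert d; decide⟩
  · exact ⟨_, _, _, rfl, by revert d; decide⟩
  · exact ⟨_, _, _, rfl, by revert d; decide⟩
  · exact ⟨_, _, _, rfl, by revert d; decide⟩

theorem mem_of_keyTile {S : Code} {i : Fin 4} {d : Digit} (h : keyTile i d ∈ tileSet S) : d ∈ S i := by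
  obtain ⟨y, z, w, e, hk⟩ := exists_keyTile i d
  rw [e] at h
  have inj : ∀ h' v' : Marking × Marking, v'.1.a = 1 → cross (h1 y) (v z w) = cross h' v' →
      (h1 y, v z w) = (h', v') ∨
        (h1 y, v z w) = ((h'.2.reflect, h'.1.reflect), (v'.1.reflect, v'.2.reflect)) :=
    fun h' v' hv e => cross_injective e rfl rfl rfl hv
  have hc : ∀ h' v' : Marking × Marking, v'.1.a = 1 → cross (h1 y) (v z w) = cross h' v' →
      h'.1.c = 1 ∨ h'.2.c = 1 := by
    intro h' v' hv e
    rcases inj h' v' hv e with e | e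
    · left
      have := congrArg (fun x => x.1.1.c) e
      exact this.symm
    · right
      have := congrArg (fun x => x.1.1.c) e
      exact this.symm
  rcases h with ((h | (h | ⟨z', w', h⟩)) | ⟨⟨i', d'⟩, hα, h⟩) | ⟨α, β, -, -, h⟩
  · exact absurd h (cross_ne_outward rfl)
  · rcases h with h | h | h
    · exact absurd (hc _ _ rfl h) (by decide)
    · exact absurd (hc _ _ rfl h) (by decide)
    · exact absurd (hc _ _ rfl h) (by decide)
  · exact absurd (hc _ _ rfl h) (by decide)
  · obtain ⟨x, hx, h⟩ := mem_atomTiles.1 h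
    have hx' : ∀ i d, ∀ x ∈ atomList i d, x.2.1.a = 1 ∧ x.1.2.c ≠ 1 := by decide
    rcases inj _ _ (hx' _ _ x hx).1 h with e | e
    · rw [Prod.mk.eta] at e
      obtain ⟨rfl, rfl⟩ := hk i' d' (by rw [e]; exact hx)
      exact hα
    · have := congrArg (fun x => x.1.1.c) e
      exact absurd this.symm (hx' _ _ x hx).2
  · have hv := (by decide : ∀ i d i', (pairTable i d i').2.1.a = 1) β.child β.digit α.child
    rcases h with h | h
    · exact absurd (hc _ _ hv h) (by rw [h3]; simp)
    · exact absurd (hc _ _ hv h) (by rw [hNeg3]; simp)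

theorem good_tileSet (S : Code) : Good S (tileSet S) :=
  ⟨tileSet_subset S, outward_subset S, fun _ _ h => mem_of_keyTile h⟩

/-- The hierarchy provides a marked frame of level `|v.1| + |v.2|`, and the length of its arms, a
power of two, exceeds this number. -/
theorem Good.not_periodic {S : Code} {T : Set TileClass} (hT : Good S T) {τ : ℤ × ℤ → Tile}
    (h : τ ∈ Tilings T) : ¬ ∃ v : ℤ × ℤ, v ≠ 0 ∧ ∀ p, τ (p + v) = τ p := by
  rintro ⟨v, hv, hp⟩
  have hM : τ ∈ Tilings masterTiles := ⟨h.1, fun p => hT.master (h.2 p)⟩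
  obtain ⟨q, ⟨-, hq⟩, -⟩ := h.1.unique_cornered 0 0
  obtain ⟨g, d, hg, -⟩ := exists_marked hM hq
  obtain ⟨C, -, hC⟩ := hT.exists_hierarchy h hg
  obtain ⟨⟨k, hk⟩, -, hs⟩ := hC (v.1.natAbs + v.2.natAbs)
  have hm : Marked τ _ k := hs hk.root
  refine hm.not_periodic hM hv ?_ hp
  have : ((v.1.natAbs + v.2.natAbs : ℕ) : ℤ) < 2 ^ (v.1.natAbs + v.2.natAbs) := by
    exact_mod_cast (v.1.natAbs + v.2.natAbs).lt_two_pow_self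
  rwa [Nat.cast_add, Int.natCast_natAbs, Int.natCast_natAbs] at this

theorem aperiodic_tileSet {S : Code} (hS : S.Full) : Aperiodic (tileSet S) := by
  obtain ⟨τ, h, -⟩ := exists_typed_tiling hS
  exact ⟨⟨τ, h⟩, fun τ h => (good_tileSet S).not_periodic h⟩

theorem enforces_tileSet {S : Code} (hS : S.Full) : Enforces S (tileSet S) where
  isLocal := by
    obtain ⟨R, hR⟩ := exists_localRule
    exact ⟨R, fun τ _ => hR τ⟩
  hierarchical τ h := (good_tileSet S).hierarchical h
  framed τ h g hg := (good_tileSet S).exists_hierarchy h hg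
  onto X hX := exists_preimage hS hX
  realizes n g C hC := by
    obtain ⟨τ, h, -, h'⟩ := exists_realization hS hC
    exact ⟨τ, h, h'⟩

end DominoTiles

namespace DominoTiles

/-! ### The tiles that occur in a supertile -/

/-- The supertile of level `n` in which the children of the frames of level `m + 1` are placed in the
orientations `δ m`. -/
def tree (δ : ℕ → Fin 4 → Digit) : ℕ → Isom → Set (ℕ × Isom)
  | 0, g => {(0, g)}
  | n + 1, g => insert (n + 1, g) (⋃ i, tree δ n (childFrame n g i (δ n i)))

theorem tree_framed {S : Code} {δ : ℕ → Fin 4 → Digit} (h : ∀ n i, δ n i ∈ S i) :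
    ∀ n g, FramedSupertile S n g (tree δ n g)
  | 0, g => .zero g
  | n + 1, g => .succ n g (δ n) _ (h n) fun _ => tree_framed h n _

/-- A deterministic code leaves no choice, so level and frame determine the supertile. -/
theorem FramedSupertile.eq_tree {S : Code} {χ : Fin 4 → Digit} (hS : ∀ i, S i = {χ i}) {n : ℕ}
    {g : Isom} {C : Set (ℕ × Isom)} (h : FramedSupertile S n g C) : C = tree (fun _ => χ) n g := by
  induction h with
  | zero g => rfl
  | succ n g d C hd hC ih =>
    obtain rfl : d = χ := funext fun i => Finset.mem_singleton.1 (hS i ▸ hd i)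
    rw [tree, funext ih]

theorem tree_root (δ : ℕ → Fin 4 → Digit) (n : ℕ) (g : Isom) : (n, g) ∈ tree δ n g := by
  cases n
  · exact rfl
  · exact Set.mem_insert _ _

theorem tree_child (δ : ℕ → Fin 4 → Digit) (n : ℕ) (g : Isom) (i : Fin 4) :
    tree δ n (childFrame n g i (δ n i)) ⊆ tree δ (n + 1) g :=
  fun _ hx => .inr (Set.mem_iUnion.2 ⟨i, hx⟩)

theorem marked_of_tree {δ : ℕ → Fin 4 → Digit} {τ : ℤ × ℤ → Tile} {n : ℕ} {g : Isom}
    (h : tree δ n g ⊆ framing τ) : Marked τ n g := by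
  have := h (tree_root δ n g)
  rwa [framing, Set.mem_ofPred_eq] at this

theorem marked_corner_level {τ : ℤ × ℤ → Tile} {n : ℕ} {g : Isom} (h : Marked τ n g) (e : Digit)
    (o : Bool) : τ ((g * sym e).point ((2 ^ n : ℤ) • cornerPos o)) =
      (g * sym e).tile (corner (n == 0) o e) := by
  obtain ⟨h1, h2, -⟩ := h e
  rw [Isom.comp_eq] at h1 h2
  cases o
  · have e : (2 ^ n : ℤ) • cornerPos false = (-2 ^ n, 2 ^ n) := by ext <;> simp [cornerPos]
    rw [e]; exact h2
  · have e : (2 ^ n : ℤ) • cornerPos true = (-3 * 2 ^ n, 2 ^ n) := by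
      ext
      · simp [cornerPos]; ring
      · simp [cornerPos]
    rw [e]; exact h1

theorem corner_edge (k o : Bool) (e : Digit) : (corner k o e).edge = (corner true o e).edge := by
  cases o <;> rfl

/-- The ends of a child of level `n` carry corners of the parent. -/
theorem end_edge {τ : ℤ × ℤ → Tile} {n : ℕ} {g : Isom} (h : Marked τ (n + 1) g)
    (hp : ∀ i f, (childAt n i * sym f).point (-2 * 2 ^ n, 0) =
      (sym (endCorner i f).1).point ((2 ^ (n + 1) : ℤ) • cornerPos (endCorner i f).2))
    (i : Fin 4) (d f : Digit) (j : Dir) :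
    (τ ((childFrame n g i d * sym f).point (-2 * 2 ^ n, 0))).edge ((childFrame n g i d * sym f).dir j) =
      (childFrame n g i d * sym f).mark (endEdge i (nim d f) j) := by
  have hd : (childAt n i * sym (nim d f)).dir j = (childAt 0 i * sym (nim d f)).dir j := rfl
  have hm : ∀ m, (childAt n i * sym (nim d f)).mark m = (childAt 0 i * sym (nim d f)).mark m :=
    fun _ => rfl
  rw [childFrame_eq, mul_assoc, mul_assoc, sym_mul_sym, Isom.mul_point, hp, ← Isom.mul_point,
    marked_corner_level h, Isom.mul_dir, Isom.mul_tile, Isom.tile_edge_dir, Isom.mul_mark g, hd, hm,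
    endEdge, Isom.mark_involutive]
  congr 1
  rw [← (sym (endCorner i (nim d f)).1).dir_inv_dir ((childAt 0 i * sym (nim d f)).dir j),
    Isom.tile_edge_dir, Isom.tile_edge_dir, corner_edge]

theorem end_edge_zero {τ : ℤ × ℤ → Tile} {g : Isom} (h : Marked τ 1 g) (i : Fin 4) (d f : Digit)
    (j : Dir) : (τ ((childFrame 0 g i d * sym f).point (-2, 0))).edge ((childFrame 0 g i d * sym f).dir j) =
      (childFrame 0 g i d * sym f).mark (endEdge i (nim d f) j) :=
  end_edge (n := 0) h (by decide) i d f j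

theorem end_edge_one {τ : ℤ × ℤ → Tile} {g : Isom} (h : Marked τ 2 g) (i : Fin 4) (d f : Digit)
    (j : Dir) : (τ ((childFrame 1 g i d * sym f).point (-4, 0))).edge ((childFrame 1 g i d * sym f).dir j) =
      (childFrame 1 g i d * sym f).mark (endEdge i (nim d f) j) :=
  end_edge (n := 1) h (by decide) i d f j

/-- The classes of tiles that occur in a tiling. -/
def Occurring (τ : ℤ × ℤ → Tile) : Set TileClass := {t | ∃ p, (τ p).cls = t}

theorem act_inv_edge_iff {G : Isom} {τ : ℤ × ℤ → Tile} {p : ℤ × ℤ} {j : Dir} {m : Marking} :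
    (act G⁻¹ τ p).edge j = m ↔ (τ (G.point p)).edge (G.dir j) = G.mark m := by
  refine ⟨?_, act_inv_edge⟩
  rintro rfl
  rw [← Isom.tile_edge_dir, act_inv_point, Isom.tile_inv_tile]

theorem Quarter.west {τ : ℤ × ℤ → Tile} (h : τ ∈ Tilings masterTiles) {d : Digit} (hq : Quarter τ d)
    (h2 : τ (-3, -1) = (DominoTiles.sym 2).tile (outerCorner true (nim d 2))) :
    (τ (-3, 0)).cornered = false ∧ (τ (-3, 0)).edge 3 = (τ (-2, 0)).edge 3 := by
  have e0 : (τ (-3, 0)).edge 0 = ⟨-1, 1, 0, d⟩ :=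
    h.1.edge_fit (p := (-3, 1)) (j := 2) (m := ⟨1, -1, 0, d⟩) (by rw [hq.1]; rfl)
  have e2 : (τ (-3, 0)).edge 2 = ⟨-1, -1, 0, nim d 2⟩ :=
    h.1.edge_fit (p := (-3, -1)) (j := 0) (m := ⟨1, 1, 0, nim d 2⟩) (by rw [h2]; rfl)
  obtain ⟨j, hj⟩ := crossing_of_in (h.2 (-3, 0)) (i := 0) (by rw [e0])
  refine ⟨hj.uncornered, ?_⟩
  have := pass_of_in (h.2 (-3, 0)) (j := 3) (by
    change ((τ (-3, 0)).edge 0).a = -1; rw [e0]) (by change ((τ (-3, 0)).edge 2).a = -1; rw [e2])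
  rw [this]
  change opp ((τ (-3, 0)).edge 1) = _
  rw [h.1.fit (-2, 0) 3, opp_opp]

/-- Corners of the level `1` frame stand at the ends of the child, so the tiles beside the ends are
determined by `i` and `d`. By evaluation, each tile of the atomic set arises in this way, some only
after a reflection. -/
theorem atomTiles_subset_occurring {τ : ℤ × ℤ → Tile} (h : τ ∈ Tilings masterTiles) {g : Isom}
    (hg : Marked τ 1 g) {i : Fin 4} {d : Digit} (hk : Marked τ 0 (childFrame 0 g i d)) :
    atomTiles ⟨i, d⟩ ⊆ Occurring τ := by
  intro t ht
  obtain ⟨x, hx, rfl⟩ := mem_atomTiles.1 ht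
  have key : ∀ i d, ∀ x ∈ atomList i d,
      (∃ f, x = (h1 f, (endEdge i (nim d f) 0, opp (endEdge i (nim d f) 0)))) ∨
      ∃ f, x = (h0 (nim f 2), (endEdge i (nim d f) 3, opp (endEdge i (nim d f) 3))) ∨
        x = (h0 f, ((endEdge i (nim d f) 3).reflect, (opp (endEdge i (nim d f) 3)).reflect)) := by
    decide
  rcases key i d x hx with ⟨f, rfl⟩ | ⟨f, hf⟩
  · refine ⟨_, (key_of_child h hk f).trans ?_⟩
    rw [end_edge_zero hg, Isom.mark_involutive]
  · refine ⟨(childFrame 0 g i d * sym f).point (-3, 0), ?_⟩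
    obtain ⟨hc, hw⟩ := (marked_quarter hk f).west (act_mem_tilings h _) (marked_view hk f 2 true)
    rw [act_inv_edge (end_edge_zero hg i d f 3), act_inv_edge_iff] at hw
    rw [act_inv_point] at hc
    rw [cls_west h.1 hk hc hw (end_edge_zero hg i d f 3)]
    rcases hf with rfl | rfl
    · rfl
    · have : nim (nim f 2) 2 = f := by clear * -; revert f; decide
      rw [cross_h0_reflect, this]

/-- The straight arm through the middle of a marked frame. -/
theorem Marked.middle {τ : ℤ × ℤ → Tile} (h : τ ∈ Tilings masterTiles) {k : Isom} (hk : Marked τ 0 k)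
    (d : Digit) {m : Marking} (hm : (DominoTiles.act (k * sym d)⁻¹ τ (0, -2)).edge 0 = m) :
    ∀ y, y = -1 ∨ y = 0 ∨ y = 1 → (DominoTiles.act (k * sym d)⁻¹ τ (0, y)).cornered = false ∧
      (DominoTiles.act (k * sym d)⁻¹ τ (0, y)).edge 0 = m ∧
      (DominoTiles.act (k * sym d)⁻¹ τ (0, y)).edge 2 = opp m := by
  have hσ := act_mem_tilings h (k * sym d)⁻¹
  have v0 : DominoTiles.act (k * sym d)⁻¹ τ (-1, 1) = innerCorner true d := (marked_quarter hk d).2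
  have v1 : DominoTiles.act (k * sym d)⁻¹ τ (1, 1) = (sym 1).tile (innerCorner true (nim d 1)) :=
    marked_view hk d 1 false
  have v2 : DominoTiles.act (k * sym d)⁻¹ τ (-1, -1) = (sym 2).tile (innerCorner true (nim d 2)) :=
    marked_view hk d 2 false
  have v3 : DominoTiles.act (k * sym d)⁻¹ τ (1, -1) = (sym 3).tile (innerCorner true (nim d 3)) :=
    marked_view hk d 3 false
  have oW : Outward (DominoTiles.act (k * sym d)⁻¹ τ (-2, 0)) := by
    have := outward_of_end h hk ⟨d, rfl⟩
    rw [act_inv_point]; exact this.tile _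
  have oE : Outward (DominoTiles.act (k * sym d)⁻¹ τ (2, 0)) := by
    have := outward_of_end h hk ⟨nim d 1, rfl⟩
    rw [← sym_mul_sym, ← mul_assoc, Isom.mul_point (k * sym d)] at this
    rw [act_inv_point]; exact this.tile _
  generalize DominoTiles.act (k * sym d)⁻¹ τ = σ at *
  -- Plain arms of the two inner corners enter the square between end and centre from above and
  -- below, so the arm from the outward end passes it and reaches the centre. The same holds on the
  -- other side; hence only the vertical arm can pass through the centre.
  have aW : ((σ (0, 0)).edge 3).a = -1 := by
    have e0 : (σ (-1, 0)).edge 0 = minus := hσ.1.edge_fit (p := (-1, 1)) (j := 2) (m := plus) (by rw [v0]; rfl)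
    have e2 : (σ (-1, 0)).edge 2 = minus := hσ.1.edge_fit (p := (-1, -1)) (j := 0) (m := plus) (by rw [v2]; rfl)
    have := pass_of_in (hσ.2 (-1, 0)) (j := 1) (by change ((σ (-1, 0)).edge 2).a = -1; rw [e2]; rfl)
      (by change ((σ (-1, 0)).edge 0).a = -1; rw [e0]; rfl)
    rw [hσ.1.fit (-1, 0) 1, this]
    change - -((σ (-1, 0)).edge 3).a = -1
    rw [neg_neg, hσ.1.fit (-2, 0) 1]
    change -((σ (-2, 0)).edge 1).a = -1
    rw [oW.a]
  have aE : ((σ (0, 0)).edge 1).a = -1 := by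
    have e0 : (σ (1, 0)).edge 0 = minus := hσ.1.edge_fit (p := (1, 1)) (j := 2) (m := plus) (by rw [v1]; rfl)
    have e2 : (σ (1, 0)).edge 2 = minus := hσ.1.edge_fit (p := (1, -1)) (j := 0) (m := plus) (by rw [v3]; rfl)
    have := pass_of_in (hσ.2 (1, 0)) (j := 3) (by change ((σ (1, 0)).edge 0).a = -1; rw [e0]; rfl)
      (by change ((σ (1, 0)).edge 2).a = -1; rw [e2]; rfl)
    rw [hσ.1.fit (1, 0) 3, this]
    change - -((σ (1, 0)).edge 1).a = -1
    rw [neg_neg, hσ.1.fit (2, 0) 3]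
    change -((σ (2, 0)).edge 3).a = -1
    rw [oE.a]
  have step : ∀ y, ((σ (0, y)).edge 1).a = -1 → ((σ (0, y)).edge 3).a = -1 → (σ (0, y + -1)).edge 0 = m →
      (σ (0, y)).cornered = false ∧ (σ (0, y)).edge 0 = m ∧ (σ (0, y)).edge 2 = opp m := by
    intro y h1 h3 h2
    obtain ⟨j, hj⟩ := crossing_of_in (hσ.2 (0, y)) h1
    have e2 : (σ (0, y)).edge 2 = opp m := hσ.1.edge_fit (p := (0, y + -1)) (j := 0) h2
    refine ⟨hj.uncornered, ?_, e2⟩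
    rw [pass_of_in (hσ.2 (0, y)) (j := 0) h1 h3]
    exact (congrArg opp e2).trans (opp_opp m)
  have s1 := step (-1)
    (by rw [hσ.1.edge_fit (p := (1, -1)) (j := 3) (m := ⟨1, 1, 3, nim d 3⟩) (by rw [v3]; rfl)]; rfl)
    (by rw [hσ.1.edge_fit (p := (-1, -1)) (j := 1) (m := ⟨1, -1, 3, nim d 2⟩) (by rw [v2]; rfl)]; rfl) (by rw [show (-1 + -1 : ℤ) = -2 from rfl]; exact hm)
  have s2 := step 0 aE aW s1.2.1
  have s3 := step 1
    (by rw [hσ.1.edge_fit (p := (1, 1)) (j := 3) (m := ⟨1, -1, 3, nim d 1⟩) (by rw [v1]; rfl)]; rfl)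
    (by rw [hσ.1.edge_fit (p := (-1, 1)) (j := 1) (m := ⟨1, 1, 3, d⟩) (by rw [v0]; rfl)]; rfl) s2.2.1
  rintro y (rfl | rfl | rfl)
  exacts [s1, s2, s3]

/-- Two steps below the centre of the child, seen from the corner chosen in the table, lies an end
of its parent of level `1`, which carries a corner of the frame of level `2`. The arm from there
passes straight through the middle of the child and gives both tiles of the pair. -/
theorem pairTiles_subset_occurring {τ : ℤ × ℤ → Tile} (h : τ ∈ Tilings masterTiles) {g : Isom}
    (hg : Marked τ 2 g) {b : Fin 4} {e : Digit} {i : Fin 4} {d : Digit}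
    (hk : Marked τ 0 (childFrame 0 (childFrame 1 g b e) i d)) :
    pairTiles ⟨b, e⟩ ⟨i, d⟩ ⊆ Occurring τ := by
  have hG : childFrame 0 (childFrame 1 g b e) i d * sym (nim d (pairTable b e i).1) =
      childFrame 1 g b e * (childAt 0 i * sym (pairTable b e i).1) := by
    rw [childFrame_eq 0, mul_assoc, mul_assoc, sym_mul_sym, nim_nim_cancel]
  have hp : ∀ b e i, (childAt 0 i * sym (pairTable b e i).1).point (0, -2) =
      (sym (centreCorner i).1).point (-4, 0) := by decide
  have hm := hk.middle h (nim d (pairTable b e i).1) (m := (pairTable b e i).2.1) (by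
    rw [act_inv_edge_iff, hG, Isom.mul_point, hp, ← Isom.mul_point, Isom.mul_dir, centreCorner_dir,
      ← Isom.mul_dir, end_edge_one hg, Isom.mul_mark _ (childAt 0 i * _), centreCorner_mark,
      ← Isom.mul_mark])
  rw [← pairTable_opp] at hm
  have key := cls_centre h.1 hk (d := nim d (pairTable b e i).1) (x := (pairTable b e i).2)
    (pairTable_opp b e i) ?_ ?_ ?_
  · rintro t (rfl | rfl)
    · exact ⟨_, key.1⟩
    · exact ⟨_, key.2⟩
  · rintro y (rfl | rfl)
    · have := (hm 1 (by simp)).1; rwa [act_inv_point] at this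
    · have := (hm (-1) (by simp)).1; rwa [act_inv_point] at this
  · rintro y (rfl | rfl)
    · exact act_inv_edge_iff.1 (hm 0 (by simp)).2.1
    · exact act_inv_edge_iff.1 (hm 1 (by simp)).2.1
  · rintro y (rfl | rfl)
    · exact act_inv_edge_iff.1 (hm 0 (by simp)).2.2
    · exact act_inv_edge_iff.1 (hm (-1) (by simp)).2.2

theorem outwardTiles_subset_occurring {τ : ℤ × ℤ → Tile} {g g' : Isom} (hg : Marked τ 0 g)
    (hg' : Marked τ 1 g') : outwardTiles ⊆ Occurring τ := by
  have h0 : ∀ o d, (corner true o d).cls ∈ Occurring τ := fun o d =>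
    ⟨_, by rw [marked_corner_level hg d o, Isom.tile_cls]; rfl⟩
  have h1 : ∀ o d, (corner false o d).cls ∈ Occurring τ := fun o d =>
    ⟨_, by rw [marked_corner_level hg' d o, Isom.tile_cls]; rfl⟩
  rintro t ⟨k | k, d, rfl | rfl⟩
  exacts [h1 true d, h1 false d, h0 true d, h0 false d]

/-- On the side `i` of the point `p` the neighbouring cornered tiles have plain markings around `p`. -/
def HalfPlain (τ : ℤ × ℤ → Tile) (p : ℤ × ℤ) (i : Dir) : Prop :=
  ∀ s, s ≠ i → s ≠ i + 2 → (τ (p + vec i + vec s)).edge (i + 2) = plus ∧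
    (τ (p + vec i + vec s)).edge (s + 2) = plus

/-- In the middle of a long edge of the level `1` domino, outer corners of two children adjoin. The
arms that leave an outer corner to the outside are plain. -/
theorem halfPlain_of_children {τ : ℤ × ℤ → Tile} {g : Isom}
    (hk : ∀ i, ∃ d, Marked τ 0 (childFrame 0 g i d)) (t : Digit) :
    HalfPlain τ ((g * sym t).point (0, 4)) ((g * sym t).dir 2) := by
  have key : ∀ t s, s ≠ (sym t).dir 2 → s ≠ (sym t).dir 2 + 2 → ∃ i f,
      (childAt 0 i * sym f).point (-3, 1) = (sym t).point (0, 4) + vec ((sym t).dir 2) + vec s ∧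
      ((sym t).dir 2 + 2 = (childAt 0 i * sym f).dir 0 ∨ (sym t).dir 2 + 2 = (childAt 0 i * sym f).dir 3) ∧
      (s + 2 = (childAt 0 i * sym f).dir 0 ∨ s + 2 = (childAt 0 i * sym f).dir 3) := by decide
  intro s h1 h2
  obtain ⟨s, rfl⟩ : ∃ s', g.dir s' = s := ⟨_, g.dir_inv_dir s⟩
  rw [Isom.mul_dir] at h1 h2 ⊢
  rw [← Isom.dir_add_two] at h2
  rw [g.dir_injective.ne_iff] at h1 h2
  obtain ⟨i, f, e, e1, e2⟩ := key t s h1 h2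
  rw [Isom.mul_point, ← Isom.point_add_vec, ← Isom.point_add_vec, ← e, ← g.dir_add_two,
    ← g.dir_add_two, ← Isom.mul_point]
  obtain ⟨d, hd⟩ := hk i
  have hG : childFrame 0 g i d * sym (nim d f) = g * (childAt 0 i * sym f) := by
    rw [childFrame_eq, mul_assoc, mul_assoc, sym_mul_sym, nim_nim_cancel]
  have hc := (marked_corner hd (nim d f)).1
  rw [hG] at hc
  have pl : ∀ j, j = 0 ∨ j = 3 → (τ ((g * (childAt 0 i * sym f)).point (-3, 1))).edge
      (g.dir ((childAt 0 i * sym f).dir j)) = plus := by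
    intro j hj
    rw [hc, ← Isom.mul_dir, Isom.tile_edge_dir]
    rcases hj with rfl | rfl
    · rw [(corner_edges _).1, mark_plus]
    · rw [(corner_edges _).2.1, mark_plus]
  constructor
  · rcases e1 with e1 | e1 <;> rw [e1]
    · exact pl 0 (.inl rfl)
    · exact pl 3 (.inr rfl)
  · rcases e2 with e2 | e2 <;> rw [e2]
    · exact pl 0 (.inl rfl)
    · exact pl 3 (.inr rfl)

/-- At an end of the level `2` frame two children of level `1` touch with the middles of their long
edges, so all four cornered neighbours of the end show plain arms. -/
theorem exists_halfPlain {τ : ℤ × ℤ → Tile} {g : Isom}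
    (hk : ∀ i, ∃ d, ∀ i', ∃ d', Marked τ 0 (childFrame 0 (childFrame 1 g i d) i' d')) (t : Digit) :
    ∃ i, HalfPlain τ ((g * sym t).point (-8, 0)) i ∧ HalfPlain τ ((g * sym t).point (-8, 0)) (i + 2) := by
  have key : ∀ t, ∃ i i', (childAt 1 i * sym 2).point (0, 4) = (sym t).point (-8, 0) ∧
      (childAt 1 i' * sym 2).point (0, 4) = (sym t).point (-8, 0) ∧
      (childAt 1 i' * sym 2).dir 2 = (childAt 1 i * sym 2).dir 2 + 2 := by decide
  have h : ∀ i, HalfPlain τ ((g * (childAt 1 i * sym 2)).point (0, 4))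
      ((g * (childAt 1 i * sym 2)).dir 2) := by
    intro i
    obtain ⟨d, hd⟩ := hk i
    have := halfPlain_of_children hd (nim d 2)
    rwa [childFrame_eq, mul_assoc, mul_assoc, sym_mul_sym, nim_nim_cancel] at this
  obtain ⟨i, i', e1, e2, e3⟩ := key t
  refine ⟨(g * (childAt 1 i * sym 2)).dir 2, ?_, ?_⟩
  · have := h i
    rwa [Isom.mul_point, e1, ← Isom.mul_point] at this
  · have := h i'
    rwa [Isom.mul_point, e2, ← Isom.mul_point, Isom.mul_dir, e3, Isom.dir_add_two, ← Isom.mul_dir] at this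

theorem cross_hPlain_reflect (m m' : Marking) :
    cross hPlain (m, m') = cross hPlain (m.reflect, m'.reflect) := by
  rw [cross_eq, cross_eq, ← Isom.tile_cls (sym 1) (crossTile hPlain (m, m'))]
  exact congrArg _ (tile_ext4 rfl rfl rfl rfl rfl)

theorem cross_hPlain_occurs {τ : ℤ × ℤ → Tile} (h : τ ∈ Tilings masterTiles) {p : ℤ × ℤ}
    (hp : ∃ i, HalfPlain τ p i ∧ HalfPlain τ p (i + 2)) (j : Dir) :
    cross hPlain ((τ p).edge j, opp ((τ p).edge j)) ∈ Occurring τ := by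
  obtain ⟨i, h1, h2⟩ := hp
  have side : ∀ s, s = j + 1 ∨ s = j + 3 → (τ (p + vec j)).edge s = minus := by
    intro s hs
    have key : ∀ i j s : Dir, s = j + 1 ∨ s = j + 3 →
        ((j = i ∨ j = i + 2) ∧ s ≠ j ∧ s ≠ j + 2) ∨
        ((s = i ∨ s = i + 2) ∧ j ≠ s ∧ j ≠ s + 2) := by decide
    have h12 : ∀ k, k = i ∨ k = i + 2 → HalfPlain τ p k := by
      rintro k (rfl | rfl) <;> assumption
    have h3 : (τ (p + vec j + vec s)).edge (s + 2) = plus := by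
      rcases key i j s hs with ⟨hj, h4, h5⟩ | ⟨hj, h4, h5⟩
      · exact (h12 j hj s h4 h5).2
      · have := (h12 s hj j h4 h5).1
        rwa [add_right_comm] at this
    refine h.1.edge_fit h3 (hk := (dir_add_two_two s).symm) (hq := ?_)
    rw [add_assoc _ (vec s), vec_add_vec, add_zero]
  have e1 := side _ (.inl rfl)
  have e3 := side _ (.inr rfl)
  obtain ⟨k, hk⟩ := crossing_of_in (h.2 (p + vec j)) (i := j + 1) (by rw [e1]; rfl)
  have e2 : (τ (p + vec j)).edge (j + 2) = opp ((τ p).edge j) := h.1.fit p j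
  have e0 : (τ (p + vec j)).edge j = (τ p).edge j := by
    rw [pass_of_in (h.2 (p + vec j)) (j := j) (by rw [e1]; rfl) (by rw [e3]; rfl), e2, opp_opp]
  refine ⟨p + vec j, ?_⟩
  have hi : ∀ i j : Dir, (turnTo 0 (j + 1)).dir i = j + i := by decide
  have e : τ (p + vec j) = (turnTo 0 (j + 1)).tile
      (crossTile hPlain ((τ p).edge j, opp ((τ p).edge j))) := by
    refine Isom.tile_ext_dir (turnTo 0 (j + 1)) hk.uncornered fun i => ?_
    rw [Isom.tile_edge_dir, hi]
    have : ∀ i : Dir, i = 0 ∨ i = 1 ∨ i = 2 ∨ i = 3 := by decide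
    rcases this i with rfl | rfl | rfl | rfl
    · rw [add_zero]; exact e0
    · exact e1
    · exact e2
    · exact e3
  rw [e, Isom.tile_cls, cross_eq]

theorem cross_corner_occurs {τ : ℤ × ℤ → Tile} (h : τ ∈ Tilings masterTiles) {n : ℕ} {g : Isom}
    (hg : Marked τ n g) (e : Digit) (o : Bool)
    (hp : ∃ i, HalfPlain τ ((g * sym e).point ((2 ^ n : ℤ) • cornerPos o)) i ∧
      HalfPlain τ ((g * sym e).point ((2 ^ n : ℤ) • cornerPos o)) (i + 2)) (j : Dir) :
    cross hPlain ((corner true o e).edge j, opp ((corner true o e).edge j)) ∈ Occurring τ := by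
  have := cross_hPlain_occurs h hp ((g * sym e).dir j)
  rw [marked_corner_level hg, Isom.tile_edge_dir, corner_edge, ← mark_opp] at this
  generalize (corner true o e).edge j = m at *
  unfold Isom.mark at this
  split_ifs at this
  · rwa [← cross_hPlain_reflect] at this
  · exact this

/-- Every type of signed arm with every digit leaves some corner tile, possibly with the opposite
sign, which a reflection of the crossing tile repairs. -/
theorem cross_hPlain_subset {A : Set TileClass}
    (h : ∀ e o j, cross hPlain ((corner true o e).edge j, opp ((corner true o e).edge j)) ∈ A) :
    cross hPlain vPlain ∈ A ∧ ∀ z w, cross hPlain (v z w) ∈ A := by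
  have h' : ∀ {e o j x}, ((corner true o e).edge j, opp ((corner true o e).edge j)) = x →
      cross hPlain x ∈ A := fun hx => hx ▸ h _ _ _
  have hr : ∀ {e o j m m'}, ((corner true o e).edge j, opp ((corner true o e).edge j)) =
      (m.reflect, m'.reflect) → cross hPlain (m, m') ∈ A := fun hx => by
    rw [cross_hPlain_reflect, ← hx]; exact h _ _ _
  refine ⟨h' (e := 0) (o := true) (j := 0) rfl, fun z w => ?_⟩
  have h4 : ∀ i : Fin 4, i = 0 ∨ i = 1 ∨ i = 2 ∨ i = 3 := by decide
  rcases h4 z with rfl | rfl | rfl | rfl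
  · exact hr (e := w) (o := true) (j := 2) rfl
  · exact h' (e := w) (o := true) (j := 1) rfl
  · exact hr (e := w) (o := false) (j := 3) rfl
  · exact h' (e := w) (o := false) (j := 1) rfl

theorem cross_h0_occurs {τ : ℤ × ℤ → Tile} (h : τ ∈ Tilings masterTiles) {g : Isom} {d : Digit}
    (hg : Marked τ 1 g) (hk : Marked τ 0 (childFrame 0 g 2 d)) (e : Digit) :
    cross (h0 (nim e 2)) vPlain ∈ Occurring τ := by
  obtain ⟨hc, hw⟩ := (marked_quarter hk e).west (act_mem_tilings h _) (marked_view hk e 2 true)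
  have he : ∀ f, endEdge 2 f 3 = plus := by decide
  have e3 := end_edge_zero hg 2 d e 3
  rw [he] at e3
  rw [act_inv_edge e3, act_inv_edge_iff] at hw
  rw [act_inv_point] at hc
  exact ⟨_, cls_west h.1 hk hc hw e3⟩

theorem corner_eq_end (e : Digit) (o : Bool) : ∃ i f, (childAt 2 i * sym f).point (-8, 0) =
    (sym e).point ((2 ^ 3 : ℤ) • cornerPos o) := by
  revert e o
  decide

/-- The corners of the level `3` frame lie at ends of level `2` children, where the surroundings are
plain. Next to them every kind of arm crosses a plain meeting. The two remaining tiles occur at the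
short sides of a child `u`, whose ends send plain arms there. -/
theorem commonTiles_subset_occurring {τ : ℤ × ℤ → Tile} (h : τ ∈ Tilings masterTiles)
    {δ : ℕ → Fin 4 → Digit} {g : Isom} (hg : tree δ 3 g ⊆ framing τ) : commonTiles ⊆ Occurring τ := by
  have h2 : ∀ i, tree δ 2 (childFrame 2 g i (δ 2 i)) ⊆ framing τ := fun i => (tree_child δ 2 g i).trans hg
  have h1 : ∀ {g}, tree δ 2 g ⊆ framing τ → ∀ i, tree δ 1 (childFrame 1 g i (δ 1 i)) ⊆ framing τ :=
    fun h i => (tree_child δ 1 _ i).trans h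
  have hk : ∀ {g}, tree δ 1 g ⊆ framing τ → ∀ i, Marked τ 0 (childFrame 0 g i (δ 0 i)) :=
    fun h i => marked_of_tree ((tree_child δ 0 _ i).trans h)
  have hm := marked_of_tree hg
  have plain := cross_hPlain_subset fun e o => by
    obtain ⟨i, f, hf⟩ := corner_eq_end e o
    have hp := exists_halfPlain (g := childFrame 2 g i (δ 2 i))
      (fun i' => ⟨_, fun i'' => ⟨_, hk (h1 (h2 i) i') i''⟩⟩) (nim (δ 2 i) f)
    rw [childFrame_eq, mul_assoc, mul_assoc, sym_mul_sym, nim_nim_cancel, Isom.mul_point, hf,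
      ← Isom.mul_point] at hp
    exact cross_corner_occurs h hm e o hp
  have hg1 := h1 (h2 0) 0
  have west := cross_h0_occurs h (marked_of_tree hg1) (hk hg1 2)
  rintro t ((rfl | rfl | rfl) | ⟨z, w, rfl⟩)
  exacts [plain.1, west 2, west 3, plain.2 z w]

theorem tiles_occur {τ : ℤ × ℤ → Tile} (h : τ ∈ Tilings masterTiles) {δ : ℕ → Fin 4 → Digit} {g : Isom}
    (hg : tree δ 3 g ⊆ framing τ) :
    outwardTiles ∪ commonTiles ⊆ Occurring τ ∧ (∀ i, atomTiles ⟨i, δ 0 i⟩ ⊆ Occurring τ) ∧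
      ∀ b i, pairTiles ⟨b, δ 1 b⟩ ⟨i, δ 0 i⟩ ⊆ Occurring τ := by
  have t2 : tree δ 2 (childFrame 2 g 0 (δ 2 0)) ⊆ framing τ := (tree_child δ 2 g 0).trans hg
  have t1 := fun b => (tree_child δ 1 _ b).trans t2
  have m2 := marked_of_tree t2
  have m1 := fun b => marked_of_tree (t1 b)
  have m0 := fun b i => marked_of_tree ((tree_child δ 0 _ i).trans (t1 b))
  refine ⟨Set.union_subset (outwardTiles_subset_occurring (m0 0 0) (m1 0))
    (commonTiles_subset_occurring h hg), fun i => atomTiles_subset_occurring h (m1 0) (m0 0 i),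
    fun b i => pairTiles_subset_occurring h m2 (m0 b i)⟩

/-! ### Minimality of the sets of tiles -/

theorem tileSet_subset_of_realizes {S : Code} (hS : S.Full) {T : Set TileClass} (hT : T ⊆ masterTiles)
    (h : ∀ n g C, FramedSupertile S n g C → ∃ τ ∈ Tilings T, C ⊆ framing τ) : tileSet S ⊆ T := by
  choose χ hχ using hS
  have key : ∀ α β, S.Has α → S.Has β →
      outwardTiles ∪ commonTiles ⊆ T ∧ atomTiles α ⊆ T ∧ pairTiles β α ⊆ T := by
    intro α β hα hβ
    have up : ∀ γ, S.Has γ → ∀ i, Function.update χ γ.child γ.digit i ∈ S i := by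
      intro γ hγ i
      rcases eq_or_ne i γ.child with rfl | hi
      · rw [Function.update_self]; exact hγ
      · rw [Function.update_of_ne hi]; exact hχ i
    -- The frames of level `0` use the orientation of `α` and those of higher levels the orientation
    -- of `β`; the other children follow an arbitrary choice. In this way the pair `β → α` occurs
    -- even if both concern the same child with different digits.
    let δ : ℕ → Fin 4 → Digit := fun n =>
      if n = 0 then Function.update χ α.child α.digit else Function.update χ β.child β.digit
    have hδ : ∀ n i, δ n i ∈ S i := by
      intro n i
      by_cases hn : n = 0
      · simp only [δ, if_pos hn]; exact up α hα i
      · simp only [δ, if_neg hn]; exact up β hβ i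
    obtain ⟨τ, hτ, hC⟩ := h 3 1 _ (tree_framed hδ 3 1)
    obtain ⟨h1, h2, h3⟩ := tiles_occur ⟨hτ.1, fun p => hT (hτ.2 p)⟩ hC
    have occ : Occurring τ ⊆ T := by rintro _ ⟨p, rfl⟩; exact hτ.2 p
    have e0 : δ 0 α.child = α.digit := by simp [δ]
    have e1 : δ 1 β.child = β.digit := by simp [δ]
    have h2' := h2 α.child
    have h3' := h3 β.child α.child
    rw [e0] at h2' h3'
    rw [e1] at h3'
    exact ⟨h1.trans occ, h2'.trans occ, h3'.trans occ⟩
  rintro t ((ht | ⟨α, hα, ht⟩) | ⟨α, β, hα, hβ, ht⟩)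
  · exact (key ⟨0, χ 0⟩ ⟨0, χ 0⟩ (hχ 0) (hχ 0)).1 ht
  · exact (key α α hα hα).2.1 ht
  · exact (key α β hα hβ).2.2 ht

/-- A tiling by a subset is a tiling by the full set, so it contains a marked supertile of level
`3`. For a deterministic code this is the unique one, in which all tiles occur. -/
theorem tilings_eq_empty {S : Code} (hS : S.Deterministic) {T : Set TileClass} (hT : T ⊂ tileSet S) :
    Tilings T = ∅ := by
  rw [Set.eq_empty_iff_forall_notMem]
  intro τ hτ
  have hτS : τ ∈ Tilings (tileSet S) := ⟨hτ.1, fun p => hT.1 (hτ.2 p)⟩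
  have hM := tilings_master hτS
  choose χ hχ using fun i => Finset.card_eq_one.1 (hS i)
  obtain ⟨q, ⟨-, hq⟩, -⟩ := hτ.1.unique_cornered 0 0
  obtain ⟨g, d, hg, -⟩ := exists_marked hM hq
  obtain ⟨C, -, hC⟩ := (good_tileSet S).exists_hierarchy hτS hg
  obtain ⟨⟨k, hk⟩, -, hs⟩ := hC 3
  rw [hk.eq_tree hχ] at hs
  obtain ⟨h1, h2, h3⟩ := tiles_occur hM hs
  have occ : Occurring τ ⊆ T := by rintro _ ⟨p, rfl⟩; exact hτ.2 p
  have has : ∀ α, S.Has α → α.digit = χ α.child := fun α hα => Finset.mem_singleton.1 (hχ α.child ▸ hα)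
  refine hT.2 fun t ht => occ ?_
  rcases ht with (ht | ⟨⟨i, d⟩, hα, ht⟩) | ⟨⟨i, d⟩, ⟨b, e⟩, hα, hβ, ht⟩
  · exact h1 ht
  · obtain rfl : d = χ i := has _ hα
    exact h2 i ht
  · obtain rfl : d = χ i := has _ hα
    obtain rfl : e = χ b := has _ hβ
    exact h3 b i ht

end DominoTiles

open DominoTiles in
theorem theorem2 (S : Code) (hS : S.Full) :
    tileSet S ⊆ masterTiles ∧
    Aperiodic (tileSet S) ∧
    Enforces S (tileSet S) ∧
    (∀ T : Set TileClass, T ⊆ otherTiles ∪ tileSet S → Enforces S T → tileSet S ⊆ T) ∧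
    (S.Deterministic → ∀ T : Set TileClass, T ⊂ tileSet S → Tilings T = ∅) := by
  refine ⟨tileSet_subset S, aperiodic_tileSet hS, enforces_tileSet hS,
    fun T hT hE => tileSet_subset_of_realizes hS
      (hT.trans (Set.union_subset Set.subset_union_right (tileSet_subset S))) hE.realizes,
    fun hD T hT => tilings_eq_empty hD hT⟩
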